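/- Let $\mathbb K$ be a field of characteristic zero. A *manifold* is either a smooth scheme over $\mathbb K$ or, if $\mathbb K$ is a locally compact (non-discretely) normed field, a $\mathbb K$-analytic manifold; $\mathcal O_M$ is its sheaf of regular functions and $\mathcal O_{M,a}$ its local ring at $a$, with maximal ideal $\mathfrak m_a$. **Presentations.** A *presentation of codimension $p$ at $a\in M$*, with empty set of hypersurfaces, is $\underline{\mathcal G}(a)=(N(a),\mathcal G(a),\emptyset)$, where $N(a)$ is a germ at $a$ of a submanifold of codimension $p$ and $\mathcal G(a)$ is a finite collection of pairs $(g,\mu_g)$ with $g\in\mathcal O_{N(a)}$, $\mu_g\in\mathbb Q$, $\mu_g>0$ and $\mu_a(g)\ge\mu_g$; here $\mu_x(g)=\sup\{k: g\in\mathfrak m_{N,x}^k\}$ is the order of $g$ at $x$. Its *equimultiple locus* is the germ at $a$ of $S_{\underline{\mathcal G}(a)}=\{x\in N(a):\mu_x(g)\ge\mu_g\text{ for all }(g,\mu_g)\in\mathcal G(a)\}$, and $\mu_{\underline{\mathcal G}(a)}:=\min_{(g,\mu_g)}\mu_a(g)/\mu_g$ (with $\min\emptyset=\infty$). **Test transformations.**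 Let $(N(a),\mathcal H(a))$ be as above and let $\mathcal E(a)$ be a finite set of smooth hypersurfaces through $a$. Consider the following morphisms $\sigma:M'\to M$ over a neighbourhood of $a$ and points $a'\in\sigma^{-1}(a)$. (i) *Admissible blowing-up*: $\sigma$ is a local blowing-up with smooth centre $C$, where $C$ and $\mathcal E(a)$ simultaneously have only normal crossings and $a\in C\subset S_{\underline{\mathcal H}(a)}$. Let $y_{\rm exc}$ be a local equation of $\sigma^{-1}(C)$ and let $N'$ be the strict transform of $N(a)$. The transform at $a'$ is defined if $a'\in N'$ and $\mu_{a'}(y_{\rm exc}^{-\mu_h}h\circ\sigma)\ge\mu_h$ (orders taken on $N'$) for all $(h,\mu_h)\in\mathcal H(a)$. It consists of the germ of $N'$ at $a'$, the pairs $(y_{\rm exc}^{-\mu_h}h\circ\sigma,\mu_h)$, and the set $\mathcal E(a')$ formed by $\sigma^{-1}(C)$ and the strict transforms through $a'$ of the elements of $\mathcal E(a)$. (If $\mu_h=m/n$ in lowest terms is not an integer, the pair $(h,\mu_h)$ is to be replaced by $(h^n,m)$.) (ii) *Product with a line*: $\sigma:M'=W\times\mathbb A^1\to W$ with $W$ a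 neighbourhood of $a$, and $a'=(a,0)$. The transform consists of $\sigma^{-1}(N(a))$, the pairs $(h\circ\sigma,\mu_h)$, and $\mathcal E(a')=\{\sigma^{-1}(H):H\in\mathcal E(a)\}\cup\{W\times0\}$. (iii) *Exceptional blowing-up*: $\sigma$ is the local blowing-up with centre $H_0\cap H_1$, where $H_0,H_1\in\mathcal E(a)$, and $a'$ is the unique point of $\sigma^{-1}(a)$ on the strict transform $H_1'$ of $H_1$. The submanifold and the functions are transformed as in (ii), and $\mathcal E(a')$ is as in (i). In a sequence of test transformations, a transformation of type (iii) is allowed only in these two situations: directly after a product with a line $\sigma:M_i=M_{i-1}\times\mathbb A^1\to M_{i-1}$, with $H_0=M_{i-1}\times0$ and $H_1=\sigma^{-1}(H)$ for some $H\in\mathcal E(a_{i-1})$; or directly after a transformation $\sigma$ of type (iii) with centre $H_0\cap H_1$, the new pair then being $\sigma^{-1}(H_0\cap H_1)$ and $H_1'$. **Equivalence.** Two presentations at $a$ with empty sets of hypersurfaces, possibly of different codimensions, are *equivalent* if the following two conditions hold for them and continue to hold for their transforms after every finite sequence of test transformations (applied to both simultaneously, with common $\mathcal E$) that starts from $\mathcal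 E(a)=\emptyset$: (1) their equimultiple loci coincide as germs; (2) for every admissible blowing-up and every point $a'$ over the given point, the transform at $a'$ of one of them is defined if and only if the transform at $a'$ of the other is. They are *semicoherent equivalent* if $S_{\underline{\mathcal G}(a)}=S_{\underline{\mathcal C}(a)}$ as germs at $a$ and the presentations which they induce at $x$ are equivalent for every $x$ in a neighbourhood of $a$ in this common locus. **Theorem.** Let $M$ be a manifold, $a\in M$, and let $\underline{\mathcal G}(a)=(N(a),\mathcal G(a),\emptyset)$ be a presentation of codimension $p$ at $a$. If $\mu_{\underline{\mathcal G}(a)}=1$, then $\underline{\mathcal G}(a)$ is semicoherent equivalent to a presentation $\underline{\mathcal C}(a)=(N_{+1}(a),\mathcal C(a),\emptyset)$ of codimension $p+1$ at $a$. -/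

import Mathlib

open scoped Manifold ContDiff Topology
open CategoryTheory AlgebraicGeometry

universe u

noncomputable section

namespace Desing

/-! ### Regular systems of parameters of a local ring -/

/-- `u` is a regular system of parameters of the (regular) local ring `R`: a generating system of
the maximal ideal with `dim 𝔪/𝔪²` elements. -/
def IsRegularSystem {R : Type u} [CommRing R] [IsLocalRing R] {n : ℕ} (u : Fin n → R) : Prop :=
  Ideal.span (Set.range u) = IsLocalRing.maximalIdeal R ∧
    n = Module.finrank (IsLocalRing.ResidueField R) (IsLocalRing.CotangentSpace R)

/-- `z₁, …, z_p` is part of a regular system of parameters, i.e. `z₁, …, z_p` vanish at the point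
and have linearly independent differentials there. -/
def IsPartOfRegularSystem {R : Type u} [CommRing R] [IsLocalRing R] {p : ℕ} (z : Fin p → R) :
    Prop :=
  ∃ (n : ℕ) (u : Fin n → R) (ι : Fin p ↪ Fin n), IsRegularSystem u ∧ ∀ i, u (ι i) = z i

/-- The ideal `(J : y^∞)`. If `J` generates the pull-back of the ideal of a subspace and `y` is an
equation of the exceptional divisor, this is the ideal of the strict transform. -/
def saturation {R : Type u} [CommRing R] (J : Ideal R) (y : R) : Ideal R where
  carrier := {f | ∃ n : ℕ, y ^ n * f ∈ J}
  zero_mem' := ⟨0, by simp⟩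
  add_mem' := by
    rintro f g ⟨m, hm⟩ ⟨n, hn⟩
    refine ⟨m + n, ?_⟩
    have h : y ^ (m + n) * (f + g) = y ^ n * (y ^ m * f) + y ^ m * (y ^ n * g) := by ring
    rw [h]
    exact J.add_mem (J.mul_mem_left _ hm) (J.mul_mem_left _ hn)
  smul_mem' := by
    rintro c f ⟨n, hn⟩
    refine ⟨n, ?_⟩
    have h : y ^ n * (c • f) = c * (y ^ n * f) := by simp only [smul_eq_mul]; ring
    rw [h]
    exact J.mul_mem_left _ hn

/-! ### Spaces and geometric categories -/

/-- The points, the regular functions and the local rings of a space. -/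
structure FunctionSpace : Type (u + 1) where
  Pt : Type u
  [top : TopologicalSpace Pt]
  /-- (global) regular functions -/
  Fn : Type u
  [ring : CommRing Fn]
  /-- local rings -/
  Stalk : Pt → Type u
  [stalkRing : ∀ x, CommRing (Stalk x)]
  [stalkLocal : ∀ x, IsLocalRing (Stalk x)]
  germ : ∀ x, Fn →+* Stalk x

attribute [instance] FunctionSpace.top FunctionSpace.ring FunctionSpace.stalkRing
  FunctionSpace.stalkLocal

/-- The data of a category of manifolds which the definitions below refer to. It is only used for
the two categories `algebraicGeometry K` and `analyticGeometry K` constructed below. -/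
structure Geometry : Type (u + 2) where
  Obj : Type (u + 1)
  space : Obj → FunctionSpace.{u}
  Hom : Obj → Obj → Type u
  /-- composition in diagrammatic order -/
  comp : ∀ {A B C : Obj}, Hom A B → Hom B C → Hom A C
  map : ∀ {A B : Obj}, Hom A B → (space A).Pt → (space B).Pt
  pull : ∀ {A B : Obj}, Hom A B → (space B).Fn →+* (space A).Fn
  /-- isomorphisms onto open subspaces -/
  IsOpenImm : ∀ {A B : Obj}, Hom A B → Prop

/-! ### The algebraic category: smooth schemes over a field -/

/-- A smooth scheme over `K`. -/
structure SmoothScheme (K : Type u) [Field K] : Type (u + 1) where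
  X : Scheme.{u}
  str : X ⟶ Spec (CommRingCat.of K)
  smooth : Smooth str

/-- A scheme with its global functions and its local rings. -/
def schemeSpace (X : Scheme.{u}) : FunctionSpace.{u} where
  Pt := X
  Fn := Γ(X, ⊤)
  Stalk x := X.presheaf.stalk x
  germ x := (X.presheaf.germ ⊤ x trivial).hom

/-- Smooth schemes over `K` and morphisms of `K`-schemes. -/
def algebraicGeometry (K : Type u) [Field K] : Geometry.{u} where
  Obj := SmoothScheme K
  space M := schemeSpace M.X
  Hom A B := {f : A.X ⟶ B.X // f ≫ B.str = A.str}
  comp f g := ⟨f.1 ≫ g.1, by rw [Category.assoc, g.2, f.2]⟩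
  map f x := f.1 x
  pull f := f.1.appTop.hom
  IsOpenImm f := IsOpenImmersion f.1

/-! ### The analytic category: analytic manifolds over a normed field -/

/-- A `K`-analytic manifold. -/
structure AnalyticManifold (K : Type u) [NontriviallyNormedField K] : Type (u + 1) where
  dim : ℕ
  X : Type u
  [top : TopologicalSpace X]
  [t2 : T2Space X]
  [charted : ChartedSpace (Fin dim → K) X]
  [manifold : IsManifold 𝓘(K, Fin dim → K) ω X]

attribute [instance] AnalyticManifold.top AnalyticManifold.t2 AnalyticManifold.charted
  AnalyticManifold.manifold

/-- The ring of germs at `x` of analytic functions. -/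
def analyticStalk {K : Type u} [NontriviallyNormedField K] (M : AnalyticManifold K) (x : M.X) :
    Subring (Filter.Germ (𝓝 x) K) where
  carrier := {φ | ∃ f : M.X → K, ContMDiffAt 𝓘(K, Fin M.dim → K) 𝓘(K) ω f x ∧ φ = f}
  mul_mem' := by
    rintro _ _ ⟨f, hf, rfl⟩ ⟨g, hg, rfl⟩
    exact ⟨f * g, hf.mul hg, rfl⟩
  one_mem' := ⟨1, contMDiffAt_const, rfl⟩
  add_mem' := by
    rintro _ _ ⟨f, hf, rfl⟩ ⟨g, hg, rfl⟩
    exact ⟨f + g, hf.add hg, rfl⟩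
  zero_mem' := ⟨0, contMDiffAt_const, rfl⟩
  neg_mem' := by
    rintro _ ⟨f, hf, rfl⟩
    exact ⟨-f, hf.neg, rfl⟩

theorem analyticStalk_isUnit {K : Type u} [NontriviallyNormedField K] (M : AnalyticManifold K)
    (x : M.X) (φ : analyticStalk M x) (h : Filter.Germ.value φ.1 ≠ 0) : IsUnit φ := by
  obtain ⟨_, f, hf, rfl⟩ := φ
  have h0 : f x ≠ 0 := h
  refine IsUnit.of_mul_eq_one (⟨((f⁻¹ : M.X → K) : Filter.Germ (𝓝 x) K), f⁻¹, ?_, rfl⟩ :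
    analyticStalk M x) ?_
  · exact ((contDiffAt_inv K h0).contMDiffAt.comp x hf :)
  · apply Subtype.ext
    refine Filter.Germ.coe_eq.2 ?_
    filter_upwards [hf.continuousAt.eventually_ne h0] with y hy
    exact mul_inv_cancel₀ hy

instance analyticStalk_isLocalRing {K : Type u} [NontriviallyNormedField K]
    (M : AnalyticManifold K) (x : M.X) : IsLocalRing (analyticStalk M x) := by
  have hnt : Nontrivial (analyticStalk M x) :=
    ⟨⟨0, 1, fun h => zero_ne_one (α := K)
      (congrArg (fun ψ : analyticStalk M x => Filter.Germ.value ψ.1) h)⟩⟩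
  refine ⟨fun {φ ψ} h => ?_⟩
  have hv : Filter.Germ.value φ.1 + Filter.Germ.value ψ.1 = 1 := by
    have h1 := congrArg (fun θ : analyticStalk M x =>
      (Filter.Germ.valueRingHom : Filter.Germ (𝓝 x) K →+* K) θ.1) h
    simpa using! h1
  by_cases h0 : Filter.Germ.value φ.1 = 0
  · right
    apply analyticStalk_isUnit
    rw [h0, zero_add] at hv
    rw [hv]
    exact one_ne_zero
  · exact Or.inl (analyticStalk_isUnit M x φ h0)

/-- An analytic manifold with its global analytic functions and its rings of analytic germs. -/
def analyticSpace {K : Type u} [NontriviallyNormedField K] (M : AnalyticManifold K) :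
    FunctionSpace.{u} where
  Pt := M.X
  Fn := C^ω⟮𝓘(K, Fin M.dim → K), M.X; 𝓘(K), K⟯
  Stalk x := analyticStalk M x
  germ x :=
    { toFun := fun f => ⟨((f : M.X → K) : Filter.Germ (𝓝 x) K), f, f.contMDiff x, rfl⟩
      map_one' := rfl
      map_mul' := fun _ _ => rfl
      map_zero' := rfl
      map_add' := fun _ _ => rfl }

/-- Analytic manifolds over `K` and analytic maps. -/
def analyticGeometry (K : Type u) [NontriviallyNormedField K] : Geometry.{u} where
  Obj := AnalyticManifold K
  space M := analyticSpace M
  Hom A B := C^ω⟮𝓘(K, Fin A.dim → K), A.X; 𝓘(K, Fin B.dim → K), B.X⟯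
  comp f g := g.comp f
  map f x := f x
  pull f :=
    { toFun := fun h => ContMDiffMap.comp h f
      map_one' := rfl
      map_mul' := fun _ _ => rfl
      map_zero' := rfl
      map_add' := fun _ _ => rfl }
  IsOpenImm {A B} f := Topology.IsOpenEmbedding f ∧
    IsLocalDiffeomorph 𝓘(K, Fin A.dim → K) 𝓘(K, Fin B.dim → K) ω f

/-! ### Orders and equimultiple loci -/

namespace FunctionSpace

variable (X : FunctionSpace.{u})

/-- The regular function `f` vanishes at `x`. -/
def VanishesAt (f : X.Fn) (x : X.Pt) : Prop :=
  X.germ x f ∈ IsLocalRing.maximalIdeal (X.Stalk x)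

/-- The ideal in the local ring at `x` generated by a finite family of functions. -/
def idealAt {p : ℕ} (z : Fin p → X.Fn) (x : X.Pt) : Ideal (X.Stalk x) :=
  Ideal.span (Set.range fun i => X.germ x (z i))

/-- The order `μ_x(f|_N)`, where `N` is the subspace `z = 0`: the supremum of all `k` such that
the class of `f` lies in the `k`-th power of the maximal ideal of `𝒪_{N,x} = 𝒪_x / (z)`. -/
def orderOn {p : ℕ} (z : Fin p → X.Fn) (x : X.Pt) (f : X.Fn) : ℕ∞ :=
  ⨆ (k : ℕ) (_ : X.germ x f ∈ IsLocalRing.maximalIdeal (X.Stalk x) ^ k ⊔ X.idealAt z x), (k : ℕ∞)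

/-- The subspace `x₁ = ⋯ = x_k = 0` is smooth of codimension `k`. -/
def IsSmoothCentre {k : ℕ} (x : Fin k → X.Fn) : Prop :=
  ∀ w : X.Pt, (∀ j, X.VanishesAt (x j) w) → IsPartOfRegularSystem fun j => X.germ w (x j)

/-- The subspace `x = 0` and the hypersurfaces `e = 0`, `e ∈ E`, simultaneously have only normal
crossings at `a`: in suitable coordinates at `a`, all of them are coordinate subspaces. -/
def NormalCrossings (a : X.Pt) {k : ℕ} (x : Fin k → X.Fn) (E : List X.Fn) : Prop :=
  ∃ (n : ℕ) (u : Fin n → X.Stalk a), IsRegularSystem u ∧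
    (∃ I : Set (Fin n), X.idealAt x a = Ideal.span (u '' I)) ∧
    ∀ e ∈ E, ∃ i, Ideal.span {X.germ a e} = Ideal.span {u i}

end FunctionSpace

/-- A subspace `z = 0` together with a finite collection of pairs `(h, m)` of a function and an
assigned integral multiplicity. -/
structure Weighted (X : FunctionSpace.{u}) : Type u where
  codim : ℕ
  eqs : Fin codim → X.Fn
  fns : List (X.Fn × ℕ)

namespace Weighted

variable {X : FunctionSpace.{u}}

/-- `x` lies in the equimultiple locus: `x ∈ N` and `μ_x(h) ≥ m` for all `(h, m)`. -/
def Locus (P : Weighted X) (x : X.Pt) : Prop :=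
  (∀ i, X.VanishesAt (P.eqs i) x) ∧ ∀ h ∈ P.fns, (h.2 : ℕ∞) ≤ X.orderOn P.eqs x h.1

/-- Inverse image of the subspace and of all functions. -/
def pull {Y : FunctionSpace.{u}} (φ : X.Fn →+* Y.Fn) (P : Weighted X) : Weighted Y where
  codim := P.codim
  eqs i := φ (P.eqs i)
  fns := P.fns.map fun h => (φ h.1, h.2)

end Weighted

/-! ### Local blowings-up and products with a line -/

namespace Geometry

variable (𝒢 : Geometry.{u})

/-- Points of a manifold. -/
abbrev Pt (M : 𝒢.Obj) : Type u := (𝒢.space M).Pt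

/-- Regular functions on a manifold. -/
abbrev Fn (M : 𝒢.Obj) : Type u := (𝒢.space M).Fn

variable {𝒢}

/-- `π : B ⟶ M` is the chart `U_{x_i}` of the blowing-up of `M` with smooth centre
`x₁ = ⋯ = x_k = 0`: the universal manifold over `M` with functions `y_j` such that
`x_j ∘ π = y_j · (x_i ∘ π)` and `y_i = 1`, that is, the submanifold
`{x_j = y_j x_i, j ≠ i}` of `M × 𝔸^{k-1}`. -/
def IsBlowupChart {B M : 𝒢.Obj} (π : 𝒢.Hom B M) {k : ℕ} (x : Fin k → 𝒢.Fn M) (i : Fin k)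
    (y : Fin k → 𝒢.Fn B) : Prop :=
  y i = 1 ∧ (∀ j, 𝒢.pull π (x j) = y j * 𝒢.pull π (x i)) ∧
    ∀ (T : 𝒢.Obj) (f : 𝒢.Hom T M) (v : Fin k → 𝒢.Fn T), v i = 1 →
      (∀ j, 𝒢.pull f (x j) = v j * 𝒢.pull f (x i)) →
      ∃! g : 𝒢.Hom T B, 𝒢.comp g π = f ∧ ∀ j, 𝒢.pull g (y j) = v j

/-- `σ : M' ⟶ M` is the restriction to an open subspace of the chart `U_{x_i}` of the blowing-up
of `M` with smooth centre `x₁ = ⋯ = x_k = 0`. The exceptional divisor is `x_i ∘ σ = 0`. -/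
def IsLocalBlowup {M' M : 𝒢.Obj} (σ : 𝒢.Hom M' M) {k : ℕ} (x : Fin k → 𝒢.Fn M) (i : Fin k)
    (y : Fin k → 𝒢.Fn M') : Prop :=
  (𝒢.space M).IsSmoothCentre x ∧
    ∃ (B : 𝒢.Obj) (π : 𝒢.Hom B M) (v : Fin k → 𝒢.Fn B) (j : 𝒢.Hom M' B),
      IsBlowupChart π x i v ∧ 𝒢.IsOpenImm j ∧ σ = 𝒢.comp j π ∧ ∀ l, y l = 𝒢.pull j (v l)

/-- `σ : L ⟶ M` is the projection of `L = M × 𝔸¹`, and `t` is the coordinate of `𝔸¹`. -/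
def IsLineProduct {L M : 𝒢.Obj} (σ : 𝒢.Hom L M) (t : 𝒢.Fn L) : Prop :=
  ∀ (T : 𝒢.Obj) (f : 𝒢.Hom T M) (s : 𝒢.Fn T),
    ∃! g : 𝒢.Hom T L, 𝒢.comp g σ = f ∧ 𝒢.pull g t = s

/-! ### Transforms by blowings-up -/

/-- The germ at `a'` of the ideal of the strict transform by `σ` of the subspace `z = 0`;
`exc` is an equation of the exceptional divisor. -/
def strictIdeal {M' M : 𝒢.Obj} (σ : 𝒢.Hom M' M) (exc : 𝒢.Fn M') (a' : 𝒢.Pt M') {p : ℕ}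
    (z : Fin p → 𝒢.Fn M) : Ideal ((𝒢.space M').Stalk a') :=
  saturation ((𝒢.space M').idealAt (fun i => 𝒢.pull σ (z i)) a') ((𝒢.space M').germ a' exc)

/-- `a'` lies in the strict transform `N'` of `N`, and `μ_{a'}(exc^{-m} · h ∘ σ) ≥ m` (the order
being that of a function on `N'`) for all `(h, m)`. -/
def Survives {M' M : 𝒢.Obj} (σ : 𝒢.Hom M' M) (exc : 𝒢.Fn M') (a' : 𝒢.Pt M')
    (P : Weighted (𝒢.space M)) : Prop :=
  strictIdeal σ exc a' P.eqs ≠ ⊤ ∧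
    ∀ h ∈ P.fns, ∃ g : (𝒢.space M').Stalk a',
      (𝒢.space M').germ a' exc ^ h.2 * g - (𝒢.space M').germ a' (𝒢.pull σ h.1) ∈
        strictIdeal σ exc a' P.eqs ∧
      g ∈ IsLocalRing.maximalIdeal ((𝒢.space M').Stalk a') ^ h.2 ⊔ strictIdeal σ exc a' P.eqs

/-- `P'` represents the transform of `P` at `a'` by an admissible blowing-up `σ`: its subspace is
(near `a'`) the strict transform `N'`, and its pairs are `(exc^{-m} · h ∘ σ, m)`. -/
def IsTransform {M' M : 𝒢.Obj} (σ : 𝒢.Hom M' M) (exc : 𝒢.Fn M') (a' : 𝒢.Pt M')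
    (P : Weighted (𝒢.space M)) (P' : Weighted (𝒢.space M')) : Prop :=
  P'.codim = P.codim ∧
    (𝒢.space M').idealAt P'.eqs a' = strictIdeal σ exc a' P.eqs ∧
    List.Forall₂ (fun h h' => h'.2 = h.2 ∧
      (𝒢.space M').germ a' exc ^ h.2 * (𝒢.space M').germ a' h'.1 -
        (𝒢.space M').germ a' (𝒢.pull σ h.1) ∈ strictIdeal σ exc a' P.eqs) P.fns P'.fns

/-- `E'` represents the transform of `E` at `a'`: the exceptional divisor together with the strict
transforms, as far as they pass through `a'`, of the hypersurfaces in `E`. -/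
def IsDivisorTransform {M' M : 𝒢.Obj} (σ : 𝒢.Hom M' M) (exc : 𝒢.Fn M') (a' : 𝒢.Pt M')
    (E : List (𝒢.Fn M)) (E' : List (𝒢.Fn M')) : Prop :=
  ∃ L : List (𝒢.Fn M'), E' = exc :: L ∧
    (∀ e' ∈ L, ∃ e ∈ E, strictIdeal σ exc a' ![e] ≠ ⊤ ∧
      Ideal.span {(𝒢.space M').germ a' e'} = strictIdeal σ exc a' ![e]) ∧
    ∀ e ∈ E, strictIdeal σ exc a' ![e] ≠ ⊤ → ∃ e' ∈ L,
      Ideal.span {(𝒢.space M').germ a' e'} = strictIdeal σ exc a' ![e]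

/-- The centre `C = {x = 0}` is admissible at `a` for `P` and `E`: `C` and `E` simultaneously have
only normal crossings, and `a ∈ C ⊆ S_P` (as germs at `a`). -/
def IsAdmissible {M : 𝒢.Obj} (a : 𝒢.Pt M) (E : List (𝒢.Fn M)) {k : ℕ} (x : Fin k → 𝒢.Fn M)
    (P : Weighted (𝒢.space M)) : Prop :=
  (𝒢.space M).NormalCrossings a x E ∧ (∀ j, (𝒢.space M).VanishesAt (x j) a) ∧
    ∀ᶠ w in 𝓝 a, (∀ j, (𝒢.space M).VanishesAt (x j) w) → P.Locus w

/-! ### Sequences of test transformations and equivalence -/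

variable (𝒢)

/-- A stage of a sequence of test transformations: a manifold `M`, a point `a`, the collection `E`
of exceptional hypersurfaces at `a` (given by equations), the pairs `(H₀, H₁)` of elements of `E`
whose intersection may be the centre of an exceptional blowing-up at this stage, and the
transforms `P`, `Q` of the two presentations that are being compared. -/
structure Stage : Type (u + 1) where
  M : 𝒢.Obj
  a : 𝒢.Pt M
  E : List (𝒢.Fn M)
  pairs : List (𝒢.Fn M × 𝒢.Fn M)
  P : Weighted (𝒢.space M)
  Q : Weighted (𝒢.space M)

variable {𝒢}

/-- One step of a sequence of test transformations. Exceptional blowings-up occur only after a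
product with a line, with a hypersurface `H` chosen before that product, or after another
exceptional blowing-up; `pairs` keeps track of the centres which are then allowed. -/
inductive Step : Stage 𝒢 → Stage 𝒢 → Prop
  /-- passage to an open neighbourhood of the point (the germs do not change) -/
  | shrink {M M' : 𝒢.Obj} (j : 𝒢.Hom M' M) (a : 𝒢.Pt M) (a' : 𝒢.Pt M') (E pairs P Q) :
      𝒢.IsOpenImm j → 𝒢.map j a' = a →
      Step ⟨M, a, E, pairs, P, Q⟩
        ⟨M', a', E.map (𝒢.pull j), pairs.map (fun e => (𝒢.pull j e.1, 𝒢.pull j e.2)),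
          P.pull (𝒢.pull j), Q.pull (𝒢.pull j)⟩
  /-- (i) admissible blowing-up -/
  | admissible {M M' : 𝒢.Obj} (σ : 𝒢.Hom M' M) (a : 𝒢.Pt M) (a' : 𝒢.Pt M') (E pairs P Q E' P' Q')
      {k : ℕ} (x : Fin k → 𝒢.Fn M) (i : Fin k) (y : Fin k → 𝒢.Fn M') :
      IsLocalBlowup σ x i y → 𝒢.map σ a' = a →
      IsAdmissible a E x P → IsAdmissible a E x Q →
      Survives σ (𝒢.pull σ (x i)) a' P → Survives σ (𝒢.pull σ (x i)) a' Q →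
      IsTransform σ (𝒢.pull σ (x i)) a' P P' → IsTransform σ (𝒢.pull σ (x i)) a' Q Q' →
      IsDivisorTransform σ (𝒢.pull σ (x i)) a' E E' →
      Step ⟨M, a, E, pairs, P, Q⟩ ⟨M', a', E', [], P', Q'⟩
  /-- (ii) product with a line; `a' = (a, 0)` -/
  | line {M M' : 𝒢.Obj} (σ : 𝒢.Hom M' M) (t : 𝒢.Fn M') (a : 𝒢.Pt M) (a' : 𝒢.Pt M')
      (E pairs P Q) :
      IsLineProduct σ t → 𝒢.map σ a' = a → (𝒢.space M').VanishesAt t a' →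
      Step ⟨M, a, E, pairs, P, Q⟩
        ⟨M', a', t :: E.map (𝒢.pull σ), E.map (fun e => (t, 𝒢.pull σ e)),
          P.pull (𝒢.pull σ), Q.pull (𝒢.pull σ)⟩
  /-- (iii) exceptional blowing-up with centre `H₀ ∩ H₁`, where `H₀ = {e₀ = 0}`, `H₁ = {e₁ = 0}`;
  the strict transform `H₁'` is `{y₁ = 0}`, and `a'` is the point of `H₁'` over `a` -/
  | exceptional {M M' : 𝒢.Obj} (σ : 𝒢.Hom M' M) (a : 𝒢.Pt M) (a' : 𝒢.Pt M')
      (E pairs P Q E') (e₀ e₁ : 𝒢.Fn M) (y : Fin 2 → 𝒢.Fn M') :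
      (e₀, e₁) ∈ pairs → IsLocalBlowup σ ![e₀, e₁] 0 y →
      𝒢.map σ a' = a → (𝒢.space M').VanishesAt (y 1) a' →
      IsDivisorTransform σ (𝒢.pull σ e₀) a' E E' →
      Step ⟨M, a, E, pairs, P, Q⟩
        ⟨M', a', E', [(𝒢.pull σ e₀, y 1)], P.pull (𝒢.pull σ), Q.pull (𝒢.pull σ)⟩

/-- The two conditions which must hold at every stage: (1) the germs at `a` of the equimultiple
loci coincide; (2) for every admissible blowing-up and every point `a'` over `a`, the conditions
under which the two transforms at `a'` are defined are equivalent. -/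
def Stage.Compatible (s : Stage 𝒢) : Prop :=
  (∀ᶠ w in 𝓝 s.a, s.P.Locus w ↔ s.Q.Locus w) ∧
    ∀ {M' : 𝒢.Obj} (σ : 𝒢.Hom M' s.M) (a' : 𝒢.Pt M') {k : ℕ} (x : Fin k → 𝒢.Fn s.M)
      (i : Fin k) (y : Fin k → 𝒢.Fn M'),
      IsLocalBlowup σ x i y → 𝒢.map σ a' = s.a →
      IsAdmissible s.a s.E x s.P → IsAdmissible s.a s.E x s.Q →
      (Survives σ (𝒢.pull σ (x i)) a' s.P ↔ Survives σ (𝒢.pull σ (x i)) a' s.Q)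

/-- Equivalence at `a` of two presentations (with empty collection of hypersurfaces). -/
def EquivalentAt {M : 𝒢.Obj} (a : 𝒢.Pt M) (P Q : Weighted (𝒢.space M)) : Prop :=
  ∀ s : Stage 𝒢, Relation.ReflTransGen Step ⟨M, a, [], [], P, Q⟩ s → s.Compatible

end Geometry

/-! ### Presentations -/

/-- A presentation `(N(a), 𝒢(a), ∅)` of codimension `p` at `a`, given by representatives on an open
neighbourhood `U` of `a`: a submanifold germ `N(a)` of codimension `p` with equations `eqs`, and
finitely many pairs `(g, μ_g)`, `g ∈ 𝒪_{N(a)} = 𝒪_a / (eqs)`, `0 < μ_g ∈ ℚ`, `μ_a(g) ≥ μ_g`. -/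
structure Presentation (𝒢 : Geometry.{u}) (M : 𝒢.Obj) (a : 𝒢.Pt M) (p : ℕ) : Type (u + 1) where
  U : 𝒢.Obj
  incl : 𝒢.Hom U M
  isOpenImm : 𝒢.IsOpenImm incl
  pt : 𝒢.Pt U
  incl_pt : 𝒢.map incl pt = a
  eqs : Fin p → 𝒢.Fn U
  fns : List (𝒢.Fn U × ℚ)
  submanifold : IsPartOfRegularSystem fun i => (𝒢.space U).germ pt (eqs i)
  weight_pos : ∀ g ∈ fns, 0 < g.2
  weight_le : ∀ g ∈ fns, ((⌈g.2⌉₊ : ℕ) : ℕ∞) ≤ (𝒢.space U).orderOn eqs pt g.1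

namespace Presentation

variable {𝒢 : Geometry.{u}} {M : 𝒢.Obj} {a : 𝒢.Pt M} {p q : ℕ}

/-- The invariant `μ = min μ_a(g) / μ_g`, with value `⊤` if there is no finite quotient. -/
def mu (G : Presentation 𝒢 M a p) : WithTop ℚ :=
  (G.fns.map fun g =>
    WithTop.map (fun k : ℕ => (k : ℚ) / g.2) ((𝒢.space G.U).orderOn G.eqs G.pt g.1)).foldr min ⊤

/-- The presentation with denominators cleared: each `(g, m/n)`, in lowest terms, is replaced by
`(g^n, m)`, so that `exc^{-m} · g^n ∘ σ` stands for the `n`-th power of `exc^{-m/n} · g ∘ σ`. -/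
def weighted (G : Presentation 𝒢 M a p) : Weighted (𝒢.space G.U) where
  codim := p
  eqs := G.eqs
  fns := G.fns.map fun g => (g.1 ^ g.2.den, g.2.num.toNat)

/-- Semicoherent equivalence: on a common neighbourhood `W` of `a`, the equimultiple loci coincide,
and the induced presentations are equivalent at every point of the equimultiple locus near `a`. -/
def SemicoherentEquivalent (G : Presentation 𝒢 M a p) (C : Presentation 𝒢 M a q) : Prop :=
  ∃ (W : 𝒢.Obj) (b : 𝒢.Pt W) (j : 𝒢.Hom W G.U) (l : 𝒢.Hom W C.U),
    𝒢.IsOpenImm j ∧ 𝒢.IsOpenImm l ∧ 𝒢.comp j G.incl = 𝒢.comp l C.incl ∧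
    𝒢.map j b = G.pt ∧ 𝒢.map l b = C.pt ∧
    (∀ᶠ w in 𝓝 b, (G.weighted.pull (𝒢.pull j)).Locus w ↔ (C.weighted.pull (𝒢.pull l)).Locus w) ∧
    ∀ᶠ w in 𝓝 b, (G.weighted.pull (𝒢.pull j)).Locus w →
      Geometry.EquivalentAt w (G.weighted.pull (𝒢.pull j)) (C.weighted.pull (𝒢.pull l))

end Presentation

end Desing

end

/-! ### Commutative algebra of maximal contact: filtrations, dual derivations, contact data. -/

noncomputable section

namespace Desing

/-! ### Derivations and the filtration by powers of an ideal -/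

section Filtration

variable {R : Type*} [CommRing R]

/-! The proof is the construction of maximal contact, carried along every sequence of test
transformations. Since the invariant is 1, some pair `(g, k)` has order exactly `k` on `N`. In
characteristic zero there is a derivation `δ` tangent to `N` such that `δ^k g` is a unit
(`exists_derivation_iterate_isUnit`). Put `z = δ^(k-1) g`. Then `δ z` is a unit, so `z = 0` is a
smooth hypersurface `N₊₁` of `N`. Its functions are all `δ^q h` with weight `m - q`, for `0 ≤ q < m`
and each pair `(h, m)` with denominators cleared.

The loci agree by Taylor's formula in `z`: `h` has order at least `m` on `N` if and only if `z`
vanishes and each `δ^q h`, `q < m`, has order at least `m - q` on `z = 0`. The argument needs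
neither completions nor coordinates. It takes place in the filtration `𝔪^k + I`, where `z δ` acts on
the graded ring with nonnegative integral eigenvalues if `δ z = 1`, and positive ones on multiples
of `z` (`mem_fil_of_eigen`, `mem_fil_of_chain`, `IsContact.order_iff`).

The relation between the two presentations must survive transformations. Under an admissible
blowing-up with exceptional equation `exc`, the multiple `exc * δ` lifts to a derivation `δ'`, and
`z` becomes `exc * z'`. The successive derivatives, divided by powers of `exc`, are again successive
derivatives for `δ'`, but only up to multiples of the preceding term. This is why `IsChain` allows
the corrections `lam q * c q` (`IsChain.transform`). Under a product with a line or an exceptional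
blowing-up nothing is divided, so `δ` itself has to lift; for the exceptional blowing-up this holds
because `δ` is logarithmic along the exceptional hypersurfaces. Contact together with this
logarithmic condition is `Invariant`. It is preserved by every step (`Invariant.step`) and implies
both conditions of equivalence (`Invariant.compatible`). At the start there are no hypersurfaces, so
the logarithmic condition is empty. Contact data consist of finitely many relations between germs
and therefore persist at nearby points (`eventually_hasContact`), which gives semicoherence.

The geometric input is isolated in `DiffStructure`: lifting of derivations, a Nullstellensatz for
smooth subspaces, and separatedness. It is verified in both categories. Products and blowings-up are
given there only by universal properties among manifolds. In the algebraic case derivations are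
lifted by deforming points over the dual numbers (`exists_dual_lift`); in the analytic case the
universal property is used to produce coordinates (`exists_coord_of_unique`), and derivations are
written down in them. -/

/-- The filtration of `R` by the ideals `𝔪 ^ k + I`. -/
def fil (m I : Ideal R) (k : ℕ) : Ideal R := m ^ k ⊔ I

variable {m I : Ideal R} {δ : Derivation ℤ R R} {z : R}

theorem fil_zero : fil m I 0 = ⊤ := by simp [fil]

theorem le_fil (k : ℕ) : I ≤ fil m I k := le_sup_right

theorem pow_le_fil (k : ℕ) : m ^ k ≤ fil m I k := le_sup_left

theorem fil_antitone : Antitone (fil m I) := fun _ _ h => sup_le_sup_right (Ideal.pow_le_pow_right h) _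

theorem mul_mem_fil {i j : ℕ} {a b : R} (ha : a ∈ fil m I i) (hb : b ∈ fil m I j) :
    a * b ∈ fil m I (i + j) := by
  obtain ⟨a₁, ha₁, a₂, ha₂, rfl⟩ := Submodule.mem_sup.1 ha
  obtain ⟨b₁, hb₁, b₂, hb₂, rfl⟩ := Submodule.mem_sup.1 hb
  have h : (a₁ + a₂) * (b₁ + b₂) = a₁ * b₁ + (a₂ * (b₁ + b₂) + a₁ * b₂) := by ring
  rw [h]
  refine Submodule.add_mem_sup ?_ (I.add_mem (I.mul_mem_right _ ha₂) (I.mul_mem_left _ hb₂))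
  rw [pow_add]
  exact Ideal.mul_mem_mul ha₁ hb₁

theorem pow_mul_mem_fil (hz : z ∈ m) (e : ℕ) {d : ℕ} {b : R} (hb : b ∈ fil m I d) :
    z ^ e * b ∈ fil m I (e + d) :=
  mul_mem_fil (pow_le_fil e (Ideal.pow_mem_pow hz e)) hb

theorem pow_mem_fil {i : ℕ} {a : R} (ha : a ∈ fil m I i) (n : ℕ) : a ^ n ∈ fil m I (n * i) := by
  induction n with
  | zero => simp [fil_zero]
  | succ n ih =>
    rw [pow_succ, add_mul, one_mul]
    exact mul_mem_fil ih ha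

theorem derivation_mem_pow (δ : Derivation ℤ R R) (m : Ideal R) :
    ∀ (k : ℕ) {f : R}, f ∈ m ^ (k + 1) → δ f ∈ m ^ k := by
  intro k
  induction k with
  | zero => simp
  | succ k ih =>
    intro f hf
    rw [pow_succ] at hf
    refine Submodule.mul_induction_on hf (fun a ha b hb => ?_) (fun a b ha hb => ?_)
    · rw [Derivation.leibniz, smul_eq_mul, smul_eq_mul]
      refine add_mem (Ideal.mul_mem_right _ _ ha) ?_
      rw [pow_succ']
      exact Ideal.mul_mem_mul hb (ih ha)
    · rw [map_add]
      exact add_mem ha hb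

theorem derivation_mem_fil (hI : ∀ f ∈ I, δ f ∈ I) {k : ℕ} {f : R} (hf : f ∈ fil m I (k + 1)) :
    δ f ∈ fil m I k := by
  obtain ⟨a, ha, b, hb, rfl⟩ := Submodule.mem_sup.1 hf
  rw [map_add]
  exact Submodule.add_mem_sup (derivation_mem_pow δ m k ha) (hI b hb)

theorem derivation_span_le {S : Set R} (h : ∀ f ∈ S, δ f ∈ Ideal.span S) :
    ∀ f ∈ Ideal.span S, δ f ∈ Ideal.span S := by
  intro f hf
  induction hf using Submodule.span_induction with
  | mem x hx => exact h x hx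
  | zero => simp
  | add x y _ _ hx hy => rw [map_add]; exact add_mem hx hy
  | smul a x hx hx' =>
    rw [smul_eq_mul, Derivation.leibniz, smul_eq_mul, smul_eq_mul]
    exact add_mem (Ideal.mul_mem_left _ _ hx') (Ideal.mul_mem_right _ _ hx)

/-- The extra factor `z` removes the truncated exponent `e - 1` from the Leibniz rule. If `δ z = 1`,
this says that `z ^ e` is an eigenvector of `z δ` with eigenvalue `e`. -/
theorem mul_derivation_pow (δ : Derivation ℤ R R) (z : R) (e : ℕ) :
    z * δ (z ^ e) = e * z ^ e * δ z := by
  rcases e with _ | e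
  · simp
  · rw [Derivation.leibniz_pow]
    simp only [Nat.add_sub_cancel, smul_eq_mul, nsmul_eq_mul, pow_succ]
    ring

theorem mem_of_natCast_mul_mem (hn : ∀ n : ℕ, n ≠ 0 → IsUnit (n : R)) {J : Ideal R} {n : ℕ}
    (h0 : n ≠ 0) {f : R} (h : (n : R) * f ∈ J) : f ∈ J :=
  (Ideal.unit_mul_mem_iff_mem J (hn n h0)).1 h

/-- The operator `z δ`, where `δ z = 1`, has only nonnegative eigenvalues on the associated graded
ring, and only positive ones on the multiples of `z`. -/
theorem mem_fil_of_eigen (hn : ∀ n : ℕ, n ≠ 0 → IsUnit (n : R)) (hz : z ∈ m) (h1 : δ z = 1)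
    (hI : ∀ f ∈ I, δ f ∈ I) (d : ℕ) : ∀ (e c : ℕ) (f b : R), 0 < e + c → b ∈ fil m I d →
    f - z ^ e * b ∈ fil m I (e + d + 1) → z * δ f + c * f ∈ fil m I (e + d + 1) →
    f ∈ fil m I (e + d + 1) := by
  induction d with
  | zero =>
    intro e c f b hec _ hfb hf
    have h2 : z * δ (f - z ^ e * b) ∈ fil m I (e + 0 + 1) := by
      have := pow_mul_mem_fil (I := I) hz 1 (derivation_mem_fil (m := m) hI hfb)
      rw [pow_one] at this
      exact fil_antitone (by omega) this
    -- For `d = 0` the error term `z ^ (e + 1) * δ b` already lies in the next filtration step.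
    -- Hence `(e + c) * z ^ e * b` lies there too, and `e + c` is invertible.
    have h3 : z ^ (e + 1) * δ b ∈ fil m I (e + 0 + 1) :=
      pow_mul_mem_fil hz (e + 1) (d := 0) (by simp [fil_zero])
    have h4 := mul_derivation_pow δ z e
    have h5 : (((e + c : ℕ) : R)) * (z ^ e * b) ∈ fil m I (e + 0 + 1) := by
      have : (((e + c : ℕ) : R)) * (z ^ e * b) = (z * δ f + c * f) - z * δ (f - z ^ e * b)
          - c * (f - z ^ e * b) - z ^ (e + 1) * δ b := by
        rw [map_sub, Derivation.leibniz, smul_eq_mul, smul_eq_mul]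
        rw [h1] at h4
        push_cast
        linear_combination (-b) * h4
      rw [this]
      exact sub_mem (sub_mem (sub_mem hf h2) (Ideal.mul_mem_left _ _ hfb)) h3
    have h6 := mem_of_natCast_mul_mem hn (by omega) h5
    simpa using add_mem hfb h6
  | succ d ih =>
    intro e c f b hec hb hfb hf
    have h2 : z * δ (f - z ^ e * b) ∈ fil m I (e + (d + 1) + 1) := by
      have := pow_mul_mem_fil (I := I) hz 1 (derivation_mem_fil (m := m) hI hfb)
      rw [pow_one] at this
      exact fil_antitone (by omega) this
    have h4 := mul_derivation_pow δ z e
    -- Modulo the next step, `(e + c) * z ^ e * b` equals `- z ^ (e + 1) * δ b`. The leading term is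
    -- thus rewritten with one more factor `z` and a coefficient one step lower in the filtration,
    -- to which the induction hypothesis applies.
    obtain ⟨v, hv⟩ := (hn (e + c) (by omega)).exists_left_inv
    have hidx : e + (d + 1) + 1 = e + 1 + d + 1 := by omega
    rw [hidx] at hf hfb h2 ⊢
    refine ih (e + 1) c f (-(v * δ b)) (by omega)
      (neg_mem (Ideal.mul_mem_left _ _ (derivation_mem_fil hI hb))) ?_ hf
    have : f - z ^ (e + 1) * -(v * δ b) = (f - z ^ e * b) + v * ((z * δ f + c * f)
        - z * δ (f - z ^ e * b) - c * (f - z ^ e * b)) := by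
      rw [map_sub, Derivation.leibniz, smul_eq_mul, smul_eq_mul]
      rw [h1] at h4
      push_cast at hv
      linear_combination (-v * b) * h4 - z ^ e * b * hv
    rw [this]
    exact add_mem hfb (Ideal.mul_mem_left _ _
      (sub_mem (sub_mem hf h2) (Ideal.mul_mem_left _ _ hfb)))

/-- Since `δ (z * b) = z * δ b + b`, the operator `z δ + 1` annihilates the class of `b` in each
graded piece below degree `j`. All its eigenvalues there are positive, so `b` climbs up the
filtration one step at a time. -/
theorem mem_fil_of_mul_mem_of_derivation_eq_one (hn : ∀ n : ℕ, n ≠ 0 → IsUnit (n : R))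
    (hz : z ∈ m) (h1 : δ z = 1) (hI : ∀ f ∈ I, δ f ∈ I) {j : ℕ} {b : R}
    (h : z * b ∈ fil m I (j + 1)) : b ∈ fil m I j := by
  suffices ∀ i, i ≤ j → b ∈ fil m I i from this j le_rfl
  intro i
  induction i with
  | zero => simp [fil_zero]
  | succ i ih =>
    intro hij
    have hb := ih (by omega)
    have h2 : z * δ b + ((1 : ℕ) : R) * b ∈ fil m I (0 + i + 1) := by
      have := derivation_mem_fil hI h
      rw [Derivation.leibniz, h1, smul_eq_mul, smul_eq_mul, mul_one] at this
      rw [Nat.cast_one, one_mul]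
      exact fil_antitone (by omega) this
    have := mem_fil_of_eigen hn hz h1 hI i 0 1 b b (by omega) hb (by simp) h2
    rwa [zero_add] at this

theorem smul_derivation_mem (hI : ∀ f ∈ I, δ f ∈ I) (v : R) : ∀ f ∈ I, (v • δ) f ∈ I := by
  intro f hf
  rw [Derivation.smul_apply, smul_eq_mul]
  exact Ideal.mul_mem_left _ _ (hI f hf)

/-- If `δ z` is a unit, multiplication by `z` shifts the filtration by exactly one. -/
theorem mem_fil_of_mul_mem (hn : ∀ n : ℕ, n ≠ 0 → IsUnit (n : R)) (hz : z ∈ m)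
    (h1 : IsUnit (δ z)) (hI : ∀ f ∈ I, δ f ∈ I) {j : ℕ} {b : R}
    (h : z * b ∈ fil m I (j + 1)) : b ∈ fil m I j := by
  obtain ⟨v, hv⟩ := h1.exists_left_inv
  exact mem_fil_of_mul_mem_of_derivation_eq_one (δ := v • δ) hn hz
    (by rw [Derivation.smul_apply, smul_eq_mul, hv]) (smul_derivation_mem hI v) h

theorem mem_fil_of_pow_mul_mem (hn : ∀ n : ℕ, n ≠ 0 → IsUnit (n : R)) (hz : z ∈ m)
    (h1 : IsUnit (δ z)) (hI : ∀ f ∈ I, δ f ∈ I) {j : ℕ} (e : ℕ) : ∀ {b : R},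
    z ^ e * b ∈ fil m I (j + e) → b ∈ fil m I j := by
  induction e with
  | zero => intro b h; simpa using h
  | succ e ih =>
    intro b h
    rw [pow_succ', mul_assoc] at h
    exact ih (mem_fil_of_mul_mem hn hz h1 hI h)

/-- If `δ z` is a unit and `I` is closed, then `z` is not a zero divisor modulo `I`. -/
theorem mem_of_mul_mem_of_separated (hn : ∀ n : ℕ, n ≠ 0 → IsUnit (n : R)) (hz : z ∈ m)
    (h1 : IsUnit (δ z)) (hI : ∀ f ∈ I, δ f ∈ I)
    (hsep : ∀ f, (∀ k, f ∈ fil m I k) → f ∈ I) {b : R} (h : z * b ∈ I) : b ∈ I :=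
  hsep b fun _ => mem_fil_of_mul_mem hn hz h1 hI (le_fil _ h)

/-- The class of `f` in degree `j` is a multiple of `z` by `hf'` and is killed by `z δ` by `hδ`. On
multiples of `z` the eigenvalues of `z δ` (with `δ z` normalized to 1) are positive, so the class is
zero. In degree 0 it suffices that `z` itself lies in `m`. -/
theorem mem_fil_succ_of_mem_sup (hn : ∀ n : ℕ, n ≠ 0 → IsUnit (n : R)) (hz : z ∈ m)
    (h1 : IsUnit (δ z)) (hI : ∀ f ∈ I, δ f ∈ I) {j : ℕ} {f : R} (hf : f ∈ fil m I j)
    (hf' : f ∈ fil m I (j + 1) ⊔ Ideal.span {z}) (hδ : δ f ∈ fil m I j) : f ∈ fil m I (j + 1) := by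
  obtain ⟨v, hv⟩ := h1.exists_left_inv
  obtain ⟨s, hs, _, ht, rfl⟩ := Submodule.mem_sup.1 hf'
  obtain ⟨b, rfl⟩ := Ideal.mem_span_singleton'.1 ht
  rcases j with _ | j
  · refine add_mem hs (Ideal.mul_mem_left _ _ (pow_le_fil _ ?_))
    simpa using hz
  have hzb : z * b ∈ fil m I (j + 1) := by
    have := sub_mem hf (fil_antitone (Nat.le_succ _) hs)
    rwa [add_sub_cancel_left, mul_comm] at this
  have hb := mem_fil_of_mul_mem hn hz h1 hI hzb
  have := mem_fil_of_eigen (δ := v • δ) (I := I) hn hz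
    (by rw [Derivation.smul_apply, smul_eq_mul, hv]) (smul_derivation_mem hI v) j 1 0
    (s + b * z) b (by omega) hb (by
      rw [pow_one, mul_comm z b, add_sub_cancel_right]
      exact fil_antitone (by omega) hs) (by
      rw [Nat.cast_zero, zero_mul, add_zero, Derivation.smul_apply, smul_eq_mul]
      have := pow_mul_mem_fil (I := I) hz 1 (Ideal.mul_mem_left _ v hδ)
      rw [pow_one] at this
      exact fil_antitone (by omega) this)
  exact fil_antitone (by omega) this

/-- `c 0, …, c n` is a sequence of successive derivatives of `h`, up to lower order terms and
modulo `I`. -/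
structure IsChain (I : Ideal R) (δ : Derivation ℤ R R) (h : R) (n : ℕ) (c lam : ℕ → R) : Prop where
  zero : c 0 - h ∈ I
  succ : ∀ q < n, δ (c q) - c (q + 1) - lam q * c q ∈ I

/-- A derivation preserving `I` lowers the filtration by at most one, and the correction `lam q * c
q` is even one step better than required. -/
theorem chain_mem_fil (hI : ∀ f ∈ I, δ f ∈ I) {c lam : ℕ → R} {n : ℕ}
    (hc : ∀ q < n, δ (c q) - c (q + 1) - lam q * c q ∈ I) (h0 : c 0 ∈ fil m I n) :
    ∀ q ≤ n, c q ∈ fil m I (n - q) := by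
  intro q
  induction q with
  | zero => intro _; simpa using h0
  | succ q ih =>
    intro hq
    have h1 := ih (by omega)
    have h2 : δ (c q) ∈ fil m I (n - (q + 1)) :=
      derivation_mem_fil hI (by rwa [show n - (q + 1) + 1 = n - q by omega])
    have h3 := le_fil (m := m) (n - (q + 1)) (hc q (by omega))
    have : c (q + 1) = δ (c q) - lam q * c q - (δ (c q) - c (q + 1) - lam q * c q) := by ring
    rw [this]
    exact sub_mem (sub_mem h2 (Ideal.mul_mem_left _ _ (fil_antitone (by omega) h1))) h3

/-- Taylor's formula in the direction of `z`: order `n - q` of the successive derivatives along `z =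
0` gives order `n` for the function itself. All terms of the chain are improved simultaneously,
because raising `c q` to level `j + 1` requires `c (q + 1)` at level `j`. -/
theorem mem_fil_of_chain (hn : ∀ n : ℕ, n ≠ 0 → IsUnit (n : R)) (hz : z ∈ m)
    (h1 : IsUnit (δ z)) (hI : ∀ f ∈ I, δ f ∈ I) {c lam : ℕ → R} {n : ℕ}
    (hc : ∀ q < n, δ (c q) - c (q + 1) - lam q * c q ∈ I)
    (h : ∀ q < n, c q ∈ fil m I (n - q) ⊔ Ideal.span {z}) : c 0 ∈ fil m I n := by
  suffices ∀ j q, q < n → c q ∈ fil m I (min j (n - q)) by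
    rcases Nat.eq_zero_or_pos n with rfl | hpos
    · simp [fil_zero]
    · simpa using this n 0 hpos
  intro j
  induction j with
  | zero => intro q _; simp [fil_zero]
  | succ j ih =>
    intro q hq
    rcases Nat.lt_or_ge j (n - q) with hj | hj
    · have hmin : min (j + 1) (n - q) = j + 1 := by omega
      rw [hmin]
      have hcq : c q ∈ fil m I j := by
        have := ih q hq
        rwa [show min j (n - q) = j by omega] at this
      have hcq1 : c (q + 1) ∈ fil m I j := by
        rcases Nat.lt_or_ge (q + 1) n with hq1 | hq1
        · have := ih (q + 1) hq1
          rwa [show min j (n - (q + 1)) = j by omega] at this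
        -- Here `q = n - 1`, so `j = 0` and nothing is required of `c n`.
        · rw [show j = 0 by omega, fil_zero]; trivial
      refine mem_fil_succ_of_mem_sup hn hz h1 hI hcq ?_ ?_
      · have hle : fil m I (n - q) ⊔ Ideal.span {z} ≤ fil m I (j + 1) ⊔ Ideal.span {z} :=
          sup_le_sup_right (fil_antitone (by omega)) _
        exact hle (h q hq)
      · have : δ (c q) = (δ (c q) - c (q + 1) - lam q * c q) + c (q + 1) + lam q * c q := by ring
        rw [this]
        exact add_mem (add_mem (le_fil _ (hc q hq)) hcq1) (Ideal.mul_mem_left _ _ hcq)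
    · have := ih q hq
      rwa [show min j (n - q) = min (j + 1) (n - q) by omega] at this

end Filtration

end Desing

namespace Desing

/-! ### Derivations dual to a system of parameters -/

section Dual

open IsLocalRing

variable {R : Type*} [CommRing R] [IsLocalRing R]

/-- The elements `z i` lie in the maximal ideal, and there are derivations in `S` which are dual to
them modulo the maximal ideal. -/
def HasDual (S : Submodule R (Derivation ℤ R R)) {k : ℕ} (z : Fin k → R) : Prop :=
  (∀ i, z i ∈ maximalIdeal R) ∧ ∃ D : Fin k → Derivation ℤ R R, (∀ i, D i ∈ S) ∧
    ∀ i j, D i (z j) - (if i = j then 1 else 0) ∈ maximalIdeal R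

variable {S : Submodule R (Derivation ℤ R R)}

theorem derivation_sum_apply {ι : Type*} (s : Finset ι) (D : ι → Derivation ℤ R R) (f : R) :
    (∑ i ∈ s, D i) f = ∑ i ∈ s, D i f := by
  classical
  induction s using Finset.induction_on with
  | empty => simp
  | insert a s ha ih => rw [Finset.sum_insert ha, Finset.sum_insert ha, Derivation.add_apply, ih]

/-- The matrix of values `D i (z j)` is the identity over the residue field, hence invertible. Its
inverse corrects the derivations. -/
theorem exists_exact_dual {k : ℕ} {z : Fin k → R} {D : Fin k → Derivation ℤ R R}
    (h : ∀ i j, D i (z j) - (if i = j then 1 else 0) ∈ maximalIdeal R) :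
    ∃ B : Matrix (Fin k) (Fin k) R,
      ∀ i j, (∑ l, B i l • D l) (z j) = if i = j then 1 else 0 := by
  let A : Matrix (Fin k) (Fin k) R := fun i j => D i (z j)
  have hA : A.map (residue R) = 1 := by
    ext i j
    rw [Matrix.map_apply, Matrix.one_apply]
    have := (residue_eq_zero_iff _).2 (h i j)
    rw [map_sub, sub_eq_zero] at this
    rw [this]
    split_ifs <;> simp
  have hdet : IsUnit A.det := by
    rw [← residue_ne_zero_iff_isUnit, RingHom.map_det, RingHom.mapMatrix_apply, hA, Matrix.det_one]
    exact one_ne_zero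
  refine ⟨A⁻¹, fun i j => ?_⟩
  rw [derivation_sum_apply]
  have := congrFun (congrFun (Matrix.nonsing_inv_mul A hdet) i) j
  rw [Matrix.mul_apply, Matrix.one_apply] at this
  rw [← this]
  rfl

theorem HasDual.exists_exact {k : ℕ} {z : Fin k → R} (h : HasDual S z) :
    ∃ D : Fin k → Derivation ℤ R R, (∀ i, D i ∈ S) ∧
      ∀ i j, D i (z j) = if i = j then 1 else 0 := by
  obtain ⟨_, D, hD, h⟩ := h
  obtain ⟨B, hB⟩ := exists_exact_dual h
  exact ⟨fun i => ∑ l, B i l • D l, fun i => Submodule.sum_mem _ fun l _ => S.smul_mem _ (hD l), hB⟩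

theorem isUnit_of_sub_mem {a b : R} (ha : IsUnit a) (h : b - a ∈ maximalIdeal R) : IsUnit b := by
  by_contra hb
  exact (mem_maximalIdeal a).1 (by simpa using sub_mem ((mem_maximalIdeal b).2 hb) h) ha

/-- A triangular correction: `δ` is scaled to take the value 1 on `t`, and multiples of it are
subtracted from the `D i` to kill their values on `t`. By `hz`, the values on the old `z i` change
only within the maximal ideal. -/
theorem HasDual.snoc {k : ℕ} {z : Fin k → R} (h : HasDual S z) {t : R} (ht : t ∈ maximalIdeal R)
    {δ : Derivation ℤ R R} (hδ : δ ∈ S) (hz : ∀ i, δ (z i) ∈ maximalIdeal R) (hu : IsUnit (δ t)) :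
    HasDual S (Fin.snoc (α := fun _ => R) z t) := by
  obtain ⟨hm, D, hD, h⟩ := h
  obtain ⟨v, hv⟩ := hu.exists_left_inv
  refine ⟨fun i => ?_, Fin.snoc (α := fun _ => Derivation ℤ R R)
    (fun i => D i - (D i t * v) • δ) (v • δ), fun i => ?_, fun i j => ?_⟩
  · refine Fin.lastCases ?_ (fun i => ?_) i
    · simpa using ht
    · simpa using hm i
  · refine Fin.lastCases ?_ (fun i => ?_) i
    · simpa using S.smul_mem v hδ
    · simpa using sub_mem (hD i) (S.smul_mem _ hδ)
  · refine Fin.lastCases ?_ (fun i => ?_) i <;> refine Fin.lastCases ?_ (fun j => ?_) j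
    · simp [hv]
    · simpa [(Fin.castSucc_lt_last j).ne'] using Ideal.mul_mem_left _ v (hz j)
    · have : D i t - D i t * v * δ t = 0 := by rw [mul_assoc, hv, mul_one, sub_self]
      simp [(Fin.castSucc_lt_last i).ne, this]
    · have := sub_mem (h i j) (Ideal.mul_mem_left _ (D i t * v) (hz j))
      simp only [Fin.snoc_castSucc, Derivation.sub_apply, Derivation.smul_apply, smul_eq_mul,
        Fin.castSucc_inj]
      convert this using 1
      ring

theorem range_snoc {α : Type*} {k : ℕ} (z : Fin k → α) (t : α) :
    Set.range (Fin.snoc (α := fun _ => α) z t) = insert t (Set.range z) := by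
  ext x
  constructor
  · rintro ⟨i, rfl⟩
    refine Fin.lastCases ?_ (fun i => ?_) i <;> simp
  · rintro (rfl | ⟨i, rfl⟩)
    · exact ⟨Fin.last k, by simp⟩
    · exact ⟨i.castSucc, by simp⟩

theorem span_range_snoc {k : ℕ} (z : Fin k → R) (t : R) :
    Ideal.span (Set.range (Fin.snoc (α := fun _ => R) z t)) =
      Ideal.span (Set.range z) ⊔ Ideal.span {t} := by
  rw [range_snoc, Ideal.span_insert, sup_comm]

theorem derivation_maximalIdeal_sq {f : R} (δ : Derivation ℤ R R) (hf : f ∈ maximalIdeal R ^ 2) :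
    δ f ∈ maximalIdeal R := by
  simpa using derivation_mem_pow δ (maximalIdeal R) 1 hf

/-- The `n` classes span `𝔪/𝔪²`, whose dimension is `n`. -/
theorem IsRegularSystem.linearIndependent {n : ℕ} {u : Fin n → R} (hu : IsRegularSystem u) :
    LinearIndependent (ResidueField R) fun i => (maximalIdeal R).toCotangent
      ⟨u i, hu.1 ▸ Ideal.subset_span ⟨i, rfl⟩⟩ := by
  refine linearIndependent_of_top_le_span_of_card_eq_finrank ?_ (by simpa using hu.2)
  rintro x -
  obtain ⟨⟨f, hf⟩, rfl⟩ := Ideal.toCotangent_surjective _ x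
  have hf' := hf
  rw [← hu.1] at hf'
  obtain ⟨c, rfl⟩ := (Ideal.mem_span_range_iff_exists_fun).1 hf'
  have : (maximalIdeal R).toCotangent ⟨∑ i, c i * u i, hf⟩ = ∑ i, residue R (c i) •
      (maximalIdeal R).toCotangent ⟨u i, hu.1 ▸ Ideal.subset_span ⟨i, rfl⟩⟩ := by
    have h2 : (⟨∑ i, c i * u i, hf⟩ : maximalIdeal R) =
        ∑ i, c i • ⟨u i, hu.1 ▸ Ideal.subset_span ⟨i, rfl⟩⟩ := by
      ext; simp
    rw [h2, map_sum]
    exact Finset.sum_congr rfl fun i _ => by rw [map_smul]; rfl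
  rw [this]
  exact Submodule.sum_mem _ fun i _ => Submodule.smul_mem _ _ (Submodule.subset_span ⟨i, rfl⟩)

/-- The vectors of values on `u` of the derivations in `S`, taken in the residue field, form a
subspace `W`. If `W` were proper, a nonzero linear form would vanish on it. Lifting its coefficients
gives a combination of the `u i` which all derivations of `S` send into `𝔪`; by `hS` it lies in
`𝔪²`, contradicting the independence of the `u i` modulo `𝔪²`. -/
theorem IsRegularSystem.hasDual
    (hS : ∀ f ∈ maximalIdeal R, (∀ δ ∈ S, δ f ∈ maximalIdeal R) → f ∈ maximalIdeal R ^ 2)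
    {n : ℕ} {u : Fin n → R} (hu : IsRegularSystem u) : HasDual S u := by
  have hmem : ∀ i, u i ∈ maximalIdeal R := fun i => hu.1 ▸ Ideal.subset_span ⟨i, rfl⟩
  refine ⟨hmem, ?_⟩
  let W : Submodule (ResidueField R) (Fin n → ResidueField R) :=
    { carrier := {v | ∃ δ ∈ S, ∀ i, residue R (δ (u i)) = v i}
      zero_mem' := ⟨0, S.zero_mem, by simp⟩
      add_mem' := by
        rintro a b ⟨δ, hδ, ha⟩ ⟨ε, hε, hb⟩
        exact ⟨δ + ε, add_mem hδ hε, fun i => by simp [ha, hb]⟩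
      smul_mem' := by
        rintro c a ⟨δ, hδ, ha⟩
        obtain ⟨c, rfl⟩ := residue_surjective c
        exact ⟨c • δ, S.smul_mem c hδ, fun i => by simp [ha]⟩ }
  have hW : W = ⊤ := by
    by_contra hne
    obtain ⟨φ, hφ0, hφ⟩ := Submodule.exists_le_ker_of_lt_top W (lt_top_iff_ne_top.2 hne)
    choose a ha using fun i => residue_surjective (φ (Pi.single i 1))
    have hφa : ∀ v, φ v = ∑ i, residue R (a i) * v i := by
      intro v
      conv_lhs => rw [← Finset.univ_sum_single v]
      rw [map_sum]
      refine Finset.sum_congr rfl fun i _ => ?_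
      have h1 : (Pi.single i (v i) : Fin n → ResidueField R) = v i • Pi.single i 1 := by
        ext j
        by_cases h : j = i
        · subst h; simp
        · simp [h]
      rw [ha, h1, map_smul, smul_eq_mul, mul_comm]
    have hsum : ∑ i, a i * u i ∈ maximalIdeal R :=
      sum_mem fun i _ => Ideal.mul_mem_left _ _ (hmem i)
    have hsq : ∑ i, a i * u i ∈ maximalIdeal R ^ 2 := by
      refine hS _ hsum fun δ hδ => ?_
      have h1 : (fun i => residue R (δ (u i))) ∈ W := ⟨δ, hδ, fun i => rfl⟩
      have h2 := hφ h1
      rw [LinearMap.mem_ker, hφa] at h2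
      rw [← residue_eq_zero_iff, map_sum, map_sum, ← h2]
      refine Finset.sum_congr rfl fun i _ => ?_
      rw [Derivation.leibniz]
      simp [(residue_eq_zero_iff _).2 (hmem i)]
    have hli := Fintype.linearIndependent_iff.1 hu.linearIndependent (fun i => residue R (a i)) (by
      rw [← (Ideal.toCotangent_eq_zero _ ⟨_, hsum⟩).2 hsq]
      have h2 : (⟨∑ i, a i * u i, hsum⟩ : maximalIdeal R) = ∑ i, a i • ⟨u i, hmem i⟩ := by
        ext; simp
      rw [h2, map_sum]
      exact Finset.sum_congr rfl fun i _ => by rw [map_smul]; rfl)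
    apply hφ0
    ext v
    simp [hφa, hli]
  have : ∀ i : Fin n, ∃ δ ∈ S, ∀ j, residue R (δ (u j)) = if i = j then 1 else 0 := by
    intro i
    have h1 : (fun j => if i = j then (1 : ResidueField R) else 0) ∈ W := hW ▸ trivial
    exact h1
  choose D hD h using this
  refine ⟨D, hD, fun i j => ?_⟩
  rw [← residue_eq_zero_iff, map_sub, h]
  split_ifs <;> simp

theorem HasDual.comp {n k : ℕ} {u : Fin n → R} (hu : HasDual S u) (ι : Fin k ↪ Fin n) :
    HasDual S (u ∘ ι) := by
  obtain ⟨h, D, hD, hd⟩ := hu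
  refine ⟨fun i => h _, D ∘ ι, fun i => hD _, fun i j => ?_⟩
  simpa using hd (ι i) (ι j)

theorem IsPartOfRegularSystem.hasDual
    (hS : ∀ f ∈ maximalIdeal R, (∀ δ ∈ S, δ f ∈ maximalIdeal R) → f ∈ maximalIdeal R ^ 2)
    {k : ℕ} {z : Fin k → R} (hz : IsPartOfRegularSystem z) : HasDual S z := by
  obtain ⟨n, u, ι, hu, h⟩ := hz
  have := (hu.hasDual hS).comp ι
  rwa [show u ∘ ι = z from funext h] at this

/-- Derivations send `𝔪²` into `𝔪`, so the dual system makes the classes of the `z i` independent in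
`𝔪/𝔪²`. They are completed to a basis, and by Nakayama's lemma lifts of the basis generate `𝔪`. -/
theorem HasDual.isPartOfRegularSystem (hfg : (maximalIdeal R).FG) {k : ℕ} {z : Fin k → R}
    (hz : HasDual S z) : IsPartOfRegularSystem z := by
  classical
  obtain ⟨hm, D, -, hd⟩ := hz
  have hfin : Module.Finite R (maximalIdeal R) := Module.Finite.iff_fg.2 hfg
  have hfin' : Module.Finite R (CotangentSpace R) :=
    Module.Finite.of_surjective (maximalIdeal R).toCotangent (Ideal.toCotangent_surjective _)
  have hfin'' : Module.Finite (ResidueField R) (CotangentSpace R) :=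
    Module.Finite.of_restrictScalars_finite R _ _
  have hli : LinearIndependent (ResidueField R)
      fun i => ((maximalIdeal R).toCotangent ⟨z i, hm i⟩ : CotangentSpace R) := by
    rw [Fintype.linearIndependent_iff]
    intro g hg i
    choose a ha using fun i => residue_surjective (g i)
    have hsum : ∑ i, a i * z i ∈ maximalIdeal R :=
      sum_mem fun i _ => Ideal.mul_mem_left _ _ (hm i)
    have h2 : (⟨∑ i, a i * z i, hsum⟩ : maximalIdeal R) = ∑ i, a i • ⟨z i, hm i⟩ := by
      ext; simp
    have h3 : (maximalIdeal R).toCotangent ⟨∑ i, a i * z i, hsum⟩ = 0 := by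
      rw [h2, map_sum, ← hg]
      exact Finset.sum_congr rfl fun i _ => by rw [map_smul, ← ha]; rfl
    have h4 := derivation_maximalIdeal_sq (D i) ((Ideal.toCotangent_eq_zero _ _).1 h3)
    rw [← residue_eq_zero_iff, map_sum, map_sum] at h4
    rw [← ha, ← h4]
    symm
    rw [Finset.sum_eq_single i]
    · have := (residue_eq_zero_iff _).2 (hd i i)
      rw [map_sub, if_pos rfl, map_one, sub_eq_zero] at this
      rw [Derivation.leibniz]
      simp [(residue_eq_zero_iff _).2 (hm i), this]
    · intro j _ hj
      have := (residue_eq_zero_iff _).2 (hd i j)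
      rw [if_neg hj.symm, sub_zero] at this
      rw [Derivation.leibniz]
      simp [(residue_eq_zero_iff _).2 (hm j), this]
    · simp
  let v : Fin k → CotangentSpace R := fun i => (maximalIdeal R).toCotangent ⟨z i, hm i⟩
  have hv : LinearIndepOn (ResidueField R) id (Set.range v) := hli.linearIndepOn_id
  let b := Module.Basis.extend hv
  have hfi : Finite (hv.extend (Set.subset_univ _)) := Module.Finite.finite_basis b
  have hfi' := Fintype.ofFinite (hv.extend (Set.subset_univ _))
  let e := Fintype.equivFin (hv.extend (Set.subset_univ _))
  choose lift hlift using Ideal.toCotangent_surjective (maximalIdeal R)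
  -- The lifts are arbitrary, except that the class of `z i` has to be lifted to `z i` itself.
  let u : hv.extend (Set.subset_univ _) → maximalIdeal R := fun x =>
    if h : ∃ i, v i = x then ⟨z h.choose, hm _⟩ else lift x
  have hub : ∀ i, (maximalIdeal R).toCotangent (u i) = b i := by
    intro i
    rw [Module.Basis.extend_apply_self]
    by_cases h : ∃ j, v j = i
    · simp only [u, dif_pos h]
      exact h.choose_spec
    · simp only [u, dif_neg h]
      exact hlift _
  have hmem : ∀ i, v i ∈ hv.extend (Set.subset_univ _) := fun i => hv.subset_extend _ ⟨i, rfl⟩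
  have huz : ∀ i, (u ⟨v i, hmem i⟩ : R) = z i := by
    intro i
    have h : ∃ j, v j = v i := ⟨i, rfl⟩
    simp only [u, dif_pos h]
    exact congrArg z (hli.injective h.choose_spec)
  refine ⟨_, fun i => (u (e.symm i) : R), ⟨fun i => e ⟨v i, hmem i⟩, fun i j h => ?_⟩,
    ⟨?_, ?_⟩, fun i => ?_⟩
  · exact hli.injective (Subtype.ext_iff.1 (e.injective h))
  · have hrange : Set.range (fun i => (u (e.symm i) : R)) = Set.range fun i => (u i : R) :=
      e.symm.surjective.range_comp fun i => (u i : R)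
    rw [hrange]
    refine le_antisymm (Ideal.span_le.2 ?_) ?_
    · rintro _ ⟨i, rfl⟩; exact (u i).2
    refine Submodule.le_of_le_smul_of_le_jacobson_bot hfg
      (maximalIdeal_le_jacobson ⊥) fun f hf => ?_
    obtain ⟨c, hc⟩ : ∃ c : hv.extend (Set.subset_univ _) → R,
        (maximalIdeal R).toCotangent ⟨f, hf⟩ = (maximalIdeal R).toCotangent (∑ i, c i • u i) := by
      choose c hc using fun i => residue_surjective
        (b.repr ((maximalIdeal R).toCotangent ⟨f, hf⟩) i)
      refine ⟨c, ?_⟩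
      conv_lhs => rw [← b.sum_repr ((maximalIdeal R).toCotangent ⟨f, hf⟩)]
      rw [map_sum]
      exact Finset.sum_congr rfl fun i _ => by rw [map_smul, hub, ← hc]; rfl
    rw [Ideal.toCotangent_eq] at hc
    have hsum : ∑ i, c i * (u i : R) ∈ Ideal.span (Set.range fun i => (u i : R)) :=
      sum_mem fun i _ => Ideal.mul_mem_left _ _ (Ideal.subset_span ⟨i, rfl⟩)
    have : f = (∑ i, c i * (u i : R)) + (f - ∑ i, c i * (u i : R)) := by ring
    rw [this]
    refine Submodule.add_mem_sup hsum ?_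
    rw [smul_eq_mul, ← sq]
    simpa using hc
  · rw [Module.finrank_eq_card_basis b]
  · change (u (e.symm (e ⟨v i, hmem i⟩)) : R) = z i
    rw [Equiv.symm_apply_apply]
    exact huz i

/-! ### Derivations which detect the order -/

theorem iterate_derivation_mem (δ : Derivation ℤ R R) (k : ℕ) : ∀ (d : ℕ) {f : R},
    f ∈ maximalIdeal R ^ (d + k) → δ^[d] f ∈ maximalIdeal R ^ k := by
  intro d
  induction d with
  | zero => intro f hf; simpa using hf
  | succ d ih =>
    intro f hf
    rw [Function.iterate_succ_apply]
    exact ih (derivation_mem_pow δ _ _ (by rwa [show d + k + 1 = d + 1 + k by omega]))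

/-- A Leibniz term with a derivative on `r` leaves fewer than `d` derivatives for `f`, and so lies
in `𝔪`. -/
theorem iterate_derivation_mul_sub (δ : Derivation ℤ R R) : ∀ (d : ℕ) (r : R) {f : R},
    f ∈ maximalIdeal R ^ d → δ^[d] (r * f) - r * δ^[d] f ∈ maximalIdeal R := by
  intro d
  induction d with
  | zero => intro r f _; simp
  | succ d ih =>
    intro r f hf
    rw [Function.iterate_succ_apply, Function.iterate_succ_apply, Derivation.leibniz, smul_eq_mul,
      smul_eq_mul, iterate_map_add]
    have h1 := ih r (derivation_mem_pow δ _ d hf)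
    have h2 : δ^[d] (f * δ r) ∈ maximalIdeal R := by
      simpa using iterate_derivation_mem δ 1 d (Ideal.mul_mem_right (δ r) _ hf)
    rw [add_sub_right_comm]
    exact add_mem h1 h2

/-- Modulo `𝔪`, only the `d + 1` Leibniz terms with exactly one derivative on `y` survive. -/
theorem iterate_derivation_mul_sub' (δ : Derivation ℤ R R) : ∀ (d : ℕ) {y f : R},
    y ∈ maximalIdeal R → f ∈ maximalIdeal R ^ d →
    δ^[d + 1] (y * f) - (d + 1 : ℕ) * (δ y * δ^[d] f) ∈ maximalIdeal R := by
  intro d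
  induction d with
  | zero =>
    intro y f hy _
    simp only [zero_add, Function.iterate_one, Nat.cast_one, one_mul, Function.iterate_zero, id]
    rw [Derivation.leibniz, smul_eq_mul, smul_eq_mul, mul_comm f, add_sub_cancel_right]
    exact Ideal.mul_mem_right _ _ hy
  | succ d ih =>
    intro y f hy hf
    rw [Function.iterate_succ_apply, Derivation.leibniz, smul_eq_mul, smul_eq_mul, iterate_map_add]
    have h1 := ih hy (derivation_mem_pow δ _ d hf)
    have h2 := iterate_derivation_mul_sub δ (d + 1) (δ y) hf
    rw [← Function.iterate_succ_apply δ d] at h1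
    have := add_mem h1 h2
    convert this using 1
    rw [mul_comm f]
    push_cast
    ring

theorem multiset_prod_mem_pow (s : Multiset R) (hs : ∀ y ∈ s, y ∈ maximalIdeal R) :
    s.prod ∈ maximalIdeal R ^ Multiset.card s := by
  induction s using Multiset.induction_on with
  | empty => simp
  | cons a s ih =>
    rw [Multiset.prod_cons, Multiset.card_cons, pow_succ']
    exact Ideal.mul_mem_mul (hs a (by simp)) (ih fun y hy => hs y (by simp [hy]))

theorem iterate_derivation_multiset_prod (δ : Derivation ℤ R R) (s : Multiset R)
    (hs : ∀ y ∈ s, y ∈ maximalIdeal R) :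
    δ^[Multiset.card s] s.prod - (Multiset.card s).factorial * (s.map δ).prod ∈ maximalIdeal R := by
  induction s using Multiset.induction_on with
  | empty => simp
  | cons a s ih =>
    have hs' : ∀ y ∈ s, y ∈ maximalIdeal R := fun y hy => hs y (by simp [hy])
    rw [Multiset.prod_cons, Multiset.card_cons, Multiset.map_cons, Multiset.prod_cons,
      Nat.factorial_succ]
    have h1 := iterate_derivation_mul_sub' δ (Multiset.card s) (hs a (by simp))
      (multiset_prod_mem_pow s hs')
    have h2 := Ideal.mul_mem_left _ (((Multiset.card s + 1 : ℕ) : R) * δ a) (ih hs')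
    have := add_mem h1 h2
    convert this using 1
    push_cast
    ring

theorem eval_eq_sum_multiset {n : ℕ} (u : Fin n → R) (F : MvPolynomial (Fin n) R) :
    MvPolynomial.eval u F =
      ∑ s ∈ F.support, F.coeff s * ((Finsupp.toMultiset s).map u).prod := by
  rw [MvPolynomial.eval_eq]
  refine Finset.sum_congr rfl fun s _ => ?_
  rw [Finsupp.toMultiset_map, Finsupp.prod_toMultiset,
    Finsupp.prod_mapDomain_index (by simp) (by intros; rw [pow_add]), Finsupp.prod]

theorem card_toMultiset_of_isHomogeneous {n d : ℕ} {F : MvPolynomial (Fin n) R}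
    (hF : F.IsHomogeneous d) {s : Fin n →₀ ℕ} (hs : s ∈ F.support) :
    Multiset.card (Finsupp.toMultiset s) = d := by
  rw [Finsupp.card_toMultiset, ← hF (MvPolynomial.mem_support_iff.1 hs),
    Finsupp.weight_apply]
  simp [Finsupp.sum]

/-- In a product of `d` elements of `𝔪`, the `d` derivatives have to hit each factor once, which
happens in `d!` ways; the coefficients of `F` behave like constants modulo `𝔪`. -/
theorem iterate_derivation_eval (δ : Derivation ℤ R R) {n d : ℕ} {u : Fin n → R}
    (hu : ∀ i, u i ∈ maximalIdeal R) {F : MvPolynomial (Fin n) R} (hF : F.IsHomogeneous d) :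
    δ^[d] (MvPolynomial.eval u F) - d.factorial * MvPolynomial.eval (fun i => δ (u i)) F ∈
      maximalIdeal R := by
  rw [eval_eq_sum_multiset, eval_eq_sum_multiset, Finset.mul_sum]
  have hsum : ∀ (t : Finset (Fin n →₀ ℕ)) (f : (Fin n →₀ ℕ) → R),
      δ^[d] (∑ s ∈ t, f s) = ∑ s ∈ t, δ^[d] (f s) := by
    intro t f
    rw [← Derivation.coeFn_coe, ← Module.End.coe_pow, map_sum]
  rw [hsum, ← Finset.sum_sub_distrib]
  refine sum_mem fun s hs => ?_
  have hc := card_toMultiset_of_isHomogeneous hF hs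
  have hmem : ∀ y ∈ (Finsupp.toMultiset s).map u, y ∈ maximalIdeal R := by
    intro y hy
    obtain ⟨i, -, rfl⟩ := Multiset.mem_map.1 hy
    exact hu i
  have hcard : Multiset.card ((Finsupp.toMultiset s).map u) = d := by rw [Multiset.card_map, hc]
  have h1 := iterate_derivation_mul_sub δ d (F.coeff s) (hcard ▸ multiset_prod_mem_pow _ hmem)
  have h2 := Ideal.mul_mem_left _ (F.coeff s) (iterate_derivation_multiset_prod δ _ hmem)
  rw [hcard, Multiset.map_map] at h2
  have := add_mem h1 h2
  convert this using 1
  simp only [Function.comp_def]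
  ring

/-- If `g` has order exactly `d` on the coordinate subspace `u ∘ ι = 0`, then `δ ^ d g` is a unit
for a derivation `δ` which annihilates the equations of that subspace. -/
theorem exists_derivation_iterate_isUnit (hn : ∀ n : ℕ, n ≠ 0 → IsUnit (n : R)) {n k : ℕ}
    {u : Fin n → R} (hu : Ideal.span (Set.range u) = maximalIdeal R) (hS : HasDual S u)
    (ι : Fin k → Fin n) {d : ℕ} {g : R}
    (hg : g ∈ fil (maximalIdeal R) (Ideal.span (Set.range (u ∘ ι))) d)
    (hg' : g ∉ fil (maximalIdeal R) (Ideal.span (Set.range (u ∘ ι))) (d + 1)) :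
    ∃ δ ∈ S, (∀ i, δ (u (ι i)) = 0) ∧ IsUnit (δ^[d] g) := by
  classical
  obtain ⟨D, hD, hd⟩ := hS.exists_exact
  have hmem := hS.1
  set I := Ideal.span (Set.range (u ∘ ι)) with hI
  obtain ⟨g₀, hg₀, g₁, hg₁, rfl⟩ := Submodule.mem_sup.1 hg
  rw [← hu, Ideal.mem_span_pow_iff_exists_isHomogeneous] at hg₀
  obtain ⟨F, hF, rfl⟩ := hg₀
  -- Setting the variables of the subspace to zero changes `g` only modulo `I`. The direction `δ`
  -- chosen below may then have zero components along them.
  let G : MvPolynomial (Fin n) R :=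
    MvPolynomial.aeval (fun i => if i ∈ Set.range ι then 0 else MvPolynomial.X i) F
  have hG : G.IsHomogeneous d := by
    have := MvPolynomial.IsHomogeneous.aeval hF
      (fun i => if i ∈ Set.range ι then 0 else (MvPolynomial.X i : MvPolynomial (Fin n) R)) (n := 1)
      (fun i => by
        split_ifs
        · exact MvPolynomial.isHomogeneous_zero _ _ _
        · exact MvPolynomial.isHomogeneous_X _ _)
    rwa [one_mul] at this
  have hGeval : ∀ v : Fin n → R, MvPolynomial.eval v G =
      MvPolynomial.eval (fun i => if i ∈ Set.range ι then 0 else v i) F := by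
    intro v
    rw [MvPolynomial.eval_eq' _ F]
    simp only [G, MvPolynomial.aeval_def, MvPolynomial.eval₂_eq', map_sum, map_mul, map_prod,
      map_pow, MvPolynomial.algebraMap_eq, MvPolynomial.eval_C]
    refine Finset.sum_congr rfl fun s _ => ?_
    congr 1
    refine Finset.prod_congr rfl fun i _ => ?_
    split_ifs <;> simp
  have hFG : MvPolynomial.eval u F - MvPolynomial.eval u G ∈ I := by
    rw [hGeval, ← Ideal.Quotient.eq_zero_iff_mem, map_sub, sub_eq_zero]
    simp only [MvPolynomial.eval_eq', map_sum, map_mul, map_prod, map_pow]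
    refine Finset.sum_congr rfl fun s _ => ?_
    congr 1
    refine Finset.prod_congr rfl fun i _ => ?_
    congr 1
    split_ifs with h
    · obtain ⟨l, rfl⟩ := h
      rw [map_zero, Ideal.Quotient.eq_zero_iff_mem]
      exact Ideal.subset_span ⟨l, rfl⟩
    · rfl
  -- Otherwise all coefficients of `G` would lie in `𝔪`, and `g` would belong to the next filtration
  -- step, against `hg'`.
  have hGne : MvPolynomial.map (residue R) G ≠ 0 := by
    intro h0
    apply hg'
    have h1 : MvPolynomial.eval u G ∈ fil (maximalIdeal R) I (d + 1) := by
      apply pow_le_fil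
      rw [eval_eq_sum_multiset]
      refine sum_mem fun s hs => ?_
      rw [pow_succ']
      refine Ideal.mul_mem_mul ?_ ?_
      · rw [← residue_eq_zero_iff, ← MvPolynomial.coeff_map, h0, MvPolynomial.coeff_zero]
      · have hc := card_toMultiset_of_isHomogeneous hG hs
        rw [← Multiset.card_map u] at hc
        rw [← hc]
        refine multiset_prod_mem_pow _ fun y hy => ?_
        obtain ⟨i, -, rfl⟩ := Multiset.mem_map.1 hy
        exact hmem i
    have h2 := add_mem (add_mem (le_fil (m := maximalIdeal R) (d + 1) hFG) h1)
      (le_fil (m := maximalIdeal R) (d + 1) hg₁)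
    simpa using h2
  -- Over an infinite field a nonzero polynomial has a point where it does not vanish. That point
  -- provides the components of `δ` in the dual system.
  have hinf : Infinite (ResidueField R) := by
    have : CharZero (ResidueField R) := by
      refine charZero_of_inj_zero fun m hm => ?_
      by_contra h0
      have := (hn m h0).map (residue R)
      rw [map_natCast, hm] at this
      exact not_isUnit_zero this
    infer_instance
  obtain ⟨v, hv⟩ : ∃ v : Fin n → ResidueField R,
      MvPolynomial.eval v (MvPolynomial.map (residue R) G) ≠ 0 := by
    by_contra! h
    exact hGne (MvPolynomial.funext fun v => by rw [h v, map_zero])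
  choose w hw using fun i => residue_surjective (v i)
  have hunit : IsUnit (MvPolynomial.eval w G) := by
    rw [← residue_ne_zero_iff_isUnit]
    convert hv
    rw [MvPolynomial.eval_map, MvPolynomial.eval, MvPolynomial.coe_eval₂Hom,
      MvPolynomial.eval₂_comp_left, show (residue R) ∘ w = v from funext hw, RingHom.comp_id]
  rw [hGeval] at hunit
  let w' : Fin n → R := fun i => if i ∈ Set.range ι then 0 else w i
  let δ : Derivation ℤ R R := ∑ i, w' i • D i
  have hδ : ∀ j, δ (u j) = w' j := by
    intro j
    simp only [δ, derivation_sum_apply, Derivation.smul_apply, smul_eq_mul, hd]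
    simp
  have hδι : ∀ i, δ (u (ι i)) = 0 := fun i => by simp [hδ, w']
  refine ⟨δ, Submodule.sum_mem _ fun i _ => S.smul_mem _ (hD i), hδι, ?_⟩
  have hδI : ∀ f ∈ I, δ f ∈ I := derivation_span_le (by
    rintro _ ⟨i, rfl⟩
    simp [hδι])
  have hIm : I ≤ maximalIdeal R := Ideal.span_le.2 (by rintro _ ⟨i, rfl⟩; exact hmem _)
  have hit : δ^[d] g₁ ∈ I := by
    have : ∀ d, δ^[d] g₁ ∈ I := by
      intro d
      induction d with
      | zero => exact hg₁
      | succ d ih => rw [Function.iterate_succ_apply']; exact hδI _ ih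
    exact this d
  have h1 := iterate_derivation_eval δ hmem hF
  rw [iterate_map_add]
  refine isUnit_of_sub_mem (((hn d.factorial (Nat.factorial_ne_zero d)).mul hunit)) ?_
  have := add_mem h1 (hIm hit)
  convert this using 1
  simp only [hδ, w']
  ring

end Dual

end Desing

namespace Desing

/-! ### Contact data in a local ring -/

section Contact

open IsLocalRing

variable {R : Type*} [CommRing R]

/-- The pairs in `Q` are, modulo `I + (z)`, the successive derivatives with respect to `δ` of the
pairs in `P`, with the corresponding weights, and `z` is one of the derivatives of weight one. -/
structure IsContact (I : Ideal R) (z : R) (δ : Derivation ℤ R R) (P Q : List (R × ℕ)) : Prop where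
  exists_right : ∀ h ∈ P, ∃ c lam : ℕ → R, IsChain I δ h.1 h.2 c lam ∧
    ∀ q < h.2, ∃ f ∈ Q, f.2 = h.2 - q ∧ f.1 - c q ∈ I ⊔ Ideal.span {z}
  exists_left : ∀ f ∈ Q, ∃ h ∈ P, ∃ c lam : ℕ → R, IsChain I δ h.1 h.2 c lam ∧
    ∃ q < h.2, f.2 = h.2 - q ∧ f.1 - c q ∈ I ⊔ Ideal.span {z}
  exists_contact : ∃ h ∈ P, ∃ c lam : ℕ → R, IsChain I δ h.1 h.2 c lam ∧
    0 < h.2 ∧ c (h.2 - 1) - z ∈ I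

/-- `I` is the ideal of a submanifold, `I'` that of a smooth hypersurface in it which has maximal
contact with `P`, and `Q` consists of the derivatives of `P` in a transversal direction. All
derivations belong to `S`. -/
def HasContact (S : Submodule R (Derivation ℤ R R)) (I I' : Ideal R) (P Q : List (R × ℕ)) : Prop :=
  ∃ (p : ℕ) (ζ : Fin p → R) (D : Fin p → Derivation ℤ R R) (δ : Derivation ℤ R R) (z : R),
    (∀ i, D i ∈ S) ∧ (∀ i j, D i (ζ j) = if i = j then 1 else 0) ∧ δ ∈ S ∧
    I = Ideal.span (Set.range ζ) ∧ I' = I ⊔ Ideal.span {z} ∧ (∀ i, δ (ζ i) ∈ I) ∧ IsUnit (δ z) ∧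
    IsContact I z δ P Q

theorem fil_sup (m I J : Ideal R) (k : ℕ) : fil m (I ⊔ J) k = fil m I k ⊔ J := by
  rw [fil, fil, sup_assoc]

theorem fil_le_of_le {m I : Ideal R} (h : I ≤ m) {k : ℕ} (hk : 0 < k) : fil m I k ≤ m :=
  sup_le (Ideal.pow_le_self hk.ne') h

variable [IsLocalRing R]

/-- From left to right, derivatives lose at most one order each, and the derivative of weight one
named in `exists_contact` shows that `z` vanishes. The converse is Taylor's formula,
`mem_fil_of_chain`. -/
theorem IsContact.order_iff (hn : ∀ n : ℕ, n ≠ 0 → IsUnit (n : R)) {I : Ideal R} {z : R}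
    {δ : Derivation ℤ R R} {P Q : List (R × ℕ)} (hI : ∀ f ∈ I, δ f ∈ I) (hz : IsUnit (δ z))
    (hc : IsContact I z δ P Q) :
    (I ≤ maximalIdeal R ∧ ∀ h ∈ P, h.1 ∈ fil (maximalIdeal R) I h.2) ↔
      (I ⊔ Ideal.span {z} ≤ maximalIdeal R ∧
        ∀ f ∈ Q, f.1 ∈ fil (maximalIdeal R) (I ⊔ Ideal.span {z}) f.2) := by
  constructor
  · rintro ⟨hIm, hP⟩
    have key : ∀ h ∈ P, ∀ c lam : ℕ → R, IsChain I δ h.1 h.2 c lam →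
        ∀ q ≤ h.2, c q ∈ fil (maximalIdeal R) I (h.2 - q) := by
      intro h hh c lam hch
      refine chain_mem_fil hI hch.succ ?_
      simpa using add_mem (le_fil (m := maximalIdeal R) h.2 hch.zero) (hP h hh)
    refine ⟨sup_le hIm ?_, fun f hf => ?_⟩
    · obtain ⟨h, hh, c, lam, hch, hpos, hzc⟩ := hc.exists_contact
      rw [Ideal.span_singleton_le_iff_mem]
      have h1 := fil_le_of_le hIm (by omega) (key h hh c lam hch (h.2 - 1) (by omega))
      simpa using sub_mem h1 (hIm hzc)
    · obtain ⟨h, hh, c, lam, hch, q, hq, hfq, hfc⟩ := hc.exists_left f hf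
      have h1 := key h hh c lam hch q hq.le
      rw [hfq]
      have h2 := add_mem (le_fil (m := maximalIdeal R) (h.2 - q) hfc)
        (by rw [fil_sup]; exact Submodule.mem_sup_left h1)
      simpa using h2
  · rintro ⟨hIm, hQ⟩
    refine ⟨le_sup_left.trans hIm, fun h hh => ?_⟩
    obtain ⟨c, lam, hch, hcf⟩ := hc.exists_right h hh
    have h1 : c 0 ∈ fil (maximalIdeal R) I h.2 := by
      refine mem_fil_of_chain hn (hIm (Submodule.mem_sup_right (Ideal.mem_span_singleton_self z)))
        hz hI hch.succ fun q hq => ?_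
      obtain ⟨f, hf, hfq, hfc⟩ := hcf q hq
      rw [← fil_sup]
      have := sub_mem (hQ f hf) (le_fil (m := maximalIdeal R) f.2 hfc)
      rw [hfq] at this
      simpa using this
    simpa using sub_mem h1 (le_fil (m := maximalIdeal R) h.2 hch.zero)

end Contact

/-! ### Transforms of contact data -/

section Blowup

open IsLocalRing

variable {R R' : Type*} [CommRing R] [CommRing R'] {φ : R →+* R'}

theorem saturation_eq_of_forall {J₀ J : Ideal R'} {exc : R'} (h₀ : J₀ ≤ J)
    (h₁ : ∀ f ∈ J, exc * f ∈ J₀) (hreg : ∀ b, exc * b ∈ J → b ∈ J) : saturation J₀ exc = J := by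
  refine le_antisymm ?_ fun f hf => ⟨1, by simpa using h₁ f hf⟩
  rintro f ⟨n, hf⟩
  have := h₀ hf
  clear hf
  induction n with
  | zero => simpa using this
  | succ n ih =>
    rw [pow_succ', mul_assoc] at this
    exact ih (hreg _ this)

theorem mem_of_pow_mul_mem {J : Ideal R'} {exc : R'} (hreg : ∀ b, exc * b ∈ J → b ∈ J) (n : ℕ)
    {b : R'} (h : exc ^ n * b ∈ J) : b ∈ J := by
  induction n with
  | zero => simpa using h
  | succ n ih =>
    rw [pow_succ', mul_assoc] at h
    exact ih (hreg _ h)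

/-- As `δ' exc` is a multiple of `exc`, differentiating `exc ^ n * f` gives `exc ^ n * δ' f` up to a
multiple of `exc ^ n * f`; the exponent `n` does not have to grow. -/
theorem derivation_saturation {J₀ : Ideal R'} {exc : R'} {δ' : Derivation ℤ R' R'} {β : R'}
    (hβ : δ' exc = exc * β) (h : ∀ f ∈ J₀, δ' f ∈ J₀) :
    ∀ f ∈ saturation J₀ exc, δ' f ∈ saturation J₀ exc := by
  rintro f ⟨n, hf⟩
  refine ⟨n, ?_⟩
  have h1 := h _ hf
  have h2 : δ' (exc ^ n) = n * exc ^ n * β := by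
    rcases n with _ | n
    · simp
    · rw [Derivation.leibniz_pow, hβ]
      simp only [Nat.add_sub_cancel, smul_eq_mul, nsmul_eq_mul, pow_succ]
      ring
  rw [Derivation.leibniz, h2, smul_eq_mul, smul_eq_mul] at h1
  have h3 := sub_mem h1 (J₀.mul_mem_left (n * β) hf)
  convert h3 using 1
  ring

variable {I : Ideal R} {J : Ideal R'} {exc β z' : R'} {z : R} {δ : Derivation ℤ R R}
  {δ' : Derivation ℤ R' R'}

/-- The quotient `c' q` of `φ (c q)` by `exc ^ (n - q)` is constructed recursively from `g`. Passing
from `q` to `q + 1` uses one power of `exc` less, which matches the factor `exc` in `δ' ∘ φ = exc *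
(φ ∘ δ)`. -/
theorem IsChain.transform (hIJ : I.map φ ≤ J) (hreg : ∀ b, exc * b ∈ J → b ∈ J)
    (hβ : δ' exc = exc * β) (hδ : ∀ r, δ' (φ r) = exc * φ (δ r)) (hJ : ∀ f ∈ J, δ' f ∈ J)
    {h : R} {n : ℕ} {c lam : ℕ → R} (hc : IsChain I δ h n c lam) {h' g : R'}
    (hg : exc ^ n * g - φ h ∈ J) (hgh : g - h' ∈ J) :
    ∃ c' lam' : ℕ → R', c' 0 = g ∧ IsChain J δ' h' n c' lam' ∧
      ∀ q ≤ n, exc ^ (n - q) * c' q - φ (c q) ∈ J := by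
  have hφ : ∀ r ∈ I, φ r ∈ J := fun r hr => hIJ (Ideal.mem_map_of_mem φ hr)
  -- Differentiating `exc ^ (n - q) * c' q` yields the additional term `(n - q) * β * exc ^ (n - q)
  -- * c' q`. It is absorbed in the correction, so a chain without corrections usually acquires them
  -- after a blowing-up.
  let lam' : ℕ → R' := fun q => exc * φ (lam q) - (n - q : ℕ) * β
  let c' : ℕ → R' := fun q => Nat.rec g (fun q b => δ' b - lam' q * b) q
  have hc' : ∀ q, c' (q + 1) = δ' (c' q) - lam' q * c' q := fun q => rfl
  refine ⟨c', lam', rfl, ⟨hgh, fun q _ => ?_⟩, fun q => ?_⟩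
  · rw [hc']
    convert J.zero_mem using 1
    ring
  · induction q with
    | zero =>
      intro _
      have := sub_mem hg (hφ _ hc.zero)
      rw [map_sub] at this
      convert this using 1
      change exc ^ (n - 0) * g - φ (c 0) = _
      rw [Nat.sub_zero]
      ring
    | succ q ih =>
      intro hq
      obtain ⟨k, hk⟩ : ∃ k, n - q = k + 1 := ⟨n - q - 1, by omega⟩
      have h0 := ih (by omega)
      have h1 := hJ _ h0
      have h2 := hφ _ (hc.succ q (by omega))
      have h3 : δ' (exc ^ (k + 1)) = (k + 1 : ℕ) * exc ^ (k + 1) * β := by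
        rw [Derivation.leibniz_pow, hβ]
        simp only [Nat.add_sub_cancel, smul_eq_mul, nsmul_eq_mul, pow_succ]
        ring
      rw [hk] at h0 h1
      rw [map_sub, Derivation.leibniz, h3, hδ, smul_eq_mul, smul_eq_mul] at h1
      rw [map_sub, map_sub, map_mul] at h2
      -- Differentiation gives the desired relation multiplied by `exc`, which is cancelled modulo
      -- `J`.
      refine hreg _ ?_
      have h4 := add_mem (add_mem h1 (J.mul_mem_left exc h2))
        (J.mul_mem_left (-(exc * φ (lam q))) h0)
      convert h4 using 1
      rw [hc', show n - (q + 1) = k by omega]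
      simp only [lam']
      rw [hk]
      ring

/-- The transform of `P` at the given point of the blowing-up is defined. -/
def RingSurvives [IsLocalRing R'] (φ : R →+* R') (J : Ideal R') (exc : R') (P : List (R × ℕ)) :
    Prop :=
  J ≠ ⊤ ∧ ∀ h ∈ P, ∃ g, exc ^ h.2 * g - φ h.1 ∈ J ∧ g ∈ maximalIdeal R' ^ h.2 ⊔ J

/-- Applying `δ'` to `φ z = exc * z'` and cancelling `exc` gives `δ' z' = φ (δ z) - β * z'` modulo
`J`; the last term lies in the maximal ideal. -/
theorem isUnit_derivation_transform [IsLocalRing R'] (hJm : J ≤ maximalIdeal R')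
    (hreg : ∀ b, exc * b ∈ J → b ∈ J)
    (hβ : δ' exc = exc * β) (hδ : ∀ r, δ' (φ r) = exc * φ (δ r)) (hz' : φ z = exc * z')
    (hzm : z' ∈ maximalIdeal R') (hz : IsUnit (δ z)) : IsUnit (δ' z') := by
  have h1 := hδ z
  rw [hz', Derivation.leibniz, hβ, smul_eq_mul, smul_eq_mul] at h1
  have h2 : exc * (δ' z' - (φ (δ z) - β * z')) ∈ J := by
    convert J.zero_mem using 1
    linear_combination h1
  refine isUnit_of_sub_mem (hz.map φ) ?_
  have := sub_mem (hJm (hreg _ h2)) (Ideal.mul_mem_left _ β hzm)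
  convert this using 1
  ring

/-- This is the argument of `IsContact.order_iff` for the divided functions, whose chains for `δ'`
come from `IsChain.transform`. The assumptions on `J` and `J + (z')` are conditional because the
given point need not lie on the strict transforms. -/
theorem IsContact.survives_iff [IsLocalRing R'] (hn : ∀ n : ℕ, n ≠ 0 → IsUnit (n : R'))
    {P Q : List (R × ℕ)} (hc : IsContact I z δ P Q) (hz : IsUnit (δ z))
    (hIJ : I.map φ ≤ J) (hreg : J ≠ ⊤ → ∀ b, exc * b ∈ J → b ∈ J)
    (hreg' : J ⊔ Ideal.span {z'} ≠ ⊤ →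
      ∀ b, exc * b ∈ J ⊔ Ideal.span {z'} → b ∈ J ⊔ Ideal.span {z'})
    (hβ : δ' exc = exc * β) (hδ : ∀ r, δ' (φ r) = exc * φ (δ r))
    (hJ : J ≠ ⊤ → ∀ f ∈ J, δ' f ∈ J)
    (hz' : φ z = exc * z') (hdiv : J ≠ ⊤ → ∀ h ∈ P, ∃ g, exc ^ h.2 * g - φ h.1 ∈ J) :
    RingSurvives φ J exc P ↔ RingSurvives φ (J ⊔ Ideal.span {z'}) exc Q := by
  have hφ : ∀ r ∈ I, φ r ∈ J := fun r hr => hIJ (Ideal.mem_map_of_mem φ hr)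
  have hφ' : ∀ r ∈ I ⊔ Ideal.span {z}, φ r ∈ J ⊔ Ideal.span {z'} := by
    intro r hr
    obtain ⟨a, ha, b, hb, rfl⟩ := Submodule.mem_sup.1 hr
    obtain ⟨b, rfl⟩ := Ideal.mem_span_singleton'.1 hb
    rw [map_add, map_mul, hz', ← mul_assoc]
    exact Submodule.add_mem_sup (hφ a ha) (Ideal.mul_mem_left _ _ (Ideal.mem_span_singleton_self _))
  constructor
  · rintro ⟨hne, hP⟩
    have hJm := le_maximalIdeal hne
    have key : ∀ h ∈ P, ∀ c lam : ℕ → R, IsChain I δ h.1 h.2 c lam → ∃ c' : ℕ → R',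
        (∀ q ≤ h.2, exc ^ (h.2 - q) * c' q - φ (c q) ∈ J) ∧
        ∀ q ≤ h.2, c' q ∈ fil (maximalIdeal R') J (h.2 - q) := by
      intro h hh c lam hch
      obtain ⟨g, hg, hgm⟩ := hP h hh
      obtain ⟨c', lam', hc0, hch', hcc⟩ := hch.transform hIJ (hreg hne) hβ hδ (hJ hne) hg
        (h' := g) (by simp)
      exact ⟨c', hcc, chain_mem_fil (hJ hne) hch'.succ (hc0 ▸ hgm)⟩
    -- The divided derivative of weight one has order at least one. After cancelling `exc` it agrees
    -- with `z'` modulo `J`, so the point lies on the strict transform of the hypersurface.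
    have hzm : z' ∈ maximalIdeal R' := by
      obtain ⟨h, hh, c, lam, hch, hpos, hzc⟩ := hc.exists_contact
      obtain ⟨c', hcc, hcm⟩ := key h hh c lam hch
      have h1 := hcc (h.2 - 1) (by omega)
      have h2 := fil_le_of_le hJm (by omega) (hcm (h.2 - 1) (by omega))
      rw [show h.2 - (h.2 - 1) = 1 by omega, pow_one] at h1
      have h3 := hφ _ hzc
      rw [map_sub, hz'] at h3
      have h4 : exc * (c' (h.2 - 1) - z') ∈ J := by
        convert add_mem h1 h3 using 1
        ring
      simpa using sub_mem h2 (hJm (hreg hne _ h4))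
    refine ⟨ne_top_of_le_ne_top (Ideal.IsPrime.ne_top inferInstance) (sup_le hJm
      ((Ideal.span_singleton_le_iff_mem _).2 hzm)), fun f hf => ?_⟩
    obtain ⟨h, hh, c, lam, hch, q, hq, hfq, hfc⟩ := hc.exists_left f hf
    obtain ⟨c', hcc, hcm⟩ := key h hh c lam hch
    refine ⟨c' q, ?_, ?_⟩
    · have h1 := hφ' _ hfc
      rw [map_sub] at h1
      rw [hfq]
      have := sub_mem (Submodule.mem_sup_left (hcc q hq.le)) h1
      convert this using 1
      ring
    · rw [hfq, ← sup_assoc]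
      exact Submodule.mem_sup_left (hcm q hq.le)
  · rintro ⟨hne', hQ⟩
    have hne : J ≠ ⊤ := ne_top_of_le_ne_top hne' le_sup_left
    have hJm' := le_maximalIdeal hne'
    have hJm := le_maximalIdeal hne
    have hzm : z' ∈ maximalIdeal R' :=
      hJm' (Submodule.mem_sup_right (Ideal.mem_span_singleton_self z'))
    refine ⟨hne, fun h hh => ?_⟩
    -- Survival of `Q` only gives quotients modulo `J + (z')`. That `h` is divisible already modulo
    -- `J` has to be supplied separately.
    obtain ⟨g, hg⟩ := hdiv hne h hh
    refine ⟨g, hg, ?_⟩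
    obtain ⟨c, lam, hch, hcf⟩ := hc.exists_right h hh
    obtain ⟨c', lam', hc0, hch', hcc⟩ := hch.transform hIJ (hreg hne) hβ hδ (hJ hne) hg
      (h' := g) (by simp)
    rw [← hc0]
    refine mem_fil_of_chain (m := maximalIdeal R') hn hzm
      (isUnit_derivation_transform hJm (hreg hne) hβ hδ hz' hzm hz) (hJ hne) hch'.succ
      fun q hq => ?_
    obtain ⟨f, hf, hfq, hfc⟩ := hcf q hq
    obtain ⟨g', hg', hgm⟩ := hQ f hf
    have h1 := hφ' _ hfc
    rw [map_sub] at h1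
    rw [hfq] at hg' hgm
    have h2 : exc ^ (h.2 - q) * (g' - c' q) ∈ J ⊔ Ideal.span {z'} := by
      have := sub_mem (add_mem hg' h1) (Submodule.mem_sup_left (hcc q hq.le))
      convert this using 1
      ring
    have h3 := mem_of_pow_mul_mem (hreg' hne') _ h2
    rw [← fil_sup]
    simpa [fil] using sub_mem hgm (Submodule.mem_sup_right h3)

/-- `P'` consists of the functions `exc ^ (-m) * h`, modulo `J`. -/
def RingTransform (φ : R →+* R') (J : Ideal R') (exc : R') (P : List (R × ℕ))
    (P' : List (R' × ℕ)) : Prop :=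
  List.Forall₂ (fun h h' => h'.2 = h.2 ∧ exc ^ h.2 * h'.1 - φ h.1 ∈ J) P P'

theorem exists_of_forall₂_left {α β : Type*} {r : α → β → Prop} {l : List α} {l' : List β}
    (h : List.Forall₂ r l l') {a : α} (ha : a ∈ l) : ∃ b ∈ l', r a b := by
  induction h with
  | nil => simp at ha
  | cons hr _ ih =>
    rcases List.mem_cons.1 ha with rfl | ha
    · exact ⟨_, by simp, hr⟩
    · obtain ⟨b, hb, hab⟩ := ih ha
      exact ⟨b, by simp [hb], hab⟩

theorem exists_of_forall₂_right {α β : Type*} {r : α → β → Prop} {l : List α} {l' : List β}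
    (h : List.Forall₂ r l l') {b : β} (hb : b ∈ l') : ∃ a ∈ l, r a b :=
  exists_of_forall₂_left h.flip hb

/-- The derivatives of a transformed function are the old derivatives divided by powers of `exc`.
Such quotients are unique modulo `J` and modulo `J + (z')` by `hreg` and `hreg'`, so they agree with
the given transforms of `Q` and with `z'`. -/
theorem IsContact.transform {P Q : List (R × ℕ)} (hc : IsContact I z δ P Q) (hIJ : I.map φ ≤ J)
    (hreg : ∀ b, exc * b ∈ J → b ∈ J)
    (hreg' : ∀ b, exc * b ∈ J ⊔ Ideal.span {z'} → b ∈ J ⊔ Ideal.span {z'})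
    (hβ : δ' exc = exc * β) (hδ : ∀ r, δ' (φ r) = exc * φ (δ r)) (hJ : ∀ f ∈ J, δ' f ∈ J)
    (hz' : φ z = exc * z') {P' Q' : List (R' × ℕ)} (hP : RingTransform φ J exc P P')
    (hQ : RingTransform φ (J ⊔ Ideal.span {z'}) exc Q Q') : IsContact J z' δ' P' Q' := by
  have hφ : ∀ r ∈ I, φ r ∈ J := fun r hr => hIJ (Ideal.mem_map_of_mem φ hr)
  have hφ' : ∀ r ∈ I ⊔ Ideal.span {z}, φ r ∈ J ⊔ Ideal.span {z'} := by
    intro r hr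
    obtain ⟨a, ha, b, hb, rfl⟩ := Submodule.mem_sup.1 hr
    obtain ⟨b, rfl⟩ := Ideal.mem_span_singleton'.1 hb
    rw [map_add, map_mul, hz', ← mul_assoc]
    exact Submodule.add_mem_sup (hφ a ha) (Ideal.mul_mem_left _ _ (Ideal.mem_span_singleton_self _))
  have key : ∀ (h : R × ℕ) (c lam : ℕ → R), IsChain I δ h.1 h.2 c lam → ∀ h' : R' × ℕ,
      h'.2 = h.2 → exc ^ h.2 * h'.1 - φ h.1 ∈ J → ∃ c' lam' : ℕ → R',
        IsChain J δ' h'.1 h'.2 c' lam' ∧ ∀ q ≤ h.2, exc ^ (h.2 - q) * c' q - φ (c q) ∈ J := by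
    intro h c lam hch h' hw hh'
    obtain ⟨c', lam', -, hch', hcc⟩ := hch.transform hIJ hreg hβ hδ hJ hh' (h' := h'.1) (by simp)
    exact ⟨c', lam', hw ▸ hch', hcc⟩
  have key' : ∀ (h : R × ℕ) (c : ℕ → R) (c' : ℕ → R') (q : ℕ),
      exc ^ (h.2 - q) * c' q - φ (c q) ∈ J → ∀ (f : R × ℕ) (f' : R' × ℕ), f.2 = h.2 - q →
      f.1 - c q ∈ I ⊔ Ideal.span {z} → exc ^ f.2 * f'.1 - φ f.1 ∈ J ⊔ Ideal.span {z'} →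
      f'.1 - c' q ∈ J ⊔ Ideal.span {z'} := by
    intro h c c' q hcc f f' hfq hfc hff
    have h1 := hφ' _ hfc
    rw [map_sub] at h1
    rw [hfq] at hff
    refine mem_of_pow_mul_mem hreg' (h.2 - q) ?_
    have := sub_mem (add_mem hff h1) (Submodule.mem_sup_left hcc)
    convert this using 1
    ring
  refine ⟨fun h' hh' => ?_, fun f' hf' => ?_, ?_⟩
  · obtain ⟨h, hh, hw, hr⟩ := exists_of_forall₂_right hP hh'
    obtain ⟨c, lam, hch, hcf⟩ := hc.exists_right h hh
    obtain ⟨c', lam', hch', hcc⟩ := key h c lam hch h' hw hr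
    refine ⟨c', lam', hch', fun q hq => ?_⟩
    rw [hw] at hq ⊢
    obtain ⟨f, hf, hfq, hfc⟩ := hcf q hq
    obtain ⟨f', hf', hfw, hfr⟩ := exists_of_forall₂_left hQ hf
    exact ⟨f', hf', hfw.trans hfq, key' h c c' q (hcc q hq.le) f f' hfq hfc hfr⟩
  · obtain ⟨f, hf, hfw, hfr⟩ := exists_of_forall₂_right hQ hf'
    obtain ⟨h, hh, c, lam, hch, q, hq, hfq, hfc⟩ := hc.exists_left f hf
    obtain ⟨h', hh', hw, hr⟩ := exists_of_forall₂_left hP hh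
    obtain ⟨c', lam', hch', hcc⟩ := key h c lam hch h' hw hr
    exact ⟨h', hh', c', lam', hch', q, hw.symm ▸ hq, by rw [hfw, hw, hfq],
      key' h c c' q (hcc q hq.le) f f' hfq hfc hfr⟩
  · obtain ⟨h, hh, c, lam, hch, hpos, hzc⟩ := hc.exists_contact
    obtain ⟨h', hh', hw, hr⟩ := exists_of_forall₂_left hP hh
    obtain ⟨c', lam', hch', hcc⟩ := key h c lam hch h' hw hr
    refine ⟨h', hh', c', lam', hch', hw.symm ▸ hpos, ?_⟩
    rw [hw]
    have h1 := hcc (h.2 - 1) (by omega)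
    rw [show h.2 - (h.2 - 1) = 1 by omega, pow_one] at h1
    have h3 := hφ _ hzc
    rw [map_sub, hz'] at h3
    refine hreg _ ?_
    convert add_mem h1 h3 using 1
    ring

/-- Contact data are compatible with ring homomorphisms to which the derivations extend. -/
theorem IsContact.map {P Q : List (R × ℕ)} (hc : IsContact I z δ P Q)
    (hδ : ∀ r, δ' (φ r) = φ (δ r)) : IsContact (I.map φ) (φ z) δ'
      (P.map fun h => (φ h.1, h.2)) (Q.map fun h => (φ h.1, h.2)) := by
  have hsup : I.map φ ⊔ Ideal.span {φ z} = (I ⊔ Ideal.span {z}).map φ := by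
    rw [Ideal.map_sup, Ideal.map_span, Set.image_singleton]
  have key : ∀ (h : R) (n : ℕ) (c lam : ℕ → R), IsChain I δ h n c lam →
      IsChain (I.map φ) δ' (φ h) n (fun q => φ (c q)) (fun q => φ (lam q)) := by
    intro h n c lam hch
    refine ⟨?_, fun q hq => ?_⟩
    · rw [← map_sub]; exact Ideal.mem_map_of_mem φ hch.zero
    · rw [hδ, ← map_sub, ← map_mul, ← map_sub]; exact Ideal.mem_map_of_mem φ (hch.succ q hq)
  refine ⟨fun h' hh' => ?_, fun f' hf' => ?_, ?_⟩
  · obtain ⟨h, hh, rfl⟩ := List.mem_map.1 hh'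
    obtain ⟨c, lam, hch, hcf⟩ := hc.exists_right h hh
    refine ⟨_, _, key _ _ c lam hch, fun q hq => ?_⟩
    obtain ⟨f, hf, hfq, hfc⟩ := hcf q hq
    refine ⟨_, List.mem_map.2 ⟨f, hf, rfl⟩, hfq, ?_⟩
    rw [hsup, ← map_sub]
    exact Ideal.mem_map_of_mem φ hfc
  · obtain ⟨f, hf, rfl⟩ := List.mem_map.1 hf'
    obtain ⟨h, hh, c, lam, hch, q, hq, hfq, hfc⟩ := hc.exists_left f hf
    refine ⟨_, List.mem_map.2 ⟨h, hh, rfl⟩, _, _, key _ _ c lam hch, q, hq, hfq, ?_⟩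
    rw [hsup, ← map_sub]
    exact Ideal.mem_map_of_mem φ hfc
  · obtain ⟨h, hh, c, lam, hch, hpos, hzc⟩ := hc.exists_contact
    refine ⟨_, List.mem_map.2 ⟨h, hh, rfl⟩, _, _, key _ _ c lam hch, hpos, ?_⟩
    rw [← map_sub]
    exact Ideal.mem_map_of_mem φ hzc

theorem HasContact.map {S : Submodule R (Derivation ℤ R R)}
    {S' : Submodule R' (Derivation ℤ R' R')} {I' : Ideal R} {P Q : List (R × ℕ)}
    (hc : HasContact S I I' P Q)
    (hS : ∀ δ ∈ S, ∃ δ' ∈ S', ∀ r, δ' (φ r) = φ (δ r)) :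
    HasContact S' (I.map φ) (I'.map φ) (P.map fun h => (φ h.1, h.2))
      (Q.map fun h => (φ h.1, h.2)) := by
  obtain ⟨p, ζ, D, δ, z, hD, hdual, hδ, rfl, rfl, hδζ, hu, hc⟩ := hc
  choose D' hD' hDφ using fun i => hS (D i) (hD i)
  obtain ⟨δ', hδ', hδφ⟩ := hS δ hδ
  refine ⟨p, fun i => φ (ζ i), D', δ', φ z, hD', fun i j => ?_, hδ', ?_, ?_, fun i => ?_, ?_,
    hc.map hδφ⟩
  · rw [hDφ, hdual]
    split_ifs <;> simp
  · rw [Ideal.map_span, ← Set.range_comp]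
    rfl
  · rw [Ideal.map_sup, Ideal.map_span φ {z}, Set.image_singleton]
  · rw [hδφ]
    exact Ideal.mem_map_of_mem φ (hδζ i)
  · rw [hδφ]
    exact hu.map φ

end Blowup

end Desing

/-! ### Differential structures, and the invariance of contact under test transformations. -/

namespace Desing

/-! ### Differential structures on a category of manifolds -/

open IsLocalRing

/-- Sections, derivations and their behaviour under the morphisms which occur in test
transformations. -/
structure DiffStructure (𝒢 : Geometry.{u}) where
  stalkMap {A B : 𝒢.Obj} (f : 𝒢.Hom A B) (x : 𝒢.Pt A) :
    (𝒢.space B).Stalk (𝒢.map f x) →+* (𝒢.space A).Stalk x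
  isLocalHom_stalkMap {A B : 𝒢.Obj} (f : 𝒢.Hom A B) (x : 𝒢.Pt A) : IsLocalHom (stalkMap f x)
  stalkMap_germ {A B : 𝒢.Obj} (f : 𝒢.Hom A B) (x : 𝒢.Pt A) (s : 𝒢.Fn B) :
    stalkMap f x ((𝒢.space B).germ _ s) = (𝒢.space A).germ x (𝒢.pull f s)
  continuous_map {A B : 𝒢.Obj} (f : 𝒢.Hom A B) : Continuous (𝒢.map f)
  /-- families of germs which come from a regular function near `a` -/
  Sec {M : 𝒢.Obj} (a : 𝒢.Pt M) : Subring (∀ w, (𝒢.space M).Stalk w)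
  germ_mem_sec {M : 𝒢.Obj} (a : 𝒢.Pt M) (f : 𝒢.Fn M) : (fun w => (𝒢.space M).germ w f) ∈ Sec a
  exists_sec {M : 𝒢.Obj} {a : 𝒢.Pt M} (f : (𝒢.space M).Stalk a) : ∃ s ∈ Sec a, s a = f
  sec_eventually_eq_zero {M : 𝒢.Obj} {a : 𝒢.Pt M} {s : ∀ w, (𝒢.space M).Stalk w} :
    s ∈ Sec a → s a = 0 → ∀ᶠ w in 𝓝 a, s w = 0
  /-- the derivations over the ground field -/
  Der {M : 𝒢.Obj} (a : 𝒢.Pt M) :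
    Submodule ((𝒢.space M).Stalk a) (Derivation ℤ ((𝒢.space M).Stalk a) ((𝒢.space M).Stalk a))
  exists_der_family {M : 𝒢.Obj} {a : 𝒢.Pt M} {δ} : δ ∈ Der a →
    ∃ D : ∀ w, Derivation ℤ ((𝒢.space M).Stalk w) ((𝒢.space M).Stalk w), D a = δ ∧
      (∀ᶠ w in 𝓝 a, D w ∈ Der w) ∧ ∀ s ∈ Sec a, (fun w => D w (s w)) ∈ Sec a
  mem_sq_of_der {M : 𝒢.Obj} {a : 𝒢.Pt M} (f) : f ∈ maximalIdeal ((𝒢.space M).Stalk a) →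
    (∀ δ ∈ Der a, δ f ∈ maximalIdeal ((𝒢.space M).Stalk a)) →
    f ∈ maximalIdeal ((𝒢.space M).Stalk a) ^ 2
  fg_maximalIdeal {M : 𝒢.Obj} (a : 𝒢.Pt M) : (maximalIdeal ((𝒢.space M).Stalk a)).FG
  isUnit_natCast {M : 𝒢.Obj} (a : 𝒢.Pt M) (n : ℕ) : n ≠ 0 → IsUnit (n : (𝒢.space M).Stalk a)
  -- Krull's intersection theorem for the local ring of a submanifold. It serves to turn statements
  -- about orders into membership in the ideal.
  separated {M : 𝒢.Obj} {a : 𝒢.Pt M} {k : ℕ} {z : Fin k → (𝒢.space M).Stalk a} :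
    HasDual (Der a) z → ∀ f, (∀ n, f ∈ fil (maximalIdeal _) (Ideal.span (Set.range z)) n) →
    f ∈ Ideal.span (Set.range z)
  nullstellensatz {M : 𝒢.Obj} {a : 𝒢.Pt M} {k : ℕ} {z : Fin k → ∀ w, (𝒢.space M).Stalk w} :
    (∀ i, z i ∈ Sec a) → HasDual (Der a) (fun i => z i a) → ∀ f ∈ Sec a,
    (∀ᶠ w in 𝓝 a, (∀ i, z i w ∈ maximalIdeal _) → f w ∈ maximalIdeal _) →
    f a ∈ Ideal.span (Set.range fun i => z i a)
  der_openImm {A B : 𝒢.Obj} {j : 𝒢.Hom A B} : 𝒢.IsOpenImm j → ∀ (x : 𝒢.Pt A),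
    ∀ δ ∈ Der (𝒢.map j x), ∃ δ' ∈ Der x, ∀ r, δ' (stalkMap j x r) = stalkMap j x (δ r)
  der_line {L M : 𝒢.Obj} {σ : 𝒢.Hom L M} {t : 𝒢.Fn L} : Geometry.IsLineProduct σ t →
    ∀ (x : 𝒢.Pt L), ∀ δ ∈ Der (𝒢.map σ x),
    ∃ δ' ∈ Der x, (∀ r, δ' (stalkMap σ x r) = stalkMap σ x (δ r)) ∧ δ' ((𝒢.space L).germ x t) = 0
  -- Differentiating `x j = y j * x i` shows that a lift of `∑ e l * D l` with values `η j` on `y j`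
  -- must satisfy the displayed equation. The field asserts that this necessary condition is
  -- sufficient, for every point over the centre.
  der_blowup {M' M : 𝒢.Obj} {σ : 𝒢.Hom M' M} {k : ℕ} {x : Fin k → 𝒢.Fn M} {i : Fin k}
    {y : Fin k → 𝒢.Fn M'} : Geometry.IsLocalBlowup σ x i y → ∀ (a' : 𝒢.Pt M'),
    (∀ j, (𝒢.space M).VanishesAt (x j) (𝒢.map σ a')) → ∀ (n : ℕ)
    (D : Fin n → Derivation ℤ ((𝒢.space M).Stalk (𝒢.map σ a')) ((𝒢.space M).Stalk (𝒢.map σ a')))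
    (e : Fin n → (𝒢.space M').Stalk a') (η : Fin k → (𝒢.space M').Stalk a'),
    (∀ l, D l ∈ Der (𝒢.map σ a')) → η i = 0 →
    (∀ j, ∑ l, e l * (stalkMap σ a' (D l ((𝒢.space M).germ _ (x j))) -
      (𝒢.space M').germ a' (y j) * stalkMap σ a' (D l ((𝒢.space M).germ _ (x i)))) =
        (𝒢.space M').germ a' (𝒢.pull σ (x i)) * η j) →
    ∃ δ' ∈ Der a', (∀ r, δ' (stalkMap σ a' r) = ∑ l, e l * stalkMap σ a' (D l r)) ∧
      ∀ j, δ' ((𝒢.space M').germ a' (y j)) = η j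
  exists_openImm {M : 𝒢.Obj} (a : 𝒢.Pt M) {ι : Type} [Finite ι]
    (s : ι → ∀ w, (𝒢.space M).Stalk w) : (∀ i, s i ∈ Sec a) →
    ∃ (U : 𝒢.Obj) (j : 𝒢.Hom U M) (b : 𝒢.Pt U) (f : ι → 𝒢.Fn U), 𝒢.IsOpenImm j ∧
      𝒢.map j b = a ∧ ∀ i w, (𝒢.space U).germ w (f i) = stalkMap j w (s i (𝒢.map j w))
  isOpenImm_comp {A B C : 𝒢.Obj} {f : 𝒢.Hom A B} {g : 𝒢.Hom B C} :
    𝒢.IsOpenImm f → 𝒢.IsOpenImm g → 𝒢.IsOpenImm (𝒢.comp f g)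
  map_comp {A B C : 𝒢.Obj} (f : 𝒢.Hom A B) (g : 𝒢.Hom B C) (x : 𝒢.Pt A) :
    𝒢.map (𝒢.comp f g) x = 𝒢.map g (𝒢.map f x)
  pull_comp {A B C : 𝒢.Obj} (f : 𝒢.Hom A B) (g : 𝒢.Hom B C) (s : 𝒢.Fn C) :
    𝒢.pull (𝒢.comp f g) s = 𝒢.pull f (𝒢.pull g s)
  exists_id (A : 𝒢.Obj) : ∃ f : 𝒢.Hom A A, 𝒢.IsOpenImm f ∧ (∀ x, 𝒢.map f x = x) ∧
    (∀ s, 𝒢.pull f s = s) ∧ ∀ {B : 𝒢.Obj} (g : 𝒢.Hom A B), 𝒢.comp f g = g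

namespace DiffStructure

variable {𝒢 : Geometry.{u}} {M M' : 𝒢.Obj} (𝒟 : DiffStructure 𝒢)

instance {A B : 𝒢.Obj} (f : 𝒢.Hom A B) (x : 𝒢.Pt A) : IsLocalHom (𝒟.stalkMap f x) :=
  𝒟.isLocalHom_stalkMap f x

theorem stalkMap_mem_maximalIdeal (f : 𝒢.Hom M' M) (x : 𝒢.Pt M')
    (r : (𝒢.space M).Stalk (𝒢.map f x)) :
    𝒟.stalkMap f x r ∈ maximalIdeal _ ↔ r ∈ maximalIdeal _ := by
  rw [mem_maximalIdeal, mem_maximalIdeal, mem_nonunits_iff, mem_nonunits_iff, isUnit_map_iff]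

theorem vanishesAt_pull (𝒟 : DiffStructure 𝒢) (f : 𝒢.Hom M' M) (x : 𝒢.Pt M') (s : 𝒢.Fn M) :
    (𝒢.space M').VanishesAt (𝒢.pull f s) x ↔ (𝒢.space M).VanishesAt s (𝒢.map f x) := by
  rw [FunctionSpace.VanishesAt, FunctionSpace.VanishesAt, ← 𝒟.stalkMap_germ,
    𝒟.stalkMap_mem_maximalIdeal]

theorem idealAt_pull (f : 𝒢.Hom M' M) (x : 𝒢.Pt M') {p : ℕ} (z : Fin p → 𝒢.Fn M) :
    (𝒢.space M').idealAt (fun i => 𝒢.pull f (z i)) x =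
      ((𝒢.space M).idealAt z (𝒢.map f x)).map (𝒟.stalkMap f x) := by
  rw [FunctionSpace.idealAt, FunctionSpace.idealAt, Ideal.map_span, ← Set.range_comp]
  simp only [Function.comp_def, 𝒟.stalkMap_germ]

theorem map_fil_le (f : 𝒢.Hom M' M) (x : 𝒢.Pt M') {I : Ideal ((𝒢.space M).Stalk (𝒢.map f x))}
    {k : ℕ} {r : (𝒢.space M).Stalk (𝒢.map f x)} (hr : r ∈ fil (maximalIdeal _) I k) :
    𝒟.stalkMap f x r ∈ fil (maximalIdeal _) (I.map (𝒟.stalkMap f x)) k := by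
  obtain ⟨a, ha, b, hb, rfl⟩ := Submodule.mem_sup.1 hr
  rw [map_add]
  refine Submodule.add_mem_sup ?_ (Ideal.mem_map_of_mem _ hb)
  have h1 : (maximalIdeal ((𝒢.space M).Stalk (𝒢.map f x))).map (𝒟.stalkMap f x) ≤ maximalIdeal _ :=
    ((local_hom_TFAE (𝒟.stalkMap f x)).out 0 2 rfl rfl).1 inferInstance
  refine Ideal.pow_right_mono h1 k ?_
  rw [← Ideal.map_pow]
  exact Ideal.mem_map_of_mem _ ha

/-! Sections -/

/-- The coefficients of a linear relation at `a` extend to sections, and a section with zero germ at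
`a` vanishes near `a`. -/
theorem eventually_mem_span {a : 𝒢.Pt M} {s : ∀ w, (𝒢.space M).Stalk w} (hs : s ∈ 𝒟.Sec a) {k : ℕ}
    {t : Fin k → ∀ w, (𝒢.space M).Stalk w} (ht : ∀ i, t i ∈ 𝒟.Sec a)
    (h : s a ∈ Ideal.span (Set.range fun i => t i a)) :
    ∀ᶠ w in 𝓝 a, s w ∈ Ideal.span (Set.range fun i => t i w) := by
  obtain ⟨c, hc⟩ := Ideal.mem_span_range_iff_exists_fun.1 h
  choose cs hcs hca using fun i => 𝒟.exists_sec (c i)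
  have h1 : s - ∑ i, cs i * t i ∈ 𝒟.Sec a :=
    sub_mem hs (sum_mem fun i _ => mul_mem (hcs i) (ht i))
  have h2 := 𝒟.sec_eventually_eq_zero h1 (by simp [← hc, hca])
  filter_upwards [h2] with w hw
  have : s w = ∑ i, cs i w * t i w := by
    have := sub_eq_zero.1 hw
    simpa using this
  rw [this]
  exact sum_mem fun i _ => Ideal.mul_mem_left _ _ (Ideal.subset_span ⟨i, rfl⟩)

theorem eventually_eq {a : 𝒢.Pt M} {s t : ∀ w, (𝒢.space M).Stalk w} (hs : s ∈ 𝒟.Sec a)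
    (ht : t ∈ 𝒟.Sec a) (h : s a = t a) : ∀ᶠ w in 𝓝 a, s w = t w := by
  filter_upwards [𝒟.sec_eventually_eq_zero (sub_mem hs ht) (by simp [h])] with w hw
  exact sub_eq_zero.1 hw

theorem eventually_isUnit {a : 𝒢.Pt M} {s : ∀ w, (𝒢.space M).Stalk w} (hs : s ∈ 𝒟.Sec a)
    (h : IsUnit (s a)) : ∀ᶠ w in 𝓝 a, IsUnit (s w) := by
  obtain ⟨v, hv⟩ := h.exists_left_inv
  obtain ⟨t, ht, rfl⟩ := 𝒟.exists_sec v
  filter_upwards [𝒟.eventually_eq (mul_mem ht hs) (one_mem _) hv] with w hw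
  exact .of_mul_eq_one_right (t w) hw

theorem eventually_sup_span {a : 𝒢.Pt M} {s : ∀ w, (𝒢.space M).Stalk w} (hs : s ∈ 𝒟.Sec a) {k : ℕ}
    {t : Fin k → ∀ w, (𝒢.space M).Stalk w} (ht : ∀ i, t i ∈ 𝒟.Sec a)
    {z : ∀ w, (𝒢.space M).Stalk w} (hz : z ∈ 𝒟.Sec a)
    (h : s a ∈ Ideal.span (Set.range fun i => t i a) ⊔ Ideal.span {z a}) :
    ∀ᶠ w in 𝓝 a, s w ∈ Ideal.span (Set.range fun i => t i w) ⊔ Ideal.span {z w} := by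
  have hsn : ∀ w, (fun i => (Fin.snoc (α := fun _ => ∀ w, (𝒢.space M).Stalk w) t z) i w) =
      Fin.snoc (α := fun _ => (𝒢.space M).Stalk w) (fun i => t i w) (z w) := by
    intro w
    ext i
    refine Fin.lastCases ?_ (fun i => ?_) i <;> simp
  simp only [← span_range_snoc] at h ⊢
  simp only [← hsn] at h ⊢
  refine 𝒟.eventually_mem_span hs (fun i => ?_) h
  refine Fin.lastCases ?_ (fun i => ?_) i
  · simpa using hz
  · simpa using ht i

/-- The germs at `w` of the pairs of `P`. -/
def germs (P : Weighted (𝒢.space M)) (w : 𝒢.Pt M) : List ((𝒢.space M).Stalk w × ℕ) :=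
  P.fns.map fun h => ((𝒢.space M).germ w h.1, h.2)

/-- Because the filtration decreases, failure at `m` bounds the supremum by `m - 1`. Orders are
henceforth replaced by ideal membership. -/
theorem natCast_le_orderOn_iff {X : FunctionSpace.{u}} {p : ℕ} {z : Fin p → X.Fn} {x : X.Pt}
    {f : X.Fn} {m : ℕ} :
    (m : ℕ∞) ≤ X.orderOn z x f ↔ X.germ x f ∈ fil (maximalIdeal _) (X.idealAt z x) m := by
  constructor
  · intro h
    by_contra hf
    rcases Nat.eq_zero_or_pos m with rfl | hm
    · simp [fil_zero] at hf
    have : X.orderOn z x f ≤ ((m - 1 : ℕ) : ℕ∞) := by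
      refine iSup₂_le fun k hk => ?_
      rw [Nat.cast_le]
      by_contra hkm
      exact hf (fil_antitone (by omega) hk)
    have h2 := h.trans this
    rw [Nat.cast_le] at h2
    omega
  · intro h
    exact le_iSup₂_of_le m h le_rfl

theorem locus_iff {P : Weighted (𝒢.space M)} {w : 𝒢.Pt M} :
    P.Locus w ↔ (𝒢.space M).idealAt P.eqs w ≤ maximalIdeal _ ∧
      ∀ h ∈ germs P w, h.1 ∈ fil (maximalIdeal _) ((𝒢.space M).idealAt P.eqs w) h.2 := by
  refine and_congr ?_ ?_
  · rw [FunctionSpace.idealAt, Ideal.span_le, Set.range_subset_iff]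
    rfl
  · simp only [germs, List.mem_map, forall_exists_index, and_imp, forall_apply_eq_imp_iff₂]
    exact forall₂_congr fun h _ => natCast_le_orderOn_iff

theorem locus_iff_of_hasContact (𝒟 : DiffStructure 𝒢) {P Q : Weighted (𝒢.space M)} {w : 𝒢.Pt M} {S}
    (h : HasContact S ((𝒢.space M).idealAt P.eqs w) ((𝒢.space M).idealAt Q.eqs w) (germs P w)
      (germs Q w)) : P.Locus w ↔ Q.Locus w := by
  obtain ⟨p, ζ, D, δ, z, -, -, -, hI, hI', hδ, hu, hc⟩ := h
  rw [locus_iff, locus_iff, hI']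
  refine hc.order_iff (𝒟.isUnit_natCast w) ?_ hu
  rw [hI] at hδ ⊢
  exact derivation_span_le (by rintro _ ⟨i, rfl⟩; exact hδ i)

/-- Finitely many relations between germs persist in a neighbourhood. -/
theorem eventually_isChain {a : 𝒢.Pt M} {k : ℕ} {t : Fin k → ∀ w, (𝒢.space M).Stalk w}
    (ht : ∀ i, t i ∈ 𝒟.Sec a)
    {D : ∀ w, Derivation ℤ ((𝒢.space M).Stalk w) ((𝒢.space M).Stalk w)}
    (hD : ∀ s ∈ 𝒟.Sec a, (fun w => D w (s w)) ∈ 𝒟.Sec a) {h : ∀ w, (𝒢.space M).Stalk w}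
    (hh : h ∈ 𝒟.Sec a) {n : ℕ} {c lam : ℕ → (𝒢.space M).Stalk a}
    (hc : IsChain (Ideal.span (Set.range fun i => t i a)) (D a) (h a) n c lam) :
    ∃ cs : ℕ → ∀ w, (𝒢.space M).Stalk w, (∀ q, cs q ∈ 𝒟.Sec a) ∧ (∀ q, cs q a = c q) ∧
      ∀ᶠ w in 𝓝 a, ∃ lam', IsChain (Ideal.span (Set.range fun i => t i w)) (D w) (h w) n
        (fun q => cs q w) lam' := by
  choose cs hcs hca using fun q => 𝒟.exists_sec (c q)
  choose ls hls hla using fun q => 𝒟.exists_sec (lam q)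
  refine ⟨cs, hcs, hca, ?_⟩
  have h1 := 𝒟.eventually_mem_span (sub_mem (hcs 0) hh) ht (by
    simpa [hca] using hc.zero)
  have h2 : ∀ᶠ w in 𝓝 a, ∀ q ∈ Finset.range n, D w (cs q w) - cs (q + 1) w - ls q w * cs q w ∈
      Ideal.span (Set.range fun i => t i w) := by
    rw [Filter.eventually_all_finset]
    intro q hq
    have := 𝒟.eventually_mem_span (sub_mem (sub_mem (hD _ (hcs q)) (hcs (q + 1)))
      (mul_mem (hls q) (hcs q))) ht (by
        simpa [hca, hla] using hc.succ q (Finset.mem_range.1 hq))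
    simpa using this
  filter_upwards [h1, h2] with w hw1 hw2
  exact ⟨fun q => ls q w, by simpa using hw1, fun q hq => hw2 q (Finset.mem_range.2 hq)⟩

theorem eventually_span_eq {a : 𝒢.Pt M} {k l : ℕ} {s : Fin k → ∀ w, (𝒢.space M).Stalk w}
    {t : Fin l → ∀ w, (𝒢.space M).Stalk w} (hs : ∀ i, s i ∈ 𝒟.Sec a) (ht : ∀ i, t i ∈ 𝒟.Sec a)
    (h : Ideal.span (Set.range fun i => s i a) = Ideal.span (Set.range fun i => t i a)) :
    ∀ᶠ w in 𝓝 a, Ideal.span (Set.range fun i => s i w) = Ideal.span (Set.range fun i => t i w) := by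
  have h1 : ∀ᶠ w in 𝓝 a, ∀ i, s i w ∈ Ideal.span (Set.range fun i => t i w) :=
    Filter.eventually_all.2 fun i => 𝒟.eventually_mem_span (hs i) ht
      (h ▸ Ideal.subset_span ⟨i, rfl⟩)
  have h2 : ∀ᶠ w in 𝓝 a, ∀ i, t i w ∈ Ideal.span (Set.range fun i => s i w) :=
    Filter.eventually_all.2 fun i => 𝒟.eventually_mem_span (ht i) hs
      (h ▸ Ideal.subset_span ⟨i, rfl⟩)
  filter_upwards [h1, h2] with w hw1 hw2
  refine le_antisymm (Ideal.span_le.2 ?_) (Ideal.span_le.2 ?_)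
  · rintro _ ⟨i, rfl⟩; exact hw1 i
  · rintro _ ⟨i, rfl⟩; exact hw2 i

/-- Contact data are finitely many identities and ideal memberships between sections and their
derivatives, together with one unit. The derivations extend to families acting on sections, so each
relation persists near `a`. -/
theorem eventually_hasContact {P Q : Weighted (𝒢.space M)} {a : 𝒢.Pt M}
    (h : HasContact (𝒟.Der a) ((𝒢.space M).idealAt P.eqs a) ((𝒢.space M).idealAt Q.eqs a)
      (germs P a) (germs Q a)) :
    ∀ᶠ w in 𝓝 a, HasContact (𝒟.Der w) ((𝒢.space M).idealAt P.eqs w) ((𝒢.space M).idealAt Q.eqs w)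
      (germs P w) (germs Q w) := by
  obtain ⟨p, ζ, D, δ, z, hD, hdual, hδ, hI, hI', hδζ, hu, hc⟩ := h
  rw [hI] at hI' hδζ hc
  choose ζs hζs hζa using fun i => 𝒟.exists_sec (ζ i)
  obtain ⟨zs, hzs, hza⟩ := 𝒟.exists_sec z
  choose Ds hDa hDw hDs using fun i => 𝒟.exists_der_family (hD i)
  obtain ⟨δs, rfl, hδw, hδs⟩ := 𝒟.exists_der_family hδ
  obtain rfl : (fun i => ζs i a) = ζ := funext hζa
  subst hza
  have e1 : ∀ᶠ w in 𝓝 a, ∀ i, Ds i w ∈ 𝒟.Der w := Filter.eventually_all.2 hDw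
  have e2 : ∀ᶠ w in 𝓝 a, ∀ i j, Ds i w (ζs j w) = if i = j then 1 else 0 := by
    refine Filter.eventually_all.2 fun i => Filter.eventually_all.2 fun j => ?_
    have := 𝒟.eventually_eq (hDs i _ (hζs j)) (t := if i = j then 1 else 0)
      (by split_ifs; exacts [one_mem _, zero_mem _]) (by
        rw [hDa, hdual]; split_ifs <;> rfl)
    filter_upwards [this] with w hw
    rw [hw]
    split_ifs <;> rfl
  have e3 := 𝒟.eventually_span_eq (fun i => 𝒟.germ_mem_sec a (P.eqs i)) hζs hI
  have e4 : ∀ᶠ w in 𝓝 a, (𝒢.space M).idealAt Q.eqs w =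
      Ideal.span (Set.range fun i => ζs i w) ⊔ Ideal.span {zs w} := by
    have h1 : ∀ᶠ w in 𝓝 a, ∀ i, (𝒢.space M).germ w (Q.eqs i) ∈
        Ideal.span (Set.range fun i => ζs i w) ⊔ Ideal.span {zs w} :=
      Filter.eventually_all.2 fun i => 𝒟.eventually_sup_span (𝒟.germ_mem_sec a (Q.eqs i)) hζs hzs
        (hI' ▸ Ideal.subset_span ⟨i, rfl⟩)
    have h2 : ∀ᶠ w in 𝓝 a, ∀ i, ζs i w ∈ (𝒢.space M).idealAt Q.eqs w :=
      Filter.eventually_all.2 fun i => 𝒟.eventually_mem_span (hζs i)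
        (fun i => 𝒟.germ_mem_sec a (Q.eqs i))
        (hI'.symm ▸ Submodule.mem_sup_left (Ideal.subset_span ⟨i, rfl⟩) :
          ζs i a ∈ (𝒢.space M).idealAt Q.eqs a)
    have h3 : ∀ᶠ w in 𝓝 a, zs w ∈ (𝒢.space M).idealAt Q.eqs w :=
      𝒟.eventually_mem_span hzs (fun i => 𝒟.germ_mem_sec a (Q.eqs i))
        (hI'.symm ▸ Submodule.mem_sup_right (Ideal.mem_span_singleton_self _) :
          zs a ∈ (𝒢.space M).idealAt Q.eqs a)
    filter_upwards [h1, h2, h3] with w h1 h2 h3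
    refine le_antisymm (Ideal.span_le.2 ?_) (sup_le (Ideal.span_le.2 ?_)
      ((Ideal.span_singleton_le_iff_mem _).2 h3))
    · rintro _ ⟨i, rfl⟩; exact h1 i
    · rintro _ ⟨i, rfl⟩; exact h2 i
  have e5 : ∀ᶠ w in 𝓝 a, ∀ i, δs w (ζs i w) ∈ Ideal.span (Set.range fun i => ζs i w) :=
    Filter.eventually_all.2 fun i => 𝒟.eventually_mem_span (hδs _ (hζs i)) hζs (hδζ i)
  have e6 := 𝒟.eventually_isUnit (hδs _ hzs) hu
  have e7 : ∀ᶠ w in 𝓝 a, ∀ h ∈ P.fns, ∃ c lam : ℕ → (𝒢.space M).Stalk w,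
      IsChain (Ideal.span (Set.range fun i => ζs i w)) (δs w) ((𝒢.space M).germ w h.1) h.2 c lam ∧
      ∀ q < h.2, ∃ f ∈ Q.fns, f.2 = h.2 - q ∧ (𝒢.space M).germ w f.1 - c q ∈
        Ideal.span (Set.range fun i => ζs i w) ⊔ Ideal.span {zs w} := by
    suffices ∀ h ∈ P.fns, ∀ᶠ w in 𝓝 a, ∃ c lam : ℕ → (𝒢.space M).Stalk w,
        IsChain (Ideal.span (Set.range fun i => ζs i w)) (δs w) ((𝒢.space M).germ w h.1) h.2 c lam ∧
        ∀ q ∈ Finset.range h.2, ∃ f ∈ Q.fns, f.2 = h.2 - q ∧ (𝒢.space M).germ w f.1 - c q ∈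
          Ideal.span (Set.range fun i => ζs i w) ⊔ Ideal.span {zs w} by
      have h0 := (Filter.eventually_all_finite (List.finite_toSet P.fns)).2 this
      simpa using h0
    intro h hh
    obtain ⟨c, lam, hch, hcf⟩ := hc.exists_right _ (List.mem_map_of_mem (f := fun h =>
      ((𝒢.space M).germ a h.1, h.2)) hh)
    obtain ⟨cs, hcs, hca, hcw⟩ := 𝒟.eventually_isChain hζs hδs (𝒟.germ_mem_sec a h.1) hch
    have : ∀ᶠ w in 𝓝 a, ∀ q ∈ Finset.range h.2, ∃ f ∈ Q.fns, f.2 = h.2 - q ∧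
        (𝒢.space M).germ w f.1 - cs q w ∈
          Ideal.span (Set.range fun i => ζs i w) ⊔ Ideal.span {zs w} := by
      rw [Filter.eventually_all_finset]
      intro q hq
      obtain ⟨_, hf₀, hfq, hfc⟩ := hcf q (Finset.mem_range.1 hq)
      obtain ⟨f, hf, rfl⟩ := List.mem_map.1 hf₀
      filter_upwards [𝒟.eventually_sup_span (sub_mem (𝒟.germ_mem_sec a f.1) (hcs q)) hζs hzs
        (by simpa [hca] using hfc)] with w hw
      exact ⟨f, hf, hfq, hw⟩
    filter_upwards [hcw, this] with w ⟨lam', hw1⟩ hw2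
    exact ⟨_, lam', hw1, hw2⟩
  have e8 : ∀ᶠ w in 𝓝 a, ∀ f ∈ Q.fns, ∃ h ∈ P.fns, ∃ c lam : ℕ → (𝒢.space M).Stalk w,
      IsChain (Ideal.span (Set.range fun i => ζs i w)) (δs w) ((𝒢.space M).germ w h.1) h.2 c lam ∧
      ∃ q < h.2, f.2 = h.2 - q ∧ (𝒢.space M).germ w f.1 - c q ∈
        Ideal.span (Set.range fun i => ζs i w) ⊔ Ideal.span {zs w} := by
    refine (Filter.eventually_all_finite (List.finite_toSet Q.fns)).2 fun f hf => ?_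
    obtain ⟨_, hh₀, c, lam, hch, q, hq, hfq, hfc⟩ := hc.exists_left _ (List.mem_map_of_mem
      (f := fun h => ((𝒢.space M).germ a h.1, h.2)) hf)
    obtain ⟨h, hh, rfl⟩ := List.mem_map.1 hh₀
    obtain ⟨cs, hcs, hca, hcw⟩ := 𝒟.eventually_isChain hζs hδs (𝒟.germ_mem_sec a h.1) hch
    filter_upwards [hcw, 𝒟.eventually_sup_span (sub_mem (𝒟.germ_mem_sec a f.1) (hcs q)) hζs hzs
        (by simpa [hca] using hfc)] with w ⟨lam', hw1⟩ hw2
    exact ⟨h, hh, _, lam', hw1, q, hq, hfq, hw2⟩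
  have e9 : ∀ᶠ w in 𝓝 a, ∃ h ∈ P.fns, ∃ c lam : ℕ → (𝒢.space M).Stalk w,
      IsChain (Ideal.span (Set.range fun i => ζs i w)) (δs w) ((𝒢.space M).germ w h.1) h.2 c lam ∧
      0 < h.2 ∧ c (h.2 - 1) - zs w ∈ Ideal.span (Set.range fun i => ζs i w) := by
    obtain ⟨_, hh₀, c, lam, hch, hpos, hcz⟩ := hc.exists_contact
    obtain ⟨h, hh, rfl⟩ := List.mem_map.1 hh₀
    obtain ⟨cs, hcs, hca, hcw⟩ := 𝒟.eventually_isChain hζs hδs (𝒟.germ_mem_sec a h.1) hch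
    filter_upwards [hcw, 𝒟.eventually_mem_span (sub_mem (hcs (h.2 - 1)) hzs) hζs
        (by simpa [hca] using hcz)] with w ⟨lam', hw1⟩ hw2
    exact ⟨h, hh, _, lam', hw1, hpos, hw2⟩
  filter_upwards [e1, e2, e3, e4, e5, e6, hδw, e7, e8, e9] with w e1 e2 e3 e4 e5 e6 hδw e7 e8 e9
  refine ⟨p, fun i => ζs i w, fun i => Ds i w, δs w, zs w, e1, e2, hδw, e3, ?_, ?_, e6, ?_⟩
  · rw [e4]; exact congrArg (· ⊔ _) e3.symm
  · intro i
    rw [show (𝒢.space M).idealAt P.eqs w = _ from e3]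
    exact e5 i
  · rw [show (𝒢.space M).idealAt P.eqs w = _ from e3]
    refine ⟨?_, ?_, ?_⟩
    · intro h hh₀
      obtain ⟨h, hh, rfl⟩ := List.mem_map.1 hh₀
      obtain ⟨c, lam, hch, hcf⟩ := e7 h hh
      refine ⟨c, lam, hch, fun q hq => ?_⟩
      obtain ⟨f, hf, hfq, hfc⟩ := hcf q hq
      exact ⟨_, List.mem_map_of_mem hf, hfq, hfc⟩
    · intro f hf₀
      obtain ⟨f, hf, rfl⟩ := List.mem_map.1 hf₀
      obtain ⟨h, hh, c, lam, hch, q, hq, hfq, hfc⟩ := e8 f hf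
      exact ⟨_, List.mem_map_of_mem hh, c, lam, hch, q, hq, hfq, hfc⟩
    · obtain ⟨h, hh, c, lam, hch, hpos, hcz⟩ := e9
      exact ⟨_, List.mem_map_of_mem hh, c, lam, hch, hpos, hcz⟩

end DiffStructure

end Desing

namespace Desing

open IsLocalRing

namespace DiffStructure

variable {𝒢 : Geometry.{u}} {M M' : 𝒢.Obj} (𝒟 : DiffStructure 𝒢)

/-! ### Local blowings-up -/

theorem isLocalBlowup_eq (𝒟 : DiffStructure 𝒢) {σ : 𝒢.Hom M' M} {k : ℕ} {x : Fin k → 𝒢.Fn M}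
    {i : Fin k} {y : Fin k → 𝒢.Fn M'} (hb : Geometry.IsLocalBlowup σ x i y) :
    y i = 1 ∧ ∀ j, 𝒢.pull σ (x j) = y j * 𝒢.pull σ (x i) := by
  obtain ⟨-, B, π, v, j, ⟨hv, hx, -⟩, -, rfl, hy⟩ := hb
  refine ⟨by rw [hy, hv, map_one], fun l => ?_⟩
  rw [𝒟.pull_comp, 𝒟.pull_comp, hy, hx l, map_mul]

section Blowup

variable {σ : 𝒢.Hom M' M} {k : ℕ} {x : Fin k → 𝒢.Fn M} {i : Fin k} {y : Fin k → 𝒢.Fn M'}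
  {a' : 𝒢.Pt M'}

theorem hasDual_centre (hb : Geometry.IsLocalBlowup σ x i y)
    (hx : ∀ j, (𝒢.space M).VanishesAt (x j) (𝒢.map σ a')) :
    HasDual (𝒟.Der (𝒢.map σ a')) fun j => (𝒢.space M).germ (𝒢.map σ a') (x j) :=
  (hb.1 _ hx).hasDual 𝒟.mem_sq_of_der

/-- With coefficient `exc`, the equation in `der_blowup` can always be solved: `η j = δ (x j) - y j
* δ (x i)`, pulled back. -/
theorem exists_lift_blowup (hb : Geometry.IsLocalBlowup σ x i y)
    (hx : ∀ j, (𝒢.space M).VanishesAt (x j) (𝒢.map σ a')) {δ} (hδ : δ ∈ 𝒟.Der (𝒢.map σ a')) :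
    ∃ δ' ∈ 𝒟.Der a', ∀ r, δ' (𝒟.stalkMap σ a' r) =
      (𝒢.space M').germ a' (𝒢.pull σ (x i)) * 𝒟.stalkMap σ a' (δ r) := by
  obtain ⟨hy, -⟩ := 𝒟.isLocalBlowup_eq hb
  obtain ⟨δ', h, h', -⟩ := 𝒟.der_blowup hb a' hx 1 (fun _ => δ)
    (fun _ => (𝒢.space M').germ a' (𝒢.pull σ (x i)))
    (fun j => 𝒟.stalkMap σ a' (δ ((𝒢.space M).germ _ (x j))) -
      (𝒢.space M').germ a' (y j) * 𝒟.stalkMap σ a' (δ ((𝒢.space M).germ _ (x i))))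
    (fun _ => hδ) (by simp [hy]) (fun j => by simp)
  exact ⟨δ', h, by simpa using h'⟩

/-- For `D l` dual to the equations of the centre, `∑ y l * D l` lifts with value zero on every `y
j`; its value on `x i` is `y i = 1`. It is the derivative along `x i` in the chart. -/
theorem exists_der_exceptional (hb : Geometry.IsLocalBlowup σ x i y)
    (hx : ∀ j, (𝒢.space M).VanishesAt (x j) (𝒢.map σ a')) :
    ∃ F ∈ 𝒟.Der a', F ((𝒢.space M').germ a' (𝒢.pull σ (x i))) = 1 := by
  obtain ⟨hy, -⟩ := 𝒟.isLocalBlowup_eq hb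
  obtain ⟨D, hD, hd⟩ := (𝒟.hasDual_centre hb hx).exists_exact
  obtain ⟨δ', h, h', -⟩ := 𝒟.der_blowup hb a' hx k D (fun l => (𝒢.space M').germ a' (y l)) 0 hD rfl
    (fun j => by simp [hd, apply_ite (𝒟.stalkMap σ a'), mul_sub, Finset.sum_sub_distrib, hy])
  refine ⟨δ', h, ?_⟩
  rw [← 𝒟.stalkMap_germ, h']
  simp [hd, apply_ite (𝒟.stalkMap σ a'), hy]

theorem exc_mem (𝒟 : DiffStructure 𝒢) (hx : ∀ j, (𝒢.space M).VanishesAt (x j) (𝒢.map σ a')) :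
    (𝒢.space M').germ a' (𝒢.pull σ (x i)) ∈ maximalIdeal _ :=
  (𝒟.vanishesAt_pull σ a' (x i)).2 (hx i)

theorem exists_eq_exc_mul (hb : Geometry.IsLocalBlowup σ x i y)
    {r : (𝒢.space M).Stalk (𝒢.map σ a')} (hr : r ∈ (𝒢.space M).idealAt x (𝒢.map σ a')) :
    ∃ r', 𝒟.stalkMap σ a' r = (𝒢.space M').germ a' (𝒢.pull σ (x i)) * r' := by
  obtain ⟨c, rfl⟩ := Ideal.mem_span_range_iff_exists_fun.1 hr
  refine ⟨∑ j, 𝒟.stalkMap σ a' (c j) * (𝒢.space M').germ a' (y j), ?_⟩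
  rw [map_sum, Finset.mul_sum]
  refine Finset.sum_congr rfl fun j _ => ?_
  rw [map_mul, 𝒟.stalkMap_germ, (𝒟.isLocalBlowup_eq hb).2 j, map_mul]
  ring

/-- The exceptional equation has a derivation with value 1, so it is not a zero divisor modulo the
zero ideal, which is generated by the empty dual system. -/
theorem eq_zero_of_exc_mul (𝒟 : DiffStructure 𝒢) (hb : Geometry.IsLocalBlowup σ x i y)
    (hx : ∀ j, (𝒢.space M).VanishesAt (x j) (𝒢.map σ a')) {b : (𝒢.space M').Stalk a'}
    (h : (𝒢.space M').germ a' (𝒢.pull σ (x i)) * b = 0) : b = 0 := by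
  obtain ⟨F, hF, hF1⟩ := 𝒟.exists_der_exceptional hb hx
  have hdual : HasDual (𝒟.Der a') (Fin.elim0 : Fin 0 → (𝒢.space M').Stalk a') :=
    ⟨fun i => i.elim0, fun i => i.elim0, fun i => i.elim0, fun i => i.elim0⟩
  have hspan : Ideal.span (Set.range (Fin.elim0 : Fin 0 → (𝒢.space M').Stalk a')) = ⊥ := by
    rw [Set.range_eq_empty, Ideal.span_empty]
  have := mem_of_mul_mem_of_separated (I := Ideal.span (Set.range
    (Fin.elim0 : Fin 0 → (𝒢.space M').Stalk a'))) (δ := F) (𝒟.isUnit_natCast a')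
    (𝒟.exc_mem (i := i) hx) (by rw [hF1]; exact isUnit_one) (by rw [hspan]; simp)
    (𝒟.separated hdual) (b := b) (by rw [h]; exact zero_mem _)
  rwa [hspan] at this

/-- Equations of the strict transform of a submanifold which contains the centre. -/
theorem transform_dual (hb : Geometry.IsLocalBlowup σ x i y)
    (hx : ∀ j, (𝒢.space M).VanishesAt (x j) (𝒢.map σ a')) {p : ℕ}
    {ζ : Fin p → (𝒢.space M).Stalk (𝒢.map σ a')} {ζ' : Fin p → (𝒢.space M').Stalk a'}
    (hζ : ∀ l, 𝒟.stalkMap σ a' (ζ l) = (𝒢.space M').germ a' (𝒢.pull σ (x i)) * ζ' l)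
    (hm : ∀ l, ζ' l ∈ maximalIdeal _) {δ : Derivation ℤ _ _}
    {δ' : Derivation ℤ ((𝒢.space M').Stalk a') ((𝒢.space M').Stalk a')}
    (hδ : ∀ r, δ' (𝒟.stalkMap σ a' r) =
      (𝒢.space M').germ a' (𝒢.pull σ (x i)) * 𝒟.stalkMap σ a' (δ r)) (l : Fin p) :
    δ' (ζ' l) - 𝒟.stalkMap σ a' (δ (ζ l)) ∈ maximalIdeal _ := by
  have h1 := hδ (ζ l)
  rw [hζ, Derivation.leibniz, ← 𝒟.stalkMap_germ, hδ, 𝒟.stalkMap_germ, smul_eq_mul, smul_eq_mul]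
    at h1
  -- The Leibniz rule for `exc * ζ' l`, with one factor `exc` cancelled.
  have h2 := 𝒟.eq_zero_of_exc_mul hb hx (b := δ' (ζ' l) - 𝒟.stalkMap σ a' (δ (ζ l)) +
    ζ' l * 𝒟.stalkMap σ a' (δ ((𝒢.space M).germ _ (x i)))) (by linear_combination h1)
  rw [eq_neg_of_add_eq_zero_left h2]
  exact neg_mem (Ideal.mul_mem_right _ _ (hm l))

theorem transform_hasDual (hb : Geometry.IsLocalBlowup σ x i y)
    (hx : ∀ j, (𝒢.space M).VanishesAt (x j) (𝒢.map σ a')) {p : ℕ}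
    {ζ : Fin p → (𝒢.space M).Stalk (𝒢.map σ a')} {ζ' : Fin p → (𝒢.space M').Stalk a'}
    (hζ : ∀ l, 𝒟.stalkMap σ a' (ζ l) = (𝒢.space M').germ a' (𝒢.pull σ (x i)) * ζ' l)
    (hm : ∀ l, ζ' l ∈ maximalIdeal _) {S : Submodule _ (Derivation ℤ _ _)} {S'}
    (hS : ∀ δ ∈ S, ∃ δ' ∈ S', ∀ r, δ' (𝒟.stalkMap σ a' r) =
      (𝒢.space M').germ a' (𝒢.pull σ (x i)) * 𝒟.stalkMap σ a' (δ r))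
    (hdual : HasDual S ζ) : HasDual S' ζ' := by
  obtain ⟨D, hD, hd⟩ := hdual.exists_exact
  choose D' hD' hDφ using fun l => hS (D l) (hD l)
  refine ⟨hm, D', hD', fun l m => ?_⟩
  have := 𝒟.transform_dual hb hx hζ hm (hDφ l) m
  rw [hd] at this
  split_ifs at this ⊢ <;> simpa using this

/-- The strict transform is transversal to the exceptional divisor. The derivation `F` with `F exc =
1` is made tangent to `ζ' = 0`, modulo `𝔪`, by subtracting multiples of the lifted dual derivations
`D' l`. As `D' l exc` lies in `𝔪`, the value on `exc` remains a unit. -/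
theorem transform_hasDual_snoc (hb : Geometry.IsLocalBlowup σ x i y)
    (hx : ∀ j, (𝒢.space M).VanishesAt (x j) (𝒢.map σ a')) {p : ℕ}
    {ζ : Fin p → (𝒢.space M).Stalk (𝒢.map σ a')} {ζ' : Fin p → (𝒢.space M').Stalk a'}
    (hζ : ∀ l, 𝒟.stalkMap σ a' (ζ l) = (𝒢.space M').germ a' (𝒢.pull σ (x i)) * ζ' l)
    (hm : ∀ l, ζ' l ∈ maximalIdeal _) (hdual : HasDual (𝒟.Der (𝒢.map σ a')) ζ) :
    HasDual (𝒟.Der a') (Fin.snoc (α := fun _ => (𝒢.space M').Stalk a') ζ'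
      ((𝒢.space M').germ a' (𝒢.pull σ (x i)))) := by
  obtain ⟨F, hF, hF1⟩ := 𝒟.exists_der_exceptional hb hx
  obtain ⟨D, hD, hd⟩ := hdual.exists_exact
  choose D' hD' hDφ using fun l => 𝒟.exists_lift_blowup hb hx (hD l)
  have hexc : ∀ l, D' l ((𝒢.space M').germ a' (𝒢.pull σ (x i))) ∈ maximalIdeal _ := by
    intro l
    rw [← 𝒟.stalkMap_germ, hDφ]
    exact Ideal.mul_mem_right _ _ (𝒟.exc_mem hx)
  have hDζ : ∀ l m, D' l (ζ' m) - (if l = m then 1 else 0) ∈ maximalIdeal _ := by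
    intro l m
    have := 𝒟.transform_dual hb hx hζ hm (hDφ l) m
    rw [hd] at this
    split_ifs at this ⊢ <;> simpa using this
  refine HasDual.snoc ⟨hm, D', hD', hDζ⟩ (𝒟.exc_mem hx) (δ := F - ∑ l, F (ζ' l) • D' l)
    (sub_mem hF (Submodule.sum_mem _ fun l _ => Submodule.smul_mem _ _ (hD' l))) (fun m => ?_) ?_
  · rw [Derivation.sub_apply, derivation_sum_apply]
    have h1 : ∑ l, F (ζ' l) * (D' l (ζ' m) - (if l = m then 1 else 0)) ∈ maximalIdeal _ :=
      sum_mem fun l _ => Ideal.mul_mem_left _ _ (hDζ l m)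
    have h2 := neg_mem h1
    convert h2 using 1
    simp [mul_sub, Finset.sum_sub_distrib]
  · refine isUnit_of_sub_mem isUnit_one ?_
    rw [Derivation.sub_apply, derivation_sum_apply, hF1, sub_sub_cancel_left]
    exact neg_mem (sum_mem fun l _ => Ideal.mul_mem_left _ _ (hexc l))

theorem exists_der_exceptional_tangent {p : ℕ} {ζ' : Fin p → (𝒢.space M').Stalk a'}
    {exc : (𝒢.space M').Stalk a'}
    (h : HasDual (𝒟.Der a') (Fin.snoc (α := fun _ => (𝒢.space M').Stalk a') ζ' exc)) :
    ∃ F ∈ 𝒟.Der a', F exc = 1 ∧ ∀ l, F (ζ' l) = 0 := by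
  obtain ⟨D, hD, hd⟩ := h.exists_exact
  refine ⟨D (Fin.last p), hD _, ?_, fun l => ?_⟩
  · simpa using hd (Fin.last p) (Fin.last p)
  · simpa [(Fin.castSucc_lt_last l).ne'] using hd (Fin.last p) l.castSucc

/-- There is a derivation annihilating the `ζ' l` with value 1 on `exc`, and the ideal of the strict
transform is closed; hence `exc` is not a zero divisor modulo this ideal. -/
theorem transform_regular (hb : Geometry.IsLocalBlowup σ x i y)
    (hx : ∀ j, (𝒢.space M).VanishesAt (x j) (𝒢.map σ a')) {p : ℕ}
    {ζ : Fin p → (𝒢.space M).Stalk (𝒢.map σ a')} {ζ' : Fin p → (𝒢.space M').Stalk a'}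
    (hζ : ∀ l, 𝒟.stalkMap σ a' (ζ l) = (𝒢.space M').germ a' (𝒢.pull σ (x i)) * ζ' l)
    (hm : ∀ l, ζ' l ∈ maximalIdeal _) (hdual : HasDual (𝒟.Der (𝒢.map σ a')) ζ)
    {b : (𝒢.space M').Stalk a'}
    (h : (𝒢.space M').germ a' (𝒢.pull σ (x i)) * b ∈ Ideal.span (Set.range ζ')) :
    b ∈ Ideal.span (Set.range ζ') := by
  obtain ⟨F, hF, hF1, hFζ⟩ := 𝒟.exists_der_exceptional_tangent
    (𝒟.transform_hasDual_snoc hb hx hζ hm hdual)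
  refine mem_of_mul_mem_of_separated (𝒟.isUnit_natCast a') (𝒟.exc_mem (i := i) hx)
    (hF1 ▸ isUnit_one) (derivation_span_le ?_) (𝒟.separated
      (𝒟.transform_hasDual hb hx hζ hm (fun δ hδ => 𝒟.exists_lift_blowup hb hx hδ) hdual)) h
  rintro _ ⟨l, rfl⟩
  simp [hFζ]

/-- The pulled-back ideal is generated by the `exc * ζ' l`, and `exc` is regular modulo the ideal of
the `ζ' l`. At points off the strict transform this ideal is the unit ideal and there is nothing to
cancel. -/
theorem strict_eq_span (hb : Geometry.IsLocalBlowup σ x i y)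
    (hx : ∀ j, (𝒢.space M).VanishesAt (x j) (𝒢.map σ a')) {p : ℕ}
    {ζ : Fin p → (𝒢.space M).Stalk (𝒢.map σ a')} {ζ' : Fin p → (𝒢.space M').Stalk a'}
    (hζ : ∀ l, 𝒟.stalkMap σ a' (ζ l) = (𝒢.space M').germ a' (𝒢.pull σ (x i)) * ζ' l)
    (hdual : HasDual (𝒟.Der (𝒢.map σ a')) ζ) {q : ℕ} {e : Fin q → 𝒢.Fn M}
    (he : (𝒢.space M).idealAt e (𝒢.map σ a') = Ideal.span (Set.range ζ)) :
    Geometry.strictIdeal σ (𝒢.pull σ (x i)) a' e = Ideal.span (Set.range ζ') := by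
  rw [Geometry.strictIdeal, 𝒟.idealAt_pull, he, Ideal.map_span, ← Set.range_comp]
  have hmem : ∀ l, (𝒢.space M').germ a' (𝒢.pull σ (x i)) * ζ' l ∈
      Ideal.span (Set.range (𝒟.stalkMap σ a' ∘ ζ)) :=
    fun l => by rw [← hζ]; exact Ideal.subset_span ⟨l, rfl⟩
  have hmem' : ∀ f ∈ Ideal.span (Set.range ζ'), (𝒢.space M').germ a' (𝒢.pull σ (x i)) * f ∈
      Ideal.span (Set.range (𝒟.stalkMap σ a' ∘ ζ)) := by
    intro f hf
    obtain ⟨c, rfl⟩ := Ideal.mem_span_range_iff_exists_fun.1 hf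
    rw [Finset.mul_sum]
    refine sum_mem fun l _ => ?_
    rw [mul_left_comm]
    exact Ideal.mul_mem_left _ _ (hmem l)
  refine saturation_eq_of_forall (Ideal.span_le.2 ?_) hmem' fun b hb' => ?_
  · rintro _ ⟨l, rfl⟩
    rw [Function.comp_apply, hζ]
    exact Ideal.mul_mem_left _ _ (Ideal.subset_span ⟨l, rfl⟩)
  · by_cases htop : Ideal.span (Set.range ζ') = ⊤
    · rw [htop]; trivial
    · exact 𝒟.transform_regular hb hx hζ
        (fun l => le_maximalIdeal htop (Ideal.subset_span ⟨l, rfl⟩)) hdual hb'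

/-- A function of order at least `m` along the centre is divisible by `exc ^ m` on the strict
transform. -/
theorem exists_pow_exc_mul (hb : Geometry.IsLocalBlowup σ x i y) {p : ℕ}
    {ζ' : Fin p → (𝒢.space M').Stalk a'}
    (hdual : HasDual (𝒟.Der a') (Fin.snoc (α := fun _ => (𝒢.space M').Stalk a') ζ'
      ((𝒢.space M').germ a' (𝒢.pull σ (x i)))))
    {P : Weighted (𝒢.space M)}
    (hP : ((𝒢.space M).idealAt P.eqs (𝒢.map σ a')).map (𝒟.stalkMap σ a') ≤
      Ideal.span (Set.range ζ'))
    (hS : ∀ᶠ w in 𝓝 (𝒢.map σ a'), (∀ j, (𝒢.space M).VanishesAt (x j) w) → P.Locus w)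
    {h : 𝒢.Fn M × ℕ} (hh : h ∈ P.fns) :
    ∃ g, (𝒢.space M').germ a' (𝒢.pull σ (x i)) ^ h.2 * g - (𝒢.space M').germ a' (𝒢.pull σ h.1) ∈
      Ideal.span (Set.range ζ') := by
  obtain ⟨F, hF, hF1, hFζ⟩ := 𝒟.exists_der_exceptional_tangent hdual
  choose ζs hζs hζa using fun l => 𝒟.exists_sec (ζ' l)
  obtain rfl : (fun l => ζs l a') = ζ' := funext hζa
  obtain ⟨Fs, rfl, -, hFs⟩ := 𝒟.exists_der_family hF
  have hexc := 𝒟.germ_mem_sec a' (𝒢.pull σ (x i))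
  have e1 : ∀ᶠ w in 𝓝 a', ∀ l, Fs w (ζs l w) = 0 := Filter.eventually_all.2 fun l =>
    𝒟.sec_eventually_eq_zero (hFs _ (hζs l)) (hFζ l)
  have e2 := 𝒟.eventually_eq (hFs _ hexc) (one_mem _) hF1
  have e3 : ∀ᶠ w in 𝓝 a', ∀ l, (𝒢.space M').germ w (𝒢.pull σ (P.eqs l)) ∈
      Ideal.span (Set.range fun l => ζs l w) :=
    Filter.eventually_all.2 fun l => 𝒟.eventually_mem_span
      (𝒟.germ_mem_sec a' (𝒢.pull σ (P.eqs l))) hζs (hP (by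
        rw [← 𝒟.stalkMap_germ]
        exact Ideal.mem_map_of_mem _ (Ideal.subset_span ⟨l, rfl⟩)))
  have e4 : ∀ᶠ w in 𝓝 a', (∀ j, (𝒢.space M).VanishesAt (x j) (𝒢.map σ w)) → P.Locus (𝒢.map σ w) :=
    (𝒟.continuous_map σ).continuousAt.eventually hS
  -- One factor `exc` is extracted at a time. Suppose `exc ^ j * b` equals the pull-back of `h` on
  -- `N'`, with `j < m`. At each nearby point of `N'` on the exceptional divisor the pull-back has
  -- order at least `m`, and `exc ^ j` accounts for only `j` of it; so `b` vanishes there. The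
  -- Nullstellensatz shows that `b` is a multiple of `exc` on `N'`.
  suffices ∀ j ≤ h.2, ∃ g, (𝒢.space M').germ a' (𝒢.pull σ (x i)) ^ j * g -
      (𝒢.space M').germ a' (𝒢.pull σ h.1) ∈ Ideal.span (Set.range fun l => ζs l a') from
    this _ le_rfl
  intro j
  induction j with
  | zero => exact fun _ => ⟨(𝒢.space M').germ a' (𝒢.pull σ h.1), by simp⟩
  | succ j ih =>
    intro hj
    obtain ⟨b, hbj⟩ := ih (by omega)
    obtain ⟨bs, hbs, rfl⟩ := 𝒟.exists_sec b
    have e5 := 𝒟.eventually_mem_span (sub_mem (mul_mem (pow_mem hexc j) hbs)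
      (𝒟.germ_mem_sec a' (𝒢.pull σ h.1))) hζs hbj
    have hsn : ∀ w, (fun l => (Fin.snoc (α := fun _ => ∀ w, (𝒢.space M').Stalk w) ζs
        (fun w => (𝒢.space M').germ w (𝒢.pull σ (x i)))) l w) =
        Fin.snoc (α := fun _ => (𝒢.space M').Stalk w) (fun l => ζs l w)
          ((𝒢.space M').germ w (𝒢.pull σ (x i))) := by
      intro w
      ext l
      refine Fin.lastCases ?_ (fun l => ?_) l <;> simp
    have hb' := 𝒟.nullstellensatz (z := Fin.snoc (α := fun _ => ∀ w, (𝒢.space M').Stalk w) ζs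
      (fun w => (𝒢.space M').germ w (𝒢.pull σ (x i)))) (a := a') (fun l => by
        refine Fin.lastCases ?_ (fun l => ?_) l
        · simpa using hexc
        · simpa using hζs l) (by rw [hsn]; exact hdual) bs hbs (by
      filter_upwards [e1, e2, e3, e4, e5] with w e1 e2 e3 e4 e5 hw
      have hζw : ∀ l, ζs l w ∈ maximalIdeal _ := fun l => by simpa using hw l.castSucc
      have hew : (𝒢.space M').germ w (𝒢.pull σ (x i)) ∈ maximalIdeal _ := by
        simpa using hw (Fin.last p)
      have hle : Ideal.span (Set.range fun l => ζs l w) ≤ maximalIdeal _ :=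
        Ideal.span_le.2 (by rintro _ ⟨l, rfl⟩; exact hζw l)
      -- A point of the exceptional divisor maps to the centre, because every `x l` pulls back to a
      -- multiple of `exc`; near `a` the centre lies in the locus.
      have hloc := (locus_iff.1 (e4 fun l => (𝒟.vanishesAt_pull σ w (x l)).1 (by
        rw [(𝒟.isLocalBlowup_eq hb).2 l, FunctionSpace.VanishesAt, map_mul]
        exact Ideal.mul_mem_left _ _ hew))).2 _ (List.mem_map_of_mem
          (f := fun h => ((𝒢.space M).germ _ h.1, h.2)) hh)
      have h1 := 𝒟.map_fil_le σ w hloc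
      rw [𝒟.stalkMap_germ, ← 𝒟.idealAt_pull] at h1
      have h2 : fil (maximalIdeal _) ((𝒢.space M').idealAt (fun l => 𝒢.pull σ (P.eqs l)) w) h.2 ≤
          fil (maximalIdeal _) (Ideal.span (Set.range fun l => ζs l w)) h.2 :=
        sup_le_sup_left (Ideal.span_le.2 (by rintro _ ⟨l, rfl⟩; exact e3 l)) _
      have h3 := add_mem (le_fil (m := maximalIdeal _) h.2 e5) (h2 h1)
      have h4 : (𝒢.space M').germ w (𝒢.pull σ (x i)) ^ j * bs w ∈
          fil (maximalIdeal _) (Ideal.span (Set.range fun l => ζs l w)) (h.2 - j + j) := by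
        rw [show h.2 - j + j = h.2 by omega]
        simpa using h3
      refine fil_le_of_le hle (by omega) (mem_fil_of_pow_mul_mem (δ := Fs w) (𝒟.isUnit_natCast w)
        hew (by rw [e2]; exact isUnit_one) (derivation_span_le ?_) j h4)
      rintro _ ⟨l, rfl⟩
      simp [e1])
    rw [hsn, span_range_snoc] at hb'
    obtain ⟨s, hs, t, ht, hst⟩ := Submodule.mem_sup.1 hb'
    obtain ⟨g, rfl⟩ := Ideal.mem_span_singleton'.1 ht
    refine ⟨g, ?_⟩
    have := sub_mem hbj (Ideal.mul_mem_left _ ((𝒢.space M').germ a' (𝒢.pull σ (x i)) ^ j) hs)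
    convert this using 1
    rw [← hst]
    ring

end Blowup

end DiffStructure

end Desing

namespace Desing

open IsLocalRing

namespace DiffStructure

variable {𝒢 : Geometry.{u}} {M M' : 𝒢.Obj} (𝒟 : DiffStructure 𝒢)

/-! ### Logarithmic derivations and the invariant of a sequence of test transformations -/

/-- The derivations at `a` which are tangent to the hypersurfaces in `L`. -/
def LogDer (a : 𝒢.Pt M) (L : List (𝒢.Fn M)) :
    Submodule ((𝒢.space M).Stalk a) (Derivation ℤ ((𝒢.space M).Stalk a) ((𝒢.space M).Stalk a)) where
  carrier := {δ | δ ∈ 𝒟.Der a ∧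
    ∀ e ∈ L, δ ((𝒢.space M).germ a e) ∈ Ideal.span {(𝒢.space M).germ a e}}
  zero_mem' := ⟨zero_mem _, fun _ _ => by simp⟩
  add_mem' := fun h h' => ⟨add_mem h.1 h'.1, fun e he => add_mem (h.2 e he) (h'.2 e he)⟩
  smul_mem' := fun c _ h => ⟨Submodule.smul_mem _ c h.1,
    fun e he => Ideal.mul_mem_left _ c (h.2 e he)⟩

theorem logDer_nil (a : 𝒢.Pt M) : 𝒟.LogDer a [] = 𝒟.Der a := by
  ext δ
  exact ⟨fun h => h.1, fun h => ⟨h, by simp⟩⟩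

/-- All hypersurfaces which are recorded at a stage. -/
def divisors (s : Geometry.Stage 𝒢) : List (𝒢.Fn s.M) :=
  s.E ++ (s.pairs.map Prod.fst ++ s.pairs.map Prod.snd)

/-- The hypersurface `s.Q` has maximal contact with `s.P`, transversally to the exceptional
hypersurfaces. -/
structure Invariant (s : Geometry.Stage 𝒢) : Prop where
  vanishes : ∀ e ∈ divisors s, (𝒢.space s.M).VanishesAt e s.a
  le : (𝒢.space s.M).idealAt s.Q.eqs s.a ≤ maximalIdeal _
  contact : HasContact (𝒟.LogDer s.a (divisors s)) ((𝒢.space s.M).idealAt s.P.eqs s.a)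
    ((𝒢.space s.M).idealAt s.Q.eqs s.a) (germs s.P s.a) (germs s.Q s.a)

theorem hasContact_mono {R : Type*} [CommRing R] {S S' : Submodule R (Derivation ℤ R R)}
    (hS : S ≤ S') {I I' : Ideal R} {P Q : List (R × ℕ)} (h : HasContact S I I' P Q) :
    HasContact S' I I' P Q := by
  obtain ⟨p, ζ, D, δ, z, hD, hdual, hδ, h⟩ := h
  exact ⟨p, ζ, D, δ, z, fun i => hS (hD i), hdual, hS hδ, h⟩

theorem logDer_le (a : 𝒢.Pt M) (L : List (𝒢.Fn M)) : 𝒟.LogDer a L ≤ 𝒟.Der a := fun _ h => h.1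

theorem germs_pull (σ : 𝒢.Hom M' M) (a' : 𝒢.Pt M') (P : Weighted (𝒢.space M)) :
    germs (P.pull (𝒢.pull σ)) a' =
      (germs P (𝒢.map σ a')).map fun h => (𝒟.stalkMap σ a' h.1, h.2) := by
  simp [germs, Weighted.pull, 𝒟.stalkMap_germ]

theorem idealAt_weighted_pull (σ : 𝒢.Hom M' M) (a' : 𝒢.Pt M') (P : Weighted (𝒢.space M)) :
    (𝒢.space M').idealAt (P.pull (𝒢.pull σ)).eqs a' =
      ((𝒢.space M).idealAt P.eqs (𝒢.map σ a')).map (𝒟.stalkMap σ a') :=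
  𝒟.idealAt_pull σ a' P.eqs

theorem map_le_maximalIdeal (σ : 𝒢.Hom M' M) (a' : 𝒢.Pt M')
    {I : Ideal ((𝒢.space M).Stalk (𝒢.map σ a'))} (h : I ≤ maximalIdeal _) :
    I.map (𝒟.stalkMap σ a') ≤ maximalIdeal _ :=
  Ideal.map_le_iff_le_comap.2 fun _ hr => (𝒟.stalkMap_mem_maximalIdeal σ a' _).2 (h hr)

variable {𝒟}

/-- Shrinkings, products with a line and exceptional blowings-up pull back both presentations
without division. They preserve the invariant as soon as logarithmic derivations lift as they are,
not merely after multiplication by `exc`. -/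
theorem Invariant.pull (σ : 𝒢.Hom M' M) (a' : 𝒢.Pt M') {E pairs P Q}
    (h : 𝒟.Invariant ⟨M, 𝒢.map σ a', E, pairs, P, Q⟩) {E' pairs'}
    (hv : ∀ e ∈ divisors (𝒢 := 𝒢) ⟨M', a', E', pairs', P.pull (𝒢.pull σ), Q.pull (𝒢.pull σ)⟩,
      (𝒢.space M').VanishesAt e a')
    (hlift : ∀ δ ∈ 𝒟.LogDer (𝒢.map σ a') (divisors (𝒢 := 𝒢) ⟨M, 𝒢.map σ a', E, pairs, P, Q⟩),
      ∃ δ' ∈ 𝒟.LogDer a' (divisors (𝒢 := 𝒢)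
        ⟨M', a', E', pairs', P.pull (𝒢.pull σ), Q.pull (𝒢.pull σ)⟩),
        ∀ r, δ' (𝒟.stalkMap σ a' r) = 𝒟.stalkMap σ a' (δ r)) :
    𝒟.Invariant ⟨M', a', E', pairs', P.pull (𝒢.pull σ), Q.pull (𝒢.pull σ)⟩ := by
  refine ⟨hv, ?_, ?_⟩
  · rw [𝒟.idealAt_weighted_pull]
    exact 𝒟.map_le_maximalIdeal σ a' h.le
  · rw [𝒟.idealAt_weighted_pull, 𝒟.idealAt_weighted_pull]
    simp only [𝒟.germs_pull]
    exact h.contact.map hlift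

theorem mem_span_pull {σ : 𝒢.Hom M' M} {a' : 𝒢.Pt M'}
    {δ : Derivation ℤ ((𝒢.space M).Stalk (𝒢.map σ a')) ((𝒢.space M).Stalk (𝒢.map σ a'))}
    {δ' : Derivation ℤ ((𝒢.space M').Stalk a') ((𝒢.space M').Stalk a')} {c : (𝒢.space M').Stalk a'}
    (hδ : ∀ r, δ' (𝒟.stalkMap σ a' r) = c * 𝒟.stalkMap σ a' (δ r)) {e : 𝒢.Fn M}
    (he : δ ((𝒢.space M).germ _ e) ∈ Ideal.span {(𝒢.space M).germ _ e}) :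
    δ' ((𝒢.space M').germ a' (𝒢.pull σ e)) ∈ Ideal.span {(𝒢.space M').germ a' (𝒢.pull σ e)} := by
  obtain ⟨b, hb⟩ := Ideal.mem_span_singleton'.1 he
  rw [← 𝒟.stalkMap_germ, hδ, ← hb, map_mul, ← mul_assoc]
  exact Ideal.mul_mem_left _ _ (Ideal.mem_span_singleton_self _)

theorem Invariant.shrink {j : 𝒢.Hom M' M} {a' : 𝒢.Pt M'} {E pairs P Q} (hj : 𝒢.IsOpenImm j)
    (h : 𝒟.Invariant ⟨M, 𝒢.map j a', E, pairs, P, Q⟩) :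
    𝒟.Invariant ⟨M', a', E.map (𝒢.pull j),
      pairs.map (fun e => (𝒢.pull j e.1, 𝒢.pull j e.2)), P.pull (𝒢.pull j), Q.pull (𝒢.pull j)⟩ := by
  have hd : divisors (𝒢 := 𝒢) ⟨M', a', E.map (𝒢.pull j),
      pairs.map (fun e => (𝒢.pull j e.1, 𝒢.pull j e.2)), P.pull (𝒢.pull j), Q.pull (𝒢.pull j)⟩ =
      (divisors (𝒢 := 𝒢) ⟨M, 𝒢.map j a', E, pairs, P, Q⟩).map (𝒢.pull j) := by
    simp only [divisors, List.map_append, List.map_map]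
    rfl
  refine h.pull j a' ?_ fun δ hδ => ?_
  · rw [hd]
    intro e₀ he₀
    obtain ⟨e, he, rfl⟩ := List.mem_map.1 he₀
    exact (𝒟.vanishesAt_pull j a' e).2 (h.vanishes e he)
  · obtain ⟨δ', hδ', hφ⟩ := 𝒟.der_openImm hj a' δ hδ.1
    refine ⟨δ', ⟨hδ', ?_⟩, hφ⟩
    rw [hd]
    intro e₀ he₀
    obtain ⟨e, he, rfl⟩ := List.mem_map.1 he₀
    exact mem_span_pull (c := 1) (by simpa using hφ) (hδ.2 e he)

theorem Invariant.line {σ : 𝒢.Hom M' M} {t : 𝒢.Fn M'} {a' : 𝒢.Pt M'} {E pairs P Q}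
    (hσ : Geometry.IsLineProduct σ t) (ht : (𝒢.space M').VanishesAt t a')
    (h : 𝒟.Invariant ⟨M, 𝒢.map σ a', E, pairs, P, Q⟩) :
    𝒟.Invariant ⟨M', a', t :: E.map (𝒢.pull σ), E.map (fun e => (t, 𝒢.pull σ e)),
      P.pull (𝒢.pull σ), Q.pull (𝒢.pull σ)⟩ := by
  have hd : ∀ e' ∈ divisors (𝒢 := 𝒢) ⟨M', a', t :: E.map (𝒢.pull σ),
      E.map (fun e => (t, 𝒢.pull σ e)), P.pull (𝒢.pull σ), Q.pull (𝒢.pull σ)⟩,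
      e' = t ∨ ∃ e ∈ divisors (𝒢 := 𝒢) ⟨M, 𝒢.map σ a', E, pairs, P, Q⟩, 𝒢.pull σ e = e' := by
    intro e' he
    simp only [divisors, List.mem_append, List.mem_cons, List.mem_map] at he ⊢
    rcases he with (h0 | ⟨e, he, rfl⟩) | (⟨_, ⟨e, he, rfl⟩, rfl⟩ | ⟨_, ⟨e, he, rfl⟩, rfl⟩)
    · exact .inl h0
    · exact .inr ⟨e, .inl he, rfl⟩
    · exact .inl rfl
    · exact .inr ⟨e, .inl he, rfl⟩
  refine h.pull σ a' (fun e' he' => ?_) fun δ hδ => ?_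
  · rcases hd e' he' with h0 | ⟨e, he, rfl⟩
    · rw [h0]; exact ht
    · exact (𝒟.vanishesAt_pull σ a' e).2 (h.vanishes e he)
  · obtain ⟨δ', hδ', hφ, hδt⟩ := 𝒟.der_line hσ a' δ hδ.1
    refine ⟨δ', ⟨hδ', fun e' he' => ?_⟩, hφ⟩
    rcases hd e' he' with h0 | ⟨e, he, rfl⟩
    · rw [h0, hδt]; exact zero_mem _
    · exact mem_span_pull (c := 1) (by simpa using hφ) (hδ.2 e he)

theorem divisorTransform_vanishes {σ : 𝒢.Hom M' M} {exc : 𝒢.Fn M'} {a' : 𝒢.Pt M'}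
    {E : List (𝒢.Fn M)} {E' : List (𝒢.Fn M')} (h : Geometry.IsDivisorTransform σ exc a' E E')
    (hexc : (𝒢.space M').VanishesAt exc a') : ∀ e ∈ E', (𝒢.space M').VanishesAt e a' := by
  obtain ⟨L, rfl, hL, -⟩ := h
  intro e' he'
  rcases List.mem_cons.1 he' with rfl | he'
  · exact hexc
  · obtain ⟨e, -, hne, heq⟩ := hL e' he'
    rw [← heq] at hne
    exact le_maximalIdeal hne (Ideal.mem_span_singleton_self _)

/-- The ideal of a strict transform is a saturation with respect to `exc`, and
`derivation_saturation` applies to it since `δ'` is logarithmic along `exc`. -/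
theorem divisorTransform_stable {σ : 𝒢.Hom M' M} {exc : 𝒢.Fn M'} {a' : 𝒢.Pt M'}
    {E : List (𝒢.Fn M)} {E' : List (𝒢.Fn M')} (h : Geometry.IsDivisorTransform σ exc a' E E')
    {δ' : Derivation ℤ ((𝒢.space M').Stalk a') ((𝒢.space M').Stalk a')} {β}
    (hβ : δ' ((𝒢.space M').germ a' exc) = (𝒢.space M').germ a' exc * β)
    (hE : ∀ e ∈ E, δ' ((𝒢.space M').germ a' (𝒢.pull σ e)) ∈
      Ideal.span {(𝒢.space M').germ a' (𝒢.pull σ e)}) :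
    ∀ e ∈ E', δ' ((𝒢.space M').germ a' e) ∈ Ideal.span {(𝒢.space M').germ a' e} := by
  obtain ⟨L, rfl, hL, -⟩ := h
  intro e' he'
  rcases List.mem_cons.1 he' with rfl | he'
  · rw [hβ]; exact Ideal.mul_mem_right _ _ (Ideal.mem_span_singleton_self _)
  · obtain ⟨e, he, -, heq⟩ := hL e' he'
    have h1 : (𝒢.space M').germ a' e' ∈ Geometry.strictIdeal σ exc a' ![e] :=
      heq ▸ Ideal.mem_span_singleton_self _
    have hid : (𝒢.space M').idealAt (fun i => 𝒢.pull σ ((![e] : Fin 1 → 𝒢.Fn M) i)) a' =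
        Ideal.span {(𝒢.space M').germ a' (𝒢.pull σ e)} := by
      rw [FunctionSpace.idealAt]
      congr 1
      ext r
      simp [eq_comm]
    rw [heq]
    refine derivation_saturation hβ ?_ _ h1
    rw [hid]
    refine derivation_span_le ?_
    rintro _ rfl
    exact hE e he

/-- If `δ e₀ = b₀ * e₀` and `δ e₁ = b₁ * e₁`, then `δ` lifts to the blowing-up of the intersection,
with value `(b₁ - b₀) * y 1` on the quotient `y 1` of `e₁` by `e₀`. The lift is again logarithmic
along the exceptional divisor and along `y 1`, hence along the pair recorded for the next step. -/
theorem Invariant.exceptional {σ : 𝒢.Hom M' M} {a' : 𝒢.Pt M'} {E pairs P Q E'} {e₀ e₁ : 𝒢.Fn M}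
    {y : Fin 2 → 𝒢.Fn M'} (hp : (e₀, e₁) ∈ pairs) (hb : Geometry.IsLocalBlowup σ ![e₀, e₁] 0 y)
    (hy : (𝒢.space M').VanishesAt (y 1) a')
    (hE : Geometry.IsDivisorTransform σ (𝒢.pull σ e₀) a' E E')
    (h : 𝒟.Invariant ⟨M, 𝒢.map σ a', E, pairs, P, Q⟩) :
    𝒟.Invariant ⟨M', a', E', [(𝒢.pull σ e₀, y 1)], P.pull (𝒢.pull σ), Q.pull (𝒢.pull σ)⟩ := by
  have m₀ : e₀ ∈ divisors (𝒢 := 𝒢) ⟨M, 𝒢.map σ a', E, pairs, P, Q⟩ := by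
    simp only [divisors, List.mem_append, List.mem_map]
    exact .inr (.inl ⟨_, hp, rfl⟩)
  have m₁ : e₁ ∈ divisors (𝒢 := 𝒢) ⟨M, 𝒢.map σ a', E, pairs, P, Q⟩ := by
    simp only [divisors, List.mem_append, List.mem_map]
    exact .inr (.inr ⟨_, hp, rfl⟩)
  have hx : ∀ j, (𝒢.space M).VanishesAt ((![e₀, e₁] : Fin 2 → 𝒢.Fn M) j) (𝒢.map σ a') := by
    intro j
    fin_cases j
    exacts [h.vanishes _ m₀, h.vanishes _ m₁]
  have hexc : (𝒢.space M').VanishesAt (𝒢.pull σ e₀) a' :=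
    (𝒟.vanishesAt_pull σ a' e₀).2 (h.vanishes _ m₀)
  refine h.pull σ a' (fun e he => ?_) fun δ hδ => ?_
  · simp only [divisors, List.mem_append, List.map_cons, List.map_nil, List.mem_singleton] at he
    rcases he with he | rfl | rfl
    exacts [divisorTransform_vanishes hE hexc e he, hexc, hy]
  · obtain ⟨hy0, hyj⟩ := 𝒟.isLocalBlowup_eq hb
    obtain ⟨b₀, hb₀⟩ := Ideal.mem_span_singleton'.1 (hδ.2 e₀ m₀)
    obtain ⟨b₁, hb₁⟩ := Ideal.mem_span_singleton'.1 (hδ.2 e₁ m₁)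
    have hy1 : (𝒢.space M').germ a' (𝒢.pull σ e₁) =
        (𝒢.space M').germ a' (y 1) * (𝒢.space M').germ a' (𝒢.pull σ e₀) := by
      rw [← map_mul]
      exact congrArg _ (hyj 1)
    obtain ⟨δ', hδ', hφ, hδy⟩ := 𝒟.der_blowup hb a' hx 1 (fun _ => δ) (fun _ => 1)
      ![0, (𝒢.space M').germ a' (y 1) * (𝒟.stalkMap σ a' b₁ - 𝒟.stalkMap σ a' b₀)]
      (fun _ => hδ.1) rfl (by
        intro j
        fin_cases j
        · simp [hy0]
        · simp only [Fin.mk_one, Matrix.cons_val_one, Matrix.cons_val_zero, Finset.univ_unique,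
            Finset.sum_const, Finset.card_singleton, one_smul, one_mul, ← hb₀, ← hb₁, map_mul,
            𝒟.stalkMap_germ, hy1, Matrix.cons_val_fin_one]
          ring)
    have hφ' : ∀ r, δ' (𝒟.stalkMap σ a' r) = 𝒟.stalkMap σ a' (δ r) := fun r => by simpa using hφ r
    have hβ : δ' ((𝒢.space M').germ a' (𝒢.pull σ e₀)) =
        (𝒢.space M').germ a' (𝒢.pull σ e₀) * 𝒟.stalkMap σ a' b₀ := by
      rw [← 𝒟.stalkMap_germ, hφ', ← hb₀, map_mul, mul_comm]
    refine ⟨δ', ⟨hδ', fun e he => ?_⟩, hφ'⟩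
    simp only [divisors, List.mem_append, List.map_cons, List.map_nil, List.mem_singleton] at he
    rcases he with he | rfl | rfl
    · refine divisorTransform_stable hE hβ (fun e he => ?_) e he
      refine mem_span_pull (c := 1) (by simpa using hφ') (hδ.2 e ?_)
      simp [divisors, he]
    · rw [hβ]; exact Ideal.mul_mem_right _ _ (Ideal.mem_span_singleton_self _)
    · rw [hδy 1]
      exact Ideal.mul_mem_right _ _ (Ideal.mem_span_singleton_self _)

/-! ### Admissible blowings-up -/

theorem survives_iff (σ : 𝒢.Hom M' M) (exc : 𝒢.Fn M') (a' : 𝒢.Pt M') (P : Weighted (𝒢.space M)) :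
    Geometry.Survives σ exc a' P ↔ RingSurvives (𝒟.stalkMap σ a')
      (Geometry.strictIdeal σ exc a' P.eqs) ((𝒢.space M').germ a' exc)
      (germs P (𝒢.map σ a')) := by
  refine and_congr Iff.rfl ?_
  simp only [germs, List.mem_map, forall_exists_index, and_imp, forall_apply_eq_imp_iff₂,
    𝒟.stalkMap_germ]

theorem ringTransform_of_isTransform {σ : 𝒢.Hom M' M} {exc : 𝒢.Fn M'} {a' : 𝒢.Pt M'}
    {P : Weighted (𝒢.space M)} {P' : Weighted (𝒢.space M')}
    (h : Geometry.IsTransform σ exc a' P P') : RingTransform (𝒟.stalkMap σ a')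
      (Geometry.strictIdeal σ exc a' P.eqs) ((𝒢.space M').germ a' exc)
      (germs P (𝒢.map σ a')) (germs P' a') := by
  rw [RingTransform, germs, germs, List.forall₂_map_left_iff, List.forall₂_map_right_iff]
  simpa only [𝒟.stalkMap_germ] using h.2.2

/-- The centre lies in the locus of `Q`, on which the equations of the subspace vanish; the
Nullstellensatz for the smooth centre gives the inclusion of ideals. Consequently these equations
become divisible by `exc` after the blowing-up. -/
theorem idealAt_le_centre {a : 𝒢.Pt M} {k : ℕ} {x : Fin k → 𝒢.Fn M}
    (hdual : HasDual (𝒟.Der a) fun j => (𝒢.space M).germ a (x j)) {Q : Weighted (𝒢.space M)}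
    (hQ : ∀ᶠ w in 𝓝 a, (∀ j, (𝒢.space M).VanishesAt (x j) w) → Q.Locus w) :
    (𝒢.space M).idealAt Q.eqs a ≤ (𝒢.space M).idealAt x a := by
  refine Ideal.span_le.2 ?_
  rintro _ ⟨l, rfl⟩
  refine 𝒟.nullstellensatz (z := fun j w => (𝒢.space M).germ w (x j))
    (fun j => 𝒟.germ_mem_sec a (x j)) hdual _ (𝒟.germ_mem_sec a (Q.eqs l)) ?_
  filter_upwards [hQ] with w hw hxw
  exact (hw hxw).1 l

/-- Both conclusions rest on the same configuration: the equations `ζ` of `N` and the contact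
function `z` are divided by `exc` to give `ζ'` and `z'`, which generate the strict transforms, and
`exc * δ` lifts to `δ'`. Then `IsContact.survives_iff` compares the two transforms, and
`IsContact.transform` carries the contact over. -/
theorem admissible_core {σ : 𝒢.Hom M' M} {a' : 𝒢.Pt M'} {E pairs P Q} {k : ℕ} {x : Fin k → 𝒢.Fn M}
    {i : Fin k} {y : Fin k → 𝒢.Fn M'} (hb : Geometry.IsLocalBlowup σ x i y)
    (hP : Geometry.IsAdmissible (𝒢.map σ a') E x P) (hQ : Geometry.IsAdmissible (𝒢.map σ a') E x Q)
    (h : 𝒟.Invariant ⟨M, 𝒢.map σ a', E, pairs, P, Q⟩) :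
    (Geometry.Survives σ (𝒢.pull σ (x i)) a' P ↔ Geometry.Survives σ (𝒢.pull σ (x i)) a' Q) ∧
    ∀ {P' Q' : Weighted (𝒢.space M')} {E' : List (𝒢.Fn M')},
      Geometry.Survives σ (𝒢.pull σ (x i)) a' Q →
      Geometry.IsTransform σ (𝒢.pull σ (x i)) a' P P' →
      Geometry.IsTransform σ (𝒢.pull σ (x i)) a' Q Q' →
      Geometry.IsDivisorTransform σ (𝒢.pull σ (x i)) a' E E' →
      𝒟.Invariant ⟨M', a', E', [], P', Q'⟩ := by
  have hx := hP.2.1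
  have hxdual := 𝒟.hasDual_centre hb hx
  have hcentre := idealAt_le_centre hxdual hQ.2.2
  have hQm := h.le
  have hcontact : HasContact (𝒟.LogDer (𝒢.map σ a')
      (divisors (𝒢 := 𝒢) ⟨M, 𝒢.map σ a', E, pairs, P, Q⟩))
      ((𝒢.space M).idealAt P.eqs (𝒢.map σ a')) ((𝒢.space M).idealAt Q.eqs (𝒢.map σ a'))
      (germs P (𝒢.map σ a')) (germs Q (𝒢.map σ a')) := h.contact
  obtain ⟨p, ζ, D, δ, z, hD, hdual, hδ, hI, hI', hδζ, hu, hc⟩ := hcontact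
  rw [hI'] at hQm
  have hPm : (𝒢.space M).idealAt P.eqs (𝒢.map σ a') ≤ maximalIdeal _ := le_sup_left.trans hQm
  have hζP : ∀ l, ζ l ∈ (𝒢.space M).idealAt P.eqs (𝒢.map σ a') :=
    fun l => hI ▸ Ideal.subset_span ⟨l, rfl⟩
  have hzQ : z ∈ (𝒢.space M).idealAt Q.eqs (𝒢.map σ a') :=
    hI' ▸ Submodule.mem_sup_right (Ideal.mem_span_singleton_self z)
  have hzm : z ∈ maximalIdeal _ := hQm (Submodule.mem_sup_right (Ideal.mem_span_singleton_self z))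
  choose ζ' hζ' using fun l => 𝒟.exists_eq_exc_mul hb (hcentre (hI' ▸ Submodule.mem_sup_left (hζP l)))
  obtain ⟨z', hz'⟩ := 𝒟.exists_eq_exc_mul hb (hcentre hzQ)
  have hdualL : HasDual (𝒟.LogDer (𝒢.map σ a')
      (divisors (𝒢 := 𝒢) ⟨M, 𝒢.map σ a', E, pairs, P, Q⟩)) ζ :=
    ⟨fun l => hPm (hζP l), D, hD, fun i j => by rw [hdual]; simp⟩
  have hdualζ : HasDual (𝒟.Der (𝒢.map σ a')) ζ :=
    ⟨fun l => hPm (hζP l), D, fun l => (hD l).1, fun i j => by rw [hdual]; simp⟩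
  have hdualz := hdualζ.snoc hzm hδ.1 (fun l => hPm (hδζ l)) hu
  have hζz : ∀ l, 𝒟.stalkMap σ a' ((Fin.snoc (α := fun _ => (𝒢.space M).Stalk (𝒢.map σ a')) ζ z) l) =
      (𝒢.space M').germ a' (𝒢.pull σ (x i)) *
        (Fin.snoc (α := fun _ => (𝒢.space M').Stalk a') ζ' z') l := by
    intro l
    refine Fin.lastCases ?_ (fun l => ?_) l
    · simpa using hz'
    · simpa using hζ' l
  have hsP : Geometry.strictIdeal σ (𝒢.pull σ (x i)) a' P.eqs = Ideal.span (Set.range ζ') :=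
    𝒟.strict_eq_span hb hx hζ' hdualζ hI
  have hsQ : Geometry.strictIdeal σ (𝒢.pull σ (x i)) a' Q.eqs =
      Ideal.span (Set.range ζ') ⊔ Ideal.span {z'} := by
    rw [← span_range_snoc]
    exact 𝒟.strict_eq_span hb hx hζz hdualz (by rw [hI', hI, span_range_snoc])
  obtain ⟨δ', hδ', hδφ⟩ := 𝒟.exists_lift_blowup hb hx hδ.1
  have hβ : δ' ((𝒢.space M').germ a' (𝒢.pull σ (x i))) = (𝒢.space M').germ a' (𝒢.pull σ (x i)) *
      𝒟.stalkMap σ a' (δ ((𝒢.space M).germ _ (x i))) := by rw [← 𝒟.stalkMap_germ, hδφ, 𝒟.stalkMap_germ]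
  have hIJ : ((𝒢.space M).idealAt P.eqs (𝒢.map σ a')).map (𝒟.stalkMap σ a') ≤
      Ideal.span (Set.range ζ') := by
    rw [hI, Ideal.map_span, Ideal.span_le]
    rintro _ ⟨_, ⟨l, rfl⟩, rfl⟩
    rw [hζ']
    exact Ideal.mul_mem_left _ _ (Ideal.subset_span ⟨l, rfl⟩)
  have hm : Ideal.span (Set.range ζ') ≠ ⊤ → ∀ l, ζ' l ∈ maximalIdeal _ :=
    fun hne l => le_maximalIdeal hne (Ideal.subset_span ⟨l, rfl⟩)
  have hreg : Ideal.span (Set.range ζ') ≠ ⊤ → ∀ b,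
      (𝒢.space M').germ a' (𝒢.pull σ (x i)) * b ∈ Ideal.span (Set.range ζ') →
      b ∈ Ideal.span (Set.range ζ') :=
    fun hne b => 𝒟.transform_regular hb hx hζ' (hm hne) hdualζ
  have hreg' : Ideal.span (Set.range ζ') ⊔ Ideal.span {z'} ≠ ⊤ → ∀ b,
      (𝒢.space M').germ a' (𝒢.pull σ (x i)) * b ∈ Ideal.span (Set.range ζ') ⊔ Ideal.span {z'} →
      b ∈ Ideal.span (Set.range ζ') ⊔ Ideal.span {z'} := by
    rw [← span_range_snoc]
    exact fun hne b => 𝒟.transform_regular hb hx hζz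
      (fun l => le_maximalIdeal hne (Ideal.subset_span ⟨l, rfl⟩)) hdualz
  have hJ : Ideal.span (Set.range ζ') ≠ ⊤ → ∀ f ∈ Ideal.span (Set.range ζ'),
      δ' f ∈ Ideal.span (Set.range ζ') := by
    intro hne
    refine derivation_span_le ?_
    rintro _ ⟨l, rfl⟩
    refine hreg hne _ ?_
    have h1 := hδφ (ζ l)
    rw [hζ', Derivation.leibniz, hβ, smul_eq_mul, smul_eq_mul] at h1
    have h2 : 𝒟.stalkMap σ a' (δ (ζ l)) ∈ Ideal.span (Set.range ζ') :=
      hIJ (Ideal.mem_map_of_mem _ (hδζ l))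
    rw [eq_sub_of_add_eq h1]
    exact sub_mem (Ideal.mul_mem_left _ _ h2) (Ideal.mul_mem_right _ _ (Ideal.subset_span ⟨l, rfl⟩))
  -- Divisibility of the functions of `P` on the strict transform comes from the centre being
  -- contained in the locus of `P`.
  have hdiv : Ideal.span (Set.range ζ') ≠ ⊤ → ∀ h ∈ germs P (𝒢.map σ a'), ∃ g,
      (𝒢.space M').germ a' (𝒢.pull σ (x i)) ^ h.2 * g - 𝒟.stalkMap σ a' h.1 ∈
        Ideal.span (Set.range ζ') := by
    intro hne h₀ hh₀
    obtain ⟨h, hh, rfl⟩ := List.mem_map.1 hh₀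
    rw [𝒟.stalkMap_germ]
    exact 𝒟.exists_pow_exc_mul hb (𝒟.transform_hasDual_snoc hb hx hζ' (hm hne) hdualζ) hIJ hP.2.2 hh
  refine ⟨?_, fun {P' Q' E'} hsv hP' hQ' hE' => ?_⟩
  · rw [survives_iff (𝒟 := 𝒟), survives_iff (𝒟 := 𝒟), hsP, hsQ]
    exact hc.survives_iff (𝒟.isUnit_natCast a') hu hIJ hreg hreg' hβ hδφ hJ hz' hdiv
  · have hne' := hsv.1
    rw [hsQ] at hne'
    have hne : Ideal.span (Set.range ζ') ≠ ⊤ := ne_top_of_le_ne_top hne' le_sup_left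
    have hJm' := le_maximalIdeal hne'
    have hz'm : z' ∈ maximalIdeal _ :=
      hJm' (Submodule.mem_sup_right (Ideal.mem_span_singleton_self z'))
    have hdiv' : divisors (𝒢 := 𝒢) ⟨M', a', E', [], P', Q'⟩ = E' := by simp [divisors]
    have hlift : ∀ ε ∈ 𝒟.LogDer (𝒢.map σ a')
        (divisors (𝒢 := 𝒢) ⟨M, 𝒢.map σ a', E, pairs, P, Q⟩), ∀ ε' ∈ 𝒟.Der a',
        (∀ r, ε' (𝒟.stalkMap σ a' r) =
          (𝒢.space M').germ a' (𝒢.pull σ (x i)) * 𝒟.stalkMap σ a' (ε r)) →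
        ε' ∈ 𝒟.LogDer a' E' := by
      intro ε hε ε' hε' hεφ
      refine ⟨hε', divisorTransform_stable hE' (β := 𝒟.stalkMap σ a'
        (ε ((𝒢.space M).germ _ (x i)))) (by rw [← 𝒟.stalkMap_germ, hεφ, 𝒟.stalkMap_germ]) fun e he => ?_⟩
      exact mem_span_pull hεφ (hε.2 e (by simp [divisors, he]))
    -- The lifts of `exc * D l` are dual to the `ζ' l` only modulo the maximal ideal. Linear
    -- combinations are exactly dual, and they stay logarithmic because logarithmic derivations form
    -- a submodule.
    obtain ⟨D', hD', hd'⟩ := (𝒟.transform_hasDual hb hx hζ' (hm hne) (S' := 𝒟.LogDer a' E')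
      (fun ε hε => by
        obtain ⟨ε', hε', hεφ⟩ := 𝒟.exists_lift_blowup hb hx hε.1
        exact ⟨ε', hlift ε hε ε' hε' hεφ, hεφ⟩) hdualL).exists_exact
    have hrP := ringTransform_of_isTransform (𝒟 := 𝒟) hP'
    have hrQ := ringTransform_of_isTransform (𝒟 := 𝒟) hQ'
    rw [hsP] at hrP
    rw [hsQ] at hrQ
    have hiP : (𝒢.space M').idealAt P'.eqs a' = Ideal.span (Set.range ζ') := hP'.2.1.trans hsP
    have hiQ : (𝒢.space M').idealAt Q'.eqs a' = Ideal.span (Set.range ζ') ⊔ Ideal.span {z'} :=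
      hQ'.2.1.trans hsQ
    refine ⟨?_, ?_, ?_⟩
    · rw [hdiv']
      exact divisorTransform_vanishes hE' (𝒟.exc_mem hx)
    · rw [hiQ]; exact hJm'
    · rw [hdiv', hiP, hiQ]
      exact ⟨p, ζ', D', δ', z', hD', hd', hlift δ hδ δ' hδ' hδφ, rfl, rfl,
        fun l => hJ hne _ (Ideal.subset_span ⟨l, rfl⟩),
        isUnit_derivation_transform (le_maximalIdeal hne) (hreg hne) hβ hδφ hz' hz'm hu,
        hc.transform hIJ (hreg hne) (hreg' hne') hβ hδφ (hJ hne) hz' hrP hrQ⟩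

theorem Invariant.step {s s' : Geometry.Stage 𝒢} (hs : Geometry.Step s s') (h : 𝒟.Invariant s) :
    𝒟.Invariant s' := by
  cases hs with
  | shrink j a a' E pairs P Q hj ha => subst ha; exact h.shrink hj
  | admissible σ a a' E pairs P Q E' P' Q' x i y hb ha hP hQ _ sQ tP tQ tE =>
    subst ha; exact (admissible_core hb hP hQ h).2 sQ tP tQ tE
  | line σ t a a' E pairs P Q hσ ha ht => subst ha; exact h.line hσ ht
  | exceptional σ a a' E pairs P Q E' e₀ e₁ y hp hb ha hy hE =>
    subst ha; exact h.exceptional hp hb hy hE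

theorem survives_iff_survives {σ : 𝒢.Hom M' M} {a : 𝒢.Pt M} {a' : 𝒢.Pt M'} {E pairs P Q} {k : ℕ}
    {x : Fin k → 𝒢.Fn M} {i : Fin k} {y : Fin k → 𝒢.Fn M'} (hb : Geometry.IsLocalBlowup σ x i y)
    (ha : 𝒢.map σ a' = a) (hP : Geometry.IsAdmissible a E x P) (hQ : Geometry.IsAdmissible a E x Q)
    (h : 𝒟.Invariant ⟨M, a, E, pairs, P, Q⟩) :
    Geometry.Survives σ (𝒢.pull σ (x i)) a' P ↔ Geometry.Survives σ (𝒢.pull σ (x i)) a' Q := by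
  subst ha
  exact (admissible_core hb hP hQ h).1

/-- Equality of loci concerns nearby points, where contact persists once the logarithmic condition
is dropped. The condition on transforms is the first half of `admissible_core`. -/
theorem Invariant.compatible {s : Geometry.Stage 𝒢} (h : 𝒟.Invariant s) : s.Compatible := by
  obtain ⟨M, a, E, pairs, P, Q⟩ := s
  refine ⟨?_, ?_⟩
  · filter_upwards [𝒟.eventually_hasContact (hasContact_mono (𝒟.logDer_le _ _) h.contact)]
      with w hw
    exact 𝒟.locus_iff_of_hasContact hw
  · intro M' σ a' k x i y hb ha hP hQ
    exact survives_iff_survives hb ha hP hQ h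

theorem Invariant.equivalentAt {a : 𝒢.Pt M} {P Q : Weighted (𝒢.space M)}
    (h : 𝒟.Invariant ⟨M, a, [], [], P, Q⟩) : Geometry.EquivalentAt a P Q := by
  intro s hs
  refine Invariant.compatible (𝒟 := 𝒟) ?_
  induction hs with
  | refl => exact h
  | tail _ hstep ih => exact ih.step hstep

/-- Contact data at a point give equivalent presentations at all nearby points of the locus. -/
theorem eventually_equivalentAt {a : 𝒢.Pt M} {P Q : Weighted (𝒢.space M)}
    (h : HasContact (𝒟.Der a) ((𝒢.space M).idealAt P.eqs a) ((𝒢.space M).idealAt Q.eqs a)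
      (germs P a) (germs Q a)) :
    ∀ᶠ w in 𝓝 a, (P.Locus w ↔ Q.Locus w) ∧ (P.Locus w → Geometry.EquivalentAt w P Q) := by
  filter_upwards [𝒟.eventually_hasContact h] with w hw
  have hiff := 𝒟.locus_iff_of_hasContact hw
  refine ⟨hiff, fun hP => Invariant.equivalentAt (𝒟 := 𝒟) ⟨?_, ?_, ?_⟩⟩
  · simp [divisors]
  · exact (locus_iff.1 (hiff.1 hP)).1
  · have : divisors (𝒢 := 𝒢) ⟨M, w, [], [], P, Q⟩ = [] := rfl
    rw [this, 𝒟.logDer_nil]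
    exact hw

end DiffStructure

end Desing

/-! ### Existence of maximal contact, and the theorem over an abstract differential structure. -/

namespace Desing

open IsLocalRing

namespace DiffStructure

variable {𝒢 : Geometry.{u}} {M M' : 𝒢.Obj} (𝒟 : DiffStructure 𝒢)

/-! ### Maximal contact -/

theorem hasDual_pull {j : 𝒢.Hom M' M} (hj : 𝒢.IsOpenImm j) (b : 𝒢.Pt M') {k : ℕ}
    {z : Fin k → (𝒢.space M).Stalk (𝒢.map j b)} (h : HasDual (𝒟.Der (𝒢.map j b)) z) :
    HasDual (𝒟.Der b) fun i => 𝒟.stalkMap j b (z i) := by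
  obtain ⟨hm, D, hD, hd⟩ := h
  choose D' hD' hφ using fun i => 𝒟.der_openImm hj b (D i) (hD i)
  refine ⟨fun i => (𝒟.stalkMap_mem_maximalIdeal j b _).2 (hm i), D', hD', fun i i' => ?_⟩
  have h1 := (𝒟.stalkMap_mem_maximalIdeal j b _).2 (hd i i')
  rw [map_sub, ← hφ] at h1
  split_ifs at h1 ⊢ <;> simpa using h1

theorem iterate_mem_sec {a : 𝒢.Pt M}
    {D : ∀ w, Derivation ℤ ((𝒢.space M).Stalk w) ((𝒢.space M).Stalk w)}
    (hD : ∀ s ∈ 𝒟.Sec a, (fun w => D w (s w)) ∈ 𝒟.Sec a) {s : ∀ w, (𝒢.space M).Stalk w}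
    (hs : s ∈ 𝒟.Sec a) (q : ℕ) : (fun w => (D w)^[q] (s w)) ∈ 𝒟.Sec a := by
  induction q with
  | zero => exact hs
  | succ q ih =>
    have := hD _ ih
    simpa only [Function.iterate_succ_apply'] using this

/-- Existence of a hypersurface of maximal contact, and of the corresponding coefficients. -/
theorem exists_contact {a : 𝒢.Pt M} (P : Weighted (𝒢.space M))
    (hsub : IsPartOfRegularSystem fun i => (𝒢.space M).germ a (P.eqs i)) (hP : P.Locus a)
    (hex : ∃ h ∈ P.fns, 0 < h.2 ∧
      (𝒢.space M).germ a h.1 ∉ fil (maximalIdeal _) ((𝒢.space M).idealAt P.eqs a) (h.2 + 1)) :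
    ∃ (U : 𝒢.Obj) (j : 𝒢.Hom U M) (b : 𝒢.Pt U) (z : 𝒢.Fn U) (L : List (𝒢.Fn U × ℕ)),
      𝒢.IsOpenImm j ∧ 𝒢.map j b = a ∧ (∀ f ∈ L, 0 < f.2) ∧
      (IsPartOfRegularSystem fun i => (𝒢.space U).germ b
        (Fin.snoc (α := fun _ => 𝒢.Fn U) (fun i => 𝒢.pull j (P.eqs i)) z i)) ∧
      HasContact (𝒟.Der b) ((𝒢.space U).idealAt (P.pull (𝒢.pull j)).eqs b)
        ((𝒢.space U).idealAt
          (Fin.snoc (α := fun _ => 𝒢.Fn U) (fun i => 𝒢.pull j (P.eqs i)) z) b)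
        (germs (P.pull (𝒢.pull j)) b)
        (germs ⟨P.codim + 1, Fin.snoc (α := fun _ => 𝒢.Fn U) (fun i => 𝒢.pull j (P.eqs i)) z, L⟩ b)
      := by
  have hdual := hsub.hasDual (S := 𝒟.Der a) (fun f => 𝒟.mem_sq_of_der f)
  obtain ⟨E, hE, hEd⟩ := hdual.exists_exact
  have hP' := locus_iff.1 hP
  obtain ⟨n, u, ι, hu, hui⟩ := hsub
  have hui' : u ∘ ι = fun i => (𝒢.space M).germ a (P.eqs i) := funext hui
  obtain ⟨h₀, hh₀, hpos, hnot⟩ := hex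
  have hmem := hP'.2 _ (List.mem_map_of_mem (f := fun h : 𝒢.Fn M × ℕ =>
    ((𝒢.space M).germ a h.1, h.2)) hh₀)
  -- The order of `h₀` on the subspace is exactly its weight: at least the weight by `hmem`, and not
  -- more by `hnot`.
  obtain ⟨δ, hδ, hδ0, hunit⟩ := exists_derivation_iterate_isUnit (𝒟.isUnit_natCast a) hu.1
    (hu.hasDual (fun f => 𝒟.mem_sq_of_der f)) ι (d := h₀.2) (g := (𝒢.space M).germ a h₀.1)
    (by rw [hui']; exact hmem) (by rw [hui']; exact hnot)
  simp only [hui] at hδ0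
  obtain ⟨D, rfl, -, hDs⟩ := 𝒟.exists_der_family hδ
  obtain ⟨i₀, hi₀⟩ := List.mem_iff_get.1 hh₀
  -- All derivatives `δ^q h` with `q` below the weight of `h` receive representatives on one
  -- neighbourhood. The contact function is among them, at the index of `h₀` with `q = h₀.2 - 1`.
  obtain ⟨U, j, b, f, hj, hb, hf⟩ := 𝒟.exists_openImm a
    (ι := Σ i : Fin P.fns.length, Fin (P.fns.get i).2)
    (fun i w => (D w)^[i.2] ((𝒢.space M).germ w (P.fns.get i.1).1))
    (fun i => 𝒟.iterate_mem_sec hDs (𝒟.germ_mem_sec a _) i.2)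
  subst hb
  set δ := D (𝒢.map j b) with hδdef
  set z : (𝒢.space M).Stalk (𝒢.map j b) := δ^[h₀.2 - 1] ((𝒢.space M).germ _ h₀.1) with hz
  set Q : List ((𝒢.space M).Stalk (𝒢.map j b) × ℕ) :=
    (Finset.univ : Finset (Σ i : Fin P.fns.length, Fin (P.fns.get i).2)).toList.map fun i =>
      (δ^[i.2] ((𝒢.space M).germ _ (P.fns.get i.1).1), (P.fns.get i.1).2 - i.2) with hQ
  -- Before any transformation the chains consist of honest iterated derivatives, without
  -- corrections.
  have hchain : ∀ h : 𝒢.Fn M × ℕ, IsChain ((𝒢.space M).idealAt P.eqs (𝒢.map j b)) δ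
      ((𝒢.space M).germ _ h.1) h.2 (fun q => δ^[q] ((𝒢.space M).germ _ h.1)) 0 := by
    intro h
    refine ⟨by simp, fun q _ => ?_⟩
    simp [Function.iterate_succ_apply']
  have hc : IsContact ((𝒢.space M).idealAt P.eqs (𝒢.map j b)) z δ (germs P (𝒢.map j b)) Q := by
    refine ⟨fun h hh => ?_, fun g hg => ?_, ?_⟩
    · obtain ⟨h', hh', rfl⟩ := List.mem_map.1 hh
      obtain ⟨i, rfl⟩ := List.mem_iff_get.1 hh'
      refine ⟨_, _, hchain _, fun q hq => ⟨_, List.mem_map.2 ⟨⟨i, q, hq⟩, by simp, rfl⟩, rfl, ?_⟩⟩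
      simp
    · obtain ⟨⟨i, q⟩, -, rfl⟩ := List.mem_map.1 hg
      exact ⟨_, List.mem_map_of_mem (List.get_mem _ i), _, _, hchain _, q, q.2, rfl, by simp⟩
    · exact ⟨_, List.mem_map_of_mem hh₀, _, _, hchain h₀, hpos, by simp [hz]⟩
  have hδz : IsUnit (δ z) := by
    rw [hz, ← Function.iterate_succ_apply' (f := δ), Nat.succ_eq_add_one, Nat.sub_add_cancel hpos]
    exact hunit
  have hzm : z ∈ maximalIdeal _ :=
    ((hc.order_iff (𝒟.isUnit_natCast _) (derivation_span_le (by
      rintro _ ⟨i, rfl⟩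
      rw [hδ0]; exact zero_mem _)) hδz).1 hP').1
      (Submodule.mem_sup_right (Ideal.mem_span_singleton_self z))
  have hlt : h₀.2 - 1 < (P.fns.get i₀).2 := by rw [hi₀]; omega
  have hfz : (𝒢.space U).germ b (f ⟨i₀, h₀.2 - 1, hlt⟩) = 𝒟.stalkMap j b z := by
    rw [hf]; simp only [hz, hi₀]; rfl
  have hsnoc : (fun i => (𝒢.space U).germ b (Fin.snoc (α := fun _ => 𝒢.Fn U)
      (fun i => 𝒢.pull j (P.eqs i)) (f ⟨i₀, h₀.2 - 1, hlt⟩) i)) = fun i => 𝒟.stalkMap j b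
      (Fin.snoc (α := fun _ => (𝒢.space M).Stalk (𝒢.map j b))
        (fun i => (𝒢.space M).germ _ (P.eqs i)) z i) := by
    funext i
    refine Fin.lastCases ?_ (fun i => ?_) i
    · simpa using hfz
    · simp [𝒟.stalkMap_germ]
  refine ⟨U, j, b, f ⟨i₀, h₀.2 - 1, hlt⟩,
    (Finset.univ : Finset (Σ i : Fin P.fns.length, Fin (P.fns.get i).2)).toList.map fun i =>
      (f i, (P.fns.get i.1).2 - i.2), hj, rfl, ?_, ?_, ?_⟩
  · intro g hg
    obtain ⟨⟨i, q⟩, -, rfl⟩ := List.mem_map.1 hg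
    have := q.2
    simp only
    omega
  · rw [hsnoc]
    exact (𝒟.hasDual_pull hj b (hdual.snoc hzm hδ (fun i => by rw [hδ0]; exact zero_mem _)
      hδz)).isPartOfRegularSystem (𝒟.fg_maximalIdeal b)
  · have hcon : HasContact (𝒟.Der (𝒢.map j b)) ((𝒢.space M).idealAt P.eqs (𝒢.map j b))
        ((𝒢.space M).idealAt P.eqs (𝒢.map j b) ⊔ Ideal.span {z}) (germs P (𝒢.map j b)) Q :=
      ⟨P.codim, _, E, δ, z, hE, hEd, hδ, rfl, rfl, fun i => by rw [hδ0]; exact zero_mem _, hδz, hc⟩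
    have := hcon.map (φ := 𝒟.stalkMap j b) (S' := 𝒟.Der b) (𝒟.der_openImm hj b)
    rw [𝒟.idealAt_weighted_pull, 𝒟.germs_pull]
    convert this using 1
    · rw [FunctionSpace.idealAt, hsnoc]
      rw [show (fun i => 𝒟.stalkMap j b (Fin.snoc (α := fun _ => (𝒢.space M).Stalk (𝒢.map j b))
        (fun i => (𝒢.space M).germ _ (P.eqs i)) z i)) = 𝒟.stalkMap j b ∘
        (Fin.snoc (α := fun _ => (𝒢.space M).Stalk (𝒢.map j b))
        (fun i => (𝒢.space M).germ _ (P.eqs i)) z) from rfl, Set.range_comp, ← Ideal.map_span,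
        span_range_snoc]
      rfl
    · rw [hQ, germs, List.map_map, List.map_map]
      refine List.map_congr_left fun i _ => ?_
      simp only [Function.comp_apply, hf]
      rfl

end DiffStructure

namespace Presentation

variable {𝒢 : Geometry.{u}} {M : 𝒢.Obj} {a : 𝒢.Pt M} {p : ℕ}

theorem foldr_min_mem {α : Type*} [LinearOrder α] [OrderTop α] (l : List α)
    (h : l.foldr min ⊤ ≠ ⊤) : l.foldr min ⊤ ∈ l := by
  induction l with
  | nil => simp at h
  | cons b l ih =>
    rw [List.foldr_cons] at h ⊢
    rcases min_choice b (l.foldr min ⊤) with h' | h'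
    · rw [h']; exact List.mem_cons_self
    · rw [h'] at h ⊢
      exact List.mem_cons_of_mem _ (ih h)

/-- The minimum is attained by some pair, whose weight then equals its order. In particular this
weight is a positive integer, so clearing denominators does not alter the pair. -/
theorem exists_order_eq (G : Presentation 𝒢 M a p) (hmu : G.mu = 1) :
    ∃ g ∈ G.fns, ∃ k : ℕ, 0 < k ∧ g.2 = k ∧ (𝒢.space G.U).orderOn G.eqs G.pt g.1 = k := by
  have h1 := foldr_min_mem _ (show G.mu ≠ ⊤ by rw [hmu]; exact WithTop.one_ne_top)
  obtain ⟨g, hg, hg1⟩ := List.mem_map.1 h1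
  change _ = G.mu at hg1
  rw [hmu] at hg1
  have hgpos := G.weight_pos g hg
  refine ⟨g, hg, ?_⟩
  generalize hk : (𝒢.space G.U).orderOn G.eqs G.pt g.1 = k at hg1
  induction k using WithTop.recTopCoe with
  | top => exact absurd hg1.symm WithTop.one_ne_top
  | coe k =>
    rw [WithTop.map_coe] at hg1
    have h2 : (k : ℚ) / g.2 = 1 := WithTop.coe_injective hg1
    rw [div_eq_one_iff_eq hgpos.ne'] at h2
    refine ⟨k, ?_, h2.symm, rfl⟩
    rw [← h2] at hgpos
    exact_mod_cast hgpos

/-- For a weight `m/n` in lowest terms, `g ^ n` has order at least `n * ⌈m/n⌉`, and this is at least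
`m`. -/
theorem locus_pt (G : Presentation 𝒢 M a p) : G.weighted.Locus G.pt := by
  rw [DiffStructure.locus_iff]
  refine ⟨Ideal.span_le.2 ?_, ?_⟩
  · rintro _ ⟨i, rfl⟩
    obtain ⟨n, u, ι, hu, h⟩ := G.submanifold
    have h' : u (ι i) = (𝒢.space G.U).germ G.pt (G.weighted.eqs i) := h i
    change (𝒢.space G.U).germ G.pt (G.weighted.eqs i) ∈ maximalIdeal _
    rw [← h', ← hu.1]
    exact Ideal.subset_span ⟨_, rfl⟩
  · intro h hh
    obtain ⟨h', hh', rfl⟩ := List.mem_map.1 hh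
    obtain ⟨g, hg, rfl⟩ := List.mem_map.1 hh'
    have h1 := DiffStructure.natCast_le_orderOn_iff.1 (G.weight_le g hg)
    have h2 := pow_mem_fil h1 g.2.den
    simp only [map_pow]
    refine fil_antitone ?_ h2
    have h3 : ((g.2.num.toNat : ℤ) : ℚ) ≤ ((g.2.den * ⌈g.2⌉₊ : ℕ) : ℚ) := by
      rw [Int.toNat_of_nonneg (Rat.num_nonneg.2 (G.weight_pos g hg).le), ← Rat.mul_den_eq_num]
      push_cast
      rw [mul_comm (g.2.den : ℚ)]
      exact mul_le_mul_of_nonneg_right (Nat.le_ceil _) (by positivity)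
    exact_mod_cast h3

/-- Maximal contact in a category of manifolds with a differential structure. -/
theorem exists_semicoherentEquivalent (𝒟 : DiffStructure 𝒢) (G : Presentation 𝒢 M a p)
    (hmu : G.mu = 1) :
    ∃ C : Presentation 𝒢 M a (p + 1), G.SemicoherentEquivalent C := by
  obtain ⟨g, hg, k, hk, hgk, hord⟩ := G.exists_order_eq hmu
  have hnot : (𝒢.space G.U).germ G.pt g.1 ∉
      fil (maximalIdeal _) ((𝒢.space G.U).idealAt G.eqs G.pt) (k + 1) := by
    rw [← DiffStructure.natCast_le_orderOn_iff, hord, Nat.cast_le]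
    omega
  obtain ⟨U, j, b, z, L, hj, hb, hL, hreg, hc⟩ := 𝒟.exists_contact G.weighted G.submanifold
    G.locus_pt ⟨_, List.mem_map_of_mem hg, by simp [hgk, hk], by simp only [hgk, Rat.den_natCast, pow_one, Rat.num_natCast, Int.toNat_natCast]; exact hnot⟩
  have hlocb : (G.weighted.pull (𝒢.pull j)).Locus b := by
    have h1 := DiffStructure.locus_iff.1 G.locus_pt
    rw [← hb] at h1
    rw [DiffStructure.locus_iff, 𝒟.idealAt_weighted_pull, 𝒟.germs_pull]
    refine ⟨𝒟.map_le_maximalIdeal j b h1.1, fun h hh => ?_⟩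
    obtain ⟨h', hh', rfl⟩ := List.mem_map.1 hh
    exact 𝒟.map_fil_le j b (h1.2 h' hh')
  have hlocQ := (𝒟.locus_iff_of_hasContact
    (Q := ⟨p + 1, Fin.snoc (α := fun _ => 𝒢.Fn U) (fun i => 𝒢.pull j (G.eqs i)) z, L⟩) hc).1 hlocb
  obtain ⟨l, hl, hlx, hls, hlg⟩ := 𝒟.exists_id U
  let C : Presentation 𝒢 M a (p + 1) :=
    { U := U
      incl := 𝒢.comp j G.incl
      isOpenImm := 𝒟.isOpenImm_comp hj G.isOpenImm
      pt := b
      incl_pt := by rw [𝒟.map_comp, hb, G.incl_pt]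
      eqs := Fin.snoc (α := fun _ => 𝒢.Fn U) (fun i => 𝒢.pull j (G.eqs i)) z
      fns := L.map fun f => (f.1, (f.2 : ℚ))
      submanifold := hreg
      weight_pos := by
        intro f hf
        obtain ⟨f', hf', rfl⟩ := List.mem_map.1 hf
        exact Nat.cast_pos.2 (hL f' hf')
      weight_le := by
        intro f hf
        obtain ⟨f', hf', rfl⟩ := List.mem_map.1 hf
        rw [Nat.ceil_natCast]
        exact hlocQ.2 f' hf' }
  -- The new weights are integers, hence have denominator one, and clearing denominators returns the
  -- list `L`.
  have hC : C.weighted.pull (𝒢.pull l) =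
      ⟨p + 1, Fin.snoc (α := fun _ => 𝒢.Fn U) (fun i => 𝒢.pull j (G.eqs i)) z, L⟩ := by
    simp [Weighted.pull, weighted, C, hls, Function.comp_def]
  have hev := DiffStructure.eventually_equivalentAt (𝒟 := 𝒟)
    (Q := ⟨p + 1, Fin.snoc (α := fun _ => 𝒢.Fn U) (fun i => 𝒢.pull j (G.eqs i)) z, L⟩) hc
  refine ⟨C, U, b, j, l, hj, hl, (hlg _).symm, hb, hlx b, ?_, ?_⟩
  · rw [hC]
    exact hev.mono fun w hw => hw.1
  · rw [hC]
    exact hev.mono fun w hw => hw.2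

end Presentation

end Desing

/-! ### The algebraic case: smooth schemes in characteristic zero. -/

namespace Desing

open IsLocalRing

/-! ### Derivations and dual numbers -/

section Dual

variable {R T : Type*} [CommRing R] [CommRing T]

/-- The ring homomorphism `r ↦ φ r + ε d r` to the dual numbers. -/
def dualHom (φ : R →+* T) (d : R →+ T) (hd : ∀ a b, d (a * b) = φ a * d b + φ b * d a) :
    R →+* TrivSqZeroExt T T where
  toFun r := TrivSqZeroExt.inl (φ r) + TrivSqZeroExt.inr (d r)
  map_one' := by
    have : d 1 = 0 := by simpa using hd 1 1
    simp [this]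
  map_zero' := by simp
  map_add' a b := by
    ext <;> simp
  map_mul' a b := by
    ext
    · simp
    · simp [hd, mul_comm (d a)]

@[simp]
theorem fst_dualHom (φ : R →+* T) (d : R →+ T) (hd) (r : R) :
    (dualHom φ d hd r).fst = φ r := by simp [dualHom]

@[simp]
theorem snd_dualHom (φ : R →+* T) (d : R →+ T) (hd) (r : R) :
    (dualHom φ d hd r).snd = d r := by simp [dualHom]

/-- The derivation which corresponds to a section of the dual numbers over `R`. -/
def derivationOfDual (F : R →+* TrivSqZeroExt R R) (hF : ∀ r, (F r).fst = r) :
    Derivation ℤ R R :=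
  Derivation.mk' (AddMonoidHom.toIntLinearMap
    { toFun := fun r => (F r).snd
      map_zero' := by simp
      map_add' := by simp }) (fun a b => by
        simp [TrivSqZeroExt.snd_mul, hF, mul_comm b])

@[simp]
theorem derivationOfDual_apply (F : R →+* TrivSqZeroExt R R) (hF) (r : R) :
    derivationOfDual F hF r = (F r).snd := rfl

theorem isLocalHom_fst [IsLocalRing T] :
    IsLocalHom (TrivSqZeroExt.fstHom T T T : TrivSqZeroExt T T →+* T) :=
  ⟨fun _ h => TrivSqZeroExt.isUnit_iff_isUnit_fst.2 h⟩

instance [IsLocalRing T] : IsLocalRing (TrivSqZeroExt T T) :=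
  have : IsLocalHom (TrivSqZeroExt.fstHom T T T : TrivSqZeroExt T T →+* T) := isLocalHom_fst
  RingHom.domain_isLocalRing (TrivSqZeroExt.fstHom T T T : TrivSqZeroExt T T →+* T)

/-- A derivation of a ring extends to its localizations. -/
theorem exists_derivation_isLocalization {A B : Type*} [CommRing A] [CommRing B] [Algebra A B]
    (S : Submonoid A) [IsLocalization S B] (D : Derivation ℤ A A) :
    ∃ D' : Derivation ℤ B B, ∀ a, D' (algebraMap A B a) = algebraMap A B (D a) := by
  let F₀ : A →+* TrivSqZeroExt B B := dualHom (algebraMap A B)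
    ((algebraMap A B).toAddMonoidHom.comp D.toLinearMap.toAddMonoidHom) (fun a b => by simp)
  have hu : ∀ s : S, IsUnit (F₀ s) := fun s =>
    TrivSqZeroExt.isUnit_iff_isUnit_fst.2 (by simpa [F₀] using IsLocalization.map_units B s)
  let F : B →+* TrivSqZeroExt B B := IsLocalization.lift hu
  have hF : ∀ b, (F b).fst = b := by
    have : (TrivSqZeroExt.fstHom B B B : TrivSqZeroExt B B →+* B).comp F = RingHom.id B := by
      refine IsLocalization.ringHom_ext S ?_
      ext a
      simp [F, F₀]
    exact fun b => DFunLike.congr_fun this b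
  refine ⟨derivationOfDual F hF, fun a => ?_⟩
  simp [F, F₀]

/-- Derivations along a ring homomorphism are determined on a localization by their values on the
ring. -/
theorem derivation_ext_isLocalization {A B C : Type*} [CommRing A] [CommRing B] [CommRing C]
    [Algebra A B] (S : Submonoid A) [IsLocalization S B] (φ : B →+* C) (d d' : B →+ C)
    (hd : ∀ a b, d (a * b) = φ a * d b + φ b * d a)
    (hd' : ∀ a b, d' (a * b) = φ a * d' b + φ b * d' a)
    (h : ∀ a, d (algebraMap A B a) = d' (algebraMap A B a)) : d = d' := by
  have : dualHom φ d hd = dualHom φ d' hd' := by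
    refine IsLocalization.ringHom_ext S ?_
    ext a
    · simp
    · simp [h]
  ext b
  simpa using congrArg (fun F => (F b).snd) this

end Dual

/-! ### Derivations of smooth local rings -/

section Smooth

open scoped TensorProduct

variable (K : Type u) [Field K] {R : Type u} [CommRing R] [IsLocalRing R] [Algebra K R]

/-- In characteristic zero, the cotangent space of a smooth local ring is detected by the
derivations over the ground field. -/
theorem mem_maximalIdeal_sq_of_derivation [CharZero K] [Algebra.FormallySmooth K R]
    [Algebra.EssFiniteType K R] {f : R} (hf : f ∈ maximalIdeal R)
    (h : ∀ δ : Derivation K R R, δ f ∈ maximalIdeal R) : f ∈ maximalIdeal R ^ 2 := by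
  have : Algebra.EssFiniteType K (ResidueField R) := .comp K R (ResidueField R)
  have hκ : Algebra.FormallySmooth K (ResidueField R) := inferInstance
  have hsurj : Function.Surjective (algebraMap R (ResidueField R)) := residue_surjective
  -- The residue field is formally smooth over `K`, so `𝔪/𝔪²` embeds into `κ ⊗ Ω`. It remains to
  -- show that the differential of `f` dies there.
  have hinj := (Algebra.FormallySmooth.kerCotangentToTensor_injective_iff (R := K) (P := R)
    hsurj).2 inferInstance
  have hker : RingHom.ker (algebraMap R (ResidueField R)) = maximalIdeal R := ker_residue
  have hf' : f ∈ RingHom.ker (algebraMap R (ResidueField R)) := hker ▸ hf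
  have : Module.Free R Ω[R⁄K] := Module.free_of_flat_of_isLocalRing
  let b := Module.Free.chooseBasis R Ω[R⁄K]
  have h0 : KaehlerDifferential.kerCotangentToTensor K R (ResidueField R)
      (Ideal.toCotangent _ ⟨f, hf'⟩) = 0 := by
    rw [KaehlerDifferential.kerCotangentToTensor_toCotangent]
    rw [← b.sum_repr (KaehlerDifferential.D K R f), TensorProduct.tmul_sum]
    refine Finset.sum_eq_zero fun i _ => ?_
    rw [TensorProduct.tmul_smul, TensorProduct.smul_tmul', Algebra.smul_def]
    -- The coordinates of `df` in a basis of the free module `Ω` are values of derivations at `f`.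
    have h1 := h ((b.coord i).compDer (KaehlerDifferential.D K R))
    have h2 : algebraMap R (ResidueField R) (b.repr (KaehlerDifferential.D K R f) i) = 0 :=
      (residue_eq_zero_iff _).2 h1
    rw [h2, zero_mul, TensorProduct.zero_tmul]
  rw [map_eq_zero_iff _ hinj, Ideal.toCotangent_eq_zero] at h0
  exact hker ▸ h0

/-- A smooth algebra is smooth over a polynomial ring as soon as there are derivations which are
dual to the images of the variables. -/
theorem formallySmooth_mvPolynomial {k : ℕ} {B : Type u} [CommRing B] [Algebra K B]
    [Algebra (MvPolynomial (Fin k) K) B] [IsScalarTower K (MvPolynomial (Fin k) K) B]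
    [Algebra.FormallySmooth K B] (D : Fin k → Derivation K B B)
    (hD : ∀ i j, D i (algebraMap (MvPolynomial (Fin k) K) B (MvPolynomial.X j)) =
      if i = j then 1 else 0) : Algebra.FormallySmooth (MvPolynomial (Fin k) K) B := by
  -- The dual derivations give a left inverse of the map from the differentials of the polynomial
  -- ring. The first exact sequence therefore splits, which makes the relative differentials
  -- projective; injectivity, with `H1Cotangent` of `B` over `K` being zero, makes the relative
  -- `H1Cotangent` vanish.
  let l : Ω[B⁄K] →ₗ[B] B ⊗[MvPolynomial (Fin k) K] Ω[MvPolynomial (Fin k) K⁄K] :=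
    ∑ i, (D i).liftKaehlerDifferential.smulRight (1 ⊗ₜ KaehlerDifferential.D K (MvPolynomial (Fin k) K) (MvPolynomial.X i))
  have hl : l ∘ₗ KaehlerDifferential.mapBaseChange K (MvPolynomial (Fin k) K) B = LinearMap.id := by
    refine ((KaehlerDifferential.mvPolynomialBasis K (Fin k)).baseChange B).ext fun j => ?_
    simp only [Module.Basis.baseChange_apply, KaehlerDifferential.mvPolynomialBasis_apply,
      LinearMap.comp_apply, KaehlerDifferential.mapBaseChange_tmul, one_smul,
      KaehlerDifferential.map_D, LinearMap.id_apply, l, LinearMap.sum_apply,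
      LinearMap.smulRight_apply, Derivation.liftKaehlerDifferential_comp_D]
    rw [Finset.sum_eq_single j]
    · simp [hD]
    · intro i _ hij
      simp [hD, hij]
    · simp
  have hinj : Function.Injective (KaehlerDifferential.mapBaseChange K (MvPolynomial (Fin k) K) B) :=
    Function.HasLeftInverse.injective ⟨l, fun x => DFunLike.congr_fun hl x⟩
  have hsurj : Function.Surjective (KaehlerDifferential.map K (MvPolynomial (Fin k) K) B B) :=
    KaehlerDifferential.map_surjective K (MvPolynomial (Fin k) K) B
  rw [Algebra.formallySmooth_iff]
  constructor
  · have hex := KaehlerDifferential.exact_mapBaseChange_map K (MvPolynomial (Fin k) K) B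
    obtain ⟨s, hs⟩ := ((hex.split_tfae hinj hsurj).out 1 0 rfl rfl).1 ⟨l, hl⟩
    exact Module.Projective.of_split s _ hs
  · refine ⟨fun x y => ?_⟩
    have h0 : ∀ x : Algebra.H1Cotangent (MvPolynomial (Fin k) K) B, x = 0 := by
      intro x
      have h1 : Algebra.H1Cotangent.δ K (MvPolynomial (Fin k) K) B x = 0 := hinj (by
        rw [map_zero]
        exact (Algebra.H1Cotangent.exact_δ_mapBaseChange K (MvPolynomial (Fin k) K) B).apply_apply_eq_zero x)
      obtain ⟨y, rfl⟩ := (Algebra.H1Cotangent.exact_map_δ K (MvPolynomial (Fin k) K) B x).1 h1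
      rw [Subsingleton.elim y 0, map_zero]
    rw [h0 x, h0 y]

end Smooth

end Desing

namespace Desing

open IsLocalRing

/-! ### Separatedness and reducedness of smooth subspaces -/

theorem iterate_derivation_mul {R : Type*} [CommRing R] (δ : Derivation ℤ R R) (n : ℕ) (f g : R) :
    δ^[n] (f * g) =
      ∑ ij ∈ Finset.HasAntidiagonal.antidiagonal n, n.choose ij.1 • (δ^[ij.1] f * δ^[ij.2] g) := by
  induction n with
  | zero => simp
  | succ n ih =>
    rw [Finset.sum_antidiagonal_choose_succ_nsmul (M := R) (fun i j => δ^[i] f * δ^[j] g) n,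
      Function.iterate_succ_apply', ih, map_sum, ← Finset.sum_add_distrib]
    refine Finset.sum_congr rfl fun ij hij => ?_
    rw [map_nsmul, Derivation.leibniz, Function.iterate_succ_apply', Function.iterate_succ_apply',
      smul_eq_mul, smul_eq_mul, nsmul_add, mul_comm (δ^[ij.2] g),
      n.choose_symm_of_eq_add (Finset.HasAntidiagonal.mem_antidiagonal.1 hij).symm]

/-- Krull's intersection theorem for `R ⧸ I`. -/
theorem mem_of_forall_mem_fil {R : Type*} [CommRing R] [IsLocalRing R] [IsNoetherianRing R]
    (I : Ideal R) {f : R} (hf : ∀ n, f ∈ fil (maximalIdeal R) I n) : f ∈ I := by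
  have h := Ideal.iInf_pow_smul_eq_bot_of_isLocalRing (M := R ⧸ I) (maximalIdeal R)
    (maximalIdeal.isMaximal R).ne_top
  rw [← Ideal.Quotient.eq_zero_iff_mem, ← Submodule.mem_bot (R := R), ← h, Submodule.mem_iInf]
  intro n
  obtain ⟨a, ha, b, hb, rfl⟩ := Submodule.mem_sup.1 (hf n)
  rw [map_add, Ideal.Quotient.eq_zero_iff_mem.2 hb, add_zero]
  have : (Ideal.Quotient.mk I a) = a • (1 : R ⧸ I) := by
    rw [Algebra.smul_def, mul_one]; rfl
  rw [this]
  exact Submodule.smul_mem_smul ha trivial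

/-- Smooth subspaces are reduced. If `f` is not in the ideal, it has a finite order `d`, and `δ^d f`
is a unit for some `δ` tangent to the subspace. By Leibniz, `δ^(2d) (f²)` is, modulo the maximal
ideal, a binomial coefficient times `(δ^d f)²`, hence a unit; so `f²` is not in the ideal either. -/
theorem mem_span_of_sq_mem {R : Type u} [CommRing R] [IsLocalRing R]
    {S : Submodule R (Derivation ℤ R R)}
    (hS : ∀ f ∈ maximalIdeal R, (∀ δ ∈ S, δ f ∈ maximalIdeal R) → f ∈ maximalIdeal R ^ 2)
    (hn : ∀ n : ℕ, n ≠ 0 → IsUnit (n : R)) (hfg : (maximalIdeal R).FG) {k : ℕ} {z : Fin k → R}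
    (hz : HasDual S z) (hsep : ∀ f, (∀ n, f ∈ fil (maximalIdeal R) (Ideal.span (Set.range z)) n) →
      f ∈ Ideal.span (Set.range z)) {f : R} (hf : f ^ 2 ∈ Ideal.span (Set.range z)) :
    f ∈ Ideal.span (Set.range z) := by
  by_contra hfz
  obtain ⟨n, u, ι, hu, hui⟩ := hz.isPartOfRegularSystem hfg
  have hui' : u ∘ ι = z := funext hui
  have hex : ∃ n, f ∉ fil (maximalIdeal R) (Ideal.span (Set.range z)) n := by
    by_contra hcon
    push Not at hcon
    exact hfz (hsep f hcon)
  classical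
  obtain ⟨d, hd⟩ : ∃ d, Nat.find hex = d + 1 := by
    refine Nat.exists_eq_succ_of_ne_zero fun h0 => ?_
    have := Nat.find_spec hex
    rw [h0, fil_zero] at this
    exact this trivial
  have h1 : f ∉ fil (maximalIdeal R) (Ideal.span (Set.range z)) (d + 1) := hd ▸ Nat.find_spec hex
  have h2 : f ∈ fil (maximalIdeal R) (Ideal.span (Set.range z)) d := by
    have := Nat.find_min hex (m := d) (by omega)
    push Not at this
    exact this
  obtain ⟨δ, -, hδ, hunit⟩ := exists_derivation_iterate_isUnit hn hu.1 (hu.hasDual hS) ι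
    (by rw [hui']; exact h2) (by rw [hui']; exact h1)
  have hzm : Ideal.span (Set.range z) ≤ maximalIdeal R := by
    rw [Ideal.span_le]; rintro _ ⟨i, rfl⟩; exact hz.1 i
  have hI : ∀ g ∈ Ideal.span (Set.range z), δ g ∈ Ideal.span (Set.range z) := by
    refine derivation_span_le ?_
    rintro _ ⟨i, rfl⟩
    rw [← hui, hδ]
    exact zero_mem _
  have hiter : ∀ n, ∀ g ∈ Ideal.span (Set.range z), δ^[n] g ∈ Ideal.span (Set.range z) := by
    intro n
    induction n with
    | zero => exact fun g hg => hg
    | succ n ih => intro g hg; rw [Function.iterate_succ_apply']; exact hI _ (ih g hg)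
  have hlow : ∀ i < d, δ^[i] f ∈ maximalIdeal R := by
    intro i hi
    have h3 := chain_mem_fil (m := maximalIdeal R) (lam := 0) (c := fun q => δ^[q] f) hI
      (n := d) (fun q _ => by simp [Function.iterate_succ_apply']) h2 i hi.le
    exact fil_le_of_le hzm (by omega) h3
  have hsum := hiter (d + d) _ hf
  rw [sq, iterate_derivation_mul] at hsum
  rw [← Finset.add_sum_erase _ _ (show (d, d) ∈ Finset.HasAntidiagonal.antidiagonal (d + d) by simp)] at hsum
  have hrest : ∑ ij ∈ (Finset.HasAntidiagonal.antidiagonal (d + d)).erase (d, d),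
      (d + d).choose ij.1 • (δ^[ij.1] f * δ^[ij.2] f) ∈ maximalIdeal R := by
    refine sum_mem fun ij hij => ?_
    rw [Finset.mem_erase, Finset.HasAntidiagonal.mem_antidiagonal] at hij
    refine nsmul_mem ?_ _
    rcases lt_trichotomy ij.1 d with h | h | h
    · exact Ideal.mul_mem_right _ _ (hlow _ h)
    · exact absurd (Prod.ext h (by simp only; omega)) hij.1
    · exact Ideal.mul_mem_left _ _ (hlow _ (by omega))
  have hmid : (d + d).choose d • (δ^[d] f * δ^[d] f) ∈ maximalIdeal R := by
    have := sub_mem (hzm hsum) hrest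
    simpa using this
  rw [nsmul_eq_mul] at hmid
  exact (mem_maximalIdeal _).1 hmid ((hn _ (Nat.choose_pos (by omega)).ne').mul
    (hunit.mul hunit))

end Desing

namespace Desing

open IsLocalRing

/-! ### Smooth schemes: scalars and derivations -/

namespace SmoothScheme

variable {K : Type u} [Field K] (M : SmoothScheme K)

/-- Scalars, as functions on an open subset. -/
def scalarOn (V : M.X.Opens) : K →+* Γ(M.X, V) :=
  (M.str.appLE ⊤ V le_top).hom.comp (Scheme.ΓSpecIso (CommRingCat.of K)).inv.hom

/-- Scalars, as germs of functions. -/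
def scalarAt (x : M.X) : K →+* M.X.presheaf.stalk x :=
  (M.X.presheaf.germ ⊤ x trivial).hom.comp (M.scalarOn ⊤)

theorem germ_scalarOn {V : M.X.Opens} {x : M.X} (hx : x ∈ V) (c : K) :
    M.X.presheaf.germ V x hx (M.scalarOn V c) = M.scalarAt x c := by
  have h : (M.str.appLE ⊤ ⊤ le_top) ≫ M.X.presheaf.map (homOfLE le_top).op =
      M.str.appLE ⊤ V le_top := Scheme.Hom.appLE_map _ _ _
  rw [scalarOn, scalarAt, scalarOn, ← h]
  simp only [RingHom.comp_apply, CommRingCat.hom_comp]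
  exact M.X.presheaf.germ_res_apply (homOfLE le_top : V ⟶ ⊤) x hx _

theorem smooth_scalarOn {V : M.X.Opens} (hV : IsAffineOpen V) : (M.scalarOn V).Smooth := by
  have := M.smooth
  have h : (M.str.appLE ⊤ V le_top).hom.Smooth :=
    HasRingHomProperty.appLE @Smooth M.str this ⟨⊤, isAffineOpen_top _⟩ ⟨V, hV⟩ le_top
  exact RingHom.Smooth.propertyIsLocal.respectsIso.2 _
    (Scheme.ΓSpecIso (CommRingCat.of K)).symm.commRingCatIsoToRingEquiv h

theorem exists_affine (x : M.X) (W : M.X.Opens) (hx : x ∈ W) :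
    ∃ V : M.X.Opens, IsAffineOpen V ∧ x ∈ V ∧ V ≤ W := by
  obtain ⟨_, ⟨V, hV, rfl⟩, hxV, hVW⟩ :=
    M.X.isBasis_affineOpens.exists_subset_of_mem_open hx W.2
  exact ⟨V, hV, hxV, hVW⟩

theorem smooth_stalk (x : M.X) :
    letI := (M.scalarAt x).toAlgebra
    Algebra.FormallySmooth K (M.X.presheaf.stalk x) ∧
      Algebra.EssFiniteType K (M.X.presheaf.stalk x) := by
  letI := (M.scalarAt x).toAlgebra
  obtain ⟨V, hV, hx, -⟩ := M.exists_affine x ⊤ trivial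
  letI := (M.scalarOn V).toAlgebra
  have hs : Algebra.Smooth K Γ(M.X, V) := M.smooth_scalarOn hV
  letI := TopCat.Presheaf.algebra_section_stalk M.X.presheaf (⟨x, hx⟩ : V)
  have hloc := hV.isLocalization_stalk ⟨x, hx⟩
  have : IsScalarTower K Γ(M.X, V) (M.X.presheaf.stalk x) :=
    .of_algebraMap_eq fun c => (M.germ_scalarOn hx c).symm
  have h1 : Algebra.FormallySmooth Γ(M.X, V) (M.X.presheaf.stalk x) :=
    Algebra.FormallySmooth.of_isLocalization (hV.primeIdealOf ⟨x, hx⟩).asIdeal.primeCompl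
  have h2 : Algebra.EssFiniteType Γ(M.X, V) (M.X.presheaf.stalk x) :=
    .of_isLocalization _ (hV.primeIdealOf ⟨x, hx⟩).asIdeal.primeCompl
  exact ⟨.comp K Γ(M.X, V) _, .comp K Γ(M.X, V) _⟩

instance isNoetherianRing_stalk (x : M.X) : IsNoetherianRing (M.X.presheaf.stalk x) := by
  letI := (M.scalarAt x).toAlgebra
  have := (M.smooth_stalk x).2
  exact Algebra.EssFiniteType.isNoetherianRing K _

/-- Derivations over the ground field. -/
def Der (a : M.X) :
    Submodule (M.X.presheaf.stalk a) (Derivation ℤ (M.X.presheaf.stalk a) (M.X.presheaf.stalk a)) where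
  carrier := {δ | ∀ c, δ (M.scalarAt a c) = 0}
  zero_mem' := fun _ => rfl
  add_mem' := fun h h' c => by simp [h c, h' c]
  smul_mem' := fun r δ h c => by simp [h c]

theorem mem_sq_of_der [CharZero K] {a : M.X} (f : M.X.presheaf.stalk a)
    (hf : f ∈ maximalIdeal (M.X.presheaf.stalk a))
    (h : ∀ δ ∈ M.Der a, δ f ∈ maximalIdeal (M.X.presheaf.stalk a)) :
    f ∈ maximalIdeal (M.X.presheaf.stalk a) ^ 2 := by
  letI := (M.scalarAt a).toAlgebra
  have := (M.smooth_stalk a).1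
  have := (M.smooth_stalk a).2
  refine mem_maximalIdeal_sq_of_derivation K hf fun δ => ?_
  exact h (δ.restrictScalars ℤ) fun c => δ.map_algebraMap c

theorem isUnit_natCast [CharZero K] (a : M.X) (n : ℕ) (hn : n ≠ 0) :
    IsUnit (n : M.X.presheaf.stalk a) := by
  have : IsUnit (n : K) := (Nat.cast_ne_zero.2 hn).isUnit
  simpa using this.map (M.scalarAt a)

theorem app_scalarOn {L : SmoothScheme K} {f : L.X ⟶ M.X} (hf : f ≫ M.str = L.str) (c : K) :
    f.appTop (M.scalarOn ⊤ c) = L.scalarOn ⊤ c := by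
  have h3 : M.str.appLE ⊤ ⊤ le_top ≫ f.appTop = L.str.appLE ⊤ ⊤ le_top := by
    rw [Scheme.Hom.appTop, Scheme.Hom.app_eq_appLE]
    refine (Scheme.Hom.appLE_comp_appLE _ _ _ _ _ _ _).trans ?_
    simp only [hf]
    rfl
  rw [scalarOn, scalarOn, ← h3]
  rfl

theorem stalkMap_scalarAt {L : SmoothScheme K} {f : L.X ⟶ M.X} (hf : f ≫ M.str = L.str) (x : L.X)
    (c : K) : (f.stalkMap x).hom (M.scalarAt (f x) c) = L.scalarAt x c := by
  refine (Scheme.Hom.germ_stalkMap_apply f ⊤ x trivial (M.scalarOn ⊤ c)).trans ?_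
  exact congrArg (L.X.presheaf.germ ⊤ x trivial) (M.app_scalarOn hf c)

/-! ### Derivations on an affine open subset and on its localizations. -/

section Localization

variable {M} {V : M.X.Opens}

theorem exists_derivation_basicOpen (hV : IsAffineOpen V) (D : Derivation ℤ Γ(M.X, V) Γ(M.X, V))
    (s : Γ(M.X, V)) : ∃ D' : Derivation ℤ Γ(M.X, M.X.basicOpen s) Γ(M.X, M.X.basicOpen s),
      ∀ f, D' (M.X.presheaf.map (homOfLE (M.X.basicOpen_le s)).op f) =
        M.X.presheaf.map (homOfLE (M.X.basicOpen_le s)).op (D f) := by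
  have := hV.isLocalization_basicOpen s
  exact exists_derivation_isLocalization (Submonoid.powers s) D

theorem derivation_basicOpen_ext (hV : IsAffineOpen V) (s : Γ(M.X, V)) {C : Type*} [CommRing C]
    (φ : Γ(M.X, M.X.basicOpen s) →+* C) (d d' : Γ(M.X, M.X.basicOpen s) →+ C)
    (hd : ∀ a b, d (a * b) = φ a * d b + φ b * d a)
    (hd' : ∀ a b, d' (a * b) = φ a * d' b + φ b * d' a)
    (h : ∀ f, d (M.X.presheaf.map (homOfLE (M.X.basicOpen_le s)).op f) =
      d' (M.X.presheaf.map (homOfLE (M.X.basicOpen_le s)).op f)) : d = d' := by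
  have := hV.isLocalization_basicOpen s
  exact derivation_ext_isLocalization (Submonoid.powers s) φ d d' hd hd' h

theorem exists_derivation_stalk (hV : IsAffineOpen V) (D : Derivation ℤ Γ(M.X, V) Γ(M.X, V))
    {x : M.X} (hx : x ∈ V) : ∃ D' : Derivation ℤ (M.X.presheaf.stalk x) (M.X.presheaf.stalk x),
      ∀ f, D' (M.X.presheaf.germ V x hx f) = M.X.presheaf.germ V x hx (D f) := by
  letI := TopCat.Presheaf.algebra_section_stalk M.X.presheaf (⟨x, hx⟩ : V)
  have hloc := hV.isLocalization_stalk ⟨x, hx⟩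
  exact exists_derivation_isLocalization (B := M.X.presheaf.stalk x)
    (hV.primeIdealOf ⟨x, hx⟩).asIdeal.primeCompl D

theorem derivation_stalk_ext (hV : IsAffineOpen V) {x : M.X} (hx : x ∈ V) {C : Type*} [CommRing C]
    (φ : M.X.presheaf.stalk x →+* C) (d d' : M.X.presheaf.stalk x →+ C)
    (hd : ∀ a b, d (a * b) = φ a * d b + φ b * d a)
    (hd' : ∀ a b, d' (a * b) = φ a * d' b + φ b * d' a)
    (h : ∀ f, d (M.X.presheaf.germ V x hx f) = d' (M.X.presheaf.germ V x hx f)) : d = d' := by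
  letI := TopCat.Presheaf.algebra_section_stalk M.X.presheaf (⟨x, hx⟩ : V)
  have hloc := hV.isLocalization_stalk ⟨x, hx⟩
  exact derivation_ext_isLocalization (B := M.X.presheaf.stalk x)
    (hV.primeIdealOf ⟨x, hx⟩).asIdeal.primeCompl φ d d' hd hd' h

end Localization

/-- A derivation over `ℤ` which vanishes on the scalars is a derivation over the ground field. -/
def linearDerivation {R : Type*} [CommRing R] [Algebra K R] (δ : Derivation ℤ R R)
    (h : ∀ c : K, δ (algebraMap K R c) = 0) : Derivation K R R :=
  Derivation.mk' { δ.toLinearMap.toAddMonoidHom with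
    map_smul' := fun c r => by
      change δ (c • r) = c • δ r
      rw [Algebra.smul_def, Derivation.leibniz, h, smul_zero, add_zero, smul_eq_mul,
        Algebra.smul_def] } fun a b => δ.leibniz a b

/-- Derivations over the ground field extend to a neighbourhood. -/
theorem exists_derivation_nhds {a : M.X} {δ} (hδ : δ ∈ M.Der a) :
    ∃ (V : M.X.Opens) (_ : IsAffineOpen V) (ha : a ∈ V) (D : Derivation ℤ Γ(M.X, V) Γ(M.X, V)),
      (∀ c, D (M.scalarOn V c) = 0) ∧
      ∀ f, M.X.presheaf.germ V a ha (D f) = δ (M.X.presheaf.germ V a ha f) := by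
  obtain ⟨V, hV, ha, -⟩ := M.exists_affine a ⊤ trivial
  letI := (M.scalarAt a).toAlgebra
  letI := (M.scalarOn V).toAlgebra
  have hs : Algebra.Smooth K Γ(M.X, V) := M.smooth_scalarOn hV
  letI := TopCat.Presheaf.algebra_section_stalk M.X.presheaf (⟨a, ha⟩ : V)
  have hloc := hV.isLocalization_stalk ⟨a, ha⟩
  have : IsScalarTower K Γ(M.X, V) (M.X.presheaf.stalk a) :=
    .of_algebraMap_eq fun c => (M.germ_scalarOn ha c).symm
  have : IsNoetherianRing Γ(M.X, V) := Algebra.FiniteType.isNoetherianRing K _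
  have : Module.FinitePresentation Γ(M.X, V) Ω[Γ(M.X, V)⁄K] :=
    Module.finitePresentation_of_finite _ _
  let δ₁ : Derivation K Γ(M.X, V) (M.X.presheaf.stalk a) :=
    (linearDerivation δ hδ).compAlgebraMap Γ(M.X, V)
  -- The differentials are finitely presented, so the derivation into the stalk comes from `V` up to
  -- a factor `s` which is invertible at `a`. On the basic open subset of `s` this factor is divided
  -- out.
  obtain ⟨l, s, hl⟩ := Module.FinitePresentation.exists_lift_of_isLocalizedModule
    (hV.primeIdealOf ⟨a, ha⟩).asIdeal.primeCompl
    (Algebra.linearMap Γ(M.X, V) (M.X.presheaf.stalk a)) δ₁.liftKaehlerDifferential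
  let D₀ : Derivation K Γ(M.X, V) Γ(M.X, V) := l.compDer (KaehlerDifferential.D K Γ(M.X, V))
  have hD₀ : ∀ f, M.X.presheaf.germ V a ha (D₀ f) =
      M.X.presheaf.germ V a ha s * δ (M.X.presheaf.germ V a ha f) := by
    intro f
    have h1 := DFunLike.congr_fun hl (KaehlerDifferential.D K Γ(M.X, V) f)
    simp only [LinearMap.comp_apply, Algebra.linearMap_apply] at h1
    refine Eq.trans h1 ?_
    rw [LinearMap.smul_apply, Derivation.liftKaehlerDifferential_comp_D]
    rw [Submonoid.smul_def, Algebra.smul_def]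
    rfl
  obtain ⟨D₁, hD₁⟩ := exists_derivation_basicOpen hV (D₀.restrictScalars ℤ) s
  have hunit : IsUnit (M.X.presheaf.map (homOfLE (M.X.basicOpen_le s.1)).op s.1) :=
    RingedSpace.isUnit_res_basicOpen M.X.toRingedSpace s.1
  have has : a ∈ M.X.basicOpen s.1 := by
    rw [Scheme.mem_basicOpen _ _ _ ha]
    exact IsLocalization.map_units (M.X.presheaf.stalk a) s
  obtain ⟨t, ht⟩ := hunit.exists_left_inv
  refine ⟨M.X.basicOpen s.1, hV.basicOpen s.1, has, t • D₁, fun c => ?_, fun f => ?_⟩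
  · have h1 : M.scalarOn (M.X.basicOpen s.1) c =
        M.X.presheaf.map (homOfLE (M.X.basicOpen_le s.1)).op (M.scalarOn V c) := by
      have h : M.str.appLE ⊤ V le_top ≫ M.X.presheaf.map (homOfLE (M.X.basicOpen_le s.1)).op =
          M.str.appLE ⊤ _ le_top := Scheme.Hom.appLE_map _ _ _
      rw [scalarOn, ← h]
      rfl
    have h2 : D₀ (M.scalarOn V c) = 0 := D₀.map_algebraMap c
    rw [Derivation.smul_apply, h1, hD₁]
    change t • M.X.presheaf.map _ (D₀ (M.scalarOn V c)) = 0
    rw [h2, map_zero, smul_zero]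
  · let φ : Γ(M.X, M.X.basicOpen s.1) →+* M.X.presheaf.stalk a :=
      (M.X.presheaf.germ (M.X.basicOpen s.1) a has).hom
    have hres : ∀ g, φ (M.X.presheaf.map (homOfLE (M.X.basicOpen_le s.1)).op g) =
        M.X.presheaf.germ V a ha g := fun g => M.X.presheaf.germ_res_apply _ a has g
    have key := derivation_basicOpen_ext hV s.1 φ (φ.toAddMonoidHom.comp D₁.toLinearMap.toAddMonoidHom)
      ((AddMonoidHom.mulLeft (M.X.presheaf.germ V a ha s.1)).comp
        (δ.toLinearMap.toAddMonoidHom.comp φ.toAddMonoidHom))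
      (fun a b => by simp) (fun a b => by simp; ring) (fun g => by
        have h1 : φ (D₁ (M.X.presheaf.map (homOfLE (M.X.basicOpen_le s.1)).op g)) =
            M.X.presheaf.germ V a ha s.1 *
              δ (φ (M.X.presheaf.map (homOfLE (M.X.basicOpen_le s.1)).op g)) := by
          rw [hD₁, hres, hres]
          exact hD₀ g
        exact h1)
    have h1 : φ (D₁ f) = M.X.presheaf.germ V a ha s.1 * δ (φ f) := DFunLike.congr_fun key f
    change φ (t * D₁ f) = δ (φ f)
    rw [map_mul, h1, ← mul_assoc, ← hres, ← map_mul, ht, map_one, one_mul]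

end SmoothScheme

end Desing

namespace Desing

open IsLocalRing

namespace SmoothScheme

variable {K : Type u} [Field K] (M : SmoothScheme K)

/-! ### Sections over a neighbourhood -/

/-- Families of germs which come from a section over a neighbourhood of `a`. -/
def Sec (a : M.X) : Subring (∀ w, M.X.presheaf.stalk w) where
  carrier := {s | ∃ (V : M.X.Opens) (_ : a ∈ V) (f : Γ(M.X, V)),
    ∀ w (hw : w ∈ V), s w = M.X.presheaf.germ V w hw f}
  zero_mem' := ⟨⊤, trivial, 0, fun w hw => by simp⟩
  one_mem' := ⟨⊤, trivial, 1, fun w hw => by simp⟩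
  neg_mem' := by
    rintro s ⟨V, ha, f, hf⟩
    exact ⟨V, ha, -f, fun w hw => by simp [hf w hw]⟩
  add_mem' := by
    rintro s t ⟨V, ha, f, hf⟩ ⟨W, ha', g, hg⟩
    refine ⟨V ⊓ W, ⟨ha, ha'⟩, M.X.presheaf.map (homOfLE inf_le_left).op f +
      M.X.presheaf.map (homOfLE inf_le_right).op g, fun w hw => ?_⟩
    rw [map_add, TopCat.Presheaf.germ_res_apply, TopCat.Presheaf.germ_res_apply]
    simp [hf w hw.1, hg w hw.2]
  mul_mem' := by
    rintro s t ⟨V, ha, f, hf⟩ ⟨W, ha', g, hg⟩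
    refine ⟨V ⊓ W, ⟨ha, ha'⟩, M.X.presheaf.map (homOfLE inf_le_left).op f *
      M.X.presheaf.map (homOfLE inf_le_right).op g, fun w hw => ?_⟩
    rw [map_mul, TopCat.Presheaf.germ_res_apply, TopCat.Presheaf.germ_res_apply]
    simp [hf w hw.1, hg w hw.2]

variable {M} {a : M.X}

theorem exists_sec (r : M.X.presheaf.stalk a) : ∃ s ∈ M.Sec a, s a = r := by
  classical
  obtain ⟨V, ha, f, rfl⟩ := M.X.presheaf.exists_germ_eq r
  exact ⟨fun w => if hw : w ∈ V then M.X.presheaf.germ V w hw f else 0,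
    ⟨V, ha, f, fun w hw => dif_pos hw⟩, dif_pos ha⟩

theorem sec_eventually_eq_zero {s : ∀ w, M.X.presheaf.stalk w} (hs : s ∈ M.Sec a) (h : s a = 0) :
    ∀ᶠ w in 𝓝 a, s w = 0 := by
  obtain ⟨V, ha, f, hf⟩ := hs
  have h1 : M.X.presheaf.germ V a ha f = M.X.presheaf.germ V a ha 0 := by
    rw [← hf a ha, h, map_zero]
  obtain ⟨W, haW, i, i', hW⟩ := M.X.presheaf.germ_eq a ha ha _ _ h1
  filter_upwards [W.2.mem_nhds haW] with w hw
  rw [hf w (i.le hw), ← TopCat.Presheaf.germ_res_apply M.X.presheaf i w hw, hW, map_zero, map_zero]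

/-- Finitely many families of germs come from sections over a common neighbourhood. -/
theorem exists_common_open {ι : Type*} [Finite ι] {s : ι → ∀ w, M.X.presheaf.stalk w}
    (hs : ∀ i, s i ∈ M.Sec a) : ∃ (V : M.X.Opens) (_ : a ∈ V) (f : ι → Γ(M.X, V)),
      ∀ i w (hw : w ∈ V), s i w = M.X.presheaf.germ V w hw (f i) := by
  choose V ha f hf using hs
  have hV : IsOpen (⋂ i, (V i : Set M.X)) := isOpen_iInter_of_finite fun i => (V i).2
  have hle : ∀ i, (⟨⋂ i, (V i : Set M.X), hV⟩ : M.X.Opens) ≤ V i := fun i =>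
    Set.iInter_subset (fun i => (V i : Set M.X)) i
  refine ⟨⟨⋂ i, (V i : Set M.X), hV⟩, Set.mem_iInter.2 ha,
    fun i => M.X.presheaf.map (homOfLE (hle i)).op (f i), fun i w hw => ?_⟩
  rw [TopCat.Presheaf.germ_res_apply, hf i w (hle i hw)]

theorem exists_der_family {δ} (hδ : δ ∈ M.Der a) :
    ∃ D : ∀ w, Derivation ℤ (M.X.presheaf.stalk w) (M.X.presheaf.stalk w), D a = δ ∧
      (∀ᶠ w in 𝓝 a, D w ∈ M.Der w) ∧ ∀ s ∈ M.Sec a, (fun w => D w (s w)) ∈ M.Sec a := by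
  classical
  obtain ⟨V, hV, ha, D₀, hD₀, hgerm⟩ := M.exists_derivation_nhds hδ
  choose D hD using fun (w : M.X) (hw : w ∈ V) => exists_derivation_stalk hV D₀ hw
  refine ⟨fun w => if hw : w ∈ V then D w hw else 0, ?_, ?_, ?_⟩
  · simp only [ha, dif_pos]
    have := derivation_stalk_ext hV ha (RingHom.id _) (D a ha).toLinearMap.toAddMonoidHom
      δ.toLinearMap.toAddMonoidHom (fun a b => by simp) (fun a b => by simp)
      (fun f => (hD a ha f).trans (hgerm f))
    ext r
    exact DFunLike.congr_fun this r
  · filter_upwards [V.2.mem_nhds ha] with w hw c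
    rw [dif_pos (show w ∈ V from hw), ← M.germ_scalarOn hw c, hD, hD₀, map_zero]
  · rintro s ⟨V', ha', f, hf⟩
    obtain ⟨g, hg, hag⟩ := hV.exists_basicOpen_le (V := V ⊓ V') ⟨a, ha, ha'⟩ ha
    obtain ⟨D₁, hD₁⟩ := exists_derivation_basicOpen hV D₀ g
    have hV' : M.X.basicOpen g ≤ V' := hg.trans inf_le_right
    have hVg : M.X.basicOpen g ≤ V := M.X.basicOpen_le g
    refine ⟨M.X.basicOpen g, hag, D₁ (M.X.presheaf.map (homOfLE hV').op f), fun w hw => ?_⟩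
    simp only [dif_pos (hVg hw)]
    let φ : Γ(M.X, M.X.basicOpen g) →+* M.X.presheaf.stalk w :=
      (M.X.presheaf.germ (M.X.basicOpen g) w hw).hom
    have key := derivation_basicOpen_ext hV g φ
      ((D w (hVg hw)).toLinearMap.toAddMonoidHom.comp φ.toAddMonoidHom)
      (φ.toAddMonoidHom.comp D₁.toLinearMap.toAddMonoidHom)
      (fun a b => by simp) (fun a b => by simp) (fun r => by
        have hres : ∀ g', φ (M.X.presheaf.map (homOfLE (M.X.basicOpen_le g)).op g') =
            M.X.presheaf.germ V w (hVg hw) g' := fun g' => M.X.presheaf.germ_res_apply _ w hw g'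
        change D w (hVg hw) (φ (M.X.presheaf.map (homOfLE (M.X.basicOpen_le g)).op r)) =
          φ (D₁ (M.X.presheaf.map (homOfLE (M.X.basicOpen_le g)).op r))
        rw [hD₁, hres, hres, hD])
    have h1 : D w (hVg hw) (φ (M.X.presheaf.map (homOfLE hV').op f)) =
        φ (D₁ (M.X.presheaf.map (homOfLE hV').op f)) := DFunLike.congr_fun key _
    have h2 : φ (M.X.presheaf.map (homOfLE hV').op f) = s w := by
      rw [hf w (hV' hw)]
      exact M.X.presheaf.germ_res_apply _ w hw f
    rw [h2] at h1
    exact h1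

/-- The points of an affine open subset are all the primes of its ring, so vanishing at the points
of `z = 0` means membership in the radical. At `a` the ideal of the dual system is already radical,
by `mem_span_of_sq_mem`. -/
theorem nullstellensatz [CharZero K] {k : ℕ} {z : Fin k → ∀ w, M.X.presheaf.stalk w}
    (hz : ∀ i, z i ∈ M.Sec a) (hdual : HasDual (M.Der a) fun i => z i a)
    (f : ∀ w, M.X.presheaf.stalk w) (hf : f ∈ M.Sec a)
    (h : ∀ᶠ w in 𝓝 a, (∀ i, z i w ∈ maximalIdeal (M.X.presheaf.stalk w)) →
      f w ∈ maximalIdeal (M.X.presheaf.stalk w)) :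
    f a ∈ Ideal.span (Set.range fun i => z i a) := by
  obtain ⟨V₁, ha₁, z', hz'⟩ := exists_common_open hz
  obtain ⟨V₂, ha₂, f', hf'⟩ := hf
  obtain ⟨N, hN, hNo, haN⟩ := eventually_nhds_iff.1 h
  obtain ⟨V, hV, ha, hVle⟩ := M.exists_affine a (V₁ ⊓ V₂ ⊓ ⟨N, hNo⟩) ⟨⟨ha₁, ha₂⟩, haN⟩
  have h1 : V ≤ V₁ := hVle.trans (inf_le_left.trans inf_le_left)
  have h2 : V ≤ V₂ := hVle.trans (inf_le_left.trans inf_le_right)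
  let ζ : Fin k → Γ(M.X, V) := fun i => M.X.presheaf.map (homOfLE h1).op (z' i)
  let g : Γ(M.X, V) := M.X.presheaf.map (homOfLE h2).op f'
  have hζ : ∀ i w (hw : w ∈ V), M.X.presheaf.germ V w hw (ζ i) = z i w := fun i w hw => by
    rw [hz' i w (h1 hw)]; exact M.X.presheaf.germ_res_apply _ w hw _
  have hg : ∀ w (hw : w ∈ V), M.X.presheaf.germ V w hw g = f w := fun w hw => by
    rw [hf' w (h2 hw)]; exact M.X.presheaf.germ_res_apply _ w hw _
  have hrad : g ∈ (Ideal.span (Set.range ζ)).radical := by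
    rw [Ideal.radical_eq_sInf, Ideal.mem_sInf]
    rintro p ⟨hp, hprime⟩
    let y : PrimeSpectrum Γ(M.X, V) := ⟨p, hprime⟩
    have hy : hV.fromSpec y ∈ V := by
      rw [← SetLike.mem_coe, ← hV.range_fromSpec]
      exact ⟨y, rfl⟩
    letI := TopCat.Presheaf.algebra_section_stalk M.X.presheaf (⟨hV.fromSpec y, hy⟩ : V)
    have hloc : IsLocalization.AtPrime (M.X.presheaf.stalk (hV.fromSpec y)) p :=
      hV.isLocalization_stalk' y hy
    have hmem : ∀ r : Γ(M.X, V), M.X.presheaf.germ V (hV.fromSpec y) hy r ∈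
        maximalIdeal (M.X.presheaf.stalk (hV.fromSpec y)) ↔ r ∈ p := fun r =>
      IsLocalization.AtPrime.to_map_mem_maximal_iff (M.X.presheaf.stalk (hV.fromSpec y)) p r
    rw [← hmem, hg]
    refine hN _ (hVle hy).2 fun i => ?_
    rw [← hζ i _ hy, hmem]
    exact hp (Ideal.subset_span ⟨i, rfl⟩)
  obtain ⟨n, hn⟩ := hrad
  have hn' : f a ^ n ∈ Ideal.span (Set.range fun i => z i a) := by
    have := Ideal.mem_map_of_mem (M.X.presheaf.germ V a ha).hom hn
    rw [Ideal.map_span, ← Set.range_comp, map_pow] at this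
    change M.X.presheaf.germ V a ha g ^ n ∈ _ at this
    rw [hg] at this
    convert this using 4
    rw [← hζ _ a ha]
    rfl
  have hsq : ∀ r : M.X.presheaf.stalk a, r ^ 2 ∈ Ideal.span (Set.range fun i => z i a) →
      r ∈ Ideal.span (Set.range fun i => z i a) := fun r hr =>
    mem_span_of_sq_mem (fun f => M.mem_sq_of_der f) (M.isUnit_natCast a)
      (IsNoetherian.noetherian _) hdual (fun f hf => mem_of_forall_mem_fil _ hf) hr
  have hred : (Ideal.span (Set.range fun i => z i a)).IsRadical := by
    exact (Ideal.isRadical_iff_pow_one_lt 2 one_lt_two).2 hsq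
  exact hred ⟨n, hn'⟩

/-! ### Open immersions -/

theorem exists_derivation_of_bijective {R R' : Type*} [CommRing R] [CommRing R'] {φ : R →+* R'}
    (hφ : Function.Bijective φ) (δ : Derivation ℤ R R) :
    ∃ δ' : Derivation ℤ R' R', ∀ r, δ' (φ r) = φ (δ r) := by
  let e := RingEquiv.ofBijective φ hφ
  refine ⟨Derivation.mk' (e.toRingHom.toAddMonoidHom.comp
    (δ.toLinearMap.toAddMonoidHom.comp e.symm.toRingHom.toAddMonoidHom)).toIntLinearMap
    fun a b => ?_, fun r => ?_⟩
  · simp [e.map_add, e.map_mul]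
  · change e (δ (e.symm (e r))) = e (δ r)
    rw [e.symm_apply_apply]

theorem der_openImm {A B : SmoothScheme K} {j : A.X ⟶ B.X} (hj : j ≫ B.str = A.str)
    [IsOpenImmersion j] (x : A.X) (δ) (hδ : δ ∈ B.Der (j x)) :
    ∃ δ' ∈ A.Der x, ∀ r, δ' ((j.stalkMap x).hom r) = (j.stalkMap x).hom (δ r) := by
  obtain ⟨δ', h⟩ := exists_derivation_of_bijective
    (ConcreteCategory.bijective_of_isIso (j.stalkMap x)) δ
  refine ⟨δ', fun c => ?_, h⟩
  rw [← B.stalkMap_scalarAt hj, h, hδ c, map_zero]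

/-- An open subscheme. -/
def restrict (M : SmoothScheme K) (V : M.X.Opens) : SmoothScheme K where
  X := V
  str := V.ι ≫ M.str
  smooth := by
    have := M.smooth
    infer_instance

theorem exists_openImm {ι : Type} [Finite ι] (s : ι → ∀ w, M.X.presheaf.stalk w)
    (hs : ∀ i, s i ∈ M.Sec a) :
    ∃ (U : SmoothScheme K) (j : U.X ⟶ M.X) (b : U.X) (f : ι → Γ(U.X, ⊤)), j ≫ M.str = U.str ∧
      IsOpenImmersion j ∧ j b = a ∧
      ∀ i w, U.X.presheaf.germ ⊤ w trivial (f i) = (j.stalkMap w).hom (s i (j w)) := by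
  obtain ⟨V, ha, g, hg⟩ := exists_common_open hs
  refine ⟨M.restrict V, V.ι, ⟨a, ha⟩, fun i => (V.ι.appLE V ⊤ (by simp)) (g i), rfl,
    inferInstanceAs (IsOpenImmersion V.ι), rfl, fun i w => ?_⟩
  have hw : V.ι w ∈ V := w.2
  refine Eq.trans ?_ (congrArg (V.ι.stalkMap w).hom (hg i _ hw)).symm
  refine Eq.trans ?_ (Scheme.Hom.germ_stalkMap_apply V.ι V w hw (g i)).symm
  exact TopCat.Presheaf.germ_res_apply (V : Scheme).presheaf
    (homOfLE (by simp : (⊤ : (V : Scheme).Opens) ≤ V.ι ⁻¹ᵁ V)) w trivial (V.ι.app V (g i))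

end SmoothScheme

end Desing

namespace Desing

open IsLocalRing

/-! ### Morphisms to the spectrum of a ring -/

/-- The morphism to `Spec P` defined by a homomorphism from `P` to the ring of global functions. -/
def toSpec {X : Scheme.{u}} {P : Type u} [CommRing P] (x : P →+* Γ(X, ⊤)) :
    X ⟶ Spec (CommRingCat.of P) :=
  X.toSpecΓ ≫ Spec.map (CommRingCat.ofHom x)

section

variable {X Y : Scheme.{u}} {P P' : Type u} [CommRing P] [CommRing P']

theorem comp_toSpec (f : X ⟶ Y) (x : P →+* Γ(Y, ⊤)) :
    f ≫ toSpec x = toSpec (f.appTop.hom.comp x) := by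
  rw [toSpec, toSpec, Scheme.toSpecΓ_naturality_assoc, ← Spec.map_comp]
  rfl

theorem toSpec_comp (v : P' →+* Γ(X, ⊤)) (φ : P →+* P') :
    toSpec v ≫ Spec.map (CommRingCat.ofHom φ) = toSpec (v.comp φ) := by
  rw [toSpec, toSpec, Category.assoc, ← Spec.map_comp]
  rfl

theorem toSpec_appTop (v : P →+* Γ(X, ⊤)) :
    (Scheme.ΓSpecIso (CommRingCat.of P)).inv ≫ (toSpec v).appTop = CommRingCat.ofHom v := by
  rw [toSpec, Scheme.Hom.comp_appTop, Scheme.toSpecΓ_appTop]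
  exact (Iso.inv_comp_eq _).2 (Scheme.ΓSpecIso_naturality (CommRingCat.ofHom v))

theorem toSpec_injective : Function.Injective (toSpec : (P →+* Γ(X, ⊤)) → _) := by
  intro v v' h
  have h1 := toSpec_appTop v
  rw [h, toSpec_appTop] at h1
  exact (congrArg CommRingCat.Hom.hom h1).symm

theorem toSpec_appTop_eq (f : X ⟶ Spec (CommRingCat.of P)) :
    toSpec ((Scheme.ΓSpecIso (CommRingCat.of P)).inv ≫ f.appTop).hom = f := by
  rw [toSpec]
  simp only [CommRingCat.ofHom_hom, Spec.map_comp]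
  rw [← Scheme.toSpecΓ_naturality_assoc]
  simp

theorem exists_toSpec (f : X ⟶ Spec (CommRingCat.of P)) : ∃ v : P →+* Γ(X, ⊤), toSpec v = f :=
  ⟨_, toSpec_appTop_eq f⟩

theorem fromSpecStalk_toSpec (w : X) (v : P →+* Γ(X, ⊤)) :
    X.fromSpecStalk w ≫ toSpec v =
      Spec.map (CommRingCat.ofHom ((X.presheaf.germ ⊤ w trivial).hom.comp v)) := by
  rw [toSpec, Scheme.fromSpecStalk_toSpecΓ_assoc, ← Spec.map_comp]
  rfl

end

/-- The projection from the dual numbers. -/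
def dualFst (R : CommRingCat.{u}) : CommRingCat.of (TrivSqZeroExt R R) ⟶ R :=
  CommRingCat.ofHom (TrivSqZeroExt.fstHom R R R).toRingHom

instance (R : CommRingCat.{u}) [IsLocalRing R] : IsLocalHom (dualFst R).hom := isLocalHom_fst

namespace SmoothScheme

variable {K : Type u} [Field K]

theorem str_eq_toSpec (M : SmoothScheme K) : M.str = toSpec (M.scalarOn ⊤) := by
  rw [← toSpec_appTop_eq M.str]
  congr 1
  rw [scalarOn, Scheme.Hom.appTop, Scheme.Hom.app_eq_appLE]
  rfl

variable {L M : SmoothScheme K}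

/-- Let `L` represent the pairs of a morphism to `M` and an extension from `P` to `P'` of a
homomorphism to the ring of functions. Then first order deformations of a point of `L` can be
constructed from deformations of its image in `M` and of the functions. -/
theorem exists_dual_lift {σ : L.X ⟶ M.X} (hσ : σ ≫ M.str = L.str) {P P' : Type u} [CommRing P] [CommRing P'] {i : K →+* P}
    {φ : P →+* P'} (hP' : (φ.comp i).Smooth) {x : P →+* Γ(M.X, ⊤)}
    (hx : x.comp i = M.scalarOn ⊤) {y : P' →+* Γ(L.X, ⊤)}
    (hxy : σ.appTop.hom.comp x = y.comp φ)
    (hrep : ∀ (T : SmoothScheme K) (f : T.X ⟶ M.X) (v : P' →+* Γ(T.X, ⊤)), f ≫ M.str = T.str →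
      f.appTop.hom.comp x = v.comp φ →
      ∃ g : T.X ⟶ L.X, g ≫ L.str = T.str ∧ g ≫ σ = f ∧ g.appTop.hom.comp y = v)
    (hext : ∀ (T : SmoothScheme K) (g g' : T.X ⟶ L.X), g ≫ L.str = T.str → g' ≫ L.str = T.str →
      g ≫ σ = g' ≫ σ → g.appTop.hom.comp y = g'.appTop.hom.comp y → g = g')
    (a' : L.X) {V : M.X.Opens} (ha : σ a' ∈ V) (hV : Smooth (V.ι ≫ toSpec x))
    {F₁ : M.X.presheaf.stalk (σ a') →+*
      TrivSqZeroExt (L.X.presheaf.stalk a') (L.X.presheaf.stalk a')}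
    (h₁ : ∀ r, (F₁ r).fst = (σ.stalkMap a').hom r)
    {F₂ : P' →+* TrivSqZeroExt (L.X.presheaf.stalk a') (L.X.presheaf.stalk a')}
    (h₂ : ∀ q, (F₂ q).fst = L.X.presheaf.germ ⊤ a' trivial (y q))
    (h₁₂ : ∀ p, F₁ (M.X.presheaf.germ ⊤ (σ a') trivial (x p)) = F₂ (φ p)) :
    ∃ F : L.X.presheaf.stalk a' →+*
      TrivSqZeroExt (L.X.presheaf.stalk a') (L.X.presheaf.stalk a'),
      (∀ r, (F r).fst = r) ∧ (∀ r, F ((σ.stalkMap a').hom r) = F₁ r) ∧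
      ∀ q, F (L.X.presheaf.germ ⊤ a' trivial (y q)) = F₂ q := by
  have hsm : Smooth (Spec.map (CommRingCat.ofHom (φ.comp i))) := HasRingHomProperty.Spec_iff.2 hP'
  -- The universal property may only be tested on smooth schemes, and the dual numbers are not
  -- smooth. The fibre product `T` of `V` and `Spec P'` over `Spec P` is smooth, because `V → Spec
  -- P` and `Spec P' → Spec K` are.
  let T : SmoothScheme K :=
    { X := Limits.pullback (V.ι ≫ toSpec x) (Spec.map (CommRingCat.ofHom φ))
      str := Limits.pullback.snd _ _ ≫ Spec.map (CommRingCat.ofHom (φ.comp i))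
      smooth := inferInstance }
  let p₁ : T.X ⟶ V := Limits.pullback.fst _ _
  let p₂ : T.X ⟶ Spec (CommRingCat.of P') := Limits.pullback.snd _ _
  have hp : p₁ ≫ V.ι ≫ toSpec x = p₂ ≫ Spec.map (CommRingCat.ofHom φ) := Limits.pullback.condition
  obtain ⟨v, hv⟩ := exists_toSpec p₂
  have hstr : M.str = toSpec x ≫ Spec.map (CommRingCat.ofHom i) := by
    rw [str_eq_toSpec, ← hx, toSpec_comp]
  obtain ⟨g, hgL, hgσ, hgy⟩ := hrep T (p₁ ≫ V.ι) v (by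
      rw [hstr]
      simp only [Category.assoc]
      rw [reassoc_of% hp, ← Spec.map_comp]
      rfl) (by
      apply toSpec_injective
      rw [← comp_toSpec, ← toSpec_comp, hv, Category.assoc, hp])
  have ha' : a' ∈ σ ⁻¹ᵁ V := ha
  let k : Spec (L.X.presheaf.stalk a') ⟶ (σ ⁻¹ᵁ V : L.X.Opens) :=
    (σ ⁻¹ᵁ V).fromSpecStalkOfMem a' ha'
  have hk : k ≫ (σ ⁻¹ᵁ V).ι = L.X.fromSpecStalk a' :=
    Scheme.Opens.fromSpecStalkOfMem_ι (σ ⁻¹ᵁ V) a' ha'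
  let h : (σ ⁻¹ᵁ V : L.X.Opens).toScheme ⟶ T.X :=
    Limits.pullback.lift (σ ∣_ V) ((σ ⁻¹ᵁ V).ι ≫ toSpec y) (by
      rw [morphismRestrict_ι_assoc, comp_toSpec σ, hxy, Category.assoc, toSpec_comp])
  have hh₁ : h ≫ p₁ = σ ∣_ V := Limits.pullback.lift_fst _ _ _
  have hh₂ : h ≫ p₂ = (σ ⁻¹ᵁ V).ι ≫ toSpec y := Limits.pullback.lift_snd _ _ _
  have hhσ : (h ≫ g) ≫ σ = (σ ⁻¹ᵁ V).ι ≫ σ := by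
    rw [Category.assoc, hgσ, reassoc_of% hh₁, morphismRestrict_ι]
  have hhL : (h ≫ g) ≫ L.str = (σ ⁻¹ᵁ V).ι ≫ L.str := by
    rw [← hσ, ← Category.assoc, hhσ, Category.assoc]
  have hhy : (h ≫ g) ≫ toSpec y = (σ ⁻¹ᵁ V).ι ≫ toSpec y := by
    rw [Category.assoc, comp_toSpec g, hgy, hv, hh₂]
  -- By uniqueness, mapping the part of `L` over `V` to `T` and returning by `g` gives the
  -- inclusion. It suffices, then, to deform points of `T`.
  have hhg : h ≫ g = (σ ⁻¹ᵁ V).ι :=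
    hext (L.restrict (σ ⁻¹ᵁ V)) _ _ hhL rfl hhσ
      (toSpec_injective ((comp_toSpec (h ≫ g) y).symm.trans
        (hhy.trans (comp_toSpec (σ ⁻¹ᵁ V).ι y))))
  -- The two given deformations agree over `P` by `h₁₂`, and so define a point of the fibre product
  -- with values in the dual numbers.
  let q : Spec (CommRingCat.of (TrivSqZeroExt (L.X.presheaf.stalk a') (L.X.presheaf.stalk a'))) ⟶
      T.X :=
    Limits.pullback.lift (Spec.map (CommRingCat.ofHom F₁) ≫ V.fromSpecStalkOfMem (σ a') ha)
      (Spec.map (CommRingCat.ofHom F₂)) (by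
        rw [Category.assoc, Scheme.Opens.fromSpecStalkOfMem_ι_assoc, fromSpecStalk_toSpec,
          ← Spec.map_comp, ← Spec.map_comp]
        exact congrArg Spec.map (CommRingCat.hom_ext (RingHom.ext h₁₂)))
  have hq₁ : q ≫ p₁ = Spec.map (CommRingCat.ofHom F₁) ≫ V.fromSpecStalkOfMem (σ a') ha :=
    Limits.pullback.lift_fst _ _ _
  have hq₂ : q ≫ p₂ = Spec.map (CommRingCat.ofHom F₂) := Limits.pullback.lift_snd _ _ _
  let c : Spec (L.X.presheaf.stalk a') ⟶
      Spec (CommRingCat.of (TrivSqZeroExt (L.X.presheaf.stalk a') (L.X.presheaf.stalk a'))) :=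
    Spec.map (dualFst (L.X.presheaf.stalk a'))
  have hcq : c ≫ q = k ≫ h := by
    refine Limits.pullback.hom_ext ?_ ?_
    · change (c ≫ q) ≫ p₁ = (k ≫ h) ≫ p₁
      rw [Category.assoc, Category.assoc, hq₁, hh₁, ← cancel_mono V.ι]
      rw [Category.assoc, Category.assoc, Category.assoc, morphismRestrict_ι, reassoc_of% hk,
        Scheme.Opens.fromSpecStalkOfMem_ι, ← Scheme.SpecMap_stalkMap_fromSpecStalk]
      refine (Spec.map_comp_assoc _ _ _).symm.trans ?_
      exact congrArg (fun f => Spec.map f ≫ M.X.fromSpecStalk (σ a'))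
        (CommRingCat.hom_ext (RingHom.ext h₁))
    · change (c ≫ q) ≫ p₂ = (k ≫ h) ≫ p₂
      rw [Category.assoc, Category.assoc, hq₂, hh₂, reassoc_of% hk, fromSpecStalk_toSpec]
      refine (Spec.map_comp _ _).symm.trans ?_
      exact congrArg Spec.map (CommRingCat.hom_ext (RingHom.ext h₂))
  have hcqg : c ≫ q ≫ g = L.X.fromSpecStalk a' := by
    rw [reassoc_of% hcq, hhg, hk]
  -- The dual numbers over a local ring are local, so the deformation factors through the stalk at
  -- some point `w`. Reducing modulo `ε` identifies `w` with `a'`.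
  obtain ⟨⟨w, F, hF⟩, hw⟩ := (SpecToEquivOfLocalRing L.X (CommRingCat.of
    (TrivSqZeroExt (L.X.presheaf.stalk a') (L.X.presheaf.stalk a')))).symm.surjective (q ≫ g)
  rw [SpecToEquivOfLocalRing_symm_apply] at hw
  change Spec.map F ≫ L.X.fromSpecStalk w = q ≫ g at hw
  have hloc : IsLocalHom (F ≫ dualFst (L.X.presheaf.stalk a')).hom := by
    have : IsLocalHom F.hom := hF
    infer_instance
  have hsig : (⟨w, F ≫ dualFst (L.X.presheaf.stalk a'), hloc⟩ :
      Σ x, { f : L.X.presheaf.stalk x ⟶ L.X.presheaf.stalk a' // IsLocalHom f.hom }) =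
      ⟨a', 𝟙 _, inferInstance⟩ := by
    apply (SpecToEquivOfLocalRing L.X (L.X.presheaf.stalk a')).symm.injective
    rw [SpecToEquivOfLocalRing_symm_apply, SpecToEquivOfLocalRing_symm_apply]
    change Spec.map (F ≫ dualFst (L.X.presheaf.stalk a')) ≫ L.X.fromSpecStalk w =
      Spec.map (𝟙 _) ≫ L.X.fromSpecStalk a'
    rw [Spec.map_comp, Spec.map_id, Category.id_comp, Category.assoc, hw]
    exact hcqg
  obtain ⟨hwa, hFF⟩ := Sigma.mk.inj_iff.1 hsig
  have hwa' := hwa.symm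
  subst hwa'
  have hFid : F ≫ dualFst (L.X.presheaf.stalk a') = 𝟙 _ := Subtype.ext_iff.1 (eq_of_heq hFF)
  refine ⟨F.hom, fun r => ?_, fun r => ?_, fun p => ?_⟩
  · exact congrArg (fun f => f.hom r) hFid
  · have h1 : Spec.map (σ.stalkMap a' ≫ F) ≫ M.X.fromSpecStalk (σ a') =
        Spec.map (CommRingCat.ofHom F₁) ≫ M.X.fromSpecStalk (σ a') := by
      rw [Spec.map_comp, Category.assoc, Scheme.SpecMap_stalkMap_fromSpecStalk, reassoc_of% hw,
        hgσ, reassoc_of% hq₁, Scheme.Opens.fromSpecStalkOfMem_ι]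
    rw [cancel_mono] at h1
    exact congrArg (fun f => f.hom r) (Spec.map_injective h1)
  · have h1 : Spec.map (CommRingCat.ofHom ((L.X.presheaf.germ ⊤ a' trivial).hom.comp y) ≫ F) =
        Spec.map (CommRingCat.ofHom F₂) := by
      rw [Spec.map_comp, ← fromSpecStalk_toSpec, reassoc_of% hw, comp_toSpec g, hgy, hv, hq₂]
    exact congrArg (fun f => f.hom p) (Spec.map_injective h1)

end SmoothScheme

end Desing

namespace Desing

open IsLocalRing

namespace SmoothScheme

variable {K : Type u} [Field K] {L M : SmoothScheme K}

/-! ### Products with a line -/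

/-- This is `exists_dual_lift` for `P = K` and `P' = K[X]`: the image point is deformed along `δ`,
while the coordinate `t` is kept constant. -/
theorem der_line {σ : L.X ⟶ M.X} (hσ : σ ≫ M.str = L.str) {t : Γ(L.X, ⊤)}
    (hline : ∀ (T : SmoothScheme K) (f : T.X ⟶ M.X) (s : Γ(T.X, ⊤)), f ≫ M.str = T.str →
      ∃ g : T.X ⟶ L.X, g ≫ L.str = T.str ∧ (g ≫ σ = f ∧ g.appTop t = s) ∧
        ∀ g' : T.X ⟶ L.X, g' ≫ L.str = T.str → g' ≫ σ = f → g'.appTop t = s → g' = g)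
    (x : L.X) (δ) (hδ : δ ∈ M.Der (σ x)) :
    ∃ δ' ∈ L.Der x, (∀ r, δ' ((σ.stalkMap x).hom r) = (σ.stalkMap x).hom (δ r)) ∧
      δ' (L.X.presheaf.germ ⊤ x trivial t) = 0 := by
  have hc : ∀ (T : SmoothScheme K) (g : T.X ⟶ L.X) (_ : g ≫ L.str = T.str) (v : Γ(T.X, ⊤)),
      g.appTop t = v →
      g.appTop.hom.comp (Polynomial.eval₂RingHom (L.scalarOn ⊤) t) =
        Polynomial.eval₂RingHom (T.scalarOn ⊤) v := by
    intro T g hg v hv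
    refine Polynomial.ringHom_ext (fun c => ?_) ?_
    · simpa using L.app_scalarOn hg c
    · simpa using hv
  let F₁ : M.X.presheaf.stalk (σ x) →+*
      TrivSqZeroExt (L.X.presheaf.stalk x) (L.X.presheaf.stalk x) :=
    dualHom (σ.stalkMap x).hom
      ((σ.stalkMap x).hom.toAddMonoidHom.comp δ.toLinearMap.toAddMonoidHom) (fun a b => by simp)
  let F₂ : Polynomial K →+* TrivSqZeroExt (L.X.presheaf.stalk x) (L.X.presheaf.stalk x) :=
    (TrivSqZeroExt.inlHom _ _).comp ((L.X.presheaf.germ ⊤ x trivial).hom.comp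
      (Polynomial.eval₂RingHom (L.scalarOn ⊤) t))
  have hsm : ((Polynomial.C : K →+* Polynomial K).comp (RingHom.id K)).Smooth := by
    rw [RingHom.comp_id]
    exact RingHom.smooth_algebraMap.2 ⟨inferInstance, inferInstance⟩
  obtain ⟨F, hF, hF₁, hF₂⟩ := exists_dual_lift (L := L) (M := M) hσ (i := RingHom.id K)
    (φ := Polynomial.C) hsm (x := M.scalarOn ⊤) rfl
    (y := Polynomial.eval₂RingHom (L.scalarOn ⊤) t)
    (by ext c; simpa using M.app_scalarOn hσ c)
    (fun T f v hf hv => by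
      obtain ⟨g, hg, ⟨hgσ, hgt⟩, -⟩ := hline T f (v Polynomial.X) hf
      refine ⟨g, hg, hgσ, ?_⟩
      rw [hc T g hg _ hgt]
      refine Polynomial.ringHom_ext (fun c => ?_) (by simp)
      have := DFunLike.congr_fun hv c
      simp only [RingHom.comp_apply] at this
      rw [← this]
      simpa using (M.app_scalarOn hf c).symm)
    (fun T g g' hg hg' h h' => by
      obtain ⟨k, -, -, hk⟩ := hline T (g ≫ σ) (g.appTop t) (by rw [Category.assoc, hσ, hg])
      have := DFunLike.congr_fun h' Polynomial.X
      simp only [RingHom.comp_apply, Polynomial.coe_eval₂RingHom, Polynomial.eval₂_X] at this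
      rw [hk g hg rfl rfl, hk g' hg' h.symm this.symm])
    x (V := ⊤) trivial (by
      rw [← str_eq_toSpec]
      have := M.smooth
      infer_instance)
    (F₁ := F₁) (fun r => by simp [F₁]) (F₂ := F₂) (fun q => by simp [F₂]) (fun c => by
      ext
      · simp [F₁, F₂]
        exact M.stalkMap_scalarAt hσ x c
      · simp [F₁, F₂]
        erw [hδ c]
        exact map_zero _)
  refine ⟨derivationOfDual F hF, fun c => ?_, fun r => ?_, ?_⟩
  · rw [← M.stalkMap_scalarAt hσ, derivationOfDual_apply, hF₁]
    simp [F₁, hδ c]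
  · rw [derivationOfDual_apply, hF₁]
    simp [F₁]
  · have := hF₂ Polynomial.X
    simp only [Polynomial.coe_eval₂RingHom, Polynomial.eval₂_X] at this
    rw [derivationOfDual_apply, this]
    simp [F₂]

/-! ### The smooth locus of a morphism to affine space -/

/-- A localization is formally étale, so formal smoothness over `R` may be tested over `P`. -/
theorem formallySmooth_of_comp_localization {P R S : Type*} [CommRing P] [CommRing R] [CommRing S]
    (f : P →+* R) (p : Ideal P) [hp : p.IsPrime]
    (hf : letI := f.toAlgebra; IsLocalization.AtPrime R p) {g : R →+* S}
    (h : (g.comp f).FormallySmooth) : g.FormallySmooth := by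
  letI := f.toAlgebra
  letI := g.toAlgebra
  letI := (g.comp f).toAlgebra
  have : IsScalarTower P R S := .of_algebraMap_eq fun c => rfl
  have : Algebra.FormallyEtale P R := Algebra.FormallyEtale.of_isLocalization p.primeCompl
  exact (Algebra.FormallySmooth.iff_restrictScalars (R := P) (A := R)).1 h

/-- Functions with a dual system of derivations define a morphism to affine space which is smooth
near the point. -/
theorem exists_smooth_toSpec {k : ℕ} {x : Fin k → Γ(M.X, ⊤)} {a : M.X}
    {D : Fin k → Derivation ℤ (M.X.presheaf.stalk a) (M.X.presheaf.stalk a)}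
    (hD : ∀ i, D i ∈ M.Der a)
    (hd : ∀ i j, D i (M.X.presheaf.germ ⊤ a trivial (x j)) = if i = j then 1 else 0) :
    ∃ V : M.X.Opens, a ∈ V ∧
      Smooth (V.ι ≫ toSpec (MvPolynomial.eval₂Hom (M.scalarOn ⊤) x)) := by
  set ξ := MvPolynomial.eval₂Hom (M.scalarOn ⊤) x with hξ
  have hstr : toSpec ξ ≫ Spec.map (CommRingCat.ofHom (MvPolynomial.C : K →+* MvPolynomial (Fin k) K))
      = M.str := by
    rw [str_eq_toSpec, toSpec_comp]
    congr 1
    ext c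
    simp [hξ]
  have := M.smooth
  have hft : LocallyOfFiniteType (toSpec ξ) := by
    have h1 : LocallyOfFiniteType (toSpec ξ ≫
        Spec.map (CommRingCat.ofHom (MvPolynomial.C : K →+* MvPolynomial (Fin k) K))) := by
      rw [hstr]; infer_instance
    exact locallyOfFiniteType_of_comp _
      (Spec.map (CommRingCat.ofHom (MvPolynomial.C : K →+* MvPolynomial (Fin k) K)))
  have hfp : LocallyOfFinitePresentation (toSpec ξ) :=
    have : IsNoetherianRing (CommRingCat.of (MvPolynomial (Fin k) K)) :=
      inferInstanceAs (IsNoetherianRing (MvPolynomial (Fin k) K))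
    LocallyOfFinitePresentation.iff_locallyOfFiniteType.2 hft
  -- The dual derivations make the stalk formally smooth over the polynomial ring, hence over the
  -- local ring of affine space. Thus `a` belongs to the smooth locus, which serves as `V`.
  have hfs : ((toSpec ξ).stalkMap a).hom.FormallySmooth := by
    letI := (M.scalarAt a).toAlgebra
    letI : Algebra (MvPolynomial (Fin k) K) (M.X.presheaf.stalk a) :=
      ((M.X.presheaf.germ ⊤ a trivial).hom.comp ξ).toAlgebra
    have htower : IsScalarTower K (MvPolynomial (Fin k) K) (M.X.presheaf.stalk a) :=
      .of_algebraMap_eq fun c => by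
        change M.scalarAt a c = M.X.presheaf.germ ⊤ a trivial (ξ (MvPolynomial.C c))
        rw [hξ]
        simp [scalarAt]
    have := (M.smooth_stalk a).1
    have hsm : Algebra.FormallySmooth (MvPolynomial (Fin k) K) (M.X.presheaf.stalk a) :=
      formallySmooth_mvPolynomial K (fun l => linearDerivation (D l) (hD l)) fun l j => by
        refine Eq.trans ?_ (hd l j)
        change D l (M.X.presheaf.germ ⊤ a trivial (ξ (MvPolynomial.X j))) = _
        rw [hξ]
        simp
    have hcomp : StructureSheaf.toStalk (MvPolynomial (Fin k) K) (toSpec ξ a) ≫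
        (toSpec ξ).stalkMap a = CommRingCat.ofHom ((M.X.presheaf.germ ⊤ a trivial).hom.comp ξ) := by
      apply Spec.map_injective
      rw [← fromSpecStalk_toSpec, ← Scheme.SpecMap_stalkMap_fromSpecStalk, Spec.fromSpecStalk_eq']
      exact Spec.map_comp _ _
    refine formallySmooth_of_comp_localization
      (StructureSheaf.toStalk (MvPolynomial (Fin k) K) (toSpec ξ a)).hom
      (PrimeSpectrum.asIdeal (toSpec ξ a)) (hp := PrimeSpectrum.isPrime (toSpec ξ a))
      (StructureSheaf.IsLocalization.to_stalk (MvPolynomial (Fin k) K) (toSpec ξ a)) ?_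
    have h := congrArg CommRingCat.Hom.hom hcomp
    exact Eq.mpr (congrArg (fun f => RingHom.FormallySmooth f) h)
      (RingHom.formallySmooth_algebraMap.2 hsm)
  refine ⟨(toSpec ξ).smoothLocus, hfs, ?_⟩
  rw [← Scheme.Hom.smoothLocus_eq_top_iff, ← Scheme.Hom.preimage_smoothLocus_eq]
  simp

/-! ### Charts of blowings-up -/

/-- Again `exists_dual_lift`, now with `φ` the chart `X j ↦ X j * X i` of the blowing-up of affine
space at the origin. The dual system makes the map to affine space defined by `x` smooth near the
point, and `hη` says that the prescribed deformations are compatible. -/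
theorem der_blowupChart {π : L.X ⟶ M.X} (hπ : π ≫ M.str = L.str) {k : ℕ} {x : Fin k → Γ(M.X, ⊤)}
    {i : Fin k} {y : Fin k → Γ(L.X, ⊤)} (hyi : y i = 1)
    (hxy : ∀ j, π.appTop (x j) = y j * π.appTop (x i))
    (hrep : ∀ (T : SmoothScheme K) (f : T.X ⟶ M.X) (v : Fin k → Γ(T.X, ⊤)), f ≫ M.str = T.str →
      v i = 1 → (∀ j, f.appTop (x j) = v j * f.appTop (x i)) →
      ∃ g : T.X ⟶ L.X, g ≫ L.str = T.str ∧ (g ≫ π = f ∧ ∀ j, g.appTop (y j) = v j) ∧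
        ∀ g' : T.X ⟶ L.X, g' ≫ L.str = T.str → g' ≫ π = f → (∀ j, g'.appTop (y j) = v j) → g' = g)
    (b : L.X) (hdual : HasDual (M.Der (π b)) fun j => M.X.presheaf.germ ⊤ (π b) trivial (x j))
    {n : ℕ} (D : Fin n → Derivation ℤ (M.X.presheaf.stalk (π b)) (M.X.presheaf.stalk (π b)))
    (e : Fin n → L.X.presheaf.stalk b) (η : Fin k → L.X.presheaf.stalk b)
    (hD : ∀ l, D l ∈ M.Der (π b)) (hηi : η i = 0)
    (hη : ∀ j, ∑ l, e l * ((π.stalkMap b).hom (D l (M.X.presheaf.germ ⊤ (π b) trivial (x j))) -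
      L.X.presheaf.germ ⊤ b trivial (y j) *
        (π.stalkMap b).hom (D l (M.X.presheaf.germ ⊤ (π b) trivial (x i)))) =
      L.X.presheaf.germ ⊤ b trivial (π.appTop (x i)) * η j) :
    ∃ δ' ∈ L.Der b, (∀ r, δ' ((π.stalkMap b).hom r) = ∑ l, e l * (π.stalkMap b).hom (D l r)) ∧
      ∀ j, δ' (L.X.presheaf.germ ⊤ b trivial (y j)) = η j := by
  obtain ⟨D₀, hD₀, hd₀⟩ := hdual.exists_exact
  obtain ⟨V, hbV, hV⟩ := exists_smooth_toSpec hD₀ hd₀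
  let φ : MvPolynomial (Fin k) K →+* MvPolynomial (Fin k) K :=
    MvPolynomial.eval₂Hom MvPolynomial.C fun j =>
      if j = i then MvPolynomial.X i else MvPolynomial.X j * MvPolynomial.X i
  have hφC : ∀ c, φ (MvPolynomial.C c) = MvPolynomial.C c := fun c => by simp [φ]
  have hφi : φ (MvPolynomial.X i) = MvPolynomial.X i := by simp [φ]
  have hφj : ∀ j, j ≠ i → φ (MvPolynomial.X j) = MvPolynomial.X j * MvPolynomial.X i :=
    fun j hj => by simp [φ, hj]
  let ξ : MvPolynomial (Fin k) K →+* Γ(M.X, ⊤) := MvPolynomial.eval₂Hom (M.scalarOn ⊤) x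
  have hξC : ∀ c, ξ (MvPolynomial.C c) = M.scalarOn ⊤ c := fun c => by simp [ξ]
  have hξX : ∀ j, ξ (MvPolynomial.X j) = x j := fun j => by simp [ξ]
  -- The function `y i = 1` carries no information, so the `i`-th coordinate of the chart is the
  -- exceptional equation instead.
  let υ : MvPolynomial (Fin k) K →+* Γ(L.X, ⊤) := MvPolynomial.eval₂Hom (L.scalarOn ⊤) fun j =>
    if j = i then π.appTop (x i) else y j
  have hυC : ∀ c, υ (MvPolynomial.C c) = L.scalarOn ⊤ c := fun c => by simp [υ]
  have hυi : υ (MvPolynomial.X i) = π.appTop (x i) := by simp [υ]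
  have hυj : ∀ j, j ≠ i → υ (MvPolynomial.X j) = y j := fun j hj => by simp [υ, hj]
  let d : M.X.presheaf.stalk (π b) →+ L.X.presheaf.stalk b :=
    ∑ l, (AddMonoidHom.mulLeft (e l)).comp
      ((π.stalkMap b).hom.toAddMonoidHom.comp (D l).toLinearMap.toAddMonoidHom)
  have hd : ∀ r, d r = ∑ l, e l * (π.stalkMap b).hom (D l r) := fun r => by
    simp [d]
  have hdC : ∀ c, d (M.scalarAt (π b) c) = 0 := fun c => by
    rw [hd]
    exact Finset.sum_eq_zero fun l _ => by rw [hD l c, map_zero, mul_zero]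
  let F₁ : M.X.presheaf.stalk (π b) →+*
      TrivSqZeroExt (L.X.presheaf.stalk b) (L.X.presheaf.stalk b) :=
    dualHom (π.stalkMap b).hom d (fun r s => by
      simp only [hd, Derivation.leibniz, map_add, smul_eq_mul, map_mul, Finset.mul_sum,
        ← Finset.sum_add_distrib]
      exact Finset.sum_congr rfl fun l _ => by ring)
  let F₂ : MvPolynomial (Fin k) K →+*
      TrivSqZeroExt (L.X.presheaf.stalk b) (L.X.presheaf.stalk b) :=
    MvPolynomial.eval₂Hom ((TrivSqZeroExt.inlHom _ _).comp (L.scalarAt b)) fun j =>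
      TrivSqZeroExt.inl (L.X.presheaf.germ ⊤ b trivial (υ (MvPolynomial.X j))) +
        TrivSqZeroExt.inr (if j = i then d (M.X.presheaf.germ ⊤ (π b) trivial (x i)) else η j)
  have hF₂C : ∀ c, F₂ (MvPolynomial.C c) = TrivSqZeroExt.inl (L.scalarAt b c) := fun c => by
    simp [F₂]
  have hF₂X : ∀ j, F₂ (MvPolynomial.X j) =
      TrivSqZeroExt.inl (L.X.presheaf.germ ⊤ b trivial (υ (MvPolynomial.X j))) +
        TrivSqZeroExt.inr (if j = i then d (M.X.presheaf.germ ⊤ (π b) trivial (x i)) else η j) :=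
    fun j => by simp [F₂]
  have hgerm : ∀ s, (π.stalkMap b).hom (M.X.presheaf.germ ⊤ (π b) trivial s) =
      L.X.presheaf.germ ⊤ b trivial (π.appTop s) :=
    fun s => Scheme.Hom.germ_stalkMap_apply π ⊤ b trivial s
  have hυφ : π.appTop.hom.comp ξ = υ.comp φ := by
    refine MvPolynomial.ringHom_ext (fun c => ?_) (fun j => ?_)
    · rw [RingHom.comp_apply, RingHom.comp_apply, hξC, hφC, hυC]
      exact M.app_scalarOn hπ c
    · rw [RingHom.comp_apply, RingHom.comp_apply, hξX]
      by_cases hj : j = i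
      · subst hj
        rw [hφi, hυi]
      · rw [hφj j hj, map_mul, hυi, hυj j hj]
        exact hxy j
  have hsm : (φ.comp MvPolynomial.C).Smooth := by
    rw [show φ.comp MvPolynomial.C = MvPolynomial.C from RingHom.ext hφC]
    exact RingHom.smooth_algebraMap.2 ⟨inferInstance, inferInstance⟩
  obtain ⟨F, hF, hF₁, hF₂⟩ := exists_dual_lift (L := L) (M := M) hπ (i := MvPolynomial.C)
    (φ := φ) hsm (x := ξ) (RingHom.ext hξC) (y := υ) hυφ
    (fun T f v hf hv => by
      have hv' : ∀ q, f.appTop (ξ q) = v (φ q) := fun q => DFunLike.congr_fun hv q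
      have hvi : f.appTop (x i) = v (MvPolynomial.X i) := by rw [← hξX, hv', hφi]
      obtain ⟨g, hg, ⟨hgπ, hgy⟩, -⟩ := hrep T f (fun j => if j = i then 1 else v (MvPolynomial.X j))
        hf (if_pos rfl) (fun j => by
          by_cases hj : j = i
          · subst hj; simp
          · simp only [hj, if_false]
            rw [hvi, ← hξX, hv', hφj j hj, map_mul])
      refine ⟨g, hg, hgπ, MvPolynomial.ringHom_ext (fun c => ?_) (fun j => ?_)⟩
      · rw [RingHom.comp_apply, hυC]
        refine (L.app_scalarOn hg c).trans ?_
        rw [← hφC, ← hv', hξC]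
        exact (M.app_scalarOn hf c).symm
      · rw [RingHom.comp_apply]
        by_cases hj : j = i
        · subst hj
          rw [hυi, ← hvi, ← hgπ, Scheme.Hom.comp_appTop]
          rfl
        · rw [hυj j hj]
          exact (hgy j).trans (if_neg hj))
    (fun T g g' hg hg' h h' => by
      obtain ⟨q, -, -, hq⟩ := hrep T (g ≫ π) (fun j => g.appTop (y j))
        (by rw [Category.assoc, hπ, hg]) (by simp [hyi]) (fun j => by
          rw [Scheme.Hom.comp_appTop, CommRingCat.comp_apply, CommRingCat.comp_apply, hxy, map_mul])
      rw [hq g hg rfl fun _ => rfl, hq g' hg' h.symm fun j => ?_]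
      by_cases hj : j = i
      · subst hj; simp [hyi]
      · have := DFunLike.congr_fun h' (MvPolynomial.X j)
        rw [RingHom.comp_apply, RingHom.comp_apply, hυj j hj] at this
        exact this.symm)
    b hbV hV (F₁ := F₁) (fun r => by simp [F₁]) (F₂ := F₂) (fun q => by
      have : (TrivSqZeroExt.fstHom (L.X.presheaf.stalk b) (L.X.presheaf.stalk b)
          (L.X.presheaf.stalk b)).toRingHom.comp F₂ =
          (L.X.presheaf.germ ⊤ b trivial).hom.comp υ := by
        refine MvPolynomial.ringHom_ext (fun c => ?_) (fun j => ?_)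
        · rw [RingHom.comp_apply, hF₂C, RingHom.comp_apply, hυC]
          simp [scalarAt]
        · rw [RingHom.comp_apply, hF₂X, RingHom.comp_apply]
          change TrivSqZeroExt.fst _ = _
          rw [TrivSqZeroExt.fst_add, TrivSqZeroExt.fst_inl, TrivSqZeroExt.fst_inr, add_zero]
      exact DFunLike.congr_fun this q) (fun q => by
      have : F₁.comp ((M.X.presheaf.germ ⊤ (π b) trivial).hom.comp ξ) = F₂.comp φ := by
        refine MvPolynomial.ringHom_ext (fun c => ?_) (fun j => ?_)
        · rw [RingHom.comp_apply, RingHom.comp_apply, RingHom.comp_apply, hφC, hF₂C, hξC]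
          refine TrivSqZeroExt.ext ?_ ?_
          · rw [fst_dualHom]
            exact M.stalkMap_scalarAt hπ b c
          · rw [snd_dualHom]
            exact hdC c
        · rw [RingHom.comp_apply, RingHom.comp_apply, RingHom.comp_apply, hξX]
          by_cases hj : j = i
          · subst hj
            rw [hφi, hF₂X, hυi]
            refine TrivSqZeroExt.ext ?_ ?_
            · rw [fst_dualHom]
              simpa using hgerm (x j)
            · rw [snd_dualHom]
              simp
          · rw [hφj j hj, map_mul, hF₂X, hF₂X, hυi, hυj j hj]
            refine TrivSqZeroExt.ext ?_ ?_
            · rw [fst_dualHom]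
              rw [TrivSqZeroExt.fst_mul, TrivSqZeroExt.fst_add, TrivSqZeroExt.fst_add,
                TrivSqZeroExt.fst_inl, TrivSqZeroExt.fst_inl, TrivSqZeroExt.fst_inr,
                TrivSqZeroExt.fst_inr, add_zero, add_zero, ← map_mul, ← hxy]
              exact hgerm (x j)
            · rw [snd_dualHom]
              have h := hη j
              simp only [mul_sub, Finset.sum_sub_distrib] at h
              rw [sub_eq_iff_eq_add] at h
              simp only [TrivSqZeroExt.snd_mul, TrivSqZeroExt.fst_add, TrivSqZeroExt.fst_inl,
                TrivSqZeroExt.fst_inr, TrivSqZeroExt.snd_add, TrivSqZeroExt.snd_inl,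
                TrivSqZeroExt.snd_inr, hj, if_false, if_true, add_zero, zero_add, smul_eq_mul,
                MulOpposite.smul_eq_mul_unop, MulOpposite.unop_op]
              refine (hd _).trans (h.trans ?_)
              rw [hd, Finset.mul_sum, add_comm, mul_comm (η j)]
              congr 1
              exact Finset.sum_congr rfl fun l _ => by ring
      exact DFunLike.congr_fun this q)
  refine ⟨derivationOfDual F hF, fun c => ?_, fun r => ?_, fun j => ?_⟩
  · rw [← M.stalkMap_scalarAt hπ, derivationOfDual_apply, hF₁]
    simp [F₁, hdC c]
  · rw [derivationOfDual_apply, hF₁]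
    simp [F₁, hd]
  · by_cases hj : j = i
    · subst hj
      rw [hyi, map_one, hηi, Derivation.map_one_eq_zero]
    · have := hF₂ (MvPolynomial.X j)
      rw [hυj j hj, hF₂X] at this
      rw [derivationOfDual_apply, this]
      simp [hj]

end SmoothScheme

end Desing

namespace Desing

open IsLocalRing

namespace SmoothScheme

variable {K : Type u} [Field K] {B M M' : SmoothScheme K}

theorem isLocalHom_stalkMap {X Y : Scheme.{u}} (f : X ⟶ Y) (x : X) :
    IsLocalHom (f.stalkMap x).hom := inferInstance

theorem hasDual [CharZero K] {a : M.X} {k : ℕ} {z : Fin k → M.X.presheaf.stalk a}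
    (hz : IsPartOfRegularSystem z) : HasDual (M.Der a) z :=
  hz.hasDual fun f => M.mem_sq_of_der f

theorem mem_of_forall_mem_fil {a : M.X} (I : Ideal (M.X.presheaf.stalk a))
    {f : M.X.presheaf.stalk a} (hf : ∀ n, f ∈ fil (maximalIdeal _) I n) : f ∈ I :=
  Desing.mem_of_forall_mem_fil I hf

/-- The stalk map of an open immersion is bijective, so the data are moved to the full chart and the
derivation is moved back. -/
theorem der_blowup_openImm {π : B.X ⟶ M.X} (hπ : π ≫ M.str = B.str) {j : M'.X ⟶ B.X}
    (hj : j ≫ B.str = M'.str) [IsOpenImmersion j] {k : ℕ} {x : Fin k → Γ(M.X, ⊤)}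
    {i : Fin k} {y : Fin k → Γ(B.X, ⊤)} (hyi : y i = 1)
    (hxy : ∀ j, π.appTop (x j) = y j * π.appTop (x i))
    (hrep : ∀ (T : SmoothScheme K) (f : T.X ⟶ M.X) (v : Fin k → Γ(T.X, ⊤)), f ≫ M.str = T.str →
      v i = 1 → (∀ j, f.appTop (x j) = v j * f.appTop (x i)) →
      ∃ g : T.X ⟶ B.X, g ≫ B.str = T.str ∧ (g ≫ π = f ∧ ∀ j, g.appTop (y j) = v j) ∧
        ∀ g' : T.X ⟶ B.X, g' ≫ B.str = T.str → g' ≫ π = f → (∀ j, g'.appTop (y j) = v j) → g' = g)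
    (a : M'.X)
    (hdual : HasDual (M.Der (π (j a))) fun l => M.X.presheaf.germ ⊤ (π (j a)) trivial (x l))
    {n : ℕ}
    (D : Fin n → Derivation ℤ (M.X.presheaf.stalk (π (j a))) (M.X.presheaf.stalk (π (j a))))
    (e : Fin n → M'.X.presheaf.stalk a) (η : Fin k → M'.X.presheaf.stalk a)
    (hD : ∀ l, D l ∈ M.Der (π (j a))) (hηi : η i = 0)
    {ψ : M.X.presheaf.stalk (π (j a)) →+* M'.X.presheaf.stalk a}
    (hψ : ∀ r, ψ r = (j.stalkMap a).hom ((π.stalkMap (j a)).hom r))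
    (hη : ∀ m, ∑ l, e l * (ψ (D l (M.X.presheaf.germ ⊤ (π (j a)) trivial (x m))) -
      M'.X.presheaf.germ ⊤ a trivial (j.appTop (y m)) *
        ψ (D l (M.X.presheaf.germ ⊤ (π (j a)) trivial (x i)))) =
      M'.X.presheaf.germ ⊤ a trivial (j.appTop (π.appTop (x i))) * η m) :
    ∃ δ' ∈ M'.Der a, (∀ r, δ' (ψ r) = ∑ l, e l * ψ (D l r)) ∧
      ∀ m, δ' (M'.X.presheaf.germ ⊤ a trivial (j.appTop (y m))) = η m := by
  have hbij : Function.Bijective (j.stalkMap a).hom :=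
    ConcreteCategory.bijective_of_isIso (j.stalkMap a)
  have hgerm : ∀ s, (j.stalkMap a).hom (B.X.presheaf.germ ⊤ (j a) trivial s) =
      M'.X.presheaf.germ ⊤ a trivial (j.appTop s) :=
    fun s => Scheme.Hom.germ_stalkMap_apply j ⊤ a trivial s
  choose e' he' using fun l => hbij.2 (e l)
  choose η' hη' using fun l => hbij.2 (η l)
  obtain ⟨δ, hδ, hδπ, hδy⟩ := der_blowupChart hπ hyi hxy hrep (j a) hdual D e' η' hD
    (hbij.1 (by rw [map_zero]; exact (hη' i).trans hηi)) fun m => hbij.1 (by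
      rw [map_sum, map_mul]
      rw [hgerm, hη']
      refine Eq.trans (Finset.sum_congr rfl fun l _ => ?_) (hη m)
      rw [map_mul, map_sub, map_mul]
      rw [hgerm, he', hψ, hψ])
  obtain ⟨δ', hδ', h⟩ := der_openImm hj a δ hδ
  refine ⟨δ', hδ', fun r => ?_, fun m => ?_⟩
  · rw [hψ, h, hδπ, map_sum]
    exact Finset.sum_congr rfl fun l _ => by rw [map_mul, hψ, he']
  · rw [← hgerm, h, hδy]
    exact hη' m

end SmoothScheme

/-- Smooth schemes over a field of characteristic zero. -/
def algebraicDiff (K : Type u) [Field K] [CharZero K] : DiffStructure (algebraicGeometry K) where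
  stalkMap f x := (f.1.stalkMap x).hom
  isLocalHom_stalkMap f x := SmoothScheme.isLocalHom_stalkMap f.1 x
  stalkMap_germ f x s := Scheme.Hom.germ_stalkMap_apply f.1 ⊤ x trivial s
  continuous_map f := f.1.continuous
  Sec {M} a := SmoothScheme.Sec M a
  germ_mem_sec a f := ⟨⊤, trivial, f, fun _ _ => rfl⟩
  exists_sec f := SmoothScheme.exists_sec f
  sec_eventually_eq_zero := SmoothScheme.sec_eventually_eq_zero
  Der {M} a := SmoothScheme.Der M a
  exists_der_family := SmoothScheme.exists_der_family
  mem_sq_of_der {M _} f := SmoothScheme.mem_sq_of_der M f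
  fg_maximalIdeal {M} a :=
    have := SmoothScheme.isNoetherianRing_stalk M a
    (isNoetherianRing_iff_ideal_fg _).1 this _
  isUnit_natCast {M} a := SmoothScheme.isUnit_natCast M a
  separated {M a _ _} _ f hf :=
    SmoothScheme.mem_of_forall_mem_fil (M := M) (a := a) _ hf
  nullstellensatz := SmoothScheme.nullstellensatz
  der_openImm {_ _ j} hj x δ hδ :=
    have : IsOpenImmersion j.1 := hj
    SmoothScheme.der_openImm j.2 x δ hδ
  der_line {L M σ t} h x δ hδ := by
    refine SmoothScheme.der_line (L := L) (M := M) σ.2 (t := t) (fun T f s hf => ?_) x δ hδ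
    obtain ⟨g, ⟨hg, hgt⟩, hu⟩ := h T ⟨f, hf⟩ s
    exact ⟨g.1, g.2, ⟨congrArg Subtype.val hg, hgt⟩, fun g' hg' h1 h2 =>
      congrArg Subtype.val (hu ⟨g', hg'⟩ ⟨Subtype.ext h1, h2⟩)⟩
  der_blowup {M' M σ k x i y} h a' hx n D e η hD hηi hη := by
    obtain ⟨hx', B, π, v, j, ⟨hvi, hxv, hrep⟩, hj, rfl, hy⟩ := h
    have hj' : IsOpenImmersion j.1 := hj
    obtain rfl : y = fun l => (algebraicGeometry K).pull j (v l) := funext hy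
    refine SmoothScheme.der_blowup_openImm (B := B) (M := M) (M' := M') π.2 j.2 hvi hxv
      (fun T f w hf hwi hw => ?_) a'
      (SmoothScheme.hasDual (hx' _ hx)) D e η hD hηi
      (ψ := ((j.1 ≫ π.1).stalkMap a').hom)
      (fun r => congrArg (fun f => f.hom r) (Scheme.Hom.stalkMap_comp j.1 π.1 a')) hη
    obtain ⟨g, ⟨hg, hgt⟩, hu⟩ := hrep T ⟨f, hf⟩ w hwi hw
    exact ⟨g.1, g.2, ⟨congrArg Subtype.val hg, hgt⟩, fun g' hg' h1 h2 =>
      congrArg Subtype.val (hu ⟨g', hg'⟩ ⟨Subtype.ext h1, h2⟩)⟩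
  exists_openImm {M} a ι _ s hs := by
    obtain ⟨U, j, b, f, hj, hi, hb, hf⟩ := SmoothScheme.exists_openImm (M := M) (a := a) s hs
    exact ⟨U, ⟨j, hj⟩, b, f, hi, hb, hf⟩
  isOpenImm_comp {_ _ _ f g} hf hg :=
    have h1 : IsOpenImmersion f.1 := hf
    have h2 : IsOpenImmersion g.1 := hg
    inferInstanceAs (IsOpenImmersion (f.1 ≫ g.1))
  map_comp _ _ _ := rfl
  pull_comp _ _ _ := rfl
  exists_id A := ⟨⟨𝟙 _, Category.id_comp _⟩, inferInstanceAs (IsOpenImmersion (𝟙 A.X)),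
    fun _ => rfl, fun _ => rfl, fun g => Subtype.ext (Category.id_comp g.1)⟩

end Desing

/-! ### The analytic case: manifolds over a locally compact field of characteristic zero. -/

namespace Desing

/-! ### Division of analytic functions by linear functions -/

section Division

variable {K : Type*} [NontriviallyNormedField K] {E : Type*} [NormedAddCommGroup E]
  [NormedSpace K E]

/-- The power series of `(f (y) - f (y - ℓ y • v)) / ℓ y`, where `L y = y - ℓ y • v`. -/
def divSeries (p : FormalMultilinearSeries K E K) (L : E →L[K] E) (v : E) :
    FormalMultilinearSeries K E K := fun m =>
  ∑ k : Fin (m + 1), ((p (m + 1)).compContinuousLinearMap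
    (fun j => if j ≤ k then ContinuousLinearMap.id K E else L)).curryMid k v

/-- A telescoping sum: the arguments `y` are replaced by `y - ℓ y • v` one slot at a time, and each
difference has `ℓ y • v` in a single slot. -/
theorem mul_divSeries_apply (p : FormalMultilinearSeries K E K) (ℓ : E →L[K] K) (v : E) (m : ℕ)
    (y : E) :
    ℓ y * divSeries p (ContinuousLinearMap.id K E - ℓ.smulRight v) v m (fun _ => y) =
      p (m + 1) (fun _ => y) - p (m + 1) (fun _ => y - ℓ y • v) := by
  have h := (p (m + 1)).toMultilinearMap.map_sub_map_piecewise (fun _ => y)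
    (fun _ => y - ℓ y • v) Finset.univ
  rw [Finset.piecewise_univ] at h
  refine Eq.trans ?_ h.symm
  rw [divSeries, ContinuousMultilinearMap.sum_apply, Finset.mul_sum]
  refine Finset.sum_congr rfl fun k _ => ?_
  rw [← smul_eq_mul, ← ContinuousMultilinearMap.smul_apply, ← map_smul,
    ContinuousMultilinearMap.curryMid_apply, ContinuousMultilinearMap.compContinuousLinearMap_apply]
  refine congrArg (p (m + 1)) (funext fun j => ?_)
  rcases eq_or_ne j k with rfl | hj
  · simp
  · obtain ⟨i, rfl⟩ := Fin.exists_succAbove_eq hj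
    rw [Fin.insertNth_apply_succAbove]
    rcases lt_or_gt_of_ne hj with hlt | hlt
    · simp [hlt, hlt.le]
    · simp [hlt.not_ge, hlt.not_gt, hj.symm]

theorem norm_divSeries_le (p : FormalMultilinearSeries K E K) (L : E →L[K] E) (v : E) {C : ℝ}
    (hC : 1 ≤ C) (hL : ‖L‖ ≤ C) (m : ℕ) :
    ‖divSeries p L v m‖ ≤ (m + 1) * (‖p (m + 1)‖ * C ^ (m + 1) * ‖v‖) := by
  refine (norm_sum_le _ _).trans ?_
  have h : ∀ k ∈ (Finset.univ : Finset (Fin (m + 1))),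
      ‖((p (m + 1)).compContinuousLinearMap
        (fun j => if j ≤ k then ContinuousLinearMap.id K E else L)).curryMid k v‖ ≤
      ‖p (m + 1)‖ * C ^ (m + 1) * ‖v‖ := fun k _ => by
    refine (ContinuousLinearMap.le_opNorm _ _).trans ?_
    refine mul_le_mul_of_nonneg_right ?_ (norm_nonneg _)
    rw [ContinuousMultilinearMap.norm_curryMid]
    refine (ContinuousMultilinearMap.norm_compContinuousLinearMap_le _ _).trans ?_
    refine mul_le_mul_of_nonneg_left ?_ (norm_nonneg _)
    refine (Finset.prod_le_prod (fun _ _ => norm_nonneg _)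
      (g := fun _ => C) fun j _ => ?_).trans (by simp)
    split_ifs
    · exact ContinuousLinearMap.norm_id_le.trans hC
    · exact hL
  refine (Finset.sum_le_sum h).trans ?_
  simp

/-- The number `m + 1 ≤ 2 ^ (m + 1)` of summands and the powers of the norm of `L` are absorbed by
dividing the radius by `2 * C`. -/
theorem radius_divSeries_pos (p : FormalMultilinearSeries K E K) (hp : 0 < p.radius)
    (L : E →L[K] E) (v : E) : 0 < (divSeries p L v).radius := by
  obtain ⟨ρ, hρ, hρp⟩ := ENNReal.lt_iff_exists_nnreal_btwn.1 hp
  have hρ0 : 0 < (ρ : ℝ) := by simpa using hρ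
  obtain ⟨B, hB, hb⟩ := p.norm_mul_pow_le_of_lt_radius hρp
  set C : ℝ := max 1 ‖L‖ with hC
  have hC0 : 0 < C := lt_of_lt_of_le one_pos (le_max_left _ _)
  let s : NNReal := ⟨ρ / (2 * C), by positivity⟩
  have hs : (0 : ℝ) < s := show 0 < (ρ : ℝ) / (2 * C) by positivity
  refine lt_of_lt_of_le (b := (s : ENNReal)) (by simpa using hs)
    (FormalMultilinearSeries.le_radius_of_bound _ (B * (2 * C) / ρ * ‖v‖) fun m => ?_)
  refine (mul_le_mul_of_nonneg_right
    (norm_divSeries_le p L v (le_max_left _ _) (le_max_right _ _) m) (by positivity)).trans ?_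
  have h1 : (m + 1 : ℝ) ≤ 2 ^ (m + 1) := by
    exact_mod_cast (Nat.lt_two_pow_self (n := m + 1)).le
  have h2 : (s : ℝ) ^ m = ρ ^ (m + 1) / (2 * C) ^ (m + 1) * ((2 * C) / ρ) := by
    change ((ρ : ℝ) / (2 * C)) ^ m = _
    rw [← div_pow, pow_succ]
    field_simp
  rw [h2]
  calc (m + 1 : ℝ) * (‖p (m + 1)‖ * C ^ (m + 1) * ‖v‖) *
        (ρ ^ (m + 1) / (2 * C) ^ (m + 1) * ((2 * C) / ρ))
      = ((m + 1 : ℝ) / 2 ^ (m + 1)) * (‖p (m + 1)‖ * ρ ^ (m + 1)) * ((2 * C) / ρ * ‖v‖) := by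
        rw [mul_pow]
        field_simp
    _ ≤ 1 * B * ((2 * C) / ρ * ‖v‖) := by
        refine mul_le_mul_of_nonneg_right ?_ (by positivity)
        refine mul_le_mul ?_ (hb _) (by positivity) zero_le_one
        rw [div_le_one (by positivity)]
        exact h1
    _ = _ := by ring

/-- Hadamard's lemma. The quotient is given by an explicit power series and not by integration, so
the argument works over any complete `K`. -/
theorem exists_analyticAt_mul_eq [CompleteSpace K] {f : E → K} {c : E} (hf : AnalyticAt K f c)
    (ℓ : E →L[K] K) (v : E) :
    ∃ g : E → K, AnalyticAt K g c ∧
      ∀ᶠ y in 𝓝 c, f y - f (y - ℓ (y - c) • v) = ℓ (y - c) * g y := by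
  obtain ⟨p, r, hp⟩ := hf
  set L : E →L[K] E := ContinuousLinearMap.id K E - ℓ.smulRight v with hL
  have hrad := radius_divSeries_pos p (hp.r_pos.trans_le hp.r_le) L v
  have hq := (divSeries p L v).hasFPowerSeriesOnBall hrad
  refine ⟨fun y => (divSeries p L v).sum (y - c), ?_, ?_⟩
  · have h1 : AnalyticAt K (divSeries p L v).sum (c - c) := by
      rw [sub_self]; exact hq.analyticAt
    exact h1.comp_of_eq (analyticAt_id.sub analyticAt_const) rfl
  · have hT : Filter.Tendsto (fun y => y - c) (𝓝 c) (𝓝 0) := by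
      simpa using (continuous_id.sub continuous_const).tendsto (x := c) (f := fun y : E => y - c)
    have hTL : Filter.Tendsto (fun y => (y - c) - ℓ (y - c) • v) (𝓝 c) (𝓝 0) := by
      have : Continuous fun w : E => w - ℓ w • v := by fun_prop
      have h := (this.tendsto 0).comp hT
      simpa [Function.comp_def] using h
    have e1 := hT.eventually (Metric.eball_mem_nhds (0 : E) hp.r_pos)
    have e2 := hTL.eventually (Metric.eball_mem_nhds (0 : E) hp.r_pos)
    have e3 := hT.eventually (Metric.eball_mem_nhds (0 : E) hrad)
    filter_upwards [e1, e2, e3] with y h1 h2 h3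
    have s1 := hp.hasSum h1
    have s2 := hp.hasSum h2
    have s3 := (hq.hasSum h3).mul_left (ℓ (y - c))
    rw [add_sub_cancel] at s1
    rw [show c + (y - c - ℓ (y - c) • v) = y - ℓ (y - c) • v by abel] at s2
    simp only [hL, mul_divSeries_apply, zero_add] at s3
    have s4 := s1.sub s2
    -- The constant terms cancel; the shift by one aligns degree `m + 1` of `p` with degree `m` of
    -- the quotient series.
    rw [← hasSum_nat_add_iff' 1] at s4
    have hz : p 0 (fun _ => y - c) = p 0 (fun _ => y - c - ℓ (y - c) • v) :=
      congrArg (p 0) (Subsingleton.elim _ _)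
    simp only [Finset.range_one, Finset.sum_singleton, hz, sub_self, sub_zero] at s4
    exact s4.unique s3

/-- Division by several linear functions. -/
theorem exists_analyticAt_sum_mul_eq [CompleteSpace K] {k : ℕ} {f : E → K} {c : E}
    (hf : AnalyticAt K f c) (ℓ : Fin k → E →L[K] K) (v : Fin k → E)
    (hℓ : ∀ i j, ℓ i (v j) = if i = j then 1 else 0) :
    ∃ g : Fin k → E → K, (∀ j, AnalyticAt K (g j) c) ∧
      ∀ᶠ y in 𝓝 c, f y - f (y - ∑ j, ℓ j (y - c) • v j) = ∑ j, ℓ j (y - c) * g j y := by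
  induction k generalizing f with
  | zero => exact ⟨Fin.elim0, fun j => j.elim0, by simp⟩
  | succ k ih =>
    obtain ⟨g, hg, h⟩ := ih hf (fun j => ℓ j.succ) (fun j => v j.succ)
      (fun i j => by simpa using hℓ i.succ j.succ)
    set P : E → E := fun y => y - ∑ j : Fin k, ℓ j.succ (y - c) • v j.succ with hP
    have hPan : AnalyticAt K P c := by
      refine analyticAt_id.sub (Finset.analyticAt_fun_sum _ fun j _ => ?_)
      exact (((ℓ j.succ).analyticAt _).comp_of_eq (analyticAt_id.sub analyticAt_const) rfl).smul
        analyticAt_const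
    have hPc : P c = c := by simp [hP]
    obtain ⟨g₀, hg₀, h₀⟩ := exists_analyticAt_mul_eq hf (ℓ 0) (v 0)
    refine ⟨Fin.cons (fun y => g₀ (P y)) g, ?_, ?_⟩
    · intro j
      refine Fin.cases ?_ (fun j => ?_) j
      · change AnalyticAt K (g₀ ∘ P) c
        exact AnalyticAt.comp_of_eq hg₀ hPan hPc
      · exact hg j
    · have hPt : Filter.Tendsto P (𝓝 c) (𝓝 c) := by
        have := hPan.continuousAt.tendsto
        rwa [hPc] at this
      filter_upwards [h, hPt.eventually h₀] with y h1 h2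
      -- Moving along the other directions does not change `ℓ 0`, so the two divisions do not
      -- interfere.
      have h3 : ℓ 0 (P y - c) = ℓ 0 (y - c) := by
        simp only [hP, map_sub, map_sum, map_smul, hℓ]
        simp [(Fin.succ_ne_zero _).symm]
      rw [h3] at h2
      rw [Fin.sum_univ_succ, Fin.sum_univ_succ]
      simp only [Fin.cons_zero, Fin.cons_succ]
      rw [← h1, ← h2, show P y - ℓ 0 (y - c) • v 0 =
        y - (ℓ 0 (y - c) • v 0 + ∑ j : Fin k, ℓ j.succ (y - c) • v j.succ) by
          simp only [hP]; abel]
      ring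

/-- An analytic function which is flat at a point vanishes near this point. -/
theorem eventually_eq_zero_of_flat {f : E → K} {c : E} (hf : AnalyticAt K f c)
    (h : ∀ n : ℕ, f =O[𝓝 c] fun y => ‖y - c‖ ^ n) : ∀ᶠ y in 𝓝 c, f y = 0 := by
  obtain ⟨p, hp⟩ := hf
  have hflat : ∀ n : ℕ, (fun y => f (c + y)) =O[𝓝 0] fun y => ‖y‖ ^ n := fun n => by
    have hT : Filter.Tendsto (fun y => c + y) (𝓝 0) (𝓝 c) := by
      simpa using (continuous_const.add continuous_id).tendsto (x := (0 : E))
        (f := fun y : E => c + y)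
    simpa [Function.comp_def] using (h n).comp_tendsto hT
  -- Once the lower terms vanish, the partial sum of length `k + 1` is its term of degree `k`, which
  -- is annihilated by flatness of order `k + 1`.
  have hz : ∀ n : ℕ, ∀ y : E, (p n fun _ => y) = 0 := by
    intro n
    refine Nat.strong_induction_on n fun k hk => ?_
    have psum_eq : p.partialSum (k + 1) = fun y => p k fun _ => y := by
      funext z
      refine Finset.sum_eq_single _ (fun b hb hnb => ?_) fun hn => ?_
      · exact hk b (lt_of_le_of_ne (Finset.mem_range_succ_iff.mp hb) hnb) z
      · exact False.elim (hn (Finset.mem_range.mpr (lt_add_one k)))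
    have h1 := hp.isBigO_sub_partialSum_pow (k + 1)
    rw [psum_eq] at h1
    have h2 := (hflat (k + 1)).sub h1
    simp only [sub_sub_cancel] at h2
    exact h2.continuousMultilinearMap_apply_eq_zero
  obtain ⟨r, hr⟩ := hp
  have hT : Filter.Tendsto (fun y => y - c) (𝓝 c) (𝓝 0) := by
    simpa using (continuous_id.sub continuous_const).tendsto (x := c) (f := fun y : E => y - c)
  filter_upwards [hT.eventually (Metric.eball_mem_nhds (0 : E) hr.r_pos)] with y hy
  have := hr.hasSum hy
  simp only [hz, add_sub_cancel] at this
  exact this.unique hasSum_zero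

end Division

end Desing

namespace Desing

open IsLocalRing

namespace AnalyticManifold

variable {K : Type u} [NontriviallyNormedField K] {A B M : AnalyticManifold K} {x : M.X}

/-! ### Germs of analytic functions -/

/-- `f` is an analytic function near `x`. -/
abbrev IsAn (M : AnalyticManifold K) (f : M.X → K) (x : M.X) : Prop :=
  ContMDiffAt 𝓘(K, Fin M.dim → K) 𝓘(K) ω f x

/-- `f` is an analytic map near `x`. -/
abbrev IsAnMap (f : A.X → B.X) (x : A.X) : Prop :=
  ContMDiffAt 𝓘(K, Fin A.dim → K) 𝓘(K, Fin B.dim → K) ω f x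

/-- The germ of an analytic function. -/
def toGerm (f : M.X → K) (hf : M.IsAn f x) : analyticStalk M x :=
  ⟨(f : Filter.Germ (𝓝 x) K), f, hf, rfl⟩

theorem exists_toGerm (φ : analyticStalk M x) : ∃ f, ∃ hf : M.IsAn f x, toGerm f hf = φ := by
  obtain ⟨_, f, hf, rfl⟩ := φ
  exact ⟨f, hf, rfl⟩

theorem toGerm_eq_iff {f g : M.X → K} {hf : M.IsAn f x} {hg : M.IsAn g x} :
    toGerm f hf = toGerm g hg ↔ f =ᶠ[𝓝 x] g :=
  Subtype.ext_iff.trans Filter.Germ.coe_eq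

theorem toGerm_add {f g : M.X → K} (hf : M.IsAn f x) (hg : M.IsAn g x) :
    toGerm f hf + toGerm g hg = toGerm (fun y => f y + g y) (hf.add hg) := rfl

theorem toGerm_sub {f g : M.X → K} (hf : M.IsAn f x) (hg : M.IsAn g x) :
    toGerm f hf - toGerm g hg = toGerm (fun y => f y - g y) (hf.sub hg) := rfl

theorem toGerm_mul {f g : M.X → K} (hf : M.IsAn f x) (hg : M.IsAn g x) :
    toGerm f hf * toGerm g hg = toGerm (fun y => f y * g y) (hf.mul hg) := rfl

theorem isAn_sum {ι : Type*} {s : Finset ι} {f : ι → M.X → K} (hf : ∀ i, M.IsAn (f i) x) :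
    M.IsAn (fun y => ∑ i ∈ s, f i y) x := ContMDiffAt.sum fun i _ => hf i

theorem toGerm_sum {ι : Type*} (s : Finset ι) {f : ι → M.X → K} (hf : ∀ i, M.IsAn (f i) x) :
    ∑ i ∈ s, toGerm (f i) (hf i) = toGerm (fun y => ∑ i ∈ s, f i y) (isAn_sum hf) := by
  classical
  induction s using Finset.induction_on with
  | empty => rfl
  | insert a s ha ih =>
    rw [Finset.sum_insert ha, ih, toGerm_add]
    exact toGerm_eq_iff.2 (Filter.Eventually.of_forall fun y =>
      (Finset.sum_insert (f := fun i => f i y) ha).symm)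

/-- The value of a germ at the point. -/
def value (x : M.X) : analyticStalk M x →+* K :=
  (Filter.Germ.valueRingHom : Filter.Germ (𝓝 x) K →+* K).comp (analyticStalk M x).subtype

@[simp]
theorem value_toGerm {f : M.X → K} (hf : M.IsAn f x) : value x (toGerm f hf) = f x := rfl

theorem mem_maximalIdeal_iff (φ : analyticStalk M x) :
    φ ∈ maximalIdeal (analyticStalk M x) ↔ value x φ = 0 := by
  rw [mem_maximalIdeal, mem_nonunits_iff, not_iff_comm]
  exact ⟨fun h => analyticStalk_isUnit M x φ h, fun h => (h.map (value x)).ne_zero⟩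

/-- Constant germs. -/
def const (x : M.X) : K →+* analyticStalk M x where
  toFun c := toGerm (fun _ => c) contMDiffAt_const
  map_one' := rfl
  map_mul' _ _ := rfl
  map_zero' := rfl
  map_add' _ _ := rfl

@[simp]
theorem value_const (c : K) : value x (const x c) = c := rfl

theorem isAn_eventually {f : M.X → K} (hf : M.IsAn f x) : ∀ᶠ y in 𝓝 x, M.IsAn f y :=
  (contMDiffAt_iff_contMDiffAt_nhds (by decide)).1 hf

/-- Pull-back of germs. -/
def pullGerm (f : A.X → B.X) {x : A.X} (hf : IsAnMap f x) {y : B.X} (h : f x = y) :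
    analyticStalk B y →+* analyticStalk A x where
  toFun φ := ⟨φ.1.compTendsto f (h ▸ hf.continuousAt), by
    obtain ⟨g, hg, rfl⟩ := exists_toGerm φ
    exact ⟨g ∘ f, ContMDiffAt.comp_of_eq hg hf h, rfl⟩⟩
  map_one' := rfl
  map_mul' := by
    rintro ⟨_, f, hf, rfl⟩ ⟨_, g, hg, rfl⟩
    rfl
  map_zero' := rfl
  map_add' := by
    rintro ⟨_, f, hf, rfl⟩ ⟨_, g, hg, rfl⟩
    rfl

theorem pullGerm_toGerm {f : A.X → B.X} {x : A.X} (hf : IsAnMap f x) {y : B.X} (h : f x = y)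
    {g : B.X → K} (hg : B.IsAn g y) :
    pullGerm f hf h (toGerm g hg) = toGerm (g ∘ f) (ContMDiffAt.comp_of_eq hg hf h) := rfl

@[simp]
theorem pullGerm_const {f : A.X → B.X} {x : A.X} (hf : IsAnMap f x) {y : B.X} (h : f x = y)
    (c : K) : pullGerm f hf h (const y c) = const x c := rfl

@[simp]
theorem value_pullGerm {f : A.X → B.X} {x : A.X} (hf : IsAnMap f x) {y : B.X} (h : f x = y)
    (φ : analyticStalk B y) : value x (pullGerm f hf h φ) = value y φ := by
  obtain ⟨g, hg, rfl⟩ := exists_toGerm φ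
  rw [pullGerm_toGerm, value_toGerm, value_toGerm, Function.comp_apply, h]

theorem isLocalHom_pullGerm {f : A.X → B.X} {x : A.X} (hf : IsAnMap f x) {y : B.X} (h : f x = y) :
    IsLocalHom (pullGerm f hf h) :=
  ⟨fun φ hφ => analyticStalk_isUnit B y φ (by
    have := (hφ.map (value x)).ne_zero
    rwa [value_pullGerm] at this)⟩

/-! ### Coordinate systems -/

/-- A system of coordinates at `x`, given by an analytic map and a local inverse. -/
structure Coord (M : AnalyticManifold K) (x : M.X) (N : ℕ) where
  h : M.X → Fin N → K
  g : (Fin N → K) → M.X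
  an_h : ContMDiffAt 𝓘(K, Fin M.dim → K) 𝓘(K, Fin N → K) ω h x
  an_g : ContMDiffAt 𝓘(K, Fin N → K) 𝓘(K, Fin M.dim → K) ω g (h x)
  left : ∀ᶠ y in 𝓝 x, g (h y) = y
  right : ∀ᶠ w in 𝓝 (h x), h (g w) = w

/-- The coordinates of a chart. -/
def chartCoord (M : AnalyticManifold K) (x : M.X) : M.Coord x M.dim where
  h := extChartAt 𝓘(K, Fin M.dim → K) x
  g := (extChartAt 𝓘(K, Fin M.dim → K) x).symm
  an_h := contMDiffAt_extChartAt
  an_g := (contMDiffOn_extChartAt_symm x).contMDiffAt (extChartAt_target_mem_nhds x)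
  left := by
    filter_upwards [extChartAt_source_mem_nhds (I := 𝓘(K, Fin M.dim → K)) x] with y hy
    exact (extChartAt 𝓘(K, Fin M.dim → K) x).left_inv hy
  right := by
    filter_upwards [extChartAt_target_mem_nhds (I := 𝓘(K, Fin M.dim → K)) x] with y hy
    exact (extChartAt 𝓘(K, Fin M.dim → K) x).right_inv hy

namespace Coord

variable {N : ℕ} (c : M.Coord x N)

theorem g_h : c.g (c.h x) = x := c.left.self_of_nhds

theorem tendsto_g : Filter.Tendsto c.g (𝓝 (c.h x)) (𝓝 x) := by
  have := c.an_g.continuousAt.tendsto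
  rwa [c.g_h] at this

theorem tendsto_h : Filter.Tendsto c.h (𝓝 x) (𝓝 (c.h x)) := c.an_h.continuousAt.tendsto

theorem analyticAt {f : M.X → K} (hf : M.IsAn f x) : AnalyticAt K (f ∘ c.g) (c.h x) :=
  (contMDiffAt_iff_contDiffAt.1 (ContMDiffAt.comp_of_eq hf c.an_g c.g_h)).analyticAt

theorem isAn [CompleteSpace K] {F : (Fin N → K) → K} (hF : AnalyticAt K F (c.h x)) :
    M.IsAn (F ∘ c.h) x :=
  (contMDiffAt_iff_contDiffAt.2 hF.contDiffAt).comp x c.an_h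

theorem isAn_fn (s : Fin N) : M.IsAn (fun y => c.h y s) x := contMDiffAt_pi_space.1 c.an_h s

/-- The coordinate functions. -/
def fn (s : Fin N) : analyticStalk M x := toGerm (fun y => c.h y s) (c.isAn_fn s)

@[simp]
theorem value_fn (s : Fin N) : value x (c.fn s) = c.h x s := rfl

/-- Division along all coordinate directions at once: projecting them all away leaves the base
point, so the remainder is the value there. -/
theorem exists_eq_sum [CompleteSpace K] (φ : analyticStalk M x) : ∃ ψ : Fin N → analyticStalk M x,
    φ = const x (value x φ) + ∑ s, (c.fn s - const x (c.h x s)) * ψ s := by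
  obtain ⟨f, hf, rfl⟩ := exists_toGerm φ
  obtain ⟨G, hG, h⟩ := exists_analyticAt_sum_mul_eq (c.analyticAt hf)
    (fun s => ContinuousLinearMap.proj s) (fun s => Pi.single s 1)
    (fun i j => by simp [Pi.single_apply])
  refine ⟨fun s => toGerm (G s ∘ c.h) (c.isAn (hG s)), ?_⟩
  have hs : ∀ s, (c.fn s - const x (c.h x s)) * toGerm (G s ∘ c.h) (c.isAn (hG s)) =
      toGerm (fun y => (c.h y s - c.h x s) * G s (c.h y))
        (((c.isAn_fn s).sub contMDiffAt_const).mul (c.isAn (hG s))) := fun s => rfl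
  simp only [hs]
  rw [toGerm_sum]
  refine (toGerm_eq_iff (hg := contMDiffAt_const.add (isAn_sum fun s =>
    ((c.isAn_fn s).sub contMDiffAt_const).mul (c.isAn (hG s))))).2 ?_
  filter_upwards [c.tendsto_h.eventually h, c.left] with y h1 h2
  have h3 : c.h y - ∑ j, (c.h y - c.h x) j • (Pi.single j 1 : Fin N → K) = c.h x := by
    rw [← pi_eq_sum_univ']
    simp
  simp only [ContinuousLinearMap.proj_apply, Function.comp_apply] at h1
  rw [h3, h2, c.g_h, sub_eq_iff_eq_add'] at h1
  exact h1

theorem maximalIdeal_eq [CompleteSpace K] :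
    maximalIdeal (analyticStalk M x) =
      Ideal.span (Set.range fun s => c.fn s - const x (c.h x s)) := by
  refine le_antisymm (fun φ hφ => ?_) (Ideal.span_le.2 ?_)
  · obtain ⟨ψ, hψ⟩ := c.exists_eq_sum φ
    rw [(mem_maximalIdeal_iff φ).1 hφ, map_zero, zero_add] at hψ
    rw [hψ]
    exact Ideal.sum_mem _ fun s _ => Ideal.mul_mem_right _ _ (Ideal.subset_span ⟨s, rfl⟩)
  · rintro _ ⟨s, rfl⟩
    exact (mem_maximalIdeal_iff _).2 (by simp)

/-- A function vanishing at the point is `O` of the distance, being differentiable. The auxiliary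
`J` handles the sums of products which make up a power of an ideal. -/
theorem isBigO_of_mem_pow [CompleteSpace K] (n : ℕ) {f : M.X → K} (hf : M.IsAn f x)
    (h : toGerm f hf ∈ maximalIdeal (analyticStalk M x) ^ n) :
    (f ∘ c.g) =O[𝓝 (c.h x)] fun y => ‖y - c.h x‖ ^ n := by
  induction n generalizing f with
  | zero =>
    simpa using (c.analyticAt hf).continuousAt.isBigO_one (F := ℝ)
  | succ n ih =>
    rw [pow_succ'] at h
    let J : AddSubmonoid (analyticStalk M x) :=
      { carrier := {φ | ∃ f, ∃ hf : M.IsAn f x, toGerm f hf = φ ∧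
          (f ∘ c.g) =O[𝓝 (c.h x)] fun y => ‖y - c.h x‖ ^ (n + 1)}
        zero_mem' := ⟨0, contMDiffAt_const, rfl, Asymptotics.isBigO_zero _ _⟩
        add_mem' := by
          rintro _ _ ⟨f, hf, rfl, h⟩ ⟨g, hg, rfl, h'⟩
          exact ⟨_, hf.add hg, rfl, h.add h'⟩ }
    have hJ : toGerm f hf ∈ J := by
      refine Submodule.mul_induction_on h (fun φ hφ ψ hψ => ?_) fun _ _ => J.add_mem
      obtain ⟨f₁, hf₁, rfl⟩ := exists_toGerm φ
      obtain ⟨f₂, hf₂, rfl⟩ := exists_toGerm ψ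
      refine ⟨_, hf₁.mul hf₂, rfl, ?_⟩
      have h1 : (f₁ ∘ c.g) =O[𝓝 (c.h x)] fun y => ‖y - c.h x‖ := by
        have h2 := (c.analyticAt hf₁).differentiableAt.hasFDerivAt.isBigO_sub
        have h3 : (f₁ ∘ c.g) (c.h x) = 0 := by
          rw [Function.comp_apply, c.g_h]
          exact (mem_maximalIdeal_iff _).1 hφ
        simp only [h3, sub_zero] at h2
        exact h2.norm_right
      have := h1.mul (ih hf₂ hψ)
      simp only [← pow_succ'] at this
      exact this
    obtain ⟨f', hf', he, hO⟩ := hJ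
    refine hO.congr' ?_ Filter.EventuallyEq.rfl
    exact (toGerm_eq_iff.1 he).comp_tendsto c.tendsto_g

end Coord

/-- Such a germ is flat, and flat analytic functions vanish. Noetherianity of the ring of germs is
not needed. -/
theorem eq_zero_of_forall_mem_pow [CompleteSpace K] {φ : analyticStalk M x}
    (h : ∀ n, φ ∈ maximalIdeal (analyticStalk M x) ^ n) : φ = 0 := by
  obtain ⟨f, hf, rfl⟩ := exists_toGerm φ
  let c := M.chartCoord x
  have h0 := eventually_eq_zero_of_flat (c.analyticAt hf) fun n => c.isBigO_of_mem_pow n hf (h n)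
  refine (toGerm_eq_iff (g := 0) (hg := contMDiffAt_const)).2 ?_
  filter_upwards [c.tendsto_h.eventually h0, c.left] with y h1 h2
  rw [Function.comp_apply, h2] at h1
  exact h1

/-- A derivation along a homomorphism of local rings is determined by its values on constants and
on coordinate functions. -/
theorem Coord.derivation_ext [CompleteSpace K] {N : ℕ} (c : M.Coord x N) {x' : B.X}
    {ψ : analyticStalk M x →+* analyticStalk B x'} [IsLocalHom ψ]
    {d d' : analyticStalk M x →+ analyticStalk B x'}
    (hd : ∀ a b, d (a * b) = ψ a * d b + ψ b * d a)
    (hd' : ∀ a b, d' (a * b) = ψ a * d' b + ψ b * d' a)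
    (hK : ∀ r, d (const x r) = d' (const x r)) (hc : ∀ s, d (c.fn s) = d' (c.fn s)) : d = d' := by
  -- Expanding `φ` in the coordinates expresses the difference by differences at the coefficients,
  -- multiplied by elements of the maximal ideal; each round gains one power.
  have key : ∀ n, ∀ φ, d φ - d' φ ∈ maximalIdeal (analyticStalk B x') ^ n := by
    intro n
    induction n with
    | zero => intro φ; simp
    | succ n ih =>
      intro φ
      obtain ⟨θ, hθ⟩ := c.exists_eq_sum φ
      have h1 : d φ - d' φ =
          ∑ s, ψ (c.fn s - const x (c.h x s)) * (d (θ s) - d' (θ s)) := by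
        rw [hθ]
        simp only [map_add, map_sum, hd, hd', map_sub, hK, hc, add_sub_add_left_eq_sub]
        rw [← Finset.sum_sub_distrib]
        exact Finset.sum_congr rfl fun s _ => by ring
      rw [h1, pow_succ']
      refine Ideal.sum_mem _ fun s _ => Ideal.mul_mem_mul ?_ (ih _)
      rw [mem_maximalIdeal, mem_nonunits_iff, isUnit_map_iff, ← mem_nonunits_iff,
        ← mem_maximalIdeal, mem_maximalIdeal_iff]
      simp
  exact AddMonoidHom.ext fun φ => sub_eq_zero.1 (eq_zero_of_forall_mem_pow fun n => key n φ)

end AnalyticManifold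

end Desing

namespace Desing

open IsLocalRing

namespace AnalyticManifold

variable {K : Type u} [NontriviallyNormedField K] [CompleteSpace K] {A B M : AnalyticManifold K}
  {x : M.X}

/-! ### Partial derivatives -/

namespace Coord

variable {N : ℕ} (c : M.Coord x N)

/-- The partial derivative of a function with respect to the coordinates. -/
def pdFun (s : Fin N) (f : M.X → K) (y : M.X) : K :=
  fderiv K (f ∘ c.g) (c.h y) (Pi.single s 1)

theorem isAn_pdFun (s : Fin N) {f : M.X → K} (hf : M.IsAn f x) : M.IsAn (c.pdFun s f) x :=
  c.isAn (F := fun w => fderiv K (f ∘ c.g) w (Pi.single s 1))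
    (((ContinuousLinearMap.apply K K (Pi.single s 1 : Fin N → K)).analyticAt _).comp
      (c.analyticAt hf).fderiv)

theorem pdFun_eventuallyEq (s : Fin N) {f f' : M.X → K} (h : f =ᶠ[𝓝 x] f') :
    c.pdFun s f =ᶠ[𝓝 x] c.pdFun s f' := by
  have h1 : (f ∘ c.g) =ᶠ[𝓝 (c.h x)] (f' ∘ c.g) := h.comp_tendsto c.tendsto_g
  filter_upwards [c.tendsto_h.eventually (h1.fderiv (𝕜 := K))] with y hy
  simp only [pdFun, hy]

theorem eventually_differentiableAt {f : M.X → K} (hf : M.IsAn f x) :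
    ∀ᶠ y in 𝓝 x, DifferentiableAt K (f ∘ c.g) (c.h y) :=
  c.tendsto_h.eventually ((c.analyticAt hf).eventually_analyticAt.mono
    fun _ h => h.differentiableAt)

/-- The partial derivatives, as derivations of the local ring. -/
def pd (s : Fin N) : Derivation ℤ (analyticStalk M x) (analyticStalk M x) :=
  -- The derivative of a germ is defined through a chosen representative, and does not depend on it.
  have key : ∀ {f : M.X → K} (hf : M.IsAn f x),
      toGerm _ (c.isAn_pdFun s (exists_toGerm (toGerm f hf)).choose_spec.choose) =
        toGerm _ (c.isAn_pdFun s hf) := fun {f} hf =>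
    toGerm_eq_iff.2 (c.pdFun_eventuallyEq s (toGerm_eq_iff.1
      (exists_toGerm (toGerm f hf)).choose_spec.choose_spec))
  Derivation.mk' (AddMonoidHom.toIntLinearMap (AddMonoidHom.mk' (fun φ =>
    toGerm _ (c.isAn_pdFun s (exists_toGerm φ).choose_spec.choose)) (by
      intro φ ψ
      obtain ⟨f, hf, rfl⟩ := exists_toGerm φ
      obtain ⟨g, hg, rfl⟩ := exists_toGerm ψ
      rw [toGerm_add, key, key, key, toGerm_add]
      refine toGerm_eq_iff.2 ?_
      filter_upwards [c.eventually_differentiableAt hf, c.eventually_differentiableAt hg]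
        with y h1 h2
      simp only [pdFun]
      rw [show (fun y => f y + g y) ∘ c.g = (f ∘ c.g) + (g ∘ c.g) from rfl, fderiv_add h1 h2]
      rfl))) (by
      intro φ ψ
      obtain ⟨f, hf, rfl⟩ := exists_toGerm φ
      obtain ⟨g, hg, rfl⟩ := exists_toGerm ψ
      change toGerm _ (c.isAn_pdFun s (exists_toGerm (toGerm f hf * toGerm g hg)).choose_spec.choose)
        = toGerm f hf * toGerm _ (c.isAn_pdFun s (exists_toGerm (toGerm g hg)).choose_spec.choose) +
          toGerm g hg * toGerm _ (c.isAn_pdFun s (exists_toGerm (toGerm f hf)).choose_spec.choose)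
      rw [toGerm_mul, key, key, key, toGerm_mul, toGerm_mul, toGerm_add]
      refine toGerm_eq_iff.2 ?_
      filter_upwards [c.eventually_differentiableAt hf, c.eventually_differentiableAt hg, c.left]
        with y h1 h2 h3
      simp only [pdFun]
      rw [show (fun y => f y * g y) ∘ c.g = (f ∘ c.g) * (g ∘ c.g) from rfl, fderiv_mul h1 h2]
      simp [h3])

theorem pd_toGerm (s : Fin N) {f : M.X → K} (hf : M.IsAn f x) :
    c.pd s (toGerm f hf) = toGerm (c.pdFun s f) (c.isAn_pdFun s hf) :=
  (toGerm_eq_iff (hf := c.isAn_pdFun s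
    (exists_toGerm (toGerm f hf)).choose_spec.choose)).2 (c.pdFun_eventuallyEq s (toGerm_eq_iff.1
    (exists_toGerm (toGerm f hf)).choose_spec.choose_spec))

theorem pd_const (s : Fin N) (r : K) : c.pd s (const x r) = 0 := by
  refine (c.pd_toGerm s contMDiffAt_const).trans ?_
  refine (toGerm_eq_iff (g := 0) (hg := contMDiffAt_const)).2 (Filter.Eventually.of_forall fun y => ?_)
  change fderiv K (fun _ => r) (c.h y) (Pi.single s 1) = 0
  simp

theorem pd_fn (s t : Fin N) : c.pd s (c.fn t) = if s = t then 1 else 0 := by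
  have h1 : c.pd s (c.fn t) = const x (if s = t then 1 else 0) := by
    refine (c.pd_toGerm s (c.isAn_fn t)).trans ?_
    refine (toGerm_eq_iff (hg := contMDiffAt_const)).2 ?_
    have h1 : ((fun y => c.h y t) ∘ c.g) =ᶠ[𝓝 (c.h x)]
        (ContinuousLinearMap.proj t : (Fin N → K) →L[K] K) :=
      c.right.mono fun w hw => congrFun hw t
    filter_upwards [c.tendsto_h.eventually (h1.fderiv (𝕜 := K))] with y hy
    simp only [pdFun]
    rw [hy, ContinuousLinearMap.fderiv]
    simp [Pi.single_apply, eq_comm]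
  rw [h1]
  split_ifs
  · exact map_one _
  · exact map_zero _

/-- The same pair of maps is a coordinate system at nearby points, so the partial derivatives at one
point spread to a family. -/
theorem eventually_coord :
    ∀ᶠ w in 𝓝 x, ∃ c' : M.Coord w N, c'.h = c.h ∧ c'.g = c.g := by
  have h1 := (contMDiffAt_iff_contMDiffAt_nhds (by decide)).1 c.an_h
  have h2 := (contMDiffAt_iff_contMDiffAt_nhds (by decide)).1 c.an_g
  filter_upwards [h1, c.tendsto_h.eventually h2, eventually_eventually_nhds.2 c.left,
    c.tendsto_h.eventually (eventually_eventually_nhds.2 c.right)] with w a1 a2 a3 a4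
  exact ⟨⟨c.h, c.g, a1, a2, a3, a4⟩, rfl, rfl⟩

end Coord

/-! ### Sections and derivations -/

variable (M)

/-- Families of germs which come from an analytic function near `a`. -/
def Sec (a : M.X) : Subring (∀ w, analyticStalk M w) where
  carrier := {s | ∃ f : M.X → K, ∀ᶠ w in 𝓝 a, ∃ hf : M.IsAn f w, s w = toGerm f hf}
  zero_mem' := ⟨fun _ => 0, Filter.Eventually.of_forall fun _ => ⟨contMDiffAt_const, rfl⟩⟩
  one_mem' := ⟨fun _ => 1, Filter.Eventually.of_forall fun _ => ⟨contMDiffAt_const, rfl⟩⟩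
  neg_mem' := by
    rintro s ⟨f, h⟩
    refine ⟨-f, h.mono ?_⟩
    rintro w ⟨hf, hs⟩
    exact ⟨hf.neg, by rw [Pi.neg_apply, hs]; rfl⟩
  add_mem' := by
    rintro s t ⟨f, h⟩ ⟨g, h'⟩
    refine ⟨fun y => f y + g y, (h.and h').mono ?_⟩
    rintro w ⟨⟨hf, hs⟩, hg, ht⟩
    exact ⟨hf.add hg, by rw [Pi.add_apply, hs, ht]; rfl⟩
  mul_mem' := by
    rintro s t ⟨f, h⟩ ⟨g, h'⟩
    refine ⟨fun y => f y * g y, (h.and h').mono ?_⟩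
    rintro w ⟨⟨hf, hs⟩, hg, ht⟩
    exact ⟨hf.mul hg, by rw [Pi.mul_apply, hs, ht]; rfl⟩

/-- Derivations over the ground field. -/
def Der (a : M.X) :
    Submodule (analyticStalk M a) (Derivation ℤ (analyticStalk M a) (analyticStalk M a)) where
  carrier := {δ | ∀ r, δ (const a r) = 0}
  zero_mem' := fun _ => rfl
  add_mem' := fun h h' c => by simp [h c, h' c]
  smul_mem' := fun r δ h c => by simp [h c]

variable {M} {a : M.X}

theorem exists_sec (φ : analyticStalk M a) : ∃ s ∈ M.Sec a, s a = φ := by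
  classical
  obtain ⟨f, hf, rfl⟩ := exists_toGerm φ
  exact ⟨fun w => if h : M.IsAn f w then toGerm f h else 0,
    ⟨f, (isAn_eventually hf).mono fun w h => ⟨h, dif_pos h⟩⟩, dif_pos hf⟩

theorem sec_eventually_eq_zero {s : ∀ w, analyticStalk M w} (hs : s ∈ M.Sec a) (h : s a = 0) :
    ∀ᶠ w in 𝓝 a, s w = 0 := by
  obtain ⟨f, hf⟩ := hs
  obtain ⟨h1, h2⟩ := hf.self_of_nhds
  rw [h2] at h
  have h3 := (toGerm_eq_iff (g := 0) (hg := contMDiffAt_const)).1 h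
  filter_upwards [hf, eventually_eventually_nhds.2 h3] with w hw hw'
  rw [hw.2]
  exact (toGerm_eq_iff (g := 0) (hg := contMDiffAt_const)).2 hw'

theorem Coord.pd_mem_der {N : ℕ} (c : M.Coord a N) (s : Fin N) : c.pd s ∈ M.Der a :=
  c.pd_const s

theorem Coord.derivation_eq {N : ℕ} (c : M.Coord a N) {δ δ'} (hδ : δ ∈ M.Der a)
    (hδ' : δ' ∈ M.Der a) (h : ∀ s, δ (c.fn s) = δ' (c.fn s)) : δ = δ' := by
  have : IsLocalHom (RingHom.id (analyticStalk M a)) := inferInstance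
  have := c.derivation_ext (ψ := RingHom.id _) (d := δ.toLinearMap.toAddMonoidHom)
    (d' := δ'.toLinearMap.toAddMonoidHom) (fun a b => by simp) (fun a b => by simp)
    (fun r => (hδ r).trans (hδ' r).symm) h
  exact Derivation.ext fun r => DFunLike.congr_fun this r

theorem Coord.eq_sum_pd {N : ℕ} (c : M.Coord a N) {δ} (hδ : δ ∈ M.Der a) :
    δ = ∑ s, δ (c.fn s) • c.pd s := by
  refine c.derivation_eq hδ (Submodule.sum_mem _ fun s _ =>
    Submodule.smul_mem _ _ (c.pd_mem_der s)) fun t => ?_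
  rw [derivation_sum_apply]
  simp [c.pd_fn]

/-- In coordinates `δ = ∑ G s • ∂_s` with analytic `G s`, and this formula makes sense at all points
near `a`. -/
theorem exists_der_family {δ} (hδ : δ ∈ M.Der a) :
    ∃ D : ∀ w, Derivation ℤ (analyticStalk M w) (analyticStalk M w), D a = δ ∧
      (∀ᶠ w in 𝓝 a, D w ∈ M.Der w) ∧ ∀ s ∈ M.Sec a, (fun w => D w (s w)) ∈ M.Sec a := by
  classical
  let c := M.chartCoord a
  choose G hG hGδ using fun s => exists_toGerm (δ (c.fn s))
  let P : M.X → Prop := fun w => (∃ c' : M.Coord w M.dim, c'.h = c.h ∧ c'.g = c.g) ∧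
    ∀ s, M.IsAn (G s) w
  have hP : ∀ᶠ w in 𝓝 a, P w :=
    c.eventually_coord.and (Filter.eventually_all.2 fun s => isAn_eventually (hG s))
  refine ⟨fun w => if h : P w then ∑ s, toGerm (G s) (h.2 s) • h.1.choose.pd s else 0, ?_, ?_, ?_⟩
  · have h : P a := hP.self_of_nhds
    refine (dif_pos h).trans ?_
    have hfn : ∀ s, h.1.choose.fn s = c.fn s := fun s =>
      toGerm_eq_iff.2 (Filter.Eventually.of_forall fun y =>
        congrFun (congrFun h.1.choose_spec.1 y) s)
    rw [h.1.choose.eq_sum_pd hδ]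
    exact Finset.sum_congr rfl fun s _ => by rw [hGδ, hfn]
  · filter_upwards [hP] with w hw
    rw [dif_pos hw]
    exact Submodule.sum_mem _ fun s _ => Submodule.smul_mem _ _ (Coord.pd_mem_der _ s)
  · rintro t ⟨f, hf⟩
    refine ⟨fun y => ∑ s, G s y * c.pdFun s f y, ?_⟩
    filter_upwards [hP, hf] with w hw hfw
    obtain ⟨hfw, ht⟩ := hfw
    have h1 : ∀ s, hw.1.choose.pdFun s f = c.pdFun s f := fun s => by
      funext y
      rw [Coord.pdFun, Coord.pdFun, hw.1.choose_spec.1, hw.1.choose_spec.2]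
    have h2 : ∀ s, M.IsAn (c.pdFun s f) w := fun s => by
      rw [← h1]
      exact Coord.isAn_pdFun _ s hfw
    refine ⟨isAn_sum fun s => (hw.2 s).mul (h2 s), ?_⟩
    rw [dif_pos hw, derivation_sum_apply, ht]
    refine Eq.trans (Finset.sum_congr rfl fun s _ => ?_)
      (toGerm_sum Finset.univ fun s => (hw.2 s).mul (h2 s))
    rw [Derivation.smul_apply, Coord.pd_toGerm, smul_eq_mul, toGerm_mul]
    exact toGerm_eq_iff.2 (Filter.Eventually.of_forall fun y => by
      simp only [h1, Pi.mul_apply])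

/-- Expand `φ` as a sum of centred coordinates times `ψ s`. Modulo the maximal ideal its partial
derivatives are the `ψ s`, so these lie in the maximal ideal. -/
theorem mem_sq_of_der (φ : analyticStalk M a) (hφ : φ ∈ maximalIdeal (analyticStalk M a))
    (h : ∀ δ ∈ M.Der a, δ φ ∈ maximalIdeal (analyticStalk M a)) :
    φ ∈ maximalIdeal (analyticStalk M a) ^ 2 := by
  let c := M.chartCoord a
  have hm : ∀ s, c.fn s - const a (c.h a s) ∈ maximalIdeal (analyticStalk M a) := fun s =>
    (mem_maximalIdeal_iff _).2 (by simp)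
  obtain ⟨ψ, hψ⟩ := c.exists_eq_sum φ
  rw [(mem_maximalIdeal_iff φ).1 hφ, map_zero, zero_add] at hψ
  have hψm : ∀ t, ψ t ∈ maximalIdeal (analyticStalk M a) := fun t => by
    have h1 := h _ (c.pd_mem_der t)
    rw [hψ, map_sum] at h1
    simp only [Derivation.leibniz, map_sub, c.pd_fn, c.pd_const, sub_zero, smul_eq_mul,
      mul_ite, mul_one, mul_zero, Finset.sum_add_distrib, Finset.sum_ite_eq, Finset.mem_univ,
      if_true] at h1
    refine (Ideal.add_mem_iff_right _ ?_).1 h1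
    exact Ideal.sum_mem _ fun s _ => Ideal.mul_mem_right _ _ (hm s)
  rw [hψ, pow_two]
  exact Ideal.sum_mem _ fun s _ => Ideal.mul_mem_mul (hm s) (hψm s)

theorem fg_maximalIdeal (a : M.X) : (maximalIdeal (analyticStalk M a)).FG := by
  rw [(M.chartCoord a).maximalIdeal_eq]
  exact Submodule.fg_span (Set.finite_range _)

theorem isUnit_natCast [CharZero K] (a : M.X) (n : ℕ) (hn : n ≠ 0) :
    IsUnit (n : analyticStalk M a) := by
  have : IsUnit (n : K) := (Nat.cast_ne_zero.2 hn).isUnit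
  simpa using this.map (const a)

end AnalyticManifold

end Desing

namespace Desing

open IsLocalRing

namespace AnalyticManifold

variable {K : Type u} [NontriviallyNormedField K] [CompleteSpace K] {A B M : AnalyticManifold K}
  {a : M.X}

/-! ### Coordinates adapted to a submanifold -/

/-- Change of coordinates by an analytic map with invertible differential. -/
theorem Coord.exists_trans {N : ℕ} (c : M.Coord a N) {Φ : (Fin N → K) → Fin N → K}
    (hΦ : AnalyticAt K Φ (c.h a))
    (hd : HasFDerivAt Φ (ContinuousLinearMap.id K (Fin N → K)) (c.h a)) :
    ∃ c' : M.Coord a N, c'.h = Φ ∘ c.h := by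
  have hs : HasStrictFDerivAt Φ ((ContinuousLinearEquiv.refl K (Fin N → K) :
      (Fin N → K) ≃L[K] (Fin N → K)) : (Fin N → K) →L[K] (Fin N → K)) (c.h a) := by
    have := hΦ.hasStrictFDerivAt
    rwa [hd.fderiv] at this
  let e := hs.toOpenPartialHomeomorph Φ
  have hsrc : c.h a ∈ e.source := hs.mem_toOpenPartialHomeomorph_source
  have htgt : Φ (c.h a) ∈ e.target := hs.image_mem_toOpenPartialHomeomorph_target
  have hinv : e.symm (Φ (c.h a)) = c.h a := e.left_inv hsrc
  have hsymm : ContDiffAt K ω e.symm (Φ (c.h a)) := by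
    refine e.contDiffAt_symm (f₀' := ContinuousLinearEquiv.refl K (Fin N → K)) htgt ?_ ?_
    · rw [hinv]; exact hs.hasFDerivAt
    · rw [hinv]; exact hΦ.contDiffAt
  refine ⟨⟨Φ ∘ c.h, c.g ∘ e.symm, (contMDiffAt_iff_contDiffAt.2 hΦ.contDiffAt).comp a c.an_h,
    ContMDiffAt.comp_of_eq c.an_g (contMDiffAt_iff_contDiffAt.2 hsymm) hinv, ?_, ?_⟩, rfl⟩
  · filter_upwards [c.left, c.tendsto_h.eventually (e.eventually_left_inverse hsrc)] with y h1 h2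
    have h3 : e.symm (Φ (c.h y)) = c.h y := h2
    simp only [Function.comp_apply, h3, h1]
  · have ht : Filter.Tendsto e.symm (𝓝 (Φ (c.h a))) (𝓝 (c.h a)) := by
      have := (e.continuousAt_symm htgt).tendsto
      rwa [hinv] at this
    filter_upwards [ht.eventually c.right, e.eventually_right_inverse htgt] with w h1 h2
    have h3 : Φ (e.symm w) = w := h2
    simp only [Function.comp_apply, h1, h3]

/-- The map `Φ` adds to each point the nonlinear part of `ζ j` in the direction `v j`. Its
differential at the base point is the identity, so it is a change of coordinates, after which the `z
i` are linear. -/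
theorem exists_adapted_coord {k : ℕ} {z : Fin k → analyticStalk M a} (hz : HasDual (M.Der a) z) :
    ∃ (c : M.Coord a M.dim) (ℓ : Fin k → (Fin M.dim → K) →L[K] K) (v : Fin k → Fin M.dim → K),
      (∀ i j, ℓ i (v j) = if i = j then 1 else 0) ∧
      ∀ i, ∃ ζ, ∃ hζ : M.IsAn ζ a, z i = toGerm ζ hζ ∧
        ∀ᶠ y in 𝓝 a, ζ y = ℓ i (c.h y - c.h a) := by
  obtain ⟨D, hD, hd⟩ := hz.exists_exact
  have hzm := hz.1
  let c := M.chartCoord a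
  choose ζ hζ hzζ using fun i => exists_toGerm (z i)
  let v : Fin k → Fin M.dim → K := fun j s => value a (D j (c.fn s))
  let ℓ : Fin k → (Fin M.dim → K) →L[K] K := fun i => fderiv K (ζ i ∘ c.g) (c.h a)
  have hζ0 : ∀ i, ζ i a = 0 := fun i => by
    have := (mem_maximalIdeal_iff _).1 (hzm i)
    rwa [← hzζ] at this
  have hℓv : ∀ i j, ℓ i (v j) = if i = j then 1 else 0 := fun i j => by
    have h1 := congrArg (value a) (hd j i)
    rw [c.eq_sum_pd (hD j), derivation_sum_apply, map_sum, ← hzζ] at h1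
    simp only [Derivation.smul_apply, smul_eq_mul, map_mul, c.pd_toGerm, value_toGerm] at h1
    rw [pi_eq_sum_univ' (v j), map_sum]
    simp only [map_smul, smul_eq_mul]
    refine h1.trans ?_
    rcases eq_or_ne i j with rfl | hij
    · simp
    · simp [hij, hij.symm]
  let Φ : (Fin M.dim → K) → Fin M.dim → K := fun w =>
    w + ∑ j, (ζ j (c.g w) - ℓ j (w - c.h a)) • v j
  have hΦan : AnalyticAt K Φ (c.h a) := by
    refine analyticAt_id.add (Finset.analyticAt_fun_sum _ fun j _ => ?_)
    exact ((c.analyticAt (hζ j)).sub (((ℓ j).analyticAt _).comp_of_eq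
      (analyticAt_id.sub analyticAt_const) rfl)).smul analyticAt_const
  have hΦd : HasFDerivAt Φ (ContinuousLinearMap.id K (Fin M.dim → K)) (c.h a) := by
    have h1 : ∀ j, HasFDerivAt (fun w => (ζ j (c.g w) - ℓ j (w - c.h a)) • v j)
        (0 : (Fin M.dim → K) →L[K] (Fin M.dim → K)) (c.h a) := fun j => by
      have h2 : HasFDerivAt (ζ j ∘ c.g) (ℓ j) (c.h a) :=
        (c.analyticAt (hζ j)).differentiableAt.hasFDerivAt
      have h3 : HasFDerivAt (fun w => ℓ j (w - c.h a)) (ℓ j) (c.h a) := by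
        have h := (ℓ j).hasFDerivAt.comp (c.h a) ((hasFDerivAt_id (c.h a)).sub_const (c.h a))
        rw [ContinuousLinearMap.comp_id] at h
        exact h
      have h4 := (h2.sub h3).smul_const (v j)
      simpa using h4
    have h5 := (hasFDerivAt_id (𝕜 := K) (c.h a)).add (HasFDerivAt.fun_sum (u := Finset.univ)
      fun j _ => h1 j)
    rw [Finset.sum_const_zero, add_zero] at h5
    exact h5
  obtain ⟨c', hc'⟩ := c.exists_trans hΦan hΦd
  refine ⟨c', ℓ, v, hℓv, fun i => ⟨ζ i, hζ i, (hzζ i).symm, ?_⟩⟩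
  have hΦa : Φ (c.h a) = c.h a := by simp [Φ, c.g_h, hζ0]
  filter_upwards [c.left] with y hy
  rw [hc']
  simp only [Function.comp_apply, hΦa]
  simp only [Φ, hy, add_sub_right_comm, map_add, map_sum, map_smul, hℓv]
  simp

/-- A submanifold is a retract of a neighbourhood. -/
theorem exists_retraction {k : ℕ} {z : Fin k → analyticStalk M a} (hz : HasDual (M.Der a) z) :
    ∃ (ρ : M.X → M.X) (hρ : IsAnMap ρ a) (h : ρ a = a), (∀ i, pullGerm ρ hρ h (z i) = 0) ∧
      ∀ φ, φ - pullGerm ρ hρ h φ ∈ Ideal.span (Set.range z) := by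
  obtain ⟨c, ℓ, v, hℓv, hζ⟩ := exists_adapted_coord hz
  choose ζ hζ hzζ hζℓ using hζ
  let L : (Fin M.dim → K) → Fin M.dim → K := fun w => w - ∑ j, ℓ j (w - c.h a) • v j
  have hLan : AnalyticAt K L (c.h a) := by
    refine analyticAt_id.sub (Finset.analyticAt_fun_sum _ fun j _ => ?_)
    exact (((ℓ j).analyticAt _).comp_of_eq (analyticAt_id.sub analyticAt_const) rfl).smul
      analyticAt_const
  have hLa : L (c.h a) = c.h a := by simp [L]
  have hLt : Filter.Tendsto L (𝓝 (c.h a)) (𝓝 (c.h a)) := by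
    have := hLan.continuousAt.tendsto
    rwa [hLa] at this
  have hLh : ContMDiffAt 𝓘(K, Fin M.dim → K) 𝓘(K, Fin M.dim → K) ω (L ∘ c.h) a :=
    (contMDiffAt_iff_contDiffAt.2 hLan.contDiffAt).comp a c.an_h
  have hρ : IsAnMap (c.g ∘ L ∘ c.h) a := ContMDiffAt.comp_of_eq c.an_g hLh hLa
  have hρa : (c.g ∘ L ∘ c.h) a = a := by simp [hLa, c.g_h]
  refine ⟨c.g ∘ L ∘ c.h, hρ, hρa, fun i => ?_, fun φ => ?_⟩
  · rw [hzζ, pullGerm_toGerm]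
    refine (toGerm_eq_iff (g := 0) (hg := contMDiffAt_const)).2 ?_
    have hT : Filter.Tendsto (c.g ∘ L ∘ c.h) (𝓝 a) (𝓝 a) := by
      have := hρ.continuousAt.tendsto
      rwa [hρa] at this
    filter_upwards [hT.eventually (hζℓ i), c.tendsto_h.eventually (hLt.eventually c.right)]
      with y h1 h2
    simp only [Function.comp_apply] at h1 ⊢
    rw [h1, h2]
    simp [L, hℓv]
  · obtain ⟨f, hf, rfl⟩ := exists_toGerm φ
    obtain ⟨G, hG, h⟩ := exists_analyticAt_sum_mul_eq (c.analyticAt hf) ℓ v hℓv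
    have h1 : toGerm f hf - pullGerm (c.g ∘ L ∘ c.h) hρ hρa (toGerm f hf) =
        ∑ j, z j * toGerm (G j ∘ c.h) (c.isAn (hG j)) := by
      simp only [hzζ, toGerm_mul]
      rw [toGerm_sum, pullGerm_toGerm, toGerm_sub]
      refine toGerm_eq_iff.2 ?_
      filter_upwards [c.tendsto_h.eventually h, c.left, Filter.eventually_all.2 hζℓ] with y h2 h3 h4
      simp only [Function.comp_apply, h3] at h2 ⊢
      refine h2.trans (Finset.sum_congr rfl fun j _ => ?_)
      rw [h4]
    rw [h1]
    exact Ideal.sum_mem _ fun j _ => Ideal.mul_mem_right _ _ (Ideal.subset_span ⟨j, rfl⟩)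

/-- Pulling back along the retraction kills the `z i` and puts the pull-back of `φ` into every power
of the maximal ideal, so it is zero. But `φ` differs from its pull-back by an element of the ideal.
-/
theorem separated {k : ℕ} {z : Fin k → analyticStalk M a} (hz : HasDual (M.Der a) z)
    (φ : analyticStalk M a)
    (h : ∀ n, φ ∈ fil (maximalIdeal _) (Ideal.span (Set.range z)) n) :
    φ ∈ Ideal.span (Set.range z) := by
  obtain ⟨ρ, hρ, hρa, hρz, hφ⟩ := exists_retraction hz
  have hloc := isLocalHom_pullGerm hρ hρa
  have h0 : pullGerm ρ hρ hρa φ = 0 := by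
    refine eq_zero_of_forall_mem_pow fun n => ?_
    obtain ⟨α, hα, β, hβ, rfl⟩ := Submodule.mem_sup.1 (h n)
    have hβ' : pullGerm ρ hρ hρa β = 0 := by
      have : Ideal.span (Set.range z) ≤ RingHom.ker (pullGerm ρ hρ hρa) := by
        rw [Ideal.span_le]
        rintro _ ⟨i, rfl⟩
        exact hρz i
      exact this hβ
    rw [map_add, hβ', add_zero]
    have h1 : (maximalIdeal (analyticStalk M a)).map (pullGerm ρ hρ hρa) ≤ maximalIdeal _ :=
      ((local_hom_TFAE (pullGerm ρ hρ hρa)).out 0 2 rfl rfl).1 inferInstance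
    refine Ideal.pow_right_mono h1 n ?_
    rw [← Ideal.map_pow]
    exact Ideal.mem_map_of_mem _ hα
  have := hφ φ
  rwa [h0, sub_zero] at this

/-- The retraction takes values in the submanifold, where `f` vanishes, and `f` differs from its
pull-back by an element of the ideal. No radical intervenes. -/
theorem nullstellensatz {k : ℕ} {z : Fin k → ∀ w, analyticStalk M w} (hz : ∀ i, z i ∈ M.Sec a)
    (hdual : HasDual (M.Der a) fun i => z i a) (f : ∀ w, analyticStalk M w) (hf : f ∈ M.Sec a)
    (h : ∀ᶠ w in 𝓝 a, (∀ i, z i w ∈ maximalIdeal (analyticStalk M w)) →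
      f w ∈ maximalIdeal (analyticStalk M w)) :
    f a ∈ Ideal.span (Set.range fun i => z i a) := by
  obtain ⟨ρ, hρ, hρa, hρz, hφ⟩ := exists_retraction hdual
  choose ζ hζ using hz
  obtain ⟨F, hF⟩ := hf
  obtain ⟨hFa, hfa⟩ := hF.self_of_nhds
  have hT : Filter.Tendsto ρ (𝓝 a) (𝓝 a) := by
    have := hρ.continuousAt.tendsto
    rwa [hρa] at this
  have hz0 : ∀ i, ∀ᶠ y in 𝓝 a, ζ i (ρ y) = 0 := fun i => by
    obtain ⟨h1, h2⟩ := (hζ i).self_of_nhds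
    have h3 := hρz i
    simp only [h2, pullGerm_toGerm] at h3
    exact (toGerm_eq_iff (g := 0) (hg := contMDiffAt_const)).1 h3
  have h0 : pullGerm ρ hρ hρa (f a) = 0 := by
    rw [hfa, pullGerm_toGerm]
    refine (toGerm_eq_iff (g := 0) (hg := contMDiffAt_const)).2 ?_
    filter_upwards [hT.eventually h, hT.eventually hF, hT.eventually (Filter.eventually_all.2 hζ),
      Filter.eventually_all.2 hz0] with y h1 h2 h3 h4
    obtain ⟨hF', hf'⟩ := h2
    have h5 := h1 fun i => by
      obtain ⟨h6, h7⟩ := h3 i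
      rw [h7, mem_maximalIdeal_iff]
      exact h4 i
    rw [hf', mem_maximalIdeal_iff] at h5
    exact h5
  have := hφ (f a)
  rwa [h0, sub_zero] at this

end AnalyticManifold

end Desing

namespace Desing

open IsLocalRing

namespace AnalyticManifold

variable {K : Type u} [NontriviallyNormedField K] {A B L M : AnalyticManifold K}

/-! ### Open immersions -/

/-- An open submanifold. -/
def restrict (M : AnalyticManifold K) (U : TopologicalSpace.Opens M.X) : AnalyticManifold K where
  dim := M.dim
  X := U

/-- An open subset of affine space. -/
def model {N : ℕ} (U : TopologicalSpace.Opens (Fin N → K)) : AnalyticManifold K where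
  dim := N
  X := U

theorem isAnMap_val (U : TopologicalSpace.Opens M.X) (y : (M.restrict U).X) :
    IsAnMap (A := M.restrict U) (B := M) (fun y : U => (y : M.X)) y :=
  (contMDiff_subtype_val (I := 𝓘(K, Fin M.dim → K)) (U := U)) y

theorem isLocalDiffeomorph_val (U : TopologicalSpace.Opens M.X) :
    IsLocalDiffeomorph 𝓘(K, Fin M.dim → K) 𝓘(K, Fin M.dim → K) ω (fun y : U => (y : M.X)) := by
  classical
  intro y
  have hinv : ∀ x : U, ContMDiffAt 𝓘(K, Fin M.dim → K) 𝓘(K, Fin M.dim → K) ω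
      (fun x : M.X => if h : x ∈ U then (⟨x, h⟩ : U) else y) x := fun x => by
    rw [← contMDiffAt_subtype_iff]
    refine contMDiffAt_id.congr_of_eventuallyEq (Filter.Eventually.of_forall fun z => ?_)
    simp
  refine ⟨{ toFun := fun y : U => (y : M.X)
            invFun := fun x => if h : x ∈ U then (⟨x, h⟩ : U) else y
            source := Set.univ
            target := U
            map_source' := fun z _ => z.2
            map_target' := fun _ _ => trivial
            left_inv' := fun z _ => by simp
            right_inv' := fun x hx => by
              have hx' : x ∈ U := hx
              simp [hx']
            open_source := isOpen_univ
            open_target := U.2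
            contMDiffOn_toFun := fun z _ => (contMDiff_subtype_val z).contMDiffWithinAt
            contMDiffOn_invFun := fun x hx => (hinv ⟨x, hx⟩).contMDiffWithinAt }, trivial,
    fun _ _ => rfl⟩

theorem bijective_pullGerm {j : A.X → B.X} {x : A.X} (hj : IsAnMap j x)
    (hd : IsLocalDiffeomorphAt 𝓘(K, Fin A.dim → K) 𝓘(K, Fin B.dim → K) ω j x) :
    Function.Bijective (pullGerm j hj rfl) := by
  obtain ⟨Φ, hx, hΦ⟩ := hd
  have hjx : Φ.toPartialEquiv x = j x := (hΦ hx).symm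
  have hmem : j x ∈ Φ.target := by
    rw [← hjx]
    exact Φ.map_source hx
  have hinv : Φ.symm (j x) = x := by
    rw [← hjx]
    exact Φ.left_inv hx
  have han : ContMDiffAt 𝓘(K, Fin B.dim → K) 𝓘(K, Fin A.dim → K) ω Φ.symm (j x) :=
    Φ.contMDiffOn_invFun.contMDiffAt (Φ.open_target.mem_nhds hmem)
  have hr : ∀ᶠ w in 𝓝 (j x), j (Φ.symm w) = w := by
    filter_upwards [Φ.open_target.mem_nhds hmem] with w hw
    have h1 : j (Φ.symm w) = Φ.toPartialEquiv (Φ.symm w) := hΦ (Φ.map_target hw)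
    exact h1.trans (Φ.right_inv hw)
  have hl : ∀ᶠ y in 𝓝 x, Φ.symm (j y) = y := by
    filter_upwards [Φ.open_source.mem_nhds hx] with y hy
    rw [hΦ hy]
    exact Φ.left_inv hy
  refine ⟨(injective_iff_map_eq_zero _).2 fun φ hφ => ?_, fun φ => ?_⟩
  · obtain ⟨f, hf, rfl⟩ := exists_toGerm φ
    rw [pullGerm_toGerm] at hφ
    have h0 := (toGerm_eq_iff (g := 0) (hg := contMDiffAt_const)).1 hφ
    refine (toGerm_eq_iff (g := 0) (hg := contMDiffAt_const)).2 ?_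
    have ht : Filter.Tendsto Φ.symm (𝓝 (j x)) (𝓝 x) := by
      have := han.continuousAt.tendsto
      rwa [hinv] at this
    filter_upwards [ht.eventually h0, hr] with w h1 h2
    simp only [Function.comp_apply, h2] at h1
    exact h1
  · obtain ⟨f, hf, rfl⟩ := exists_toGerm φ
    refine ⟨toGerm (f ∘ Φ.symm) (ContMDiffAt.comp_of_eq hf han hinv), ?_⟩
    rw [pullGerm_toGerm]
    refine toGerm_eq_iff.2 ?_
    filter_upwards [hl] with y hy
    simp only [Function.comp_apply, hy]

theorem der_openImm {j : A.X → B.X} {x : A.X} (hj : IsAnMap j x)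
    (hd : IsLocalDiffeomorphAt 𝓘(K, Fin A.dim → K) 𝓘(K, Fin B.dim → K) ω j x) (δ)
    (hδ : δ ∈ B.Der (j x)) :
    ∃ δ' ∈ A.Der x, ∀ r, δ' (pullGerm j hj rfl r) = pullGerm j hj rfl (δ r) := by
  obtain ⟨δ', h⟩ := SmoothScheme.exists_derivation_of_bijective (bijective_pullGerm hj hd) δ
  refine ⟨δ', fun c => ?_, h⟩
  rw [← pullGerm_const hj rfl, h, hδ c, map_zero]

theorem exists_open_of_sec {a : M.X} {ι : Type} [Finite ι] {s : ι → ∀ w, analyticStalk M w}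
    (hs : ∀ i, s i ∈ M.Sec a) :
    ∃ (U : TopologicalSpace.Opens M.X) (_ : a ∈ U) (f : ι → M.X → K),
      ∀ i, ∀ w ∈ U, ∃ hf : M.IsAn (f i) w, s i w = toGerm (f i) hf := by
  choose f hf using hs
  obtain ⟨U, hU, hUo, ha⟩ := eventually_nhds_iff.1 (Filter.eventually_all.2 hf)
  exact ⟨⟨U, hUo⟩, ha, f, fun i w hw => hU w hw i⟩

/-! ### Coordinates from a representing map -/

theorem exists_coord_of_section {N : ℕ} {x : L.X} {h : L.X → Fin N → K}
    (hh : ContMDiffAt 𝓘(K, Fin L.dim → K) 𝓘(K, Fin N → K) ω h x)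
    {U : TopologicalSpace.Opens (Fin N → K)} (hU : h x ∈ U) {g : (model U).X → L.X}
    (hg : ∀ u, IsAnMap g u) (right : ∀ u : U, h (g u) = u)
    (left : ∀ᶠ y in 𝓝 x, ∀ hy : h y ∈ U, g ⟨h y, hy⟩ = y) : ∃ c : L.Coord x N, c.h = h := by
  classical
  have hext : ∀ u : U, (fun w => if hw : w ∈ U then g ⟨w, hw⟩ else x : (Fin N → K) → L.X) u = g u :=
    fun u => by
      have : (u : Fin N → K) ∈ U := u.2
      simp [this]
  refine ⟨⟨h, fun w => if hw : w ∈ U then g ⟨w, hw⟩ else x, hh, ?_, ?_, ?_⟩, rfl⟩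
  · refine (contMDiffAt_subtype_iff (x := (⟨h x, hU⟩ : U))).1 ?_
    exact (hg ⟨h x, hU⟩).congr_of_eventuallyEq (Filter.Eventually.of_forall hext)
  · filter_upwards [left, hh.continuousAt.preimage_mem_nhds (U.2.mem_nhds hU)] with y hy hy'
    have hy'' : h y ∈ U := hy'
    simp only [hy'', dif_pos]
    exact hy hy''
  · filter_upwards [U.2.mem_nhds hU] with w hw
    have hw' : w ∈ U := hw
    simp only [hw', dif_pos]
    exact right ⟨w, hw'⟩

end AnalyticManifold

end Desing

namespace Desing

open IsLocalRing

namespace AnalyticManifold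

variable {K : Type u} [NontriviallyNormedField K] {B L M : AnalyticManifold K}

theorem isAnMap_restrict {U : TopologicalSpace.Opens L.X} {f : L.X → B.X} (y : U)
    (h : IsAnMap f (y : L.X)) : IsAnMap (A := L.restrict U) (B := B) (fun y : U => f y) y :=
  (contMDiffAt_subtype_iff (I := 𝓘(K, Fin L.dim → K)) (I' := 𝓘(K, Fin B.dim → K)) (n := ω)
    (U := U)).2 h

theorem isAnMap_model {N : ℕ} {U : TopologicalSpace.Opens (Fin N → K)} {f : (Fin N → K) → B.X}
    (u : U) (h : ContMDiffAt 𝓘(K, Fin N → K) 𝓘(K, Fin B.dim → K) ω f u) :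
    IsAnMap (A := model U) (B := B) (fun u : U => f u) u :=
  (contMDiffAt_subtype_iff (I := 𝓘(K, Fin N → K)) (I' := 𝓘(K, Fin B.dim → K)) (n := ω)
    (U := U)).2 h

theorem isAn_model {N : ℕ} {U : TopologicalSpace.Opens (Fin N → K)} {f : (Fin N → K) → K}
    (u : U) (h : ContMDiffAt 𝓘(K, Fin N → K) 𝓘(K) ω f u) :
    IsAn (model U) (fun u : U => f u) u :=
  (contMDiffAt_subtype_iff (I := 𝓘(K, Fin N → K)) (I' := 𝓘(K)) (n := ω) (U := U)).2 h

/-- That `g ∘ h` is the identity near `x` follows from uniqueness, tested on a neighbourhood of `x`: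
it has the same image under `σ` and the same functions `t j` as the inclusion. -/
theorem exists_coord_of_unique {m N : ℕ} {t : Fin m → L.X → K} {σ : L.X → M.X}
    (huniq : ∀ (T : AnalyticManifold K) (g g' : T.X → L.X), (∀ y, IsAnMap g y) →
      (∀ y, IsAnMap g' y) → (∀ y, σ (g y) = σ (g' y)) → (∀ j y, t j (g y) = t j (g' y)) → g = g')
    {x : L.X} {h : L.X → Fin N → K}
    (hh : ContMDiffAt 𝓘(K, Fin L.dim → K) 𝓘(K, Fin N → K) ω h x)
    {U : TopologicalSpace.Opens (Fin N → K)} (hU : h x ∈ U) {g : (model U).X → L.X}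
    (hg : ∀ u, IsAnMap g u) (right : ∀ u : U, h (g u) = u)
    (hσ : ∀ᶠ y in 𝓝 x, ∀ hy : h y ∈ U, σ (g ⟨h y, hy⟩) = σ y)
    (ht : ∀ᶠ y in 𝓝 x, ∀ (hy : h y ∈ U) (j), t j (g ⟨h y, hy⟩) = t j y) :
    ∃ c : L.Coord x N, c.h = h := by
  classical
  refine exists_coord_of_section hh hU hg right ?_
  obtain ⟨V, hV, hVo, hx⟩ := eventually_nhds_iff.1 (hσ.and (ht.and
    (((contMDiffAt_iff_contMDiffAt_nhds (by decide)).1 hh).and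
      (hh.continuousAt.preimage_mem_nhds (U.2.mem_nhds hU)))))
  let e : (Fin N → K) → L.X := fun w => if hw : w ∈ U then g ⟨w, hw⟩ else x
  have hext : ∀ u : U, e u = g u := fun u => by
    have : (u : Fin N → K) ∈ U := u.2
    simp [e, this]
  have hean : ∀ u : U, ContMDiffAt 𝓘(K, Fin N → K) 𝓘(K, Fin L.dim → K) ω e u := fun u =>
    (contMDiffAt_subtype_iff (x := u)).1
      ((hg u).congr_of_eventuallyEq (Filter.Eventually.of_forall hext))
  let V' : TopologicalSpace.Opens L.X := ⟨V, hVo⟩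
  have key := huniq (L.restrict V') (fun y : V' => e (h y)) (fun y : V' => (y : L.X))
    (fun (y : V') => isAnMap_restrict (f := fun y => e (h y)) y
      (ContMDiffAt.comp (g := e) (f := h) (y : L.X) (hean ⟨h y, (hV y y.2).2.2.2⟩) (hV y y.2).2.2.1))
    (fun y => isAnMap_val V' y)
    (fun (y : V') => (congrArg σ (hext ⟨h y, (hV y y.2).2.2.2⟩)).trans ((hV y y.2).1 _))
    (fun j (y : V') => (congrArg (t j) (hext ⟨h y, (hV y y.2).2.2.2⟩)).trans
      ((hV y y.2).2.1 _ j))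
  filter_upwards [hVo.mem_nhds hx] with y hy hyU
  exact (hext ⟨h y, hyU⟩).symm.trans (congrFun key ⟨y, hy⟩)

/-! ### Products with a line -/

/-- An open subset of `K^(N+1)` is used as test object. Existence yields a parametrization of `L`,
and uniqueness shows that it inverts the map given by `t` and the coordinates of `M`. -/
theorem exists_coord_line {σ : L.X → M.X} (hσ : ∀ y, IsAnMap σ y) {t : L.X → K}
    (ht : ∀ y, L.IsAn t y)
    (hex : ∀ (T : AnalyticManifold K) (f : T.X → M.X) (s : T.X → K), (∀ y, IsAnMap f y) →
      (∀ y, T.IsAn s y) → ∃ g : T.X → L.X, (∀ y, IsAnMap g y) ∧ (∀ y, σ (g y) = f y) ∧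
        ∀ y, t (g y) = s y)
    (huniq : ∀ (T : AnalyticManifold K) (g g' : T.X → L.X), (∀ y, IsAnMap g y) →
      (∀ y, IsAnMap g' y) → (∀ y, σ (g y) = σ (g' y)) → (∀ y, t (g y) = t (g' y)) → g = g')
    (x : L.X) {N : ℕ} (c : M.Coord (σ x) N) :
    ∃ c' : L.Coord x (N + 1), c'.h = fun y => Fin.cons (t y) (c.h (σ y)) := by
  have h2 := (contMDiffAt_iff_contMDiffAt_nhds (by decide)).1 c.an_g
  obtain ⟨W, hW, hWo, hx⟩ := eventually_nhds_iff.1 (h2.and c.right)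
  have htail : Continuous (fun w : Fin (N + 1) → K => Fin.tail w) :=
    continuous_pi fun s => continuous_apply s.succ
  let U : TopologicalSpace.Opens (Fin (N + 1) → K) := ⟨_, hWo.preimage htail⟩
  have htail' : ∀ w : Fin (N + 1) → K, ContMDiffAt 𝓘(K, Fin (N + 1) → K) 𝓘(K, Fin N → K) ω
      (fun w : Fin (N + 1) → K => Fin.tail w) w := fun w =>
    contMDiffAt_pi_space.2 fun s => contMDiffAt_pi_space.1 contMDiffAt_id s.succ
  obtain ⟨g, hg, hgσ, hgt⟩ := hex (model U)
    (fun u : U => c.g (Fin.tail (u : Fin (N + 1) → K)))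
    (fun u : U => (u : Fin (N + 1) → K) 0)
    (fun (u : U) => isAnMap_model (f := fun w => c.g (Fin.tail w)) u
      (ContMDiffAt.comp (u : Fin (N + 1) → K) (hW _ u.2).1 (htail' u)))
    (fun (u : U) => isAn_model (f := fun w : Fin (N + 1) → K => w 0) u
      (contMDiffAt_pi_space.1 contMDiffAt_id 0))
  have hσx : Filter.Tendsto σ (𝓝 x) (𝓝 (σ x)) := (hσ x).continuousAt.tendsto
  refine exists_coord_of_unique (t := fun _ : Fin 1 => t) (σ := σ)
    (fun T g g' h1 h2 h3 h4 => huniq T g g' h1 h2 h3 (h4 0)) ?_ (U := U) ?_ hg ?_ ?_ ?_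
  · refine contMDiffAt_pi_space.2 fun s => ?_
    refine Fin.cases ?_ (fun s => ?_) s
    · exact ht x
    · exact (c.isAn_fn s).comp x (hσ x)
  · change Fin.tail (Fin.cons (t x) (c.h (σ x)) : Fin (N + 1) → K) ∈ W
    rw [Fin.tail_cons]
    exact hx
  · intro u
    refine (congrArg₂ (fun r w => (Fin.cons r (c.h w) : Fin (N + 1) → K)) (hgt u) (hgσ u)).trans ?_
    rw [(hW _ u.2).2]
    exact Fin.cons_self_tail _
  · filter_upwards [hσx.eventually c.left] with y hy hyU
    exact (hgσ ⟨_, hyU⟩).trans (by simpa using hy)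
  · filter_upwards with y hyU _
    exact (hgt ⟨_, hyU⟩).trans (by simp)

/-- The lift has the components of `δ` in the coordinates of `M`, and component zero along `t`. -/
theorem der_line [CompleteSpace K] {σ : L.X → M.X} (hσ : ∀ y, IsAnMap σ y) {t : L.X → K}
    (ht : ∀ y, L.IsAn t y)
    (hex : ∀ (T : AnalyticManifold K) (f : T.X → M.X) (s : T.X → K), (∀ y, IsAnMap f y) →
      (∀ y, T.IsAn s y) → ∃ g : T.X → L.X, (∀ y, IsAnMap g y) ∧ (∀ y, σ (g y) = f y) ∧
        ∀ y, t (g y) = s y)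
    (huniq : ∀ (T : AnalyticManifold K) (g g' : T.X → L.X), (∀ y, IsAnMap g y) →
      (∀ y, IsAnMap g' y) → (∀ y, σ (g y) = σ (g' y)) → (∀ y, t (g y) = t (g' y)) → g = g')
    (x : L.X) (δ) (hδ : δ ∈ M.Der (σ x)) :
    ∃ δ' ∈ L.Der x, (∀ r, δ' (pullGerm σ (hσ x) rfl r) = pullGerm σ (hσ x) rfl (δ r)) ∧
      δ' (toGerm t (ht x)) = 0 := by
  let c := M.chartCoord (σ x)
  obtain ⟨c', hc'⟩ := exists_coord_line hσ ht hex huniq x c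
  let ψ := pullGerm σ (hσ x) rfl
  have hψ : IsLocalHom ψ := isLocalHom_pullGerm (hσ x) rfl
  have h0 : c'.fn 0 = toGerm t (ht x) :=
    toGerm_eq_iff.2 (Filter.Eventually.of_forall fun y => by simp [hc'])
  have hs : ∀ s : Fin M.dim, c'.fn s.succ = ψ (c.fn s) := fun s =>
    (toGerm_eq_iff (hg := (c.isAn_fn s).comp x (hσ x))).2 (Filter.Eventually.of_forall fun y => by simp [hc'])
  let δ' : Derivation ℤ (analyticStalk L x) (analyticStalk L x) :=
    ∑ s : Fin M.dim, ψ (δ (c.fn s)) • c'.pd s.succ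
  have hδ' : δ' ∈ L.Der x := Submodule.sum_mem _ fun s _ =>
    Submodule.smul_mem _ _ (c'.pd_mem_der s.succ)
  have hap : ∀ r, δ' r = ∑ s : Fin M.dim, ψ (δ (c.fn s)) * c'.pd s.succ r := fun r => by
    rw [derivation_sum_apply]
    rfl
  refine ⟨δ', hδ', fun r => ?_, ?_⟩
  · have key := c.derivation_ext (ψ := ψ)
      (d := δ'.toLinearMap.toAddMonoidHom.comp ψ.toAddMonoidHom)
      (d' := ψ.toAddMonoidHom.comp δ.toLinearMap.toAddMonoidHom)
      (fun a b => by simp) (fun a b => by simp)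
      (fun r => (hδ' r).trans (by
        change 0 = ψ (δ (const (σ x) r))
        rw [hδ, map_zero]))
      (fun s => by
        change δ' (ψ (c.fn s)) = ψ (δ (c.fn s))
        rw [hap, ← hs]
        simp [c'.pd_fn])
    exact DFunLike.congr_fun key r
  · rw [← h0, hap]
    refine Finset.sum_eq_zero fun s _ => ?_
    rw [c'.pd_fn, if_neg (Fin.succ_ne_zero s), mul_zero]

end AnalyticManifold

end Desing

namespace Desing

open IsLocalRing

namespace AnalyticManifold

variable {K : Type u} [NontriviallyNormedField K] [CompleteSpace K] {B M M' : AnalyticManifold K}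

/-! ### Blowing-up charts -/

/-- In coordinates where the centre is linear, the chart is the standard one. Its coordinates are
those of `M` with `x j` replaced by `y j` for `j ≠ i`, and they are produced as in
`exists_coord_line`. -/
theorem exists_coord_blowupChart {π : B.X → M.X} (hπ : ∀ b, IsAnMap π b) {k : ℕ}
    {x : Fin k → M.X → K} (hx : ∀ j w, M.IsAn (x j) w) {i : Fin k} {y : Fin k → B.X → K}
    (hy : ∀ j b, B.IsAn (y j) b) (hyi : ∀ b, y i b = 1)
    (hxy : ∀ j b, x j (π b) = y j b * x i (π b))
    (hex : ∀ (T : AnalyticManifold K) (f : T.X → M.X) (s : Fin k → T.X → K),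
      (∀ p, IsAnMap f p) → (∀ j p, T.IsAn (s j) p) → (∀ p, s i p = 1) →
      (∀ j p, x j (f p) = s j p * x i (f p)) → ∃ g : T.X → B.X, (∀ p, IsAnMap g p) ∧
        (∀ p, π (g p) = f p) ∧ ∀ j p, y j (g p) = s j p)
    (huniq : ∀ (T : AnalyticManifold K) (g g' : T.X → B.X), (∀ p, IsAnMap g p) →
      (∀ p, IsAnMap g' p) → (∀ p, π (g p) = π (g' p)) → (∀ j p, y j (g p) = y j (g' p)) → g = g')
    (b : B.X) (hdual : HasDual (M.Der (π b)) fun j => toGerm (x j) (hx j (π b))) :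
    ∃ (c : M.Coord (π b) M.dim) (ℓ : Fin k → (Fin M.dim → K) →L[K] K) (v : Fin k → Fin M.dim → K)
      (C : B.Coord b M.dim), (∀ l j, ℓ l (v j) = if l = j then 1 else 0) ∧
      (∀ j, ∀ᶠ w in 𝓝 (π b), x j w = ℓ j (c.h w - c.h (π b))) ∧
      C.h = fun p => c.h (π p) +
        ∑ j, ((if j = i then x i (π p) else y j p) - x j (π p)) • v j := by
  classical
  obtain ⟨c, ℓ, v, hℓv, hζ⟩ := exists_adapted_coord hdual
  have hxℓ : ∀ j, ∀ᶠ w in 𝓝 (π b), x j w = ℓ j (c.h w - c.h (π b)) := fun j => by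
    obtain ⟨ζ, hζ, h1, h2⟩ := hζ j
    filter_upwards [toGerm_eq_iff.1 h1, h2] with w h3 h4
    rw [h3, h4]
  set c₀ := c.h (π b) with hc₀
  let X : Fin k → (Fin M.dim → K) → K := fun j w =>
    ℓ i (w - c₀) * if j = i then 1 else ℓ j (w - c₀)
  -- The standard chart: `β` multiplies the linear coordinates `ℓ j`, `j ≠ i`, by `ℓ i` and changes
  -- nothing else.
  let β : (Fin M.dim → K) → Fin M.dim → K := fun w => w + ∑ j, (X j w - ℓ j (w - c₀)) • v j
  have hlan : ∀ j w, ContDiffAt K ω (fun w => ℓ j (w - c₀)) w := fun j w =>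
    (ℓ j).contDiff.contDiffAt.comp w (contDiffAt_id.sub contDiffAt_const)
  have hXan : ∀ j w, ContDiffAt K ω (X j) w := fun j w => by
    refine (hlan i w).mul ?_
    by_cases hj : j = i
    · simp only [hj, if_true]
      exact contDiffAt_const
    · simp only [hj, if_false]
      exact hlan j w
  have hβan : ∀ w, ContDiffAt K ω β w := fun w =>
    contDiffAt_id.add (ContDiffAt.sum fun j _ => ((hXan j w).sub (hlan j w)).smul contDiffAt_const)
  have hℓβ : ∀ l w, ℓ l (β w - c₀) = X l w := fun l w => by
    have h1 : β w - c₀ = (w - c₀) + ∑ j, (X j w - ℓ j (w - c₀)) • v j := by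
      simp only [β]
      abel
    rw [h1, map_add, map_sum]
    simp [hℓv]
  let h : B.X → Fin M.dim → K := fun p => c.h (π p) +
    ∑ j, ((if j = i then x i (π p) else y j p) - x j (π p)) • v j
  have hπb : Filter.Tendsto π (𝓝 b) (𝓝 (π b)) := (hπ b).continuousAt.tendsto
  have hℓh : ∀ᶠ p in 𝓝 b, ∀ l, ℓ l (h p - c₀) = if l = i then x i (π p) else y l p := by
    filter_upwards [hπb.eventually (Filter.eventually_all.2 hxℓ)] with p hp l
    have h1 : h p - c₀ = (c.h (π p) - c₀) +
        ∑ j, ((if j = i then x i (π p) else y j p) - x j (π p)) • v j := by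
      simp only [h]
      abel
    rw [h1, map_add, map_sum, ← hp l]
    simp [hℓv]
  have hXh : ∀ᶠ p in 𝓝 b, ∀ l, X l (h p) = x l (π p) := by
    filter_upwards [hℓh] with p hp l
    simp only [X, hp, if_true]
    by_cases hl : l = i
    · simp [hl]
    · rw [if_neg hl, if_neg hl, hxy l, mul_comm]
  have hβh : ∀ᶠ p in 𝓝 b, β (h p) = c.h (π p) := by
    filter_upwards [hℓh, hXh] with p h1 h2
    simp only [β, h1, h2]
    simp only [h, add_assoc, ← Finset.sum_add_distrib, ← add_smul]
    simp
  obtain ⟨W, hW, hWo, hW₀⟩ := eventually_nhds_iff.1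
    (((contMDiffAt_iff_contMDiffAt_nhds (by decide)).1 c.an_g).and (c.right.and
      (c.tendsto_g.eventually (Filter.eventually_all.2 hxℓ))))
  have hβc : Continuous β := continuous_iff_continuousAt.2 fun w => (hβan w).continuousAt
  let U : TopologicalSpace.Opens (Fin M.dim → K) := ⟨_, hWo.preimage hβc⟩
  have hxg : ∀ (u : U) l, x l (c.g (β u)) = X l u := fun u l => by
    rw [(hW _ u.2).2.2 l, (hW _ u.2).2.1, hℓβ]
  obtain ⟨g, hg, hgπ, hgy⟩ := hex (model U) (fun u : U => c.g (β (u : Fin M.dim → K)))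
    (fun j (u : U) => if j = i then 1 else ℓ j ((u : Fin M.dim → K) - c₀))
    (fun (u : U) => isAnMap_model (f := fun w => c.g (β w)) u
      (ContMDiffAt.comp (u : Fin M.dim → K) (hW _ u.2).1 (hβan u).contMDiffAt))
    (fun j (u : U) => isAn_model (f := fun w => if j = i then 1 else ℓ j (w - c₀)) u (by
      by_cases hj : j = i
      · simp only [hj, if_true]
        exact contMDiffAt_const
      · simp only [hj, if_false]
        exact (hlan j u).contMDiffAt))
    (fun u => if_pos rfl)
    (fun j (u : U) => by
      rw [hxg, hxg]
      simp only [X, if_true, mul_one]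
      exact mul_comm _ _)
  have hgπ' : ∀ u : U, π (g u) = c.g (β u) := hgπ
  have hgy' : ∀ j, ∀ u : U, y j (g u) = if j = i then 1 else ℓ j ((u : Fin M.dim → K) - c₀) := hgy
  have hright : ∀ u : U, h (g u) = u := fun u => by
    simp only [h]
    rw [hgπ', (hW _ u.2).2.1]
    simp only [hgy', hxg, β, add_assoc, ← Finset.sum_add_distrib, ← add_smul]
    refine (congrArg _ (Finset.sum_eq_zero fun j _ => ?_)).trans (add_zero _)
    by_cases hj : j = i
    · subst hj
      simp [X]
    · simp [hj]
  have hhan : ContMDiffAt 𝓘(K, Fin B.dim → K) 𝓘(K, Fin M.dim → K) ω h b := by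
    have h1 : ∀ j, B.IsAn (fun p => (if j = i then x i (π p) else y j p) - x j (π p)) b := fun j => by
      refine ContMDiffAt.sub ?_ ((hx j _).comp b (hπ b))
      by_cases hj : j = i
      · simp only [hj, if_true]
        exact (hx i _).comp b (hπ b)
      · simp only [hj, if_false]
        exact hy j b
    exact (c.an_h.comp b (hπ b)).add
      (ContMDiffAt.sum fun j _ => (h1 j).smul (contMDiffAt_const (c := v j)))
  obtain ⟨C, hC⟩ := exists_coord_of_unique (t := y) (σ := π) huniq hhan (U := U)
    (show β (h b) ∈ W by rw [hβh.self_of_nhds]; exact hW₀) hg hright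
    (by
      filter_upwards [hβh, hπb.eventually c.left] with p h1 h2 hp
      refine (hgπ' ⟨h p, hp⟩).trans ?_
      change c.g (β (h p)) = π p
      rw [h1, h2])
    (by
      filter_upwards [hℓh] with p h1 hp j
      refine (hgy' j ⟨h p, hp⟩).trans ?_
      change (if j = i then 1 else ℓ j (h p - c₀)) = y j p
      rw [h1]
      by_cases hj : j = i
      · rw [if_pos hj, hj, hyi]
      · simp [hj])
  exact ⟨c, ℓ, v, C, hℓv, hxℓ, hC⟩

theorem toGerm_eq_sum_const_mul {N : ℕ} {w : M.X} (c : M.Coord w N) (ℓ : (Fin N → K) →L[K] K)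
    {f : M.X → K} (hf : M.IsAn f w) (h : ∀ᶠ p in 𝓝 w, f p = ℓ (c.h p - c.h w)) :
    toGerm f hf = ∑ s, const w (ℓ (Pi.single s 1)) * (c.fn s - const w (c.h w s)) := by
  have hs : ∀ s, const w (ℓ (Pi.single s 1)) * (c.fn s - const w (c.h w s)) =
      toGerm (fun p => ℓ (Pi.single s 1) * (c.h p s - c.h w s))
        (contMDiffAt_const.mul ((c.isAn_fn s).sub contMDiffAt_const)) := fun s => rfl
  simp only [hs]
  rw [toGerm_sum]
  refine toGerm_eq_iff.2 ?_
  filter_upwards [h] with p hp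
  rw [hp, pi_eq_sum_univ' (c.h p - c.h w), map_sum]
  refine Finset.sum_congr rfl fun s _ => ?_
  rw [map_smul, smul_eq_mul, mul_comm]
  rfl

/-- The preceding coordinates, rewritten as identities in the local rings, where derivations can be
applied. -/
theorem exists_coord_blowupChart_germ {π : B.X → M.X} (hπ : ∀ b, IsAnMap π b) {k : ℕ}
    {x : Fin k → M.X → K} (hx : ∀ j w, M.IsAn (x j) w) {i : Fin k} {y : Fin k → B.X → K}
    (hy : ∀ j b, B.IsAn (y j) b) (hyi : ∀ b, y i b = 1)
    (hxy : ∀ j b, x j (π b) = y j b * x i (π b))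
    (hex : ∀ (T : AnalyticManifold K) (f : T.X → M.X) (s : Fin k → T.X → K),
      (∀ p, IsAnMap f p) → (∀ j p, T.IsAn (s j) p) → (∀ p, s i p = 1) →
      (∀ j p, x j (f p) = s j p * x i (f p)) → ∃ g : T.X → B.X, (∀ p, IsAnMap g p) ∧
        (∀ p, π (g p) = f p) ∧ ∀ j p, y j (g p) = s j p)
    (huniq : ∀ (T : AnalyticManifold K) (g g' : T.X → B.X), (∀ p, IsAnMap g p) →
      (∀ p, IsAnMap g' p) → (∀ p, π (g p) = π (g' p)) → (∀ j p, y j (g p) = y j (g' p)) → g = g')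
    (b : B.X) (hdual : HasDual (M.Der (π b)) fun j => toGerm (x j) (hx j (π b))) :
    ∃ (N : ℕ) (c : M.Coord (π b) N) (C : B.Coord b N) (ℓ v : Fin k → Fin N → K),
      (∀ l j, ∑ s, ℓ l s * v j s = if l = j then 1 else 0) ∧
      (∀ j, toGerm (x j) (hx j (π b)) =
        ∑ s, const (π b) (ℓ j s) * (c.fn s - const (π b) (c.h (π b) s))) ∧
      ∀ s, C.fn s = pullGerm π (hπ b) rfl (c.fn s) +
        ∑ j, ((if j = i then pullGerm π (hπ b) rfl (toGerm (x i) (hx i (π b))) else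
          toGerm (y j) (hy j b)) - pullGerm π (hπ b) rfl (toGerm (x j) (hx j (π b)))) *
          const b (v j s) := by
  classical
  obtain ⟨c, ℓ, v, C, hℓv, hxℓ, hC⟩ :=
    exists_coord_blowupChart hπ hx hy hyi hxy hex huniq b hdual
  refine ⟨M.dim, c, C, fun j s => ℓ j (Pi.single s 1), v, fun l j => ?_,
    fun j => toGerm_eq_sum_const_mul c (ℓ j) _ (hxℓ j), ?_⟩
  · rw [← hℓv l j, pi_eq_sum_univ' (v j), map_sum]
    refine Finset.sum_congr rfl fun s _ => ?_
    rw [map_smul, smul_eq_mul, mul_comm, ← pi_eq_sum_univ' (v j)]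
  let ψ := pullGerm π (hπ b) rfl
  let ξ : Fin k → analyticStalk M (π b) := fun j => toGerm (x j) (hx j (π b))
  let Y : Fin k → analyticStalk B b := fun j => toGerm (y j) (hy j b)
  let Y' : Fin k → analyticStalk B b := fun j => if j = i then ψ (ξ i) else Y j
  have hY'an : ∀ j, B.IsAn (fun p => if j = i then x i (π p) else y j p) b := fun j => by
    by_cases hj : j = i
    · simp only [hj, if_true]
      exact (hx i _).comp b (hπ b)
    · simp only [hj, if_false]
      exact hy j b
  have hY' : ∀ j, Y' j = toGerm _ (hY'an j) := fun j => by
    by_cases hj : j = i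
    · simp only [Y', hj, if_true]
      rfl
    · simp only [Y', hj, if_false]
      rfl
  intro s
  change C.fn s = ψ (c.fn s) + ∑ j, (Y' j - ψ (ξ j)) * const b (v j s)
  have h1 : ∀ j, (Y' j - ψ (ξ j)) * const b (v j s) =
      toGerm (fun p => ((if j = i then x i (π p) else y j p) - x j (π p)) * v j s)
        (((hY'an j).sub ((hx j _).comp b (hπ b))).mul contMDiffAt_const) := fun j => by
    rw [hY']
    rfl
  simp only [h1]
  rw [toGerm_sum]
  refine (toGerm_eq_iff (hg := ((c.isAn_fn s).comp b (hπ b)).add (isAn_sum fun j =>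
    ((hY'an j).sub ((hx j _).comp b (hπ b))).mul contMDiffAt_const))).2
    (Filter.Eventually.of_forall fun p => ?_)
  simp [hC, Finset.sum_apply]

-- A derivation is determined by its values on coordinates and can be prescribed there. The values
-- `V` are those forced by differentiating `hfn`; that the result lifts the given combination is
-- then checked on the coordinates of `M`.
set_option maxHeartbeats 1000000 in
theorem der_blowupChart {π : B.X → M.X} (hπ : ∀ b, IsAnMap π b) {k : ℕ}
    {x : Fin k → M.X → K} (hx : ∀ j w, M.IsAn (x j) w) {i : Fin k} {y : Fin k → B.X → K}
    (hy : ∀ j b, B.IsAn (y j) b) (hyi : ∀ b, y i b = 1)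
    (hxy : ∀ j b, x j (π b) = y j b * x i (π b))
    (hex : ∀ (T : AnalyticManifold K) (f : T.X → M.X) (s : Fin k → T.X → K),
      (∀ p, IsAnMap f p) → (∀ j p, T.IsAn (s j) p) → (∀ p, s i p = 1) →
      (∀ j p, x j (f p) = s j p * x i (f p)) → ∃ g : T.X → B.X, (∀ p, IsAnMap g p) ∧
        (∀ p, π (g p) = f p) ∧ ∀ j p, y j (g p) = s j p)
    (huniq : ∀ (T : AnalyticManifold K) (g g' : T.X → B.X), (∀ p, IsAnMap g p) →
      (∀ p, IsAnMap g' p) → (∀ p, π (g p) = π (g' p)) → (∀ j p, y j (g p) = y j (g' p)) → g = g')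
    (b : B.X) (hdual : HasDual (M.Der (π b)) fun j => toGerm (x j) (hx j (π b)))
    {n : ℕ} (D : Fin n → Derivation ℤ (analyticStalk M (π b)) (analyticStalk M (π b)))
    (e : Fin n → analyticStalk B b) (η : Fin k → analyticStalk B b)
    (hD : ∀ l, D l ∈ M.Der (π b)) (hηi : η i = 0)
    (hη : ∀ m, ∑ l, e l * (pullGerm π (hπ b) rfl (D l (toGerm (x m) (hx m (π b)))) -
      toGerm (y m) (hy m b) * pullGerm π (hπ b) rfl (D l (toGerm (x i) (hx i (π b))))) =
      pullGerm π (hπ b) rfl (toGerm (x i) (hx i (π b))) * η m) :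
    ∃ δ' ∈ B.Der b, (∀ r, δ' (pullGerm π (hπ b) rfl r) =
      ∑ l, e l * pullGerm π (hπ b) rfl (D l r)) ∧ ∀ m, δ' (toGerm (y m) (hy m b)) = η m := by
  classical
  obtain ⟨N, c, C, ℓ, v, hℓv, hξ, hfn⟩ :=
    exists_coord_blowupChart_germ hπ hx hy hyi hxy hex huniq b hdual
  let ψ := pullGerm π (hπ b) rfl
  have hψ : IsLocalHom ψ := isLocalHom_pullGerm (hπ b) rfl
  let ξ : Fin k → analyticStalk M (π b) := fun j => toGerm (x j) (hx j (π b))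
  let Y : Fin k → analyticStalk B b := fun j => toGerm (y j) (hy j b)
  let Y' : Fin k → analyticStalk B b := fun j => if j = i then ψ (ξ i) else Y j
  have hYi : Y i = 1 := (toGerm_eq_iff (hg := contMDiffAt_const)).2
    (Filter.Eventually.of_forall hyi)
  have hψξ : ∀ j, ψ (ξ j) = Y j * ψ (ξ i) := fun j =>
    (toGerm_eq_iff (hf := (hx j _).comp b (hπ b))
      (hg := (hy j b).mul ((hx i _).comp b (hπ b)))).2 (Filter.Eventually.of_forall (hxy j))
  have hℓv' : ∀ l j, ∑ s, const b (ℓ l s) * const b (v j s) = if l = j then 1 else 0 :=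
    fun l j => by
      rw [← map_one (const b), ← map_zero (const b), ← apply_ite (const b), ← hℓv l j, map_sum]
      exact Finset.sum_congr rfl fun s _ => (map_mul _ _ _).symm
  change ∀ j, ξ j = _ at hξ
  change ∀ s, C.fn s = ψ (c.fn s) + ∑ j, (Y' j - ψ (ξ j)) * const b (v j s) at hfn
  change ∀ m, ∑ l, e l * (ψ (D l (ξ m)) - Y m * ψ (D l (ξ i))) = ψ (ξ i) * η m at hη
  have hψc : ∀ r, ψ (const (π b) r) = const b r := fun r => rfl
  change ∃ δ' ∈ B.Der b, (∀ r, δ' (ψ r) = ∑ l, e l * ψ (D l r)) ∧ ∀ m, δ' (Y m) = η m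
  clear_value ψ ξ Y
  have hYfn : ∀ l, Y' l = ∑ s, const b (ℓ l s) *
      (C.fn s - const b (c.h (π b) s)) := fun l => by
    have h1 : ∀ s, const b (ℓ l s) * (C.fn s - const b (c.h (π b) s)) =
        ψ (const (π b) (ℓ l s) * (c.fn s - const (π b) (c.h (π b) s))) +
        ∑ j, (Y' j - ψ (ξ j)) * (const b (ℓ l s) * const b (v j s)) := fun s => by
      rw [hfn, map_mul, map_sub]
      simp only [hψc]
      rw [add_sub_right_comm, mul_add, Finset.mul_sum]
      congr 1
      exact Finset.sum_congr rfl fun j _ => by ring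
    simp only [h1]
    rw [Finset.sum_add_distrib, ← map_sum, ← hξ, Finset.sum_comm]
    simp only [← Finset.mul_sum, hℓv']
    simp
  let E : analyticStalk M (π b) → analyticStalk B b := fun r => ∑ l, e l * ψ (D l r)
  let η' : Fin k → analyticStalk B b := fun j => if j = i then E (ξ i) else η j
  have hEξ : ∀ j, E (ξ j) = ∑ s, const b (ℓ j s) * E (c.fn s) := fun j => by
    have h1 : ∀ l, D l (ξ j) =
        ∑ s, const (π b) (ℓ j s) * D l (c.fn s) := fun l => by
      rw [hξ, map_sum]
      refine Finset.sum_congr rfl fun s _ => ?_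
      rw [Derivation.leibniz, map_sub, hD l, hD l]
      simp
    simp only [E, h1, map_sum, map_mul, Finset.mul_sum]
    rw [Finset.sum_comm]
    refine Finset.sum_congr rfl fun s _ => Finset.sum_congr rfl fun l _ => ?_
    rw [hψc]
    ring
  let V : Fin N → analyticStalk B b := fun s =>
    E (c.fn s) + ∑ j, (η' j - E (ξ j)) * const b (v j s)
  let δ' : Derivation ℤ (analyticStalk B b) (analyticStalk B b) := ∑ s, V s • C.pd s
  have hδ' : δ' ∈ B.Der b := Submodule.sum_mem _ fun s _ =>
    Submodule.smul_mem _ _ (C.pd_mem_der s)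
  have hδfn : ∀ s, δ' (C.fn s) = V s := fun s => by
    rw [derivation_sum_apply]
    simp [C.pd_fn]
  have hδY' : ∀ j, δ' (Y' j) = η' j := fun l => by
    have h1 : δ' (Y' l) = ∑ s, const b (ℓ l s) * V s := by
      rw [hYfn, map_sum]
      refine Finset.sum_congr rfl fun s _ => ?_
      rw [Derivation.leibniz, map_sub, hδ', hδ', hδfn]
      simp
    have h2 : ∀ s, const b (ℓ l s) * V s =
        const b (ℓ l s) * E (c.fn s) +
        ∑ j, (η' j - E (ξ j)) * (const b (ℓ l s) * const b (v j s)) := fun s => by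
      rw [mul_add]
      congr 1
      rw [Finset.mul_sum]
      exact Finset.sum_congr rfl fun j _ => by ring
    rw [h1]
    simp only [h2]
    rw [Finset.sum_add_distrib, ← hEξ, Finset.sum_comm]
    simp only [← Finset.mul_sum, hℓv']
    simp
  have hδξi : δ' (ψ (ξ i)) = E (ξ i) := by
    have := hδY' i
    simpa only [Y', η', if_true] using this
  have hδY : ∀ j, δ' (Y j) = η j := fun j => by
    by_cases hj : j = i
    · rw [hj, hYi, hηi]
      exact Derivation.map_one_eq_zero δ'
    · have := hδY' j
      simpa only [Y', η', hj, if_false] using this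
  -- Here the compatibility `hη` enters: it equates the Leibniz expansion of `Y j * ψ (ξ i)` with
  -- the prescribed value on `ξ j`.
  have hδξ : ∀ j, δ' (ψ (ξ j)) = E (ξ j) := fun j => by
    have h1 := hη j
    simp only [mul_sub, Finset.sum_sub_distrib] at h1
    have h2 : ∑ l, e l * (Y j * ψ (D l (ξ i))) = Y j * E (ξ i) := by
      rw [Finset.mul_sum]
      exact Finset.sum_congr rfl fun l _ => by ring
    have h3 : E (ξ j) - Y j * E (ξ i) = ψ (ξ i) * η j := by
      rw [← h2]
      exact h1
    rw [hψξ, Derivation.leibniz, hδξi, hδY, smul_eq_mul, smul_eq_mul, ← h3]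
    ring
  refine ⟨δ', hδ', fun r => ?_, hδY⟩
  have hE : ∀ r r', E (r + r') = E r + E r' := fun r r' => by
    simp only [E, map_add, mul_add, Finset.sum_add_distrib]
  have key := c.derivation_ext (ψ := ψ)
    (d := δ'.toLinearMap.toAddMonoidHom.comp ψ.toAddMonoidHom)
    (d' := AddMonoidHom.mk' E hE)
    (fun r r' => by simp)
    (fun r r' => by
      change E (r * r') = ψ r * E r' + ψ r' * E r
      simp only [E, Finset.mul_sum]
      rw [← Finset.sum_add_distrib]
      refine Finset.sum_congr rfl fun l _ => ?_
      rw [Derivation.leibniz, smul_eq_mul, smul_eq_mul, map_add, map_mul, map_mul]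
      ring)
    (fun r => by
      change δ' (ψ (const (π b) r)) = E (const (π b) r)
      rw [hψc, hδ']
      exact (Finset.sum_eq_zero fun l _ => by rw [hD l, map_zero, mul_zero]).symm)
    (fun s => by
      change δ' (ψ (c.fn s)) = E (c.fn s)
      have h1 : ψ (c.fn s) = C.fn s - ∑ j, (Y' j - ψ (ξ j)) * const b (v j s) := by
        rw [hfn, add_sub_cancel_right]
      rw [h1, map_sub, hδfn, map_sum]
      simp only [V]
      rw [add_sub_assoc, ← Finset.sum_sub_distrib]
      refine (congrArg _ (Finset.sum_eq_zero fun j _ => ?_)).trans (add_zero _)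
      rw [Derivation.leibniz, hδ', map_sub, hδY', hδξ]
      simp [mul_comm])
  exact DFunLike.congr_fun key r

theorem der_blowup_openImm {π : B.X → M.X} (hπ : ∀ b, IsAnMap π b) {j : M'.X → B.X} {a : M'.X}
    (hj : IsAnMap j a)
    (hd : IsLocalDiffeomorphAt 𝓘(K, Fin M'.dim → K) 𝓘(K, Fin B.dim → K) ω j a) {k : ℕ}
    {x : Fin k → M.X → K} (hx : ∀ j w, M.IsAn (x j) w) {i : Fin k} {y : Fin k → B.X → K}
    (hy : ∀ j b, B.IsAn (y j) b) (hyi : ∀ b, y i b = 1)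
    (hxy : ∀ j b, x j (π b) = y j b * x i (π b))
    (hex : ∀ (T : AnalyticManifold K) (f : T.X → M.X) (s : Fin k → T.X → K),
      (∀ p, IsAnMap f p) → (∀ j p, T.IsAn (s j) p) → (∀ p, s i p = 1) →
      (∀ j p, x j (f p) = s j p * x i (f p)) → ∃ g : T.X → B.X, (∀ p, IsAnMap g p) ∧
        (∀ p, π (g p) = f p) ∧ ∀ j p, y j (g p) = s j p)
    (huniq : ∀ (T : AnalyticManifold K) (g g' : T.X → B.X), (∀ p, IsAnMap g p) →
      (∀ p, IsAnMap g' p) → (∀ p, π (g p) = π (g' p)) → (∀ j p, y j (g p) = y j (g' p)) → g = g')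
    (hdual : HasDual (M.Der (π (j a))) fun l => toGerm (x l) (hx l (π (j a))))
    {n : ℕ}
    (D : Fin n → Derivation ℤ (analyticStalk M (π (j a))) (analyticStalk M (π (j a))))
    (e : Fin n → analyticStalk M' a) (η : Fin k → analyticStalk M' a)
    (hD : ∀ l, D l ∈ M.Der (π (j a))) (hηi : η i = 0)
    {ψ : analyticStalk M (π (j a)) →+* analyticStalk M' a}
    (hψ : ∀ r, ψ r = pullGerm j hj rfl (pullGerm π (hπ (j a)) rfl r))
    (hη : ∀ m, ∑ l, e l * (ψ (D l (toGerm (x m) (hx m _))) -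
      pullGerm j hj rfl (toGerm (y m) (hy m _)) * ψ (D l (toGerm (x i) (hx i _)))) =
      pullGerm j hj rfl (pullGerm π (hπ (j a)) rfl (toGerm (x i) (hx i _))) * η m) :
    ∃ δ' ∈ M'.Der a, (∀ r, δ' (ψ r) = ∑ l, e l * ψ (D l r)) ∧
      ∀ m, δ' (pullGerm j hj rfl (toGerm (y m) (hy m _))) = η m := by
  have hbij := bijective_pullGerm hj hd
  choose e' he' using fun l => hbij.2 (e l)
  choose η' hη' using fun l => hbij.2 (η l)
  obtain ⟨δ, hδ, hδπ, hδy⟩ := der_blowupChart hπ hx hy hyi hxy hex huniq (j a) hdual D e' η' hD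
    (hbij.1 (by rw [map_zero]; exact (hη' i).trans hηi)) fun m => hbij.1 (by
      rw [map_sum, map_mul, hη']
      refine Eq.trans (Finset.sum_congr rfl fun l _ => ?_) (hη m)
      rw [map_mul, map_sub, map_mul, he', hψ, hψ])
  obtain ⟨δ', hδ', h⟩ := der_openImm hj hd δ hδ
  refine ⟨δ', hδ', fun r => ?_, fun m => ?_⟩
  · rw [hψ, h, hδπ, map_sum]
    exact Finset.sum_congr rfl fun l _ => by rw [map_mul, hψ, he']
  · rw [h, hδy, hη']

end AnalyticManifold

end Desing

namespace Desing

open IsLocalRing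

namespace AnalyticManifold

variable {K : Type u} [NontriviallyNormedField K] {A B C L M M' : AnalyticManifold K}

/-! ### The analytic category -/

/-- A locally compact nontrivially normed field is proper. Completeness is what the power series
arguments use. -/
theorem completeSpace (K : Type u) [NontriviallyNormedField K] [LocallyCompactSpace K] :
    CompleteSpace K :=
  have : ProperSpace K := ProperSpace.of_locallyCompactSpace K
  inferInstance

/-- Analytic maps. -/
abbrev Mor (A B : AnalyticManifold K) : Type u :=
  C^ω⟮𝓘(K, Fin A.dim → K), A.X; 𝓘(K, Fin B.dim → K), B.X⟯

/-- Analytic functions. -/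
abbrev Fun (A : AnalyticManifold K) : Type u := C^ω⟮𝓘(K, Fin A.dim → K), A.X; 𝓘(K), K⟯

/-- The homomorphism of local rings which belongs to an analytic map. -/
def stalkMap (f : Mor A B) (x : A.X) : analyticStalk B (f x) →+* analyticStalk A x :=
  pullGerm f (f.contMDiff x) rfl

theorem hasDual [CompleteSpace K] {a : M.X} {k : ℕ} {z : Fin k → analyticStalk M a}
    (hz : IsPartOfRegularSystem z) : HasDual (M.Der a) z :=
  hz.hasDual (S := M.Der a) (fun f hf h => mem_sq_of_der f hf h)

theorem germ_mem_sec (a : M.X) (f : Fun M) :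
    (fun w => toGerm f (f.contMDiff w) : ∀ w, analyticStalk M w) ∈ M.Sec a :=
  ⟨f, Filter.Eventually.of_forall fun w => ⟨f.contMDiff w, rfl⟩⟩

theorem der_line_of_isLineProduct [CompleteSpace K] {σ : Mor L M} {t : Fun L}
    (h : ∀ (T : AnalyticManifold K) (f : Mor T M) (s : Fun T),
      ∃! g : Mor T L, σ.comp g = f ∧ ContMDiffMap.comp t g = s)
    (x : L.X) (δ) (hδ : δ ∈ M.Der (σ x)) :
    ∃ δ' ∈ L.Der x, (∀ r, δ' (stalkMap σ x r) = stalkMap σ x (δ r)) ∧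
      δ' (toGerm t (t.contMDiff x)) = 0 := by
  refine der_line (σ := σ) σ.contMDiff (t := t) t.contMDiff
    (fun T f s hf hs => ?_) (fun T g g' hg hg' h1 h2 => ?_) x δ hδ
  · obtain ⟨g, ⟨h1, h2⟩, -⟩ := h T ⟨f, hf⟩ ⟨s, hs⟩
    exact ⟨g, g.contMDiff, fun y => DFunLike.congr_fun h1 y, fun y => DFunLike.congr_fun h2 y⟩
  · let G : Mor T L := ⟨g, hg⟩
    let G' : Mor T L := ⟨g', hg'⟩
    exact congrArg DFunLike.coe ((h T (σ.comp G') (ContMDiffMap.comp t G')).unique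
      (y₁ := G) (y₂ := G') ⟨ContMDiffMap.ext h1, ContMDiffMap.ext h2⟩ ⟨rfl, rfl⟩)

theorem der_blowup_of_isBlowupChart [CompleteSpace K] {π : Mor B M} {j : Mor M' B}
    (hj : IsLocalDiffeomorph 𝓘(K, Fin M'.dim → K) 𝓘(K, Fin B.dim → K) ω j) {k : ℕ}
    {x : Fin k → Fun M} {i : Fin k} {y : Fin k → Fun B} (hyi : y i = 1)
    (hxy : ∀ l, ContMDiffMap.comp (x l) π = y l * ContMDiffMap.comp (x i) π)
    (h : ∀ (T : AnalyticManifold K) (f : Mor T M) (v : Fin k → Fun T), v i = 1 →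
      (∀ l, ContMDiffMap.comp (x l) f = v l * ContMDiffMap.comp (x i) f) →
      ∃! g : Mor T B, π.comp g = f ∧ ∀ l, ContMDiffMap.comp (y l) g = v l)
    (a : M'.X)
    (hx : IsPartOfRegularSystem fun l => toGerm (x l) ((x l).contMDiff (π (j a))))
    {n : ℕ} (D : Fin n → Derivation ℤ (analyticStalk M (π (j a))) (analyticStalk M (π (j a))))
    (e : Fin n → analyticStalk M' a) (η : Fin k → analyticStalk M' a)
    (hD : ∀ l, D l ∈ M.Der (π (j a))) (hηi : η i = 0)
    (hη : ∀ m, ∑ l, e l * (stalkMap (π.comp j) a (D l (toGerm (x m) ((x m).contMDiff _))) -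
      toGerm (ContMDiffMap.comp (y m) j) (ContMDiffMap.contMDiff _ a) *
        stalkMap (π.comp j) a (D l (toGerm (x i) ((x i).contMDiff _)))) =
      toGerm (ContMDiffMap.comp (x i) (π.comp j)) (ContMDiffMap.contMDiff _ a) * η m) :
    ∃ δ' ∈ M'.Der a, (∀ r, δ' (stalkMap (π.comp j) a r) =
        ∑ l, e l * stalkMap (π.comp j) a (D l r)) ∧
      ∀ m, δ' (toGerm (ContMDiffMap.comp (y m) j) (ContMDiffMap.contMDiff _ a)) = η m := by
  refine der_blowup_openImm (π := π) π.contMDiff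
    (j := j) (j.contMDiff a) (hj a) (x := fun l => x l) (fun l => (x l).contMDiff)
    (y := fun l => y l) (fun l => (y l).contMDiff)
    (fun b => DFunLike.congr_fun hyi b) (fun l b => DFunLike.congr_fun (hxy l) b)
    (fun T f s hf hs hsi hfs => ?_) (fun T g g' hg hg' h1 h2 => ?_)
    (hasDual hx) D e η hD hηi (fun r => ?_) hη
  · obtain ⟨g, ⟨h1, h2⟩, -⟩ := h T ⟨f, hf⟩ (fun l => ⟨s l, hs l⟩) (ContMDiffMap.ext hsi)
      (fun l => ContMDiffMap.ext (hfs l))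
    exact ⟨g, g.contMDiff, fun p => DFunLike.congr_fun h1 p,
      fun l p => DFunLike.congr_fun (h2 l) p⟩
  · let G : Mor T B := ⟨g, hg⟩
    let G' : Mor T B := ⟨g', hg'⟩
    exact congrArg DFunLike.coe ((h T (π.comp G') (fun l => ContMDiffMap.comp (y l) G')
      (ContMDiffMap.ext fun p => DFunLike.congr_fun hyi (g' p))
      (fun l => ContMDiffMap.ext fun p => DFunLike.congr_fun (hxy l) (g' p))).unique
      (y₁ := G) (y₂ := G') ⟨ContMDiffMap.ext h1, fun l => ContMDiffMap.ext (h2 l)⟩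
      ⟨rfl, fun _ => rfl⟩)
  · obtain ⟨f, hf, rfl⟩ := exists_toGerm r
    rfl

theorem exists_openImm {a : M.X} {ι : Type} [Finite ι] {s : ι → ∀ w, analyticStalk M w}
    (hs : ∀ i, s i ∈ M.Sec a) :
    ∃ (U : AnalyticManifold K) (j : Mor U M) (b : U.X) (f : ι → Fun U),
      (Topology.IsOpenEmbedding j ∧
        IsLocalDiffeomorph 𝓘(K, Fin U.dim → K) 𝓘(K, Fin M.dim → K) ω j) ∧
      j b = a ∧ ∀ i w, toGerm (f i) ((f i).contMDiff w) = stalkMap j w (s i (j w)) := by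
  obtain ⟨U, ha, f, hf⟩ := exists_open_of_sec hs
  let j : Mor (M.restrict U) M := ⟨fun y : U => (y : M.X), fun y => isAnMap_val U y⟩
  refine ⟨M.restrict U, j, (⟨a, ha⟩ : U), fun i => ⟨fun y : U => f i y, fun (y : U) => ?_⟩,
    ⟨U.2.isOpenEmbedding_subtypeVal, isLocalDiffeomorph_val U⟩, rfl, fun i (w : U) => ?_⟩
  · obtain ⟨h, -⟩ := hf i y y.2
    exact (contMDiffAt_subtype_iff (I := 𝓘(K, Fin M.dim → K)) (I' := 𝓘(K)) (n := ω) (U := U)).2 h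
  · obtain ⟨h, hs⟩ := hf i w w.2
    exact (congrArg (stalkMap j w) hs).symm

end AnalyticManifold

open AnalyticManifold in
/-- Analytic manifolds over a locally compact field of characteristic zero. -/
def analyticDiff (K : Type u) [NontriviallyNormedField K] [LocallyCompactSpace K] [CharZero K] :
    DiffStructure (analyticGeometry K) :=
  have : CompleteSpace K := completeSpace K
  { stalkMap := fun {A B : AnalyticManifold K} (f : Mor A B) x => AnalyticManifold.stalkMap f x
    isLocalHom_stalkMap := fun {A B : AnalyticManifold K} (f : Mor A B) x =>
      isLocalHom_pullGerm (f.contMDiff x) rfl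
    stalkMap_germ := fun _ _ _ => rfl
    continuous_map := fun {A B : AnalyticManifold K} (f : Mor A B) => f.contMDiff.continuous
    Sec := fun {M : AnalyticManifold K} a => M.Sec a
    germ_mem_sec := fun {M : AnalyticManifold K} a f => AnalyticManifold.germ_mem_sec (M := M) a f
    exists_sec := fun {M : AnalyticManifold K} {a} f =>
      AnalyticManifold.exists_sec (M := M) (a := a) f
    sec_eventually_eq_zero := fun {M : AnalyticManifold K} {a _} =>
      AnalyticManifold.sec_eventually_eq_zero (M := M) (a := a)
    Der := fun {M : AnalyticManifold K} a => M.Der a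
    exists_der_family := fun {M : AnalyticManifold K} {a _} =>
      AnalyticManifold.exists_der_family (M := M) (a := a)
    mem_sq_of_der := fun {M : AnalyticManifold K} {a} f =>
      AnalyticManifold.mem_sq_of_der (M := M) (a := a) f
    fg_maximalIdeal := fun {M : AnalyticManifold K} a => AnalyticManifold.fg_maximalIdeal (M := M) a
    isUnit_natCast := fun {M : AnalyticManifold K} a => AnalyticManifold.isUnit_natCast (M := M) a
    separated := fun {M : AnalyticManifold K} {a _ _} =>
      AnalyticManifold.separated (M := M) (a := a)
    nullstellensatz := fun {M : AnalyticManifold K} {a _ _} =>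
      AnalyticManifold.nullstellensatz (M := M) (a := a)
    der_openImm := fun {A B : AnalyticManifold K} {j : Mor A B} hj x δ hδ =>
      AnalyticManifold.der_openImm (j.contMDiff x) (hj.2 x) δ hδ
    der_line := fun {L M : AnalyticManifold K} {σ : Mor L M} {t : Fun L} h x δ hδ =>
      der_line_of_isLineProduct h x δ hδ
    der_blowup := fun {M' M : AnalyticManifold K} {σ k x i y} h a' hx n D e η hD hηi hη => by
      obtain ⟨hx', B, π, v, j, ⟨hvi, hxv, hrep⟩, hj, rfl, hy⟩ := h
      obtain rfl : y = fun l => (analyticGeometry K).pull j (v l) := funext hy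
      exact der_blowup_of_isBlowupChart (B := B) (M := M) (M' := M') (π := π) (j := j) hj.2
        (x := x) (y := v) hvi hxv hrep a' (hx' _ hx) D e η hD hηi hη
    exists_openImm := fun {M : AnalyticManifold K} _ _ _ _ hs =>
      AnalyticManifold.exists_openImm (M := M) hs
    isOpenImm_comp := fun {A B C : AnalyticManifold K} {f : Mor A B} {g : Mor B C} hf hg =>
      ⟨hg.1.comp hf.1, fun x => (hf.2 x).comp _ _ (hg.2 (f x))⟩
    map_comp := fun _ _ _ => rfl
    pull_comp := fun _ _ _ => rfl
    exists_id := fun A : AnalyticManifold K => ⟨(ContMDiffMap.id : Mor A A),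
      ⟨Topology.IsOpenEmbedding.id,
        (Diffeomorph.refl 𝓘(K, Fin A.dim → K) A.X ω).isLocalDiffeomorph⟩, fun _ => rfl,
      fun _ => rfl, fun _ => rfl⟩ }

end Desing

end

/-! ### The theorem in the two categories of manifolds. -/

theorem theorem2p6 :
    (∀ (K : Type u) [Field K] [CharZero K]
      (M : (Desing.algebraicGeometry K).Obj) (a : (Desing.algebraicGeometry K).Pt M) (p : ℕ)
      (G : Desing.Presentation (Desing.algebraicGeometry K) M a p), G.mu = 1 →
      ∃ C : Desing.Presentation (Desing.algebraicGeometry K) M a (p + 1),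
        G.SemicoherentEquivalent C) ∧
    (∀ (K : Type u) [NontriviallyNormedField K] [LocallyCompactSpace K] [CharZero K]
      (M : (Desing.analyticGeometry K).Obj) (a : (Desing.analyticGeometry K).Pt M) (p : ℕ)
      (G : Desing.Presentation (Desing.analyticGeometry K) M a p), G.mu = 1 →
      ∃ C : Desing.Presentation (Desing.analyticGeometry K) M a (p + 1),
        G.SemicoherentEquivalent C) := by
  exact ⟨fun K _ _ _ _ _ G h =>
      Desing.Presentation.exists_semicoherentEquivalent (Desing.algebraicDiff K) G h,
    fun K _ _ _ _ _ _ G h =>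
      Desing.Presentation.exists_semicoherentEquivalent (Desing.analyticDiff K) G h⟩
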